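/- Let $\mathbb K$ be an algebraically closed field of characteristic $0$ and let $\mathbf{Art}_{\mathbb K}$ be the category of local Artinian $\mathbb K$-algebras $(A,\mathfrak m_A)$ with residue field $\mathbb K$. A functor of Artin rings is a functor $\mathbf{Art}_{\mathbb K}\to\mathbf{Set}$. **Semicosimplicial DGLAs.** A semicosimplicial DGLA $\mathfrak g^\Delta$ is a sequence of ($\mathbb Z$-graded) differential graded Lie algebras $\mathfrak g_0,\mathfrak g_1,\dots$ over $\mathbb K$ with DGLA morphisms $\partial_{k,i}\colon\mathfrak g_{i-1}\to\mathfrak g_i$, $0\le k\le i$, such that $\partial_{k+1,i+1}\partial_{l,i}=\partial_{l,i+1}\partial_{k,i}$ for $k\ge l$. Its truncation $\mathfrak g^{\Delta_{[0,2]}}$ has $\mathfrak g_n$ for $n\le 2$ and $0$ for $n>2$. **Total complex.** $\operatorname{Tot}(\mathfrak g^\Delta)^k=\prod_n\mathfrak g_n^{k-n}$, where the component of $d_{\operatorname{Tot}}x$ in $\mathfrak g_n$ is $\sum_{i=0}^n(-1)^i\partial_{i,n}x_{n-1}+(-1)^nd x_n$. **Thom–Whitney DGLA.** Let $\Omega_n$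 be the algebra of polynomial differential forms on the standard $n$-simplex, with face maps $\delta^{k,n}\colon\Omega_n\to\Omega_{n-1}$. In degree $j$, $\operatorname{Tot}_{TW}(\mathfrak g^\Delta)$ consists of the sequences $(x_n)\in\prod_n(\Omega_n\otimes\mathfrak g_n)^j$ with $\delta^{k,n}x_n=\partial_{k,n}x_{n-1}$ for all $0\le k\le n$, $n\geq 1$; differential and bracket are taken componentwise. **Deformation functor.** For a DGLA $L$, $\operatorname{Def}_L(A)$ is the set of $x\in L^1\otimes\mathfrak m_A$ with $dx+\frac12[x,x]=0$ modulo the gauge action $e^a*x=x+\sum_{n\ge0}\frac{[a,-]^n}{(n+1)!}([a,x]-da)$ of $L^0\otimes\mathfrak m_A$. **The functor $H^1_{\rm sc}$.** Let $\bullet$ be the Baker–Campbell–Hausdorff product. Let $Z^1_{\rm sc}(\exp\mathfrak g^\Delta)(A)$ be the set of pairs $(l,m)\in(\mathfrak g_0^1\oplus\mathfrak g_1^0)\otimes\mathfrak m_A$ with $dl+\frac12[l,l]=0$, $\partial_{1,1}l=e^m*\partial_{0,1}l$ and $\partial_{0,2}m\bullet(-\partial_{1,2}m)\bullet\partial_{2,2}m=dn+[\partial_{2,2}\partial_{0,1}l,n]$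 for some $n\in\mathfrak g_2^{-1}\otimes\mathfrak m_A$. Then $H^1_{\rm sc}(\exp\mathfrak g^\Delta)(A)$ is its quotient by the relation: $(l_0,m_0)\sim(l_1,m_1)$ if there are $a\in\mathfrak g_0^0\otimes\mathfrak m_A$ and $b\in\mathfrak g_1^{-1}\otimes\mathfrak m_A$ with $e^a*l_0=l_1$ and $(-m_0)\bullet(-\partial_{1,1}a)\bullet m_1\bullet\partial_{0,1}a=db+[\partial_{0,1}l_0,b]$. **Theorem.** 1. If $H^{-1}(\mathfrak g_2)=0$, there is an isomorphism of functors of Artin rings $\operatorname{Def}_{\operatorname{Tot}_{TW}(\mathfrak g^{\Delta_{[0,2]}})}\cong H^1_{\rm sc}(\exp\mathfrak g^\Delta)$, natural in $\mathfrak g^\Delta$ (among the semicosimplicial DGLAs with this property). 2. If $H^j(\mathfrak g_i)=0$ for all $i\ge0$ and $j<0$, there is an isomorphism of functors of Artin rings $\operatorname{Def}_{\operatorname{Tot}_{TW}(\mathfrak g^\Delta)}\cong H^1_{\rm sc}(\exp\mathfrak g^\Delta)$, natural in $\mathfrak g^\Delta$ (among the semicosimplicial DGLAs with this property). 3. If $H^j(\mathfrak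 g_i)=0$ for all $i\ge0$ and $j<0$, then the tangent space $H^1_{\rm sc}(\exp\mathfrak g^\Delta)(\mathbb K[\varepsilon])$ (with its usual vector space structure, the natural map $F(\mathbb K[\varepsilon]\times_{\mathbb K}\mathbb K[\varepsilon])\to F(\mathbb K[\varepsilon])\times F(\mathbb K[\varepsilon])$ being bijective for $F=H^1_{\rm sc}(\exp\mathfrak g^\Delta)$) is isomorphic to $H^1(\operatorname{Tot}(\mathfrak g^\Delta))$, and the obstructions lie in $H^2(\operatorname{Tot}(\mathfrak g^\Delta))$: to every small extension $0\to J\to B\to A\to0$ in $\mathbf{Art}_{\mathbb K}$ (that is, $\mathfrak m_BJ=0$) and every $x\in H^1_{\rm sc}(\exp\mathfrak g^\Delta)(A)$ one can attach, compatibly with morphisms of small extensions, an element of $H^2(\operatorname{Tot}(\mathfrak g^\Delta))\otimes J$ which vanishes if and only if $x$ lifts to $H^1_{\rm sc}(\exp\mathfrak g^\Delta)(B)$. -/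

import Mathlib

universe u

open CategoryTheory TensorProduct

noncomputable section

theorem neg_one_zpow_congr (K : Type u) [Field K] {a b : ℤ} (h : Even (a - b)) :
    (-1 : K) ^ a = (-1) ^ b := by
  have h0 : (-1 : K) ≠ 0 := by simp
  have h1 : (-1 : K) ^ (a - b) = 1 := h.neg_one_zpow
  calc (-1 : K) ^ a = (-1) ^ ((a - b) + b) := by congr 1; ring
    _ = (-1) ^ b := by rw [zpow_add₀ h0, h1, one_mul]

/-- A differential graded Lie algebra `(⨁ Xⁱ, d, [ , ])` over `K`, graded by `ℤ`. The differential
and the bracket are indexed by the degrees of source and target, with a proof that these match. -/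
structure DGLA (K : Type u) [Field K] where
  X : ℤ → Type u
  [addCommGroup : ∀ i, AddCommGroup (X i)]
  [module : ∀ i, Module K (X i)]
  d : ∀ i j : ℤ, i + 1 = j → X i →ₗ[K] X j
  br : ∀ i j k : ℤ, i + j = k → X i →ₗ[K] X j →ₗ[K] X k
  d_d : ∀ (i j k : ℤ) (hij : i + 1 = j) (hjk : j + 1 = k) (x : X i), d j k hjk (d i j hij x) = 0
  br_symm : ∀ (i j k : ℤ) (h : i + j = k) (h' : j + i = k) (x : X i) (y : X j),
    br i j k h x y = -((-1 : K) ^ (i * j) • br j i k h' y x)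
  leibniz : ∀ (i j k i' j' k' : ℤ) (h : i + j = k) (hi : i + 1 = i') (hj : j + 1 = j')
    (hk : k + 1 = k') (h₁ : i' + j = k') (h₂ : i + j' = k') (x : X i) (y : X j),
    d k k' hk (br i j k h x y) =
      br i' j k' h₁ (d i i' hi x) y + (-1 : K) ^ i • br i j' k' h₂ x (d j j' hj y)
  jacobi : ∀ (i j k ij jk ik l : ℤ) (hij : i + j = ij) (hjk : j + k = jk) (hik : i + k = ik)
    (h₁ : i + jk = l) (h₂ : ij + k = l) (h₃ : j + ik = l) (x : X i) (y : X j) (z : X k),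
    br i jk l h₁ x (br j k jk hjk y z) =
      br ij k l h₂ (br i j ij hij x y) z +
        (-1 : K) ^ (i * j) • br j ik l h₃ y (br i k ik hik x z)

attribute [instance] DGLA.addCommGroup DGLA.module

namespace DGLA

variable {K : Type u} [Field K]

/-- The cohomology `Hⁱ(L)`. -/
abbrev H (L : DGLA K) (i : ℤ) : Type u :=
  LinearMap.ker (L.d i (i + 1) rfl) ⧸
    (LinearMap.range (L.d (i - 1) i (sub_add_cancel i 1))).submoduleOf
      (LinearMap.ker (L.d i (i + 1) rfl))

/-- Morphisms of DGLAs. -/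
@[ext]
structure Hom (L M : DGLA K) where
  f : ∀ i, L.X i →ₗ[K] M.X i
  map_d : ∀ (i j : ℤ) (h : i + 1 = j) (x : L.X i), f j (L.d i j h x) = M.d i j h (f i x)
  map_br : ∀ (i j k : ℤ) (h : i + j = k) (x : L.X i) (y : L.X j),
    f k (L.br i j k h x y) = M.br i j k h (f i x) (f j y)

/-- The identity morphism. -/
@[simps]
def Hom.id (L : DGLA K) : Hom L L where
  f _ := LinearMap.id
  map_d _ _ _ _ := rfl
  map_br _ _ _ _ _ _ := rfl

/-- Composition of morphisms, in diagrammatic order. -/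
@[simps]
def Hom.comp {L M N : DGLA K} (φ : Hom L M) (ψ : Hom M N) : Hom L N where
  f i := ψ.f i ∘ₗ φ.f i
  map_d i j h x := by simp [φ.map_d, ψ.map_d]
  map_br i j k h x y := by simp [φ.map_br, ψ.map_br]

/-! ### Maurer–Cartan elements, gauge action, Baker–Campbell–Hausdorff product -/

/-- The Maurer–Cartan equation `dx + ½[x, x] = 0`. -/
def IsMC (L : DGLA K) (x : L.X 1) : Prop :=
  L.d 1 2 (by norm_num) x + (2⁻¹ : K) • L.br 1 1 2 (by norm_num) x x = 0

/-- `[a, -]` on elements of degree one, for `a` of degree zero. -/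
def ad₁ (L : DGLA K) (a : L.X 0) : Module.End K (L.X 1) := L.br 0 1 1 (by norm_num) a

/-- The gauge action `e^a * x = x + ∑ₙ [a, -]ⁿ([a, x] - da) / (n + 1)!`. It is only used
for nilpotent DGLAs, where the sum is finite. -/
def gauge (L : DGLA K) (a : L.X 0) (x : L.X 1) : L.X 1 :=
  x + ∑ᶠ n : ℕ, (((n + 1).factorial : K))⁻¹ •
    ((L.ad₁ a) ^ n) (L.ad₁ a x - L.d 0 1 (by norm_num) a)

/-- The iterated bracket `[x₁, [x₂, […, xₙ]]]` of elements of degree zero. -/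
def nest (L : DGLA K) : List (L.X 0) → L.X 0
  | [] => 0
  | [x] => x
  | x :: y :: l => L.br 0 0 0 (by norm_num) x (nest L (y :: l))

/-- The Baker–Campbell–Hausdorff product `a • b` on `L⁰`, by Dynkin's formula
`∑ₖ (-1)^(k-1)/k ∑ [a^r₁ b^s₁ ⋯ a^rₖ b^sₖ] / ((∑ rᵢ + sᵢ) ∏ rᵢ! sᵢ!)`, the inner sum being over all
`(r₁, s₁), …, (rₖ, sₖ) ≠ (0, 0)`. It is only used for nilpotent DGLAs, where the sum is finite. -/
def bch (L : DGLA K) (a b : L.X 0) : L.X 0 :=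
  ∑ᶠ w : List {p : ℕ × ℕ // p ≠ 0},
    ((-1 : K) ^ (w.length + 1) / (w.length * (w.map fun p => p.1.1 + p.1.2).sum *
        (w.map fun p => p.1.1.factorial * p.1.2.factorial).prod : ℕ)) •
      L.nest (w.flatMap fun p => List.replicate p.1.1 a ++ List.replicate p.1.2 b)

/-- `h` belongs to the irrelevant stabilizer of `x`: it has the form `dn + [x, n]`. -/
def IrrStab (L : DGLA K) (x : L.X 1) (h : L.X 0) : Prop :=
  ∃ n : L.X (-1), h = L.d (-1) 0 (by norm_num) n + L.br 1 (-1) 0 (by norm_num) x n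

/-- The nilpotency that makes the sums above finite. -/
structure Nilp (L : DGLA K) : Prop where
  nest : ∃ N : ℕ, ∀ l : List (L.X 0), N ≤ l.length → L.nest l = 0
  ad : ∃ N : ℕ, ∀ (a : L.X 0) (x : L.X 1) (n : ℕ), N ≤ n → ((L.ad₁ a) ^ n) x = 0

theorem Hom.map_nest {L M : DGLA K} (φ : Hom L M) : ∀ l : List (L.X 0),
    φ.f 0 (L.nest l) = M.nest (l.map (φ.f 0))
  | [] => by simp [DGLA.nest]
  | [x] => by simp [DGLA.nest]
  | x :: y :: l => by
    have := Hom.map_nest φ (y :: l)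
    simp only [List.map_cons] at this
    simp [DGLA.nest, φ.map_br, this]

theorem bch_finite (L : DGLA K) (hL : L.Nilp) (a b : L.X 0) :
    (Function.support fun w : List {p : ℕ × ℕ // p ≠ 0} =>
    ((-1 : K) ^ (w.length + 1) / (w.length * (w.map fun p => p.1.1 + p.1.2).sum *
        (w.map fun p => p.1.1.factorial * p.1.2.factorial).prod : ℕ)) •
      L.nest (w.flatMap fun p => List.replicate p.1.1 a ++ List.replicate p.1.2 b)).Finite := by
  obtain ⟨N, hN⟩ := hL.nest
  let S : Set {p : ℕ × ℕ // p ≠ 0} := {p | p.1.1 ≤ N ∧ p.1.2 ≤ N}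
  have hS : S.Finite := by
    have h1 : ((Set.Iic N ×ˢ Set.Iic N : Set (ℕ × ℕ))).Finite :=
      (Set.finite_Iic N).prod (Set.finite_Iic N)
    refine (h1.preimage (f := fun p : {p : ℕ × ℕ // p ≠ 0} => p.1)
      Subtype.val_injective.injOn).subset ?_
    intro p hp
    exact ⟨hp.1, hp.2⟩
  have : Finite S := hS
  refine ((List.finite_length_le S N).image (List.map Subtype.val)).subset ?_
  intro w hw
  have hlen : (w.map fun p => p.1.1 + p.1.2).sum < N := by
    by_contra hcon
    apply hw
    have : N ≤ (w.flatMap fun p => List.replicate p.1.1 a ++ List.replicate p.1.2 b).length := by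
      simpa [List.length_flatMap] using not_lt.mp hcon
    simp only
    rw [hN _ this, smul_zero]
  have hmem : ∀ p ∈ w, p ∈ S := by
    intro p hp
    have : p.1.1 + p.1.2 ≤ (w.map fun p => p.1.1 + p.1.2).sum :=
      List.single_le_sum (by simp) _ (List.mem_map_of_mem hp)
    exact ⟨by omega, by omega⟩
  have hw1 : w.length ≤ N := by
    have : w.length • 1 ≤ (w.map fun p => p.1.1 + p.1.2).sum := by
      rw [← List.length_map (as := w) (fun p => p.1.1 + p.1.2)]
      refine List.card_nsmul_le_sum _ _ ?_
      intro x hx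
      obtain ⟨p, -, rfl⟩ := List.mem_map.mp hx
      have := p.2
      rcases p with ⟨⟨r, s⟩, h⟩
      by_contra hh
      apply h
      simp only [not_le, Nat.lt_one_iff, Nat.add_eq_zero_iff] at hh
      ext <;> simp [hh.1, hh.2]
    rw [nsmul_eq_mul, mul_one, Nat.cast_id] at this
    omega
  refine ⟨w.attachWith (· ∈ S) hmem, ?_, ?_⟩
  · exact (List.length_attachWith (l := w) (p := (· ∈ S)) (H := hmem)).le.trans hw1
  · exact List.attachWith_map_subtype_val hmem

theorem Hom.map_bch {L M : DGLA K} (φ : Hom L M) (hL : L.Nilp) (a b : L.X 0) :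
    φ.f 0 (L.bch a b) = M.bch (φ.f 0 a) (φ.f 0 b) := by
  unfold bch
  rw [← LinearMap.toAddMonoidHom_coe, AddMonoidHom.map_finsum _ (L.bch_finite hL a b)]
  refine finsum_congr fun w => ?_
  simp [Hom.map_nest, List.map_flatMap]

theorem Hom.map_ad {L M : DGLA K} (φ : Hom L M) (a : L.X 0) (n : ℕ) (x : L.X 1) :
    φ.f 1 (((L.ad₁ a) ^ n) x) = ((M.ad₁ (φ.f 0 a)) ^ n) (φ.f 1 x) := by
  induction n with
  | zero => simp
  | succ n ih =>
    rw [pow_succ', pow_succ', Module.End.mul_apply, Module.End.mul_apply, ← ih]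
    simp [ad₁, φ.map_br]

theorem Hom.map_gauge {L M : DGLA K} (φ : Hom L M) (hL : L.Nilp) (a : L.X 0) (x : L.X 1) :
    φ.f 1 (L.gauge a x) = M.gauge (φ.f 0 a) (φ.f 1 x) := by
  unfold gauge
  obtain ⟨N, hN⟩ := hL.ad
  rw [map_add, ← LinearMap.toAddMonoidHom_coe, AddMonoidHom.map_finsum]
  · congr 1
    refine finsum_congr fun n => ?_
    have h1 : φ.f 1 (L.ad₁ a x) = M.ad₁ (φ.f 0 a) (φ.f 1 x) := φ.map_br ..
    simp [Hom.map_ad, φ.map_d, h1]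
  · refine (Set.finite_lt_nat N).subset fun n hn => ?_
    by_contra hcon
    exact hn (by simp only; rw [hN _ _ _ (not_lt.mp hcon), smul_zero])

theorem Hom.map_isMC {L M : DGLA K} (φ : Hom L M) {x : L.X 1} (hx : L.IsMC x) :
    M.IsMC (φ.f 1 x) := by
  have := congrArg (φ.f 2) hx
  simpa [IsMC, φ.map_d, φ.map_br] using this

theorem Hom.map_irrStab {L M : DGLA K} (φ : Hom L M) {x : L.X 1} {h : L.X 0}
    (hx : L.IrrStab x h) : M.IrrStab (φ.f 1 x) (φ.f 0 h) := by
  obtain ⟨n, rfl⟩ := hx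
  exact ⟨φ.f (-1) n, by simp [φ.map_d, φ.map_br]⟩

/-- Maurer–Cartan elements modulo gauge equivalence. -/
def DefSet (L : DGLA K) : Type u :=
  Quot fun x y : {x : L.X 1 // L.IsMC x} => ∃ a : L.X 0, L.gauge a x.1 = y.1

/-- The map of `DefSet`s induced by a morphism. -/
def DefSet.map {L M : DGLA K} (φ : Hom L M) (hL : L.Nilp) : L.DefSet → M.DefSet :=
  Quot.map (fun x => ⟨φ.f 1 x.1, φ.map_isMC x.2⟩) fun x y ⟨a, ha⟩ =>
    ⟨φ.f 0 a, by simp only [← φ.map_gauge hL, ha]⟩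

end DGLA

/-! ### Local Artinian algebras -/

/-- Objects of `Art_K`: local Artinian `K`-algebras with residue field `K`. -/
structure Art (K : Type u) [Field K] where
  carrier : Type u
  [commRing : CommRing carrier]
  [algebra : Algebra K carrier]
  [isLocalRing : IsLocalRing carrier]
  [isArtinianRing : IsArtinianRing carrier]
  residue : Function.Bijective (algebraMap K (IsLocalRing.ResidueField carrier))

attribute [instance] Art.commRing Art.algebra Art.isLocalRing Art.isArtinianRing

namespace Art

variable {K : Type u} [Field K]

instance : Category (Art K) where
  Hom A B := A.carrier →ₐ[K] B.carrier
  id A := AlgHom.id K A.carrier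
  comp f g := AlgHom.comp g f

/-- The underlying algebra homomorphism. -/
def Hom.alg {A B : Art K} (f : A ⟶ B) : A.carrier →ₐ[K] B.carrier := f

/-- The maximal ideal `𝔪_A`. -/
abbrev max (A : Art K) : Ideal A.carrier := IsLocalRing.maximalIdeal A.carrier

theorem isNilpotent_max (A : Art K) : ∃ N : ℕ, A.max ^ N = 0 := by
  have h := IsArtinianRing.isNilpotent_jacobson_bot (R := A.carrier)
  rwa [IsLocalRing.jacobson_eq_maximalIdeal ⊥ bot_ne_top] at h

theorem map_mem_max {A B : Art K} (f : A ⟶ B) {a : A.carrier} (ha : a ∈ A.max) :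
    Hom.alg f a ∈ B.max := by
  obtain ⟨N, hN⟩ := A.isNilpotent_max
  have h0 : a ^ N = 0 := by
    have := Ideal.pow_mem_pow ha N
    rwa [hN] at this
  rw [IsLocalRing.mem_maximalIdeal, mem_nonunits_iff]
  intro hu
  have h1 := hu.pow N
  rw [← map_pow, h0, map_zero] at h1
  exact not_isUnit_zero h1

/-- The multiplication `𝔪_A × 𝔪_A → 𝔪_A`. -/
def maxMul (A : Art K) : A.max →ₗ[K] A.max →ₗ[K] A.max :=
  LinearMap.mk₂ K (fun a b => ⟨a.1 * b.1, Ideal.mul_mem_left _ _ b.2⟩)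
    (fun a b c => by ext; simp [add_mul]) (fun r a b => by ext; simp)
    (fun a b c => by ext; simp [mul_add]) (fun r a b => by ext; simp)

@[simp]
theorem maxMul_coe (A : Art K) (a b : A.max) : (A.maxMul a b : A.carrier) = a.1 * b.1 := rfl

/-- The map `𝔪_A → 𝔪_B` induced by a morphism `A ⟶ B`. -/
def maxMap {A B : Art K} (f : A ⟶ B) : A.max →ₗ[K] B.max where
  toFun a := ⟨Hom.alg f a.1, map_mem_max f a.2⟩
  map_add' a b := by ext; simp
  map_smul' r a := by ext; simp

@[simp]
theorem maxMap_coe {A B : Art K} (f : A ⟶ B) (a : A.max) :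
    (maxMap f a : B.carrier) = Hom.alg f a.1 := rfl

theorem maxMap_mul {A B : Art K} (f : A ⟶ B) (a b : A.max) :
    maxMap f (A.maxMul a b) = B.maxMul (maxMap f a) (maxMap f b) := by
  ext; simp

theorem maxMap_id (A : Art K) : maxMap (𝟙 A) = LinearMap.id := rfl

theorem maxMap_comp {A B C : Art K} (f : A ⟶ B) (g : B ⟶ C) :
    maxMap (f ≫ g) = maxMap g ∘ₗ maxMap f := rfl

end Art

namespace DGLA

variable {K : Type u} [Field K]

theorem map₂_tmul_tmul {M N P M' N' P' : Type*} [AddCommGroup M] [AddCommGroup N]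
    [AddCommGroup P] [AddCommGroup M'] [AddCommGroup N'] [AddCommGroup P'] [Module K M] [Module K N]
    [Module K P] [Module K M'] [Module K N'] [Module K P'] (f : M →ₗ[K] N →ₗ[K] P)
    (g : M' →ₗ[K] N' →ₗ[K] P') (m : M) (m' : M') (n : N) (n' : N') :
    TensorProduct.map₂ f g (m ⊗ₜ[K] m') (n ⊗ₜ[K] n') = f m n ⊗ₜ[K] g m' n' := rfl

/-- The DGLA `L ⊗ 𝔪_A`, with `d(x ⊗ a) = dx ⊗ a` and `[x ⊗ a, y ⊗ b] = [x, y] ⊗ ab`. -/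
def tens (L : DGLA K) (A : Art K) : DGLA K where
  X i := L.X i ⊗[K] A.max
  d i j h := (L.d i j h).rTensor A.max
  br i j k h := TensorProduct.map₂ (L.br i j k h) A.maxMul
  d_d i j k hij hjk x := by
    induction x with
    | zero => simp
    | add x y hx hy => simp [hx, hy]
    | tmul x a => simp [L.d_d]
  br_symm i j k h h' x y := by
    induction x with
    | zero => simp
    | add x x' hx hx' => simp only [map_add, LinearMap.add_apply, hx, hx', smul_add, neg_add]
    | tmul x a =>
      induction y with
      | zero => simp
      | add y y' hy hy' => simp only [map_add, LinearMap.add_apply, hy, hy', smul_add, neg_add]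
      | tmul y b =>
        have : A.maxMul a b = A.maxMul b a := by ext; simp [mul_comm]
        simp only [map₂_tmul_tmul]
        rw [L.br_symm i j k h h', this, TensorProduct.neg_tmul, TensorProduct.smul_tmul']
  leibniz i j k i' j' k' h hi hj hk h₁ h₂ x y := by
    induction x with
    | zero => simp
    | add x x' hx hx' =>
      simp only [map_add, LinearMap.add_apply, hx, hx', smul_add]; abel
    | tmul x a =>
      induction y with
      | zero => simp
      | add y y' hy hy' => simp only [map_add, hy, hy', smul_add]; abel
      | tmul y b =>
        simp only [map₂_tmul_tmul, LinearMap.rTensor_tmul]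
        rw [L.leibniz i j k i' j' k' h hi hj hk h₁ h₂, TensorProduct.add_tmul,
          TensorProduct.smul_tmul']
  jacobi i j k ij jk ik l hij hjk hik h₁ h₂ h₃ x y z := by
    induction x with
    | zero => simp
    | add x x' hx hx' =>
      simp only [map_add, LinearMap.add_apply, hx, hx', smul_add]; abel
    | tmul x a =>
      induction y with
      | zero => simp
      | add y y' hy hy' => simp only [map_add, LinearMap.add_apply, hy, hy', smul_add]; abel
      | tmul y b =>
        induction z with
        | zero => simp
        | add z z' hz hz' => simp only [map_add, hz, hz', smul_add]; abel
        | tmul z c =>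
          have e1 : A.maxMul (A.maxMul a b) c = A.maxMul a (A.maxMul b c) := by
            ext; simp [mul_assoc]
          have e2 : A.maxMul b (A.maxMul a c) = A.maxMul a (A.maxMul b c) := by
            ext; simp [mul_left_comm]
          simp only [map₂_tmul_tmul, e1, e2]
          rw [L.jacobi i j k ij jk ik l hij hjk hik h₁ h₂ h₃, TensorProduct.add_tmul,
            TensorProduct.smul_tmul']

/-- The morphism `L ⊗ 𝔪_A → M ⊗ 𝔪_B` induced by `L → M` and `A → B`. -/
def tensMap {L M : DGLA K} (φ : Hom L M) {A B : Art K} (f : A ⟶ B) :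
    Hom (L.tens A) (M.tens B) where
  f i := TensorProduct.map (φ.f i) (Art.maxMap f)
  map_d i j h x := by
    have H : ∀ x : L.X i ⊗[K] A.max,
        TensorProduct.map (φ.f j) (Art.maxMap f) ((L.d i j h).rTensor A.max x) =
          (M.d i j h).rTensor B.max (TensorProduct.map (φ.f i) (Art.maxMap f) x) := by
      intro x
      induction x with
      | zero => simp
      | add x y hx hy => simp only [map_add, hx, hy]
      | tmul x a => simp [φ.map_d]
    exact H x
  map_br i j k h x y := by
    have H : ∀ (x : L.X i ⊗[K] A.max) (y : L.X j ⊗[K] A.max),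
        TensorProduct.map (φ.f k) (Art.maxMap f) (TensorProduct.map₂ (L.br i j k h) A.maxMul x y) =
          TensorProduct.map₂ (M.br i j k h) B.maxMul (TensorProduct.map (φ.f i) (Art.maxMap f) x)
            (TensorProduct.map (φ.f j) (Art.maxMap f) y) := by
      intro x y
      induction x with
      | zero => simp
      | add x x' hx hx' => simp only [map_add, LinearMap.add_apply, hx, hx']
      | tmul x a =>
        induction y with
        | zero => simp
        | add y y' hy hy' => simp only [map_add, hy, hy']
        | tmul y b =>
          simp only [map₂_tmul_tmul, TensorProduct.map_tmul, φ.map_br, Art.maxMap_mul]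
    exact H x y

theorem tensMap_id (L : DGLA K) (A : Art K) : tensMap (Hom.id L) (𝟙 A) = Hom.id (L.tens A) := by
  ext i x
  simp only [tensMap, Hom.id, Art.maxMap_id, TensorProduct.map_id]
  rfl

theorem tensMap_comp {L M N : DGLA K} (φ : Hom L M) (ψ : Hom M N) {A B C : Art K} (f : A ⟶ B)
    (g : B ⟶ C) : tensMap (φ.comp ψ) (f ≫ g) = (tensMap φ f).comp (tensMap ψ g) := by
  ext i x
  simp only [tensMap, Hom.comp, Art.maxMap_comp, TensorProduct.map_comp]
  rfl

/-- The elements of `Lⁱ ⊗ 𝔪_A` that come from `Lⁱ ⊗ 𝔪_Aⁿ`. -/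
def tensFil (L : DGLA K) (A : Art K) (n : ℕ) (i : ℤ) : Submodule K ((L.tens A).X i) :=
  Submodule.span K {t : L.X i ⊗[K] A.max | ∃ x, ∃ a : A.max, a.1 ∈ A.max ^ n ∧ t = x ⊗ₜ a}

theorem mem_tensFil_one (L : DGLA K) (A : Art K) (i : ℤ) (t : (L.tens A).X i) :
    t ∈ L.tensFil A 1 i := by
  change L.X i ⊗[K] A.max at t
  induction t with
  | zero => exact zero_mem _
  | add x y hx hy => exact add_mem hx hy
  | tmul x a => exact Submodule.subset_span ⟨x, a, by simp, rfl⟩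

theorem br_mem_tensFil (L : DGLA K) (A : Art K) {m n : ℕ} (i j k : ℤ) (h : i + j = k)
    {s : (L.tens A).X i} {t : (L.tens A).X j} (hs : s ∈ L.tensFil A m i)
    (ht : t ∈ L.tensFil A n j) : (L.tens A).br i j k h s t ∈ L.tensFil A (m + n) k := by
  induction hs using Submodule.span_induction with
  | zero => simp
  | add x y _ _ hx hy => rw [map_add, LinearMap.add_apply]; exact add_mem hx hy
  | smul c x _ hx => rw [map_smul, LinearMap.smul_apply]; exact Submodule.smul_mem _ _ hx
  | mem s hs =>
    induction ht using Submodule.span_induction with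
    | zero => simp
    | add x y _ _ hx hy => rw [map_add]; exact add_mem hx hy
    | smul c x _ hx => rw [map_smul]; exact Submodule.smul_mem _ _ hx
    | mem t ht =>
      obtain ⟨x, a, ha, rfl⟩ := hs
      obtain ⟨y, b, hb, rfl⟩ := ht
      refine Submodule.subset_span ⟨L.br i j k h x y, A.maxMul a b, ?_, ?_⟩
      · rw [pow_add]; exact Ideal.mul_mem_mul ha hb
      · rfl

theorem tensFil_eq_zero (L : DGLA K) (A : Art K) {N n : ℕ} (hN : A.max ^ N = 0) (h : N ≤ n)
    (i : ℤ) {t : (L.tens A).X i} (ht : t ∈ L.tensFil A n i) : t = 0 := by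
  induction ht using Submodule.span_induction with
  | zero => rfl
  | add x y _ _ hx hy => rw [hx, hy, add_zero]
  | smul c x _ hx => rw [hx, smul_zero]
  | mem t ht =>
    obtain ⟨x, a, ha, rfl⟩ := ht
    have : a.1 ∈ A.max ^ N := Ideal.pow_le_pow_right h ha
    rw [hN] at this
    have : a = 0 := Subtype.ext this
    rw [this]; exact TensorProduct.tmul_zero _ _

theorem nest_mem_tensFil (L : DGLA K) (A : Art K) : ∀ l : List ((L.tens A).X 0),
    (L.tens A).nest l ∈ L.tensFil A l.length 0
  | [] => by simp [nest]
  | [x] => by simpa [nest] using L.mem_tensFil_one A 0 x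
  | x :: y :: l => by
    have h1 := L.nest_mem_tensFil A (y :: l)
    have h2 := L.br_mem_tensFil A 0 0 0 (by norm_num) (L.mem_tensFil_one A 0 x) h1
    simp only [nest]
    convert h2 using 1
    simp; ring_nf

theorem tens_nilp (L : DGLA K) (A : Art K) : (L.tens A).Nilp := by
  obtain ⟨N, hN⟩ := A.isNilpotent_max
  refine ⟨⟨N, fun l hl => L.tensFil_eq_zero A hN hl 0 (L.nest_mem_tensFil A l)⟩,
    ⟨N, fun a x n hn => L.tensFil_eq_zero A (n := n + 1) hN (by omega) 1 ?_⟩⟩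
  clear hn
  induction n with
  | zero => simpa using L.mem_tensFil_one A 1 x
  | succ n ih =>
    rw [pow_succ', Module.End.mul_apply]
    have := L.br_mem_tensFil A 0 1 1 (by norm_num) (L.mem_tensFil_one A 0 a) ih
    rw [add_comm 1 (n + 1)] at this
    exact this

theorem DefSet.map_id {L : DGLA K} (hL : L.Nilp) (x : L.DefSet) :
    DefSet.map (Hom.id L) hL x = x := by
  induction x using Quot.ind
  rfl

theorem DefSet.map_comp {L M N : DGLA K} (φ : Hom L M) (ψ : Hom M N) (hL : L.Nilp) (hM : M.Nilp)
    (x : L.DefSet) : DefSet.map (φ.comp ψ) hL x = DefSet.map ψ hM (DefSet.map φ hL x) := by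
  induction x using Quot.ind
  rfl

/-- The deformation functor `Def_L`: Maurer–Cartan elements of `L ⊗ 𝔪_A` modulo gauge. -/
def defFunctor (L : DGLA K) : Art K ⥤ Type u where
  obj A := (L.tens A).DefSet
  map f := TypeCat.ofHom (DefSet.map (tensMap (Hom.id L) f) (L.tens_nilp _))
  map_id A := by
    ext x
    have h := DefSet.map_id (L.tens_nilp A) x
    rw [← tensMap_id] at h
    exact h
  map_comp {A B C} f g := by
    ext x
    have h := DefSet.map_comp (tensMap (Hom.id L) f) (tensMap (Hom.id L) g) (L.tens_nilp A)
      (L.tens_nilp B) x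
    rw [← tensMap_comp] at h
    exact h

/-- The natural transformation `Def_L → Def_M` induced by a morphism `L → M`. -/
def defMap {L M : DGLA K} (φ : Hom L M) : L.defFunctor ⟶ M.defFunctor where
  app A := TypeCat.ofHom (DefSet.map (tensMap φ (𝟙 A)) (L.tens_nilp A))
  naturality A B f := by
    ext x
    have h1 := DefSet.map_comp (tensMap (Hom.id L) f) (tensMap φ (𝟙 B)) (L.tens_nilp A)
      (L.tens_nilp B) x
    have h2 := DefSet.map_comp (tensMap φ (𝟙 A)) (tensMap (Hom.id M) f) (L.tens_nilp A)
      (M.tens_nilp A) x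
    rw [← tensMap_comp, Category.comp_id] at h1
    rw [← tensMap_comp, Category.id_comp] at h2
    exact h1.symm.trans h2

end DGLA

/-! ### Semicosimplicial DGLAs -/

/-- A semicosimplicial DGLA `𝔤₀ ⇉ 𝔤₁ ⇶ 𝔤₂ ⋯`; `face n k : 𝔤ₙ → 𝔤ₙ₊₁` is `∂_{k,n+1}`. -/
structure SemicosimplicialDGLA (K : Type u) [Field K] where
  obj : ℕ → DGLA K
  face : ∀ (n : ℕ) (_ : Fin (n + 2)), DGLA.Hom (obj n) (obj (n + 1))
  face_face : ∀ (n : ℕ) (l k : Fin (n + 2)), l ≤ k →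
    (face n l).comp (face (n + 1) k.succ) = (face n k).comp (face (n + 1) l.castSucc)

namespace SemicosimplicialDGLA

variable {K : Type u} [Field K]

/-- Morphisms of semicosimplicial DGLAs. -/
structure Hom (g h : SemicosimplicialDGLA K) where
  app : ∀ n, DGLA.Hom (g.obj n) (h.obj n)
  comm : ∀ (n : ℕ) (k : Fin (n + 2)),
    (app n).comp (h.face n k) = (g.face n k).comp (app (n + 1))

/-- `𝔤^Δ ⊗ 𝔪_A`. -/
def tens (g : SemicosimplicialDGLA K) (A : Art K) : SemicosimplicialDGLA K where
  obj n := (g.obj n).tens A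
  face n k := DGLA.tensMap (g.face n k) (𝟙 A)
  face_face n l k h := by
    rw [← DGLA.tensMap_comp, ← DGLA.tensMap_comp, g.face_face n l k h]

/-- The morphism `𝔤^Δ ⊗ 𝔪_A → 𝔥^Δ ⊗ 𝔪_B` induced by `𝔤^Δ → 𝔥^Δ` and `A → B`. -/
def tensMap {g h : SemicosimplicialDGLA K} (φ : Hom g h) {A B : Art K} (f : A ⟶ B) :
    Hom (g.tens A) (h.tens B) where
  app n := DGLA.tensMap (φ.app n) f
  comm n k := by
    simp only [tens]
    rw [← DGLA.tensMap_comp, ← DGLA.tensMap_comp, φ.comm, Category.comp_id, Category.id_comp]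

/-- The identity morphism. -/
def Hom.id (g : SemicosimplicialDGLA K) : Hom g g where
  app _ := DGLA.Hom.id _
  comm _ _ := rfl

/-- `∂_{k,i} : 𝔤ᵢ₋₁ → 𝔤ᵢ` in degree `j`, for `i = n + 1`. -/
abbrev δ (g : SemicosimplicialDGLA K) (n : ℕ) (k : Fin (n + 2)) (j : ℤ) :
    (g.obj n).X j →ₗ[K] (g.obj (n + 1)).X j := (g.face n k).f j

theorem Hom.comm_apply {g h : SemicosimplicialDGLA K} (φ : Hom g h) (n : ℕ) (k : Fin (n + 2))
    (j : ℤ) (x : (g.obj n).X j) :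
    (φ.app (n + 1)).f j (g.δ n k j x) = h.δ n k j ((φ.app n).f j x) := by
  have := congrArg (fun ψ : DGLA.Hom (g.obj n) (h.obj (n + 1)) => ψ.f j x) (φ.comm n k)
  exact this.symm

/-- The conditions that define `Z¹_sc(exp 𝔤^Δ)(A)`, for `G = 𝔤^Δ ⊗ 𝔪_A`:
`dl + ½[l, l] = 0`, `∂₁l = e^m * ∂₀l`, and `∂₀m • (-∂₁m) • ∂₂m = dn + [∂₂∂₀l, n]` for some `n`. -/
structure IsZ1 (G : SemicosimplicialDGLA K) (l : (G.obj 0).X 1) (m : (G.obj 1).X 0) : Prop where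
  mc : (G.obj 0).IsMC l
  glue : G.δ 0 1 1 l = (G.obj 1).gauge m (G.δ 0 0 1 l)
  cocycle : (G.obj 2).IrrStab (G.δ 1 2 1 (G.δ 0 0 1 l))
    ((G.obj 2).bch ((G.obj 2).bch (G.δ 1 0 0 m) (-G.δ 1 1 0 m)) (G.δ 1 2 0 m))

/-- `Z¹_sc(exp 𝔤^Δ)(A)`, for `G = 𝔤^Δ ⊗ 𝔪_A`. -/
def Z1 (G : SemicosimplicialDGLA K) : Type u :=
  {z : (G.obj 0).X 1 × (G.obj 1).X 0 // G.IsZ1 z.1 z.2}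

/-- The relation `(l₀, m₀) ∼ (l₁, m₁)`: there are `a`, `b` with `e^a * l₀ = l₁` and
`-m₀ • -∂₁a • m₁ • ∂₀a = db + [∂₀l₀, b]`. -/
def Z1.Rel (G : SemicosimplicialDGLA K) (z w : G.Z1) : Prop :=
  ∃ a : (G.obj 0).X 0, (G.obj 0).gauge a z.1.1 = w.1.1 ∧
    (G.obj 1).IrrStab (G.δ 0 0 1 z.1.1)
      ((G.obj 1).bch ((G.obj 1).bch ((G.obj 1).bch (-z.1.2) (-G.δ 0 1 0 a)) w.1.2) (G.δ 0 0 0 a))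

/-- `H¹_sc(exp 𝔤^Δ)(A)`, for `G = 𝔤^Δ ⊗ 𝔪_A`. -/
def H1Set (G : SemicosimplicialDGLA K) : Type u := Quot (Z1.Rel G)

theorem Hom.map_isZ1 {G G' : SemicosimplicialDGLA K} (φ : Hom G G') (hG : ∀ n, (G.obj n).Nilp)
    {l : (G.obj 0).X 1} {m : (G.obj 1).X 0} (h : G.IsZ1 l m) :
    G'.IsZ1 ((φ.app 0).f 1 l) ((φ.app 1).f 0 m) where
  mc := (φ.app 0).map_isMC h.mc
  glue := by
    rw [← φ.comm_apply, ← φ.comm_apply, ← (φ.app 1).map_gauge (hG 1)]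
    exact congrArg _ h.glue
  cocycle := by
    have := (φ.app 2).map_irrStab h.cocycle
    rw [(φ.app 2).map_bch (hG 2), (φ.app 2).map_bch (hG 2), map_neg, φ.comm_apply, φ.comm_apply,
      φ.comm_apply, φ.comm_apply, φ.comm_apply] at this
    exact this

/-- The map of `H1Set`s induced by a morphism. -/
def H1Set.map {G G' : SemicosimplicialDGLA K} (φ : Hom G G') (hG : ∀ n, (G.obj n).Nilp) :
    G.H1Set → G'.H1Set :=
  Quot.map (fun z => ⟨((φ.app 0).f 1 z.1.1, (φ.app 1).f 0 z.1.2), φ.map_isZ1 hG z.2⟩) (by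
    rintro z w ⟨a, h1, h2⟩
    refine ⟨(φ.app 0).f 0 a, ?_, ?_⟩
    · simp only [← h1, (φ.app 0).map_gauge (hG 0)]
    · have := (φ.app 1).map_irrStab h2
      rw [(φ.app 1).map_bch (hG 1), (φ.app 1).map_bch (hG 1), (φ.app 1).map_bch (hG 1), map_neg,
        map_neg, φ.comm_apply, φ.comm_apply, φ.comm_apply] at this
      exact this)

theorem tens_nilp (g : SemicosimplicialDGLA K) (A : Art K) (n : ℕ) : ((g.tens A).obj n).Nilp :=
  (g.obj n).tens_nilp A

/-- The map of `H1Set`s induced by `𝔤^Δ → 𝔥^Δ` and `A → B`. -/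
def h1Map {g h : SemicosimplicialDGLA K} (φ : Hom g h) {A B : Art K} (f : A ⟶ B) :
    (g.tens A).H1Set → (h.tens B).H1Set :=
  H1Set.map (tensMap φ f) (g.tens_nilp A)

theorem h1Map_id (g : SemicosimplicialDGLA K) (A : Art K) (x : (g.tens A).H1Set) :
    h1Map (Hom.id g) (𝟙 A) x = x := by
  induction x using Quot.ind with
  | mk z =>
    refine congrArg (Quot.mk _) (Subtype.ext (Prod.ext ?_ ?_))
    · exact congrArg (fun ψ : DGLA.Hom _ _ => ψ.f 1 z.1.1) (DGLA.tensMap_id (g.obj 0) A)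
    · exact congrArg (fun ψ : DGLA.Hom _ _ => ψ.f 0 z.1.2) (DGLA.tensMap_id (g.obj 1) A)

theorem h1Map_comp {g h k : SemicosimplicialDGLA K} (φ : Hom g h) (ψ : Hom h k) (χ : Hom g k)
    (hχ : ∀ n, χ.app n = (φ.app n).comp (ψ.app n)) {A B C : Art K} (f : A ⟶ B)
    (e : B ⟶ C) (x : (g.tens A).H1Set) : h1Map χ (f ≫ e) x = h1Map ψ e (h1Map φ f x) := by
  induction x using Quot.ind with
  | mk z =>
    have H : ∀ n, (tensMap χ (f ≫ e)).app n =
        (DGLA.tensMap (φ.app n) f).comp (DGLA.tensMap (ψ.app n) e) := fun n => by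
      rw [← DGLA.tensMap_comp, ← hχ]; rfl
    refine congrArg (Quot.mk _) (Subtype.ext (Prod.ext ?_ ?_))
    · exact congrArg (fun ψ : DGLA.Hom _ _ => ψ.f 1 z.1.1) (H 0)
    · exact congrArg (fun ψ : DGLA.Hom _ _ => ψ.f 0 z.1.2) (H 1)

/-- The functor `H¹_sc(exp 𝔤^Δ) : Art_K ⥤ Set`. -/
def h1sc (g : SemicosimplicialDGLA K) : Art K ⥤ Type u where
  obj A := (g.tens A).H1Set
  map f := TypeCat.ofHom (h1Map (Hom.id g) f)
  map_id A := by ext x; exact h1Map_id g A x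
  map_comp f e := by ext x; exact h1Map_comp _ _ _ (fun _ => rfl) f e x

/-- The natural transformation `H¹_sc(exp 𝔤^Δ) → H¹_sc(exp 𝔥^Δ)` induced by `𝔤^Δ → 𝔥^Δ`. -/
def h1scMap {g h : SemicosimplicialDGLA K} (φ : Hom g h) : g.h1sc ⟶ h.h1sc where
  app A := TypeCat.ofHom (h1Map φ (𝟙 A))
  naturality A B f := by
    ext x
    have h1 := h1Map_comp (Hom.id g) φ φ (fun _ => rfl) f (𝟙 B) x
    have h2 := h1Map_comp φ (Hom.id h) φ (fun _ => rfl) (𝟙 A) f x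
    rw [Category.comp_id] at h1
    rw [Category.id_comp] at h2
    exact h1.symm.trans h2

/-! ### The total complex -/

/-- The degree `k` part `∏ₙ 𝔤ₙ^(k-n)` of the total complex. As for `Tot_TW` below, this is the
product over the cosimplicial degree. -/
abbrev Tot (g : SemicosimplicialDGLA K) (k : ℤ) : Type u :=
  ∀ s : {s : ℕ × ℤ // (s.1 : ℤ) + s.2 = k}, (g.obj s.1.1).X s.1.2

/-- The differential of the total complex: the component of `Dx` in `𝔤ₙʲ` is
`∑ᵢ (-1)ⁱ ∂_{i,n} x_{n-1} + (-1)ⁿ d xₙ`. -/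
def totD (g : SemicosimplicialDGLA K) (k k' : ℤ) (h : k + 1 = k') : g.Tot k →ₗ[K] g.Tot k' :=
  LinearMap.pi fun s => match s with
    | ⟨(0, j), hs⟩ => (g.obj 0).d (j - 1) j (by ring) ∘ₗ
        LinearMap.proj (⟨(0, j - 1), by simp at hs ⊢; omega⟩ : {s : ℕ × ℤ // (s.1 : ℤ) + s.2 = k})
    | ⟨(n + 1, j), hs⟩ =>
        (∑ i : Fin (n + 2), (-1 : K) ^ (i : ℕ) • g.δ n i j) ∘ₗ
          LinearMap.proj (⟨(n, j), by simp at hs ⊢; omega⟩ : {s : ℕ × ℤ // (s.1 : ℤ) + s.2 = k}) +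
        (-1 : K) ^ (n + 1) • (g.obj (n + 1)).d (j - 1) j (by ring) ∘ₗ
          LinearMap.proj
            (⟨(n + 1, j - 1), by simp at hs ⊢; omega⟩ : {s : ℕ × ℤ // (s.1 : ℤ) + s.2 = k})

/-- The cohomology `Hᵏ(Tot(𝔤^Δ))`. -/
abbrev HTot (g : SemicosimplicialDGLA K) (k : ℤ) : Type u :=
  LinearMap.ker (g.totD k (k + 1) rfl) ⧸
    (LinearMap.range (g.totD (k - 1) k (sub_add_cancel k 1))).submoduleOf
      (LinearMap.ker (g.totD k (k + 1) rfl))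

end SemicosimplicialDGLA

/-! ### Truncation -/

namespace DGLA

variable {K : Type u} [Field K]

/-- The sub-DGLA of `L` that is `L` if `P` holds and `0` otherwise. -/
def cut (P : Prop) (L : DGLA K) : DGLA K where
  X i := ({ carrier := {x | ¬P → x = 0}
            add_mem' := fun hx hy h => by rw [hx h, hy h, add_zero]
            zero_mem' := fun _ => rfl
            smul_mem' := fun c x hx h => by rw [hx h, smul_zero] } : Submodule K (L.X i))
  d i j h := (L.d i j h).restrict fun x hx hP => by rw [hx hP, map_zero]
  br i j k h := LinearMap.mk₂ K (fun x y => ⟨L.br i j k h x.1 y.1, fun hP => by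
      rw [x.2 hP, map_zero, LinearMap.zero_apply]⟩)
    (fun _ _ _ => by ext; simp) (fun _ _ _ => by ext; simp)
    (fun _ _ _ => by ext; simp) (fun _ _ _ => by ext; simp)
  d_d i j k hij hjk x := Subtype.ext (L.d_d i j k hij hjk x.1)
  br_symm i j k h h' x y := Subtype.ext (L.br_symm i j k h h' x.1 y.1)
  leibniz i j k i' j' k' h hi hj hk h₁ h₂ x y :=
    Subtype.ext (L.leibniz i j k i' j' k' h hi hj hk h₁ h₂ x.1 y.1)
  jacobi i j k ij jk ik l hij hjk hik h₁ h₂ h₃ x y z :=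
    Subtype.ext (L.jacobi i j k ij jk ik l hij hjk hik h₁ h₂ h₃ x.1 y.1 z.1)

theorem cut_eq {P : Prop} (hP : ¬P) {L : DGLA K} {i : ℤ} (x y : (cut P L).X i) : x = y :=
  Subtype.ext ((x.2 hP).trans (y.2 hP).symm)

open Classical in
/-- The morphism `cut P L → cut Q M` that is `φ` if `Q` holds and `0` otherwise. -/
def cutMap (P Q : Prop) {L M : DGLA K} (φ : Hom L M) : Hom (cut P L) (cut Q M) where
  f i := LinearMap.codRestrict _ ((if Q then φ.f i else 0) ∘ₗ Submodule.subtype _)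
    fun x hQ => by rw [if_neg hQ]; rfl
  map_d i j h x := by
    by_cases hQ : Q
    · apply Subtype.ext
      change (if Q then φ.f j else 0) (L.d i j h x.1) = M.d i j h ((if Q then φ.f i else 0) x.1)
      rw [if_pos hQ, if_pos hQ, φ.map_d]
    · exact cut_eq hQ _ _
  map_br i j k h x y := by
    by_cases hQ : Q
    · apply Subtype.ext
      change (if Q then φ.f k else 0) (L.br i j k h x.1 y.1) =
        M.br i j k h ((if Q then φ.f i else 0) x.1) ((if Q then φ.f j else 0) y.1)
      rw [if_pos hQ, if_pos hQ, if_pos hQ, φ.map_br]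
    · exact cut_eq hQ _ _

theorem cutMap_coe {P Q : Prop} {L M : DGLA K} (φ : Hom L M) (hQ : Q) (i : ℤ)
    (x : (cut P L).X i) : ((cutMap P Q φ).f i x).1 = φ.f i x.1 := by
  classical
  change (if Q then φ.f i else 0) x.1 = _
  rw [if_pos hQ]

end DGLA

namespace SemicosimplicialDGLA

variable {K : Type u} [Field K]

/-- The truncation `𝔤^{Δ_[0,N]}`: `𝔤ₙ` for `n ≤ N` and `0` for `n > N`. -/
def trunc (N : ℕ) (g : SemicosimplicialDGLA K) : SemicosimplicialDGLA K where
  obj n := DGLA.cut (n ≤ N) (g.obj n)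
  face n k := DGLA.cutMap (n ≤ N) (n + 1 ≤ N) (g.face n k)
  face_face n l k h := by
    ext i x
    by_cases hQ : n + 1 + 1 ≤ N
    · have h1 : n + 1 ≤ N := by omega
      have := congrArg (fun ψ : DGLA.Hom _ _ => ψ.f i x.1) (g.face_face n l k h)
      apply Subtype.ext
      simp only [DGLA.Hom.comp_f, LinearMap.comp_apply] at this ⊢
      rw [DGLA.cutMap_coe _ hQ, DGLA.cutMap_coe _ hQ, DGLA.cutMap_coe _ h1, DGLA.cutMap_coe _ h1,
        this]
    · exact DGLA.cut_eq hQ _ _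

/-- Truncation of morphisms. -/
def truncMap (N : ℕ) {g h : SemicosimplicialDGLA K} (φ : Hom g h) :
    Hom (g.trunc N) (h.trunc N) where
  app n := DGLA.cutMap (n ≤ N) (n ≤ N) (φ.app n)
  comm n k := by
    ext i x
    change (DGLA.cut (n ≤ N) (g.obj n)).X i at x
    by_cases hQ : n + 1 ≤ N
    · have h1 : n ≤ N := by omega
      have := congrArg (fun ψ : DGLA.Hom _ _ => ψ.f i x.1) (φ.comm n k)
      apply Subtype.ext
      simp only [DGLA.Hom.comp_f, LinearMap.comp_apply] at this
      change ((DGLA.cutMap (n ≤ N) (n + 1 ≤ N) (h.face n k)).f i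
          ((DGLA.cutMap (n ≤ N) (n ≤ N) (φ.app n)).f i x)).1 =
        ((DGLA.cutMap (n + 1 ≤ N) (n + 1 ≤ N) (φ.app (n + 1))).f i
          ((DGLA.cutMap (n ≤ N) (n + 1 ≤ N) (g.face n k)).f i x)).1
      rw [DGLA.cutMap_coe _ hQ, DGLA.cutMap_coe _ hQ, DGLA.cutMap_coe _ hQ, DGLA.cutMap_coe _ h1,
        this]
    · exact DGLA.cut_eq hQ _ _

end SemicosimplicialDGLA

/-! ### Polynomial differential forms on simplices -/

/-- A (nonnegatively graded) commutative differential graded algebra over `K`, with the conventions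
of `DGLA` on indices. -/
structure CDGA (K : Type u) [Field K] where
  X : ℕ → Type u
  [addCommGroup : ∀ p, AddCommGroup (X p)]
  [module : ∀ p, Module K (X p)]
  d : ∀ p q : ℕ, p + 1 = q → X p →ₗ[K] X q
  one : X 0
  mul : ∀ p q r : ℕ, p + q = r → X p →ₗ[K] X q →ₗ[K] X r
  one_mul : ∀ (p : ℕ) (h : 0 + p = p) (x : X p), mul 0 p p h one x = x
  d_d : ∀ (p q r : ℕ) (hpq : p + 1 = q) (hqr : q + 1 = r) (x : X p), d q r hqr (d p q hpq x) = 0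
  mul_comm : ∀ (p q r : ℕ) (h : p + q = r) (h' : q + p = r) (x : X p) (y : X q),
    mul p q r h x y = (-1 : K) ^ (p * q) • mul q p r h' y x
  mul_assoc : ∀ (p q r pq qr s : ℕ) (h₁ : p + q = pq) (h₂ : pq + r = s) (h₃ : q + r = qr)
    (h₄ : p + qr = s) (x : X p) (y : X q) (z : X r),
    mul pq r s h₂ (mul p q pq h₁ x y) z = mul p qr s h₄ x (mul q r qr h₃ y z)
  leibniz : ∀ (p q r p' q' r' : ℕ) (h : p + q = r) (hp : p + 1 = p') (hq : q + 1 = q')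
    (hr : r + 1 = r') (h₁ : p' + q = r') (h₂ : p + q' = r') (x : X p) (y : X q),
    d r r' hr (mul p q r h x y) =
      mul p' q r' h₁ (d p p' hp x) y + (-1 : K) ^ p • mul p q' r' h₂ x (d q q' hq y)

attribute [instance] CDGA.addCommGroup CDGA.module

/-- Morphisms of commutative differential graded algebras. -/
structure CDGA.Hom {K : Type u} [Field K] (Ω Ω' : CDGA K) where
  f : ∀ p, Ω.X p →ₗ[K] Ω'.X p
  map_one : f 0 Ω.one = Ω'.one
  map_d : ∀ (p q : ℕ) (h : p + 1 = q) (x : Ω.X p), f q (Ω.d p q h x) = Ω'.d p q h (f p x)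
  map_mul : ∀ (p q r : ℕ) (h : p + q = r) (x : Ω.X p) (y : Ω.X q),
    f r (Ω.mul p q r h x y) = Ω'.mul p q r h (f p x) (f q y)

/-- The identity morphism. -/
def CDGA.Hom.id {K : Type u} [Field K] (Ω : CDGA K) : CDGA.Hom Ω Ω where
  f _ := LinearMap.id
  map_one := rfl
  map_d _ _ _ _ := rfl
  map_mul _ _ _ _ _ _ := rfl

section Exterior

variable {K : Type u} [Field K] {V W : Type u} [AddCommGroup V] [Module K V] [AddCommGroup W]
  [Module K W]

/-- The product `⋀ᵖ V × ⋀^q V → ⋀^(p+q) V`. -/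
def extMul (p q r : ℕ) (h : p + q = r) : ⋀[K]^p V →ₗ[K] ⋀[K]^q V →ₗ[K] ⋀[K]^r V :=
  LinearMap.mk₂ K (fun x y => ⟨x.1 * y.1, h ▸ SetLike.mul_mem_graded x.2 y.2⟩)
    (fun _ _ _ => by ext; simp [add_mul]) (fun _ _ _ => by ext; simp)
    (fun _ _ _ => by ext; simp [mul_add]) (fun _ _ _ => by ext; simp)

@[simp]
theorem extMul_coe (p q r : ℕ) (h : p + q = r) (x : ⋀[K]^p V) (y : ⋀[K]^q V) :
    (extMul p q r h x y : ExteriorAlgebra K V) = x.1 * y.1 := rfl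

/-- `v ∧ - : ⋀ᵖ V → ⋀^(p+1) V`. -/
def extVec (v : V) (p q : ℕ) (h : p + 1 = q) : ⋀[K]^p V →ₗ[K] ⋀[K]^q V :=
  (extMul 1 p q (by omega) : ⋀[K]^1 V →ₗ[K] _)
    ⟨ExteriorAlgebra.ι K v, (pow_one (LinearMap.range (ExteriorAlgebra.ι K (M := V)))).ge ⟨v, rfl⟩⟩

@[simp]
theorem extVec_coe (v : V) (p q : ℕ) (h : p + 1 = q) (x : ⋀[K]^p V) :
    (extVec v p q h x : ExteriorAlgebra K V) = ExteriorAlgebra.ι K v * x.1 := rfl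

theorem ι_mul_of_mem (v : V) {q : ℕ} {y : ExteriorAlgebra K V} (hy : y ∈ ⋀[K]^q V) :
    ExteriorAlgebra.ι K v * y = (-1 : K) ^ q • (y * ExteriorAlgebra.ι K v) := by
  induction hy using Submodule.pow_induction_on_left' with
  | algebraMap r => simp [Algebra.commutes]
  | add x y i hx hy h1 h2 => rw [mul_add, h1, h2, add_mul, smul_add]
  | mem_mul m hm i x hx h =>
    obtain ⟨w, rfl⟩ := hm
    have := ExteriorAlgebra.ι_add_mul_swap (R := K) v w
    rw [← mul_assoc, eq_neg_of_add_eq_zero_left this, neg_mul, mul_assoc, h, pow_succ, mul_assoc]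
    simp

theorem ext_mul_comm {p q : ℕ} {x y : ExteriorAlgebra K V} (hx : x ∈ ⋀[K]^p V)
    (hy : y ∈ ⋀[K]^q V) : x * y = (-1 : K) ^ (p * q) • (y * x) := by
  induction hx using Submodule.pow_induction_on_left' with
  | algebraMap r => simp [Algebra.commutes]
  | add x y i hx hy h1 h2 => rw [add_mul, h1, h2, mul_add, smul_add]
  | mem_mul m hm i x hx h =>
    obtain ⟨w, rfl⟩ := hm
    rw [mul_assoc, h, mul_smul_comm, ← mul_assoc, ι_mul_of_mem w hy, smul_mul_assoc, smul_smul,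
      mul_assoc, ← pow_add]
    congr 2
    rw [Nat.succ_eq_add_one]
    ring

theorem extMap_coe (f : V →ₗ[K] W) (p : ℕ) (x : ⋀[K]^p V) :
    (exteriorPower.map p f x : ExteriorAlgebra K W) = ExteriorAlgebra.map f x.1 := by
  have : (Submodule.subtype _) ∘ₗ exteriorPower.map p f =
      (ExteriorAlgebra.map f).toLinearMap ∘ₗ (Submodule.subtype _) := by
    apply exteriorPower.linearMap_ext
    ext m
    simp
  exact LinearMap.congr_fun this x

end Exterior

section Forms

variable (K : Type u) [Field K]

/-- The degree `p` part `K[t₁, …, tₙ] ⊗ ⋀ᵖ⟨dt₁, …, dtₙ⟩` of `Ωₙ`. We use `t₀ = 1 - ∑ tᵢ` and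
`dt₀ = -∑ dtᵢ` to eliminate `t₀` and `dt₀`; the coordinates `t₁, …, tₙ` are indexed by `Fin n`. -/
abbrev OmegaX (n p : ℕ) : Type u :=
  MvPolynomial (Fin n) K ⊗[K] ⋀[K]^p (Fin n → K)

/-- The de Rham differential `f ω ↦ ∑ᵢ (∂f/∂tᵢ) dtᵢ ∧ ω`. -/
def omegaD (n p q : ℕ) (h : p + 1 = q) : OmegaX K n p →ₗ[K] OmegaX K n q :=
  ∑ i : Fin n, TensorProduct.map (MvPolynomial.pderiv i).toLinearMap
    (extVec (Pi.single i 1) p q h)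

variable {K} in
theorem omegaD_tmul {n p q : ℕ} (h : p + 1 = q) (f : MvPolynomial (Fin n) K)
    (a : ⋀[K]^p (Fin n → K)) : omegaD K n p q h (f ⊗ₜ a) =
      ∑ i : Fin n, MvPolynomial.pderiv i f ⊗ₜ[K] extVec (Pi.single i 1) p q h a := by
  simp [omegaD, LinearMap.sum_apply]

variable {K} in
theorem pderiv_pderiv {n : ℕ} (i j : Fin n) (f : MvPolynomial (Fin n) K) :
    MvPolynomial.pderiv i (MvPolynomial.pderiv j f) =
      MvPolynomial.pderiv j (MvPolynomial.pderiv i f) := by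
  have h : ⁅MvPolynomial.pderiv (R := K) i, MvPolynomial.pderiv (R := K) j⁆ = 0 := by
    apply MvPolynomial.derivation_ext
    intro l
    rw [Derivation.commutator_apply]
    simp only [MvPolynomial.pderiv_X, Derivation.coe_zero, Pi.zero_apply, Pi.single_apply]
    split_ifs <;> simp
  have h2 := congrArg (fun D => D f) h
  rw [Derivation.commutator_apply] at h2
  exact sub_eq_zero.mp h2

/-- The algebra `Ωₙ` of polynomial differential forms on the standard `n`-simplex. -/
def omega (n : ℕ) : CDGA K where
  X p := OmegaX K n p
  d p q h := omegaD K n p q h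
  one := 1 ⊗ₜ ⟨1, (pow_zero (LinearMap.range (ExteriorAlgebra.ι K (M := Fin n → K)))).ge
    (Submodule.one_le.mp le_rfl)⟩
  mul p q r h := TensorProduct.map₂ (LinearMap.mul K _) (extMul p q r h)
  one_mul p h x := by
    induction x using TensorProduct.induction_on with
    | zero => simp
    | add x y hx hy => simp only [map_add, hx, hy]
    | tmul f a =>
      rw [DGLA.map₂_tmul_tmul]
      congr 1
      · simp
      · ext; simp
  d_d p q r hpq hqr x := by
    induction x using TensorProduct.induction_on with
    | zero => simp
    | add x y hx hy => simp only [map_add, hx, hy, add_zero]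
    | tmul f a =>
      simp only [omegaD_tmul, map_sum]
      have hanti : ∀ i j : Fin n, extVec (K := K) (Pi.single i 1 : Fin n → K) q r hqr
          (extVec (Pi.single j 1) p q hpq a) =
          -extVec (Pi.single j 1) q r hqr (extVec (Pi.single i 1) p q hpq a) := by
        intro i j
        ext
        have := ExteriorAlgebra.ι_add_mul_swap (R := K) (Pi.single i 1 : Fin n → K) (Pi.single j 1)
        simp only [extVec_coe, ← mul_assoc, Submodule.coe_neg]
        rw [eq_neg_of_add_eq_zero_left this, neg_mul]
      have hself : ∀ i : Fin n, extVec (K := K) (Pi.single i 1 : Fin n → K) q r hqr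
          (extVec (Pi.single i 1) p q hpq a) = 0 := by
        intro i
        ext
        simp only [extVec_coe, ← mul_assoc, ExteriorAlgebra.ι_sq_zero, zero_mul]
        rfl
      rw [← Finset.sum_product']
      refine Finset.sum_involution (fun x _ => (x.2, x.1)) ?_ ?_ (by simp) (by simp)
      · rintro ⟨i, j⟩ -
        have : MvPolynomial.pderiv i (MvPolynomial.pderiv j f) =
            MvPolynomial.pderiv j (MvPolynomial.pderiv i f) := pderiv_pderiv i j f
        simp only
        rw [hanti i j, this, TensorProduct.tmul_neg, add_neg_cancel]
      · rintro ⟨i, j⟩ - hne heq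
        simp only [Prod.mk.injEq] at heq
        apply hne
        rw [heq.1]
        simp only [hself, TensorProduct.tmul_zero]
  mul_comm p q r h h' x y := by
    induction x using TensorProduct.induction_on with
    | zero => simp
    | add x x' hx hx' => simp only [map_add, LinearMap.add_apply, hx, hx', smul_add]
    | tmul f a =>
      induction y using TensorProduct.induction_on with
      | zero => simp
      | add y y' hy hy' => simp only [map_add, LinearMap.add_apply, hy, hy', smul_add]
      | tmul g b =>
        have : extMul p q r h a b = (-1 : K) ^ (p * q) • extMul q p r h' b a :=
          Subtype.ext (ext_mul_comm a.2 b.2)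
        rw [DGLA.map₂_tmul_tmul, DGLA.map₂_tmul_tmul, this, LinearMap.mul_apply',
          LinearMap.mul_apply', mul_comm, TensorProduct.tmul_smul]
  mul_assoc p q r pq qr s h₁ h₂ h₃ h₄ x y z := by
    induction x using TensorProduct.induction_on with
    | zero => simp
    | add x x' hx hx' => simp only [map_add, LinearMap.add_apply, hx, hx']
    | tmul f a =>
      induction y using TensorProduct.induction_on with
      | zero => simp
      | add y y' hy hy' => simp only [map_add, LinearMap.add_apply, hy, hy']
      | tmul g b =>
        induction z using TensorProduct.induction_on with
        | zero => simp
        | add z z' hz hz' => simp only [map_add, hz, hz']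
        | tmul k c =>
          simp only [DGLA.map₂_tmul_tmul, LinearMap.mul_apply', mul_assoc]
          congr 1
          ext
          simp [mul_assoc]
  leibniz p q r p' q' r' h hp hq hr h₁ h₂ x y := by
    induction x using TensorProduct.induction_on with
    | zero => simp
    | add x x' hx hx' => simp only [map_add, LinearMap.add_apply, hx, hx', smul_add]; abel
    | tmul f a =>
      induction y using TensorProduct.induction_on with
      | zero => simp
      | add y y' hy hy' => simp only [map_add, hy, hy', smul_add]; abel
      | tmul g b =>
        simp only [DGLA.map₂_tmul_tmul, omegaD_tmul, map_sum, LinearMap.sum_apply,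
          Finset.smul_sum, ← Finset.sum_add_distrib]
        refine Finset.sum_congr rfl fun i _ => ?_
        have e1 : extMul p' q r' h₁ (extVec (Pi.single i 1) p p' hp a) b =
            extVec (Pi.single i 1) r r' hr (extMul p q r h a b) := by
          ext; simp [mul_assoc]
        have e2 : extMul p q' r' h₂ a (extVec (Pi.single i 1) q q' hq b) =
            (-1 : K) ^ p • extVec (Pi.single i 1) r r' hr (extMul p q r h a b) := by
          ext
          simp only [extMul_coe, extVec_coe, Submodule.coe_smul, ← mul_assoc]
          rw [ι_mul_of_mem _ a.2, smul_mul_assoc, smul_smul, ← mul_pow]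
          simp
        rw [e1, e2, LinearMap.mul_apply', Derivation.leibniz, TensorProduct.tmul_smul, smul_smul,
          ← mul_pow]
        simp only [smul_eq_mul, LinearMap.mul_apply', TensorProduct.add_tmul, mul_neg, mul_one,
          neg_neg, one_pow, one_smul]
        rw [mul_comm g, add_comm]

/-- The barycentric coordinates `t₀ = 1 - ∑ tᵢ, t₁, …, tₙ` as polynomials. -/
def bary (n : ℕ) : Fin (n + 1) → MvPolynomial (Fin n) K :=
  Fin.cons (1 - ∑ i, MvPolynomial.X i) MvPolynomial.X

/-- Their differentials `dt₀ = -∑ dtᵢ, dt₁, …, dtₙ`. -/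
def dbary (n : ℕ) : Fin (n + 1) → (Fin n → K) :=
  Fin.cons (-∑ i, Pi.single i 1) fun i => Pi.single i 1

/-- The substitution `t₀, …, tₙ₊₁ ↦ t₀, …, tₖ₋₁, 0, tₖ, …, tₙ` on functions. -/
def facePoly (n : ℕ) (k : Fin (n + 2)) :
    MvPolynomial (Fin (n + 1)) K →ₐ[K] MvPolynomial (Fin n) K :=
  MvPolynomial.aeval fun i => (k.insertNth 0 (bary K n) : Fin (n + 2) → _) i.succ

/-- The substitution `dt₀, …, dtₙ₊₁ ↦ dt₀, …, dtₖ₋₁, 0, dtₖ, …, dtₙ` on constant one-forms. -/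
def faceLin (n : ℕ) (k : Fin (n + 2)) : (Fin (n + 1) → K) →ₗ[K] (Fin n → K) :=
  Fintype.linearCombination K fun i => (k.insertNth 0 (dbary K n) : Fin (n + 2) → _) i.succ

theorem pderiv_insertNth (n : ℕ) (k : Fin (n + 2)) (i : Fin n) (j : Fin (n + 2)) :
    MvPolynomial.pderiv i ((k.insertNth 0 (bary K n) : Fin (n + 2) → _) j) =
      MvPolynomial.C ((k.insertNth 0 (dbary K n) : Fin (n + 2) → Fin n → K) j i) := by
  induction j using Fin.succAboveCases k with
  | x => simp
  | p j =>
    simp only [Fin.insertNth_apply_succAbove]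
    induction j using Fin.cases with
    | zero => simp [bary, dbary, MvPolynomial.pderiv_X, Pi.single_apply]
    | succ j => simp [bary, dbary, MvPolynomial.pderiv_X, Pi.single_apply, eq_comm]

theorem pderiv_facePoly (n : ℕ) (k : Fin (n + 2)) (i : Fin n) (f : MvPolynomial (Fin (n + 1)) K) :
    MvPolynomial.pderiv i (facePoly K n k f) =
      ∑ j, faceLin K n k (Pi.single j 1) i • facePoly K n k (MvPolynomial.pderiv j f) := by
  induction f using MvPolynomial.induction_on with
  | C a => simp [facePoly]
  | add f g hf hg => simp only [map_add, hf, hg, smul_add, Finset.sum_add_distrib]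
  | mul_X f l h =>
    have h1 : MvPolynomial.pderiv i (facePoly K n k (MvPolynomial.X l)) =
        MvPolynomial.C (faceLin K n k (Pi.single l 1) i) := by
      simp only [facePoly, MvPolynomial.aeval_X, pderiv_insertNth, faceLin,
        Fintype.linearCombination_apply_single, one_smul]
    simp only [map_mul, Derivation.leibniz, h, h1, smul_eq_mul, map_add, MvPolynomial.pderiv_X,
      smul_add, Finset.sum_add_distrib, Finset.mul_sum]
    congr 1
    · rw [Finset.sum_eq_single l]
      · simp [MvPolynomial.smul_eq_C_mul, mul_comm]
      · intro j _ hj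
        simp [Pi.single_eq_of_ne hj.symm]
      · simp
    · refine Finset.sum_congr rfl fun j _ => ?_
      rw [mul_smul_comm]

/-- The face map `δ^{k,n+1} : Ωₙ₊₁ → Ωₙ`, the pull-back of forms to the face `tₖ = 0`. -/
def omegaFace (n : ℕ) (k : Fin (n + 2)) : CDGA.Hom (omega K (n + 1)) (omega K n) where
  f p := TensorProduct.map (facePoly K n k).toLinearMap (exteriorPower.map p (faceLin K n k))
  map_one := by
    have h : ∀ a b, a = (1 : MvPolynomial (Fin n) K) → b.1 = (1 : ExteriorAlgebra K (Fin n → K)) →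
        a ⊗ₜ[K] b = (omega K n).one := by
      rintro a ⟨b, hb⟩ rfl rfl; rfl
    refine h _ _ (map_one (facePoly K n k)) ?_
    rw [extMap_coe, map_one]
  map_d p q h x := by
    have H : ∀ x : OmegaX K (n + 1) p,
        TensorProduct.map (facePoly K n k).toLinearMap (exteriorPower.map q (faceLin K n k))
          (omegaD K (n + 1) p q h x) = omegaD K n p q h
            (TensorProduct.map (facePoly K n k).toLinearMap
              (exteriorPower.map p (faceLin K n k)) x) := by
      intro x
      induction x using TensorProduct.induction_on with
      | zero => simp
      | add x y hx hy => simp only [map_add, hx, hy]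
      | tmul f a =>
        have e : ∀ j : Fin (n + 1), exteriorPower.map q (faceLin K n k)
            (extVec (Pi.single j 1) p q h a) = ∑ i : Fin n, faceLin K n k (Pi.single j 1) i •
              extVec (Pi.single i 1) p q h (exteriorPower.map p (faceLin K n k) a) := by
          intro j
          ext
          rw [extMap_coe, extVec_coe, map_mul, ExteriorAlgebra.map_apply_ι]
          conv_lhs => rw [← Finset.univ_sum_single (faceLin K n k (Pi.single j 1))]
          simp only [map_sum, Finset.sum_mul, Submodule.coe_sum, Submodule.coe_smul, extVec_coe,
            extMap_coe]
          refine Finset.sum_congr rfl fun i _ => ?_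
          rw [← smul_mul_assoc, ← map_smul, ← Pi.single_smul', smul_eq_mul, mul_one]
        simp only [omegaD_tmul, map_sum, TensorProduct.map_tmul, AlgHom.toLinearMap_apply, e,
          pderiv_facePoly, TensorProduct.tmul_sum, TensorProduct.sum_tmul]
        rw [Finset.sum_comm]
        simp only [TensorProduct.tmul_smul, TensorProduct.smul_tmul']
    exact H x
  map_mul p q r h x y := by
    have H : ∀ (x : OmegaX K (n + 1) p) (y : OmegaX K (n + 1) q),
        TensorProduct.map (facePoly K n k).toLinearMap (exteriorPower.map r (faceLin K n k))
          (TensorProduct.map₂ (LinearMap.mul K _) (extMul p q r h) x y) =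
          TensorProduct.map₂ (LinearMap.mul K _) (extMul p q r h)
            (TensorProduct.map (facePoly K n k).toLinearMap
              (exteriorPower.map p (faceLin K n k)) x)
            (TensorProduct.map (facePoly K n k).toLinearMap
              (exteriorPower.map q (faceLin K n k)) y) := by
      intro x y
      induction x using TensorProduct.induction_on with
      | zero => simp
      | add x x' hx hx' => simp only [map_add, LinearMap.add_apply, hx, hx']
      | tmul f a =>
        induction y using TensorProduct.induction_on with
        | zero => simp
        | add y y' hy hy' => simp only [map_add, hy, hy']
        | tmul g b =>
          simp only [DGLA.map₂_tmul_tmul, TensorProduct.map_tmul, AlgHom.toLinearMap_apply,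
            LinearMap.mul_apply', map_mul]
          congr 1
          ext
          simp [extMap_coe]
    exact H x y

end Forms

/-! ### The DGLA `Ω ⊗ L` -/

namespace CDGA

variable {K : Type u} [Field K]

/-- The degree `k` part `⨁_{p+j=k} Ωᵖ ⊗ Lʲ` of `Ω ⊗ L`. -/
abbrev TensorX (Ω : CDGA K) (L : DGLA K) (k : ℤ) : Type u :=
  DirectSum {s : ℕ × ℤ // (s.1 : ℤ) + s.2 = k} fun s => Ω.X s.1.1 ⊗[K] L.X s.1.2

/-- The inclusion of the summand `Ωᵖ ⊗ Lʲ`. -/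
def incl (Ω : CDGA K) (L : DGLA K) (p : ℕ) (j k : ℤ) (h : (p : ℤ) + j = k) :
    Ω.X p ⊗[K] L.X j →ₗ[K] TensorX Ω L k :=
  DirectSum.lof K {s : ℕ × ℤ // (s.1 : ℤ) + s.2 = k} (fun s => Ω.X s.1.1 ⊗[K] L.X s.1.2)
    ⟨(p, j), h⟩

/-- `d(ω ⊗ x) = dω ⊗ x + (-1)ᵖ ω ⊗ dx` for `ω ∈ Ωᵖ`. -/
def tensorD (Ω : CDGA K) (L : DGLA K) (k k' : ℤ) (h : k + 1 = k') :
    TensorX Ω L k →ₗ[K] TensorX Ω L k' :=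
  DirectSum.toModule K _ _ fun s =>
    incl Ω L (s.1.1 + 1) s.1.2 k' (by have := s.2; push_cast; omega) ∘ₗ
        (Ω.d s.1.1 (s.1.1 + 1) rfl).rTensor (L.X s.1.2) +
      (-1 : K) ^ s.1.1 • incl Ω L s.1.1 (s.1.2 + 1) k' (by have := s.2; omega) ∘ₗ
        (L.d s.1.2 (s.1.2 + 1) rfl).lTensor (Ω.X s.1.1)

/-- `[ω ⊗ x, η ⊗ y] = (-1)^(jq) ωη ⊗ [x, y]` for `x ∈ Lʲ`, `η ∈ Ω^q`. -/
def tensorBr (Ω : CDGA K) (L : DGLA K) (k l m : ℤ) (h : k + l = m) :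
    TensorX Ω L k →ₗ[K] TensorX Ω L l →ₗ[K] TensorX Ω L m :=
  DirectSum.toModule K _ _ fun s => LinearMap.flip <| DirectSum.toModule K _ _ fun t =>
    LinearMap.flip <| (-1 : K) ^ (s.1.2 * (t.1.1 : ℤ)) •
      (TensorProduct.map₂ (Ω.mul s.1.1 t.1.1 (s.1.1 + t.1.1) rfl)
        (L.br s.1.2 t.1.2 (s.1.2 + t.1.2) rfl)).compr₂
        (incl Ω L (s.1.1 + t.1.1) (s.1.2 + t.1.2) m
          (by have := s.2; have := t.2; push_cast; omega))

theorem tensorD_incl (Ω : CDGA K) (L : DGLA K) {k k' : ℤ} (h : k + 1 = k') {p p' : ℕ} {j j' : ℤ}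
    (hp : p + 1 = p') (hj : j + 1 = j') (hs : (p : ℤ) + j = k) (h₁ : (p' : ℤ) + j = k')
    (h₂ : (p : ℤ) + j' = k') (ω : Ω.X p) (x : L.X j) :
    tensorD Ω L k k' h (incl Ω L p j k hs (ω ⊗ₜ x)) =
      incl Ω L p' j k' h₁ (Ω.d p p' hp ω ⊗ₜ x) +
        (-1 : K) ^ p • incl Ω L p j' k' h₂ (ω ⊗ₜ L.d j j' hj x) := by
  subst hp hj
  simp only [tensorD]
  conv_lhs => rw [incl, DirectSum.toModule_lof]
  simp

theorem tensorBr_incl (Ω : CDGA K) (L : DGLA K) {k l m : ℤ} (h : k + l = m) {p q r : ℕ}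
    {i j c : ℤ} (hr : p + q = r) (hc : i + j = c) (hs : (p : ℤ) + i = k) (ht : (q : ℤ) + j = l)
    (hm : (r : ℤ) + c = m) (ω : Ω.X p) (x : L.X i) (η : Ω.X q) (y : L.X j) :
    tensorBr Ω L k l m h (incl Ω L p i k hs (ω ⊗ₜ x)) (incl Ω L q j l ht (η ⊗ₜ y)) =
      (-1 : K) ^ (i * (q : ℤ)) •
        incl Ω L r c m hm (Ω.mul p q r hr ω η ⊗ₜ L.br i j c hc x y) := by
  subst hr hc
  simp only [tensorBr]
  conv_lhs => rw [incl, incl, DirectSum.toModule_lof, LinearMap.flip_apply,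
    DirectSum.toModule_lof, LinearMap.flip_apply]
  rfl

theorem tensor_induction (Ω : CDGA K) (L : DGLA K) {k : ℤ} {P : TensorX Ω L k → Prop}
    (zero : P 0) (add : ∀ x y, P x → P y → P (x + y))
    (incl : ∀ (p : ℕ) (j : ℤ) (h : (p : ℤ) + j = k) (ω : Ω.X p) (x : L.X j),
      P (incl Ω L p j k h (ω ⊗ₜ x))) (x : TensorX Ω L k) : P x := by
  induction x using DirectSum.induction_on with
  | zero => exact zero
  | add x y hx hy => exact add x y hx hy
  | of s t =>
    obtain ⟨⟨p, j⟩, h⟩ := s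
    change Ω.X p ⊗[K] L.X j at t
    induction t using TensorProduct.induction_on with
    | zero => rw [map_zero]; exact zero
    | add x y hx hy => rw [map_add]; exact add _ _ hx hy
    | tmul ω x => exact incl p j h ω x

/-- The DGLA `Ω ⊗ L`. -/
def tensor (Ω : CDGA K) (L : DGLA K) : DGLA K where
  X k := TensorX Ω L k
  d k k' h := tensorD Ω L k k' h
  br k l m h := tensorBr Ω L k l m h
  d_d i j k hij hjk x := by
    induction x using tensor_induction with
    | zero => simp
    | add x y hx hy => simp only [map_add, hx, hy, add_zero]
    | incl p a h ω x =>
      rw [tensorD_incl Ω L hij rfl rfl h (by push_cast; omega) (by omega), map_add, map_smul,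
        tensorD_incl Ω L hjk rfl rfl _ (by push_cast; omega) (by push_cast; omega),
        tensorD_incl Ω L hjk rfl rfl _ (by push_cast; omega) (by push_cast; omega),
        Ω.d_d, L.d_d]
      simp only [TensorProduct.zero_tmul, TensorProduct.tmul_zero, map_zero, zero_add, smul_zero,
        add_zero, pow_succ, mul_neg, mul_one]
      exact (congrArg (· + _) (neg_smul _ _)).trans (neg_add_cancel _)
  br_symm i j k h h' x y := by
    induction x using tensor_induction with
    | zero => simp
    | add x x' hx hx' => simp only [map_add, LinearMap.add_apply, hx, hx', smul_add, neg_add]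
    | incl p a hs ω x =>
      induction y using tensor_induction with
      | zero => simp
      | add y y' hy hy' => simp only [map_add, LinearMap.add_apply, hy, hy', smul_add, neg_add]
      | incl q b ht η y =>
        rw [tensorBr_incl Ω L h rfl rfl hs ht (by push_cast; omega),
          tensorBr_incl Ω L h' (add_comm q p) (add_comm b a) ht hs (by push_cast; omega),
          Ω.mul_comm p q _ _ (add_comm q p), L.br_symm a b _ _ (add_comm b a)]
        simp only [TensorProduct.tmul_neg, TensorProduct.tmul_smul, ← TensorProduct.smul_tmul',
          map_neg, map_smul, smul_neg, smul_smul]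
        congr 2
        simp only [← zpow_natCast, ← zpow_add₀ (neg_ne_zero.mpr (one_ne_zero' K))]
        apply neg_one_zpow_congr
        exact ⟨-(p * b), by rw [← hs, ← ht]; push_cast; ring⟩
  leibniz i j k i' j' k' h hi hj hk h₁ h₂ x y := by
    induction x using tensor_induction with
    | zero => simp
    | add x x' hx hx' => simp only [map_add, LinearMap.add_apply, hx, hx', smul_add]; abel
    | incl p a hs ω x =>
      induction y using tensor_induction with
      | zero => simp
      | add y y' hy hy' => simp only [map_add, hy, hy', smul_add]; abel
      | incl q b ht η y =>
        rw [tensorBr_incl Ω L h rfl rfl hs ht (by push_cast; omega), map_smul,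
          tensorD_incl Ω L hk rfl rfl _ (by push_cast; omega) (by push_cast; omega),
          tensorD_incl Ω L hi rfl rfl _ (by push_cast; omega) (by push_cast; omega),
          tensorD_incl Ω L hj rfl rfl _ (by push_cast; omega) (by push_cast; omega),
          map_add, map_add, LinearMap.add_apply, map_smul, map_smul, LinearMap.smul_apply,
          tensorBr_incl Ω L h₁ (by omega : p + 1 + q = p + q + 1) rfl _ _ (by push_cast; omega),
          tensorBr_incl Ω L h₁ rfl (by ring : a + 1 + b = a + b + 1) _ _ (by push_cast; omega),
          tensorBr_incl Ω L h₂ (by omega : p + (q + 1) = p + q + 1) rfl _ _ (by push_cast; omega),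
          tensorBr_incl Ω L h₂ rfl (by ring : a + (b + 1) = a + b + 1) _ _ (by push_cast; omega),
          Ω.leibniz p q (p + q) (p + 1) (q + 1) (p + q + 1) rfl rfl rfl rfl (by omega) (by omega),
          L.leibniz a b (a + b) (a + 1) (b + 1) (a + b + 1) rfl rfl rfl rfl (by omega) (by omega)]
        simp only [TensorProduct.add_tmul, TensorProduct.tmul_add, TensorProduct.tmul_smul,
          ← TensorProduct.smul_tmul', map_add, map_smul, smul_add, smul_smul]
        have e0 := neg_ne_zero.mpr (one_ne_zero' K)
        simp only [← zpow_natCast, ← zpow_add₀ e0]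
        have s1 : (-1 : K) ^ (a * (q : ℤ) + p) = (-1 : K) ^ (i + a * ((q + 1 : ℕ) : ℤ)) :=
          neg_one_zpow_congr K ⟨-a, by rw [← hs]; push_cast; ring⟩
        have s2 : (-1 : K) ^ (a * (q : ℤ) + ((p + q : ℕ) : ℤ)) =
            (-1 : K) ^ ((p : ℤ) + (a + 1) * q) :=
          neg_one_zpow_congr K ⟨0, by push_cast; ring⟩
        have s3 : (-1 : K) ^ (a * (q : ℤ) + (((p + q : ℕ) : ℤ) + a)) =
            (-1 : K) ^ (i + (q + a * q)) :=
          neg_one_zpow_congr K ⟨0, by rw [← hs]; push_cast; ring⟩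
        rw [← s1, ← s2, ← s3]
        abel_nf
  jacobi i j k ij jk ik l hij hjk hik h₁ h₂ h₃ x y z := by
    induction x using tensor_induction with
    | zero => simp
    | add x x' hx hx' => simp only [map_add, LinearMap.add_apply, hx, hx', smul_add]; abel
    | incl p a hs ω x =>
      induction y using tensor_induction with
      | zero => simp
      | add y y' hy hy' => simp only [map_add, LinearMap.add_apply, hy, hy', smul_add]; abel
      | incl q b ht η y =>
        induction z using tensor_induction with
        | zero => simp
        | add z z' hz hz' => simp only [map_add, hz, hz', smul_add]; abel
        | incl r c hu θ z =>
          rw [tensorBr_incl Ω L hjk rfl rfl ht hu (by push_cast; omega),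
            tensorBr_incl Ω L hij rfl rfl hs ht (by push_cast; omega),
            tensorBr_incl Ω L hik rfl rfl hs hu (by push_cast; omega),
            map_smul, map_smul, map_smul, LinearMap.smul_apply,
            tensorBr_incl Ω L h₁ rfl rfl hs _ (by push_cast; omega),
            tensorBr_incl Ω L h₂ (by omega : p + q + r = p + (q + r))
              (by omega : a + b + c = a + (b + c)) _ hu (by push_cast; omega),
            tensorBr_incl Ω L h₃ (by omega : q + (p + r) = p + (q + r))
              (by omega : b + (a + c) = a + (b + c)) ht _ (by push_cast; omega),
            L.jacobi a b c (a + b) (b + c) (a + c) (a + (b + c)) rfl rfl rfl rfl (by omega)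
              (by omega)]
          have eΩ : Ω.mul (p + q) r (p + (q + r)) (by omega) (Ω.mul p q (p + q) rfl ω η) θ =
              Ω.mul p (q + r) (p + (q + r)) rfl ω (Ω.mul q r (q + r) rfl η θ) :=
            Ω.mul_assoc ..
          have eΩ' : Ω.mul q (p + r) (p + (q + r)) (by omega) η (Ω.mul p r (p + r) rfl ω θ) =
              (-1 : K) ^ (q * p) • Ω.mul p (q + r) (p + (q + r)) rfl ω
                (Ω.mul q r (q + r) rfl η θ) := by
            rw [← eΩ, ← Ω.mul_assoc q p r (p + q) (p + r) _ (by omega) (by omega),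
              Ω.mul_comm q p (p + q) _ rfl, map_smul, LinearMap.smul_apply]
          rw [eΩ, eΩ']
          simp only [TensorProduct.tmul_add, TensorProduct.tmul_smul,
            ← TensorProduct.smul_tmul', map_add, map_smul, smul_add, smul_smul]
          have e0 := neg_ne_zero.mpr (one_ne_zero' K)
          simp only [← zpow_natCast, ← zpow_add₀ e0]
          congr 2
          · exact neg_one_zpow_congr K ⟨0, by push_cast; ring⟩
          · exact neg_one_zpow_congr K ⟨-(p * q + p * b), by rw [← hs, ← ht]; push_cast; ring⟩

/-- `Ω ⊗ L → Ω' ⊗ L'` in degree `k`. -/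
def tensorMapX {Ω Ω' : CDGA K} (σ : Hom Ω Ω') {L L' : DGLA K} (φ : DGLA.Hom L L') (k : ℤ) :
    TensorX Ω L k →ₗ[K] TensorX Ω' L' k :=
  DirectSum.toModule K _ (TensorX Ω' L' k) fun s =>
    incl Ω' L' s.1.1 s.1.2 k s.2 ∘ₗ TensorProduct.map (σ.f s.1.1) (φ.f s.1.2)

theorem tensorMapX_incl {Ω Ω' : CDGA K} (σ : Hom Ω Ω') {L L' : DGLA K} (φ : DGLA.Hom L L')
    {k : ℤ} (p : ℕ) (j : ℤ) (h : (p : ℤ) + j = k) (ω : Ω.X p) (x : L.X j) :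
    tensorMapX σ φ k (incl Ω L p j k h (ω ⊗ₜ x)) =
      incl Ω' L' p j k h (σ.f p ω ⊗ₜ φ.f j x) := by
  rw [tensorMapX]
  conv_lhs => rw [incl, DirectSum.toModule_lof]
  rfl

/-- The morphism `Ω ⊗ L → Ω' ⊗ L'` induced by `Ω → Ω'` and `L → L'`. -/
def tensorMap {Ω Ω' : CDGA K} (σ : Hom Ω Ω') {L L' : DGLA K} (φ : DGLA.Hom L L') :
    DGLA.Hom (Ω.tensor L) (Ω'.tensor L') where
  f k := tensorMapX σ φ k
  map_d k k' h x := by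
    have H := @tensorMapX_incl K _ Ω Ω' σ L L' φ
    change tensorMapX σ φ k' (tensorD Ω L k k' h x) = tensorD Ω' L' k k' h (tensorMapX σ φ k x)
    induction x using tensor_induction with
    | zero => simp
    | add x y hx hy => simp only [map_add, hx, hy]
    | incl p a hs ω x =>
      rw [tensorD_incl Ω L h rfl rfl hs (by push_cast; omega) (by omega), H,
        tensorD_incl Ω' L' h rfl rfl hs (by push_cast; omega) (by omega), map_add, map_smul, H, H,
        σ.map_d, φ.map_d]
  map_br k l m h x y := by
    have H := @tensorMapX_incl K _ Ω Ω' σ L L' φ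
    change TensorX Ω L k at x
    change TensorX Ω L l at y
    change tensorMapX σ φ m (tensorBr Ω L k l m h x y) =
      tensorBr Ω' L' k l m h (tensorMapX σ φ k x) (tensorMapX σ φ l y)
    induction x using tensor_induction with
    | zero => simp
    | add x x' hx hx' => simp only [map_add, LinearMap.add_apply, hx, hx']
    | incl p a hs ω x =>
      induction y using tensor_induction with
      | zero => simp
      | add y y' hy hy' => simp only [map_add, hy, hy']
      | incl q b ht η y =>
        rw [tensorBr_incl Ω L h rfl rfl hs ht (by push_cast; omega), H, H,
          tensorBr_incl Ω' L' h rfl rfl hs ht (by push_cast; omega), map_smul, H, σ.map_mul,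
          φ.map_br]

theorem tensorMapX_comm {Ω Ω' : CDGA K} (σ : Hom Ω Ω') {L L' : DGLA K} (φ : DGLA.Hom L L') (k : ℤ)
    (x : TensorX Ω L k) : tensorMapX σ (DGLA.Hom.id L') k (tensorMapX (Hom.id Ω) φ k x) =
      tensorMapX (Hom.id Ω') φ k (tensorMapX σ (DGLA.Hom.id L) k x) := by
  induction x using tensor_induction with
  | zero => simp
  | add x y hx hy => simp only [map_add, hx, hy]
  | incl p a hs ω x => simp only [tensorMapX_incl]; rfl

theorem tensorMapX_comp {Ω : CDGA K} {L L' L'' : DGLA K} (φ : DGLA.Hom L L')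
    (ψ : DGLA.Hom L' L'') (k : ℤ) (x : TensorX Ω L k) :
    tensorMapX (Hom.id Ω) ψ k (tensorMapX (Hom.id Ω) φ k x) =
      tensorMapX (Hom.id Ω) (φ.comp ψ) k x := by
  induction x using tensor_induction with
  | zero => simp
  | add x y hx hy => simp only [map_add, hx, hy]
  | incl p a hs ω x => simp only [tensorMapX_incl]; rfl

end CDGA

/-! ### The Thom–Whitney DGLA -/

namespace SemicosimplicialDGLA

variable {K : Type u} [Field K]

/-- `δ^{k,n+1} : Ωₙ₊₁ ⊗ 𝔤ₙ₊₁ → Ωₙ ⊗ 𝔤ₙ₊₁`. -/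
def restr (g : SemicosimplicialDGLA K) (n : ℕ) (k : Fin (n + 2)) :
    DGLA.Hom ((omega K (n + 1)).tensor (g.obj (n + 1))) ((omega K n).tensor (g.obj (n + 1))) :=
  CDGA.tensorMap (omegaFace K n k) (DGLA.Hom.id _)

/-- `∂_{k,n+1} : Ωₙ ⊗ 𝔤ₙ → Ωₙ ⊗ 𝔤ₙ₊₁`. -/
def coface (g : SemicosimplicialDGLA K) (n : ℕ) (k : Fin (n + 2)) :
    DGLA.Hom ((omega K n).tensor (g.obj n)) ((omega K n).tensor (g.obj (n + 1))) :=
  CDGA.tensorMap (CDGA.Hom.id _) (g.face n k)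

/-- The degree `j` part of `Tot_TW(𝔤^Δ)`: the families `xₙ ∈ (Ωₙ ⊗ 𝔤ₙ)ʲ` with
`δ^{k,n+1} xₙ₊₁ = ∂_{k,n+1} xₙ` for all `n` and `0 ≤ k ≤ n + 1`. -/
def twX (g : SemicosimplicialDGLA K) (j : ℤ) :
    Submodule K (∀ n, ((omega K n).tensor (g.obj n)).X j) where
  carrier := {x | ∀ n k, (g.restr n k).f j (x (n + 1)) = (g.coface n k).f j (x n)}
  add_mem' hx hy n k := by simp only [Pi.add_apply, map_add, hx n k, hy n k]
  zero_mem' n k := by simp only [Pi.zero_apply, map_zero]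
  smul_mem' c x hx n k := by simp only [Pi.smul_apply, map_smul, hx n k]

/-- The Thom–Whitney DGLA `Tot_TW(𝔤^Δ)`. -/
def totTW (g : SemicosimplicialDGLA K) : DGLA K where
  X j := g.twX j
  d i j h := LinearMap.restrict
    (LinearMap.pi fun n => ((omega K n).tensor (g.obj n)).d i j h ∘ₗ LinearMap.proj n)
    fun x hx n k => by
      simp only [LinearMap.pi_apply, LinearMap.comp_apply, LinearMap.proj_apply]
      rw [(g.restr n k).map_d, (g.coface n k).map_d, hx n k]
  br i j l h := LinearMap.mk₂ K
    (fun x y => ⟨fun n => ((omega K n).tensor (g.obj n)).br i j l h (x.1 n) (y.1 n), fun n k => by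
      rw [(g.restr n k).map_br, (g.coface n k).map_br, x.2 n k, y.2 n k]⟩)
    (fun _ _ _ => by ext; simp) (fun _ _ _ => by ext; simp)
    (fun _ _ _ => by ext; simp) (fun _ _ _ => by ext; simp)
  d_d i j k hij hjk x := Subtype.ext (funext fun n =>
    DGLA.d_d ((omega K n).tensor (g.obj n)) i j k hij hjk (x.1 n))
  br_symm i j k h h' x y := Subtype.ext (funext fun n =>
    DGLA.br_symm ((omega K n).tensor (g.obj n)) i j k h h' (x.1 n) (y.1 n))
  leibniz i j k i' j' k' h hi hj hk h₁ h₂ x y :=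
    Subtype.ext (funext fun n => DGLA.leibniz ((omega K n).tensor (g.obj n))
      i j k i' j' k' h hi hj hk h₁ h₂ (x.1 n) (y.1 n))
  jacobi i j k ij jk ik l hij hjk hik h₁ h₂ h₃ x y z :=
    Subtype.ext (funext fun n => DGLA.jacobi ((omega K n).tensor (g.obj n))
      i j k ij jk ik l hij hjk hik h₁ h₂ h₃ (x.1 n) (y.1 n) (z.1 n))

/-- The morphism `Tot_TW(𝔤^Δ) → Tot_TW(𝔥^Δ)` induced by `𝔤^Δ → 𝔥^Δ`. -/
def totTWMap {g h : SemicosimplicialDGLA K} (φ : Hom g h) : DGLA.Hom g.totTW h.totTW where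
  f j := LinearMap.restrict (p := g.twX j) (q := h.twX j)
    (LinearMap.pi fun n =>
      (CDGA.tensorMap (CDGA.Hom.id (omega K n)) (φ.app n)).f j ∘ₗ LinearMap.proj n)
    fun x hx n k => by
      have h1 := CDGA.tensorMapX_comm (omegaFace K n k) (φ.app (n + 1)) j (x (n + 1))
      have h2 := CDGA.tensorMapX_comp (Ω := omega K n) (φ.app n) (h.face n k) j (x n)
      have h3 := CDGA.tensorMapX_comp (Ω := omega K n) (g.face n k) (φ.app (n + 1)) j (x n)
      rw [φ.comm] at h2
      exact h1.trans ((congrArg _ (hx n k)).trans (h3.trans h2.symm))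
  map_d i j e x := Subtype.ext (funext fun n =>
    (CDGA.tensorMap (CDGA.Hom.id (omega K n)) (φ.app n)).map_d i j e (x.1 n))
  map_br i j k e x y := Subtype.ext (funext fun n =>
    (CDGA.tensorMap (CDGA.Hom.id (omega K n)) (φ.app n)).map_br i j k e (x.1 n) (y.1 n))

end SemicosimplicialDGLA

/-! ### Tangent spaces and obstructions of functors of Artin rings -/

namespace Art

variable {K : Type u} [Field K]

section SqZero

variable (V W : Type u) [AddCommGroup V] [Module K V] [Module Kᵐᵒᵖ V] [IsCentralScalar K V]
  [Module.Finite K V] [AddCommGroup W] [Module K W] [Module Kᵐᵒᵖ W] [IsCentralScalar K W]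
  [Module.Finite K W]

/-- The square-zero extension `K ⊕ V` as an object of `Art_K`. -/
def sqZero : Art K :=
  haveI : IsLocalRing (TrivSqZeroExt K V) := IsLocalRing.of_nonunits_add fun a b ha hb => by
    simp only [mem_nonunits_iff, TrivSqZeroExt.isUnit_iff_isUnit_fst, isUnit_iff_ne_zero, ne_eq,
      not_not, TrivSqZeroExt.fst_add] at *
    rw [ha, hb, add_zero]
  haveI : Module.Finite K (TrivSqZeroExt K V) := inferInstanceAs (Module.Finite K (K × V))
  haveI : IsArtinianRing (TrivSqZeroExt K V) := IsArtinianRing.of_finite K _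
  { carrier := TrivSqZeroExt K V
    residue := by
      refine ⟨(algebraMap K _).injective, fun y => ?_⟩
      obtain ⟨x, rfl⟩ := IsLocalRing.residue_surjective y
      refine ⟨x.fst, ?_⟩
      rw [IsScalarTower.algebraMap_apply K (TrivSqZeroExt K V), IsLocalRing.ResidueField.algebraMap_eq,
        ← sub_eq_zero, ← map_sub, IsLocalRing.residue_eq_zero_iff, IsLocalRing.mem_maximalIdeal,
        mem_nonunits_iff, TrivSqZeroExt.isUnit_iff_isUnit_fst]
      simp [TrivSqZeroExt.algebraMap_eq_inl] }

variable {V W} in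
/-- The morphism `K ⊕ V → K ⊕ W` induced by a linear map. -/
def sqZeroMap (f : V →ₗ[K] W) : sqZero (K := K) V ⟶ sqZero W := TrivSqZeroExt.map f

end SqZero

/-- An isomorphism between the tangent space `F(K[ε])` of a functor of Artin rings and a vector
space `T`. The vector space structure on `F(K[ε])` is the usual one: the two projections identify
`F(K[ε] ×_K K[ε])` with `F(K[ε]) × F(K[ε])`, addition is induced by `(x, y) ↦ x + y`, and scalar
multiplication by `c` is induced by `ε ↦ cε`. -/
structure TangentIso (F : Art K ⥤ Type u) (T : Type u) [AddCommGroup T] [Module K T] where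
  equiv : F.obj (sqZero K) ≃ T
  bijective : Function.Bijective fun z : F.obj (sqZero (K × K)) =>
    (F.map (sqZeroMap (LinearMap.fst K K K)) z, F.map (sqZeroMap (LinearMap.snd K K K)) z)
  map_add : ∀ z : F.obj (sqZero (K × K)),
    equiv (F.map (sqZeroMap (LinearMap.fst K K K + LinearMap.snd K K K)) z) =
      equiv (F.map (sqZeroMap (LinearMap.fst K K K)) z) +
        equiv (F.map (sqZeroMap (LinearMap.snd K K K)) z)
  map_smul : ∀ (c : K) (x : F.obj (sqZero K)),
    equiv (F.map (sqZeroMap (c • LinearMap.id)) x) = c • equiv x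

/-- The kernel of a morphism `B ⟶ A`, as an ideal of `B`. -/
abbrev ker {B A : Art K} (π : B ⟶ A) : Ideal B.carrier := RingHom.ker (Hom.alg π)

/-- Small extensions `0 → J → B → A → 0`: `B → A` is surjective and `𝔪_B J = 0`. -/
structure IsSmallExtension {B A : Art K} (π : B ⟶ A) : Prop where
  surjective : Function.Surjective (Hom.alg π)
  mul_eq_zero : ∀ b ∈ B.max, ∀ x ∈ ker π, b * x = 0

/-- The map on kernels induced by a commutative square. -/
def kerMap {B A B' A' : Art K} (π : B ⟶ A) (π' : B' ⟶ A') (β : B ⟶ B') (α : A ⟶ A')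
    (w : π ≫ α = β ≫ π') : ker π →ₗ[K] ker π' where
  toFun x := ⟨Hom.alg β x.1, by
    have h : Hom.alg α (Hom.alg π x.1) = Hom.alg π' (Hom.alg β x.1) :=
      congrArg (fun φ : B ⟶ A' => Hom.alg φ x.1) w
    rw [RingHom.mem_ker, ← h, (RingHom.mem_ker).mp x.2, map_zero]⟩
  map_add' x y := by ext; simp
  map_smul' c x := by ext; simp

/-- A complete obstruction theory for `F` with values in `V`: to every small extension
`0 → J → B → A → 0` and `x ∈ F(A)` there is attached, functorially in the extension, an obstruction
in `V ⊗ J` which vanishes if and only if `x` lifts to `F(B)`. -/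
structure ObstructionTheory (F : Art K ⥤ Type u) (V : Type u) [AddCommGroup V] [Module K V] where
  ob : ∀ {B A : Art K} (π : B ⟶ A), IsSmallExtension π → F.obj A → V ⊗[K] ker π
  natural : ∀ {B A B' A' : Art K} (π : B ⟶ A) (π' : B' ⟶ A') (hπ : IsSmallExtension π)
    (hπ' : IsSmallExtension π') (β : B ⟶ B') (α : A ⟶ A') (w : π ≫ α = β ≫ π') (x : F.obj A),
    ob π' hπ' (F.map α x) = (kerMap π π' β α w).lTensor V (ob π hπ x)
  complete : ∀ {B A : Art K} (π : B ⟶ A) (hπ : IsSmallExtension π) (x : F.obj A),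
    ob π hπ x = 0 ↔ ∃ y : F.obj B, F.map π y = x

end Art

end

/-! A Maurer–Cartan element x of Tot_TW(𝔤) ⊗ 𝔪_A is a compatible family of Maurer–Cartan elements
x_n on the simplices Δⁿ with values in 𝔤_n. On Δ⁰ it is an element l. Simplices are contractible, so
on Δ¹ the element x_1 is gauge equivalent to the constant ∂_0 l; the gauge transformation p is
normalised to be trivial at vertex 1, and m is its value at vertex 0. Then (l, m) is associated with
x (`Assoc`). On Δ² the coface images of p are compared along the edges with a trivialisation of x_2
over the whole triangle, and this yields the cocycle condition. It holds only up to irrelevant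
stabilizers: two gauge elements over a simplex that move a constant element c in the same way differ
at the vertices by elements that can be controlled only modulo dn + [c, n] (`irrStab_vtx`). Gauge
equivalences are treated in the same way on Δ¹. This gives a natural map Def → H¹_sc (`compare`)
without any hypothesis.

For bijectivity the higher levels have to be controlled. Integration over simplices compares Tot_TW
with Tot, also relative to the first levels (`twInt_d`, `exists_twInt_eq`); hence the kernel of the
projection of Tot_TW to the levels below N has no cohomology in degree i as soon as H^(i-n)(𝔤_n) = 0
for all n ≥ N (`kerAcyclic_twProj`). Vanishing H¹ of this kernel makes two Maurer–Cartan elements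
with equal lower levels gauge equivalent (`DGLA.exists_gauge_eq`); with N = 2 this is injectivity.
Vanishing H² of it allows a family that is Maurer–Cartan in the lower levels to be corrected in the
higher ones (`DGLA.exists_isMC`); with N = 3 this is surjectivity, once l and m have been spread out
by hand over Δ⁰, Δ¹ and Δ². Both facts are proved by induction along the powers of 𝔪_A. After
truncation only H⁻¹(𝔤_2) = 0 is left of these conditions, and H¹_sc does not see levels above two.

For the third statement the isomorphism reduces everything to Def_L for a DGLA L, where first order
deformations form H¹(L) and the curvature of a lift gives a class in H²(L) ⊗ J; integration
identifies the cohomology of Tot_TW with that of Tot.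

Two independent foundations are needed. One is the Baker–Campbell–Hausdorff theorem for Dynkin's
explicit formula: it turns degree zero into a group that acts by the gauge action (`nexp_lieBch`,
`lieBch_assoc`, `gauge_bch`). The other is polynomial de Rham theory on simplices: extension of
forms from the boundary, the radial homotopy, and Stokes' formula (`exists_extension`,
`omegaD_radial`, `integ_omegaD`). -/

noncomputable section

/-! ### Exponentials of nilpotent elements -/

section NilpotentExp

open Finset

variable (K : Type*) [Field K] {R : Type*} [Ring R] [Algebra K R]

/-- The exponential of a nilpotent element of a `K`-algebra. -/
def nexp (a : R) : R := ∑ i ∈ range (nilpotencyClass a), ((i.factorial : K))⁻¹ • a ^ i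

/-- The inner derivation `y ↦ ay - ya`. -/
def inner (a : R) : Module.End K R := LinearMap.mulLeft K a - LinearMap.mulRight K a

@[simp]
theorem inner_apply (a y : R) : inner K a y = a * y - y * a := rfl

theorem commute_mulLeft_mulRight (a b : R) :
    Commute (LinearMap.mulLeft K a) (LinearMap.mulRight K b) := by
  ext y; simp [mul_assoc]

theorem isNilpotent_mulLeft {a : R} (h : IsNilpotent a) : IsNilpotent (LinearMap.mulLeft K a) := by
  obtain ⟨k, hk⟩ := h
  exact ⟨k, by rw [LinearMap.pow_mulLeft, hk, LinearMap.mulLeft_zero_eq_zero]⟩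

theorem isNilpotent_mulRight {a : R} (h : IsNilpotent a) :
    IsNilpotent (LinearMap.mulRight K a) := by
  obtain ⟨k, hk⟩ := h
  exact ⟨k, by rw [LinearMap.pow_mulRight, hk, LinearMap.mulRight_zero_eq_zero]⟩

theorem isNilpotent_inner {a : R} (h : IsNilpotent a) : IsNilpotent (inner K a) :=
  (commute_mulLeft_mulRight K a a).isNilpotent_sub (isNilpotent_mulLeft K h)
    (isNilpotent_mulRight K h)

/-- Evaluation of formal power series at an element with `x ^ M = 0`. -/
def nilEval (x : R) {M : ℕ} (hx : x ^ M = 0) : PowerSeries K →ₐ[K] R where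
  toFun f := Polynomial.aeval x (f.trunc M)
  map_one' := by
    rcases Nat.eq_zero_or_pos M with rfl | hM
    · have : (1 : R) = 0 := by simpa using hx
      rw [this]
      exact eq_zero_of_zero_eq_one this.symm _
    · obtain ⟨m, rfl⟩ := Nat.exists_eq_succ_of_ne_zero hM.ne'
      rw [PowerSeries.trunc_one, map_one]
  map_mul' f g := by
    -- Since x ^ M = 0, evaluation at x only depends on a polynomial modulo X ^ M, so truncations
    -- may be inserted freely.
    have key : ∀ p : Polynomial K, Polynomial.aeval x p =
        Polynomial.aeval x ((p : PowerSeries K).trunc M) := by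
      intro p
      have : (Polynomial.X : Polynomial K) ^ M ∣ p - (p : PowerSeries K).trunc M := by
        rw [Polynomial.X_pow_dvd_iff]
        intro d hd
        simp [PowerSeries.coeff_trunc, hd]
      obtain ⟨c, hc⟩ := this
      have h2 := congrArg (Polynomial.aeval x) hc
      simp only [map_sub, map_mul, map_pow, Polynomial.aeval_X, hx, zero_mul] at h2
      exact sub_eq_zero.mp h2
    rw [← map_mul, key (f.trunc M * g.trunc M)]
    congr 1
    rw [← PowerSeries.trunc_trunc_mul_trunc]
    simp
  map_zero' := by simp
  map_add' f g := by simp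
  commutes' r := by
    rcases Nat.eq_zero_or_pos M with rfl | hM
    · have : (1 : R) = 0 := by simpa using hx
      exact eq_of_zero_eq_one this.symm _ _
    · obtain ⟨m, rfl⟩ := Nat.exists_eq_succ_of_ne_zero hM.ne'
      rw [show algebraMap K (PowerSeries K) r = PowerSeries.C r from rfl, PowerSeries.trunc_C]
      simp

theorem nilEval_apply (x : R) {M : ℕ} (hx : x ^ M = 0) (f : PowerSeries K) :
    nilEval K x hx f = ∑ i ∈ range M, PowerSeries.coeff i f • x ^ i := by
  change Polynomial.aeval x (f.trunc M) = _
  rw [Polynomial.aeval_def, PowerSeries.eval₂_trunc_eq_sum_range]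
  exact sum_congr rfl fun i _ => (Algebra.smul_def _ _).symm

theorem nilEval_eq_zero (x : R) {M : ℕ} (hx : x ^ M = 0) {f : PowerSeries K}
    (h : ∀ i < M, PowerSeries.coeff i f = 0) : nilEval K x hx f = 0 := by
  rw [nilEval_apply]
  exact sum_eq_zero fun i hi => by rw [h i (mem_range.mp hi), zero_smul]

/-- The power series `(e^X - 1) / X`. -/
def expQuot : PowerSeries K := PowerSeries.mk fun n => (((n + 1).factorial : K))⁻¹

/-- A polynomial approximation of `log (1 + y) / y`. -/
def logQuot {S : Type*} [Ring S] [Algebra K S] (M : ℕ) (y : S) : S :=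
  ∑ k ∈ range M, ((-1 : K) ^ k / (k + 1 : ℕ)) • y ^ k

/-- The element `(e^x - 1) / x`. -/
def nexpQuot (M : ℕ) (x : R) : R := ∑ k ∈ range M, (((k + 1).factorial : K))⁻¹ • x ^ k

theorem nilEval_expQuot (x : R) {M : ℕ} (hx : x ^ M = 0) :
    nilEval K x hx (expQuot K) = nexpQuot K M x := by
  rw [nilEval_apply, nexpQuot]
  simp [expQuot]

variable [CharZero K]

theorem nexp_eq_exp (a : R) :
    letI : Module ℚ R := Module.compHom R (algebraMap ℚ K)
    nexp K a = IsNilpotent.exp a := by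
  let _ : Module ℚ R := Module.compHom R (algebraMap ℚ K)
  refine sum_congr rfl fun i _ => ?_
  change _ = (algebraMap ℚ K ((i.factorial : ℚ)⁻¹)) • a ^ i
  simp

theorem nexp_eq_sum {a : R} {k : ℕ} (h : a ^ k = 0) :
    nexp K a = ∑ i ∈ range k, ((i.factorial : K))⁻¹ • a ^ i := by
  let _ : Module ℚ R := Module.compHom R (algebraMap ℚ K)
  rw [nexp_eq_exp, IsNilpotent.exp_eq_sum h]
  refine sum_congr rfl fun i _ => ?_
  change (algebraMap ℚ K ((i.factorial : ℚ)⁻¹)) • a ^ i = _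
  simp

theorem nexp_add_of_commute {a b : R} (h : Commute a b) (ha : IsNilpotent a)
    (hb : IsNilpotent b) : nexp K (a + b) = nexp K a * nexp K b := by
  let _ : Module ℚ R := Module.compHom R (algebraMap ℚ K)
  simp only [nexp_eq_exp]
  exact IsNilpotent.exp_add_of_commute h ha hb

@[simp]
theorem nexp_zero : nexp K (0 : R) = 1 := by
  rw [nexp_eq_sum K (pow_one 0)]; simp

theorem nexp_mul_nexp_neg {a : R} (h : IsNilpotent a) : nexp K a * nexp K (-a) = 1 := by
  rw [← nexp_add_of_commute K (Commute.neg_right rfl) h h.neg]; simp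

theorem nexp_neg_mul_nexp {a : R} (h : IsNilpotent a) : nexp K (-a) * nexp K a = 1 := by
  rw [← nexp_add_of_commute K (Commute.neg_left rfl) h.neg h]; simp

theorem map_nexp {S : Type*} [Ring S] [Algebra K S] {a : R} (ha : IsNilpotent a)
    (f : R →ₐ[K] S) : f (nexp K a) = nexp K (f a) := by
  obtain ⟨k, hk⟩ := ha
  have hk' : f a ^ k = 0 := by rw [← map_pow, hk, map_zero]
  simp [nexp_eq_sum K hk, nexp_eq_sum K hk']

theorem nexp_apply_eq_sum {V : Type*} [AddCommGroup V] [Module K V] {a : Module.End K V} {k : ℕ}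
    (h : a ^ k = 0) (v : V) :
    nexp K a v = ∑ i ∈ range k, ((i.factorial : K))⁻¹ • (a ^ i) v := by
  simp [nexp_eq_sum K h, LinearMap.sum_apply]

/-- The inner derivation is the sum of left multiplication by a and right multiplication by -a,
which commute; the exponential of the sum is the product of the exponentials. -/
theorem nexp_inner {a : R} (h : IsNilpotent a) (y : R) :
    nexp K (inner K a) y = nexp K a * y * nexp K (-a) := by
  have e : inner K a = LinearMap.mulLeft K a + LinearMap.mulRight K (-a) := by
    ext y; simp [sub_eq_add_neg]
  rw [e, nexp_add_of_commute K (commute_mulLeft_mulRight K a (-a)) (isNilpotent_mulLeft K h)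
    (isNilpotent_mulRight K h.neg)]
  have e2 := map_nexp K h (Algebra.lmul K R)
  change LinearMap.mulLeft K (nexp K a) = nexp K (LinearMap.mulLeft K a) at e2
  obtain ⟨k, hk⟩ := h.neg
  have e3 : nexp K (LinearMap.mulRight K (-a)) y = y * nexp K (-a) := by
    rw [nexp_apply_eq_sum K (k := k) (by
      rw [LinearMap.pow_mulRight, hk, LinearMap.mulRight_zero_eq_zero]), nexp_eq_sum K hk, mul_sum]
    simp [LinearMap.pow_mulRight]
  rw [Module.End.mul_apply, e3, ← e2, LinearMap.mulLeft_apply, mul_assoc]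

/-- The exponentials of compatible derivations are compatible with a bilinear map. -/
theorem nexp_bilin {U V W : Type*} [AddCommGroup U] [Module K U] [AddCommGroup V] [Module K V]
    [AddCommGroup W] [Module K W] (β : U →ₗ[K] V →ₗ[K] W) {a : Module.End K U}
    {b : Module.End K V} {c : Module.End K W} (ha : IsNilpotent a) (hb : IsNilpotent b)
    (hc : IsNilpotent c) (h : ∀ u v, c (β u v) = β (a u) v + β u (b v)) (u : U) (v : V) :
    nexp K c (β u v) = β (nexp K a u) (nexp K b v) := by
  -- The hypothesis says that β, as a linear map on U ⊗ V, intertwines a ⊗ 1 + 1 ⊗ b with c. The two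
  -- summands commute, so the exponential factors as e^a ⊗ e^b.
  let A : Module.End K (U ⊗[K] V) := Module.End.rTensorAlgHom K U V a
  let B : Module.End K (U ⊗[K] V) := Module.End.lTensorAlgHom K V U b
  have hA : IsNilpotent A := ha.map _
  have hB : IsNilpotent B := hb.map _
  have hAB : Commute A B := by
    apply TensorProduct.ext'
    intro x y
    change a x ⊗ₜ[K] b y = a x ⊗ₜ[K] b y
    rfl
  have e : c ∘ₗ TensorProduct.lift β = TensorProduct.lift β ∘ₗ (A + B) := by
    apply TensorProduct.ext'
    intro x y
    change c (β x y) = TensorProduct.lift β (a x ⊗ₜ[K] y + x ⊗ₜ[K] b y)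
    rw [map_add, h]; rfl
  have hpow : ∀ n, (c ^ n) ∘ₗ TensorProduct.lift β = TensorProduct.lift β ∘ₗ ((A + B) ^ n) := by
    intro n
    induction n with
    | zero => rfl
    | succ n ih =>
      rw [pow_succ, pow_succ, Module.End.mul_eq_comp, LinearMap.comp_assoc, e,
        ← LinearMap.comp_assoc, ih]; rfl
  obtain ⟨k, hk⟩ := hc
  obtain ⟨l, hl⟩ := hAB.isNilpotent_add hA hB
  have e1 := nexp_apply_eq_sum K (pow_eq_zero_of_le (le_max_left k l) hk) (β u v)
  have e2 := nexp_apply_eq_sum K (pow_eq_zero_of_le (le_max_right k l) hl) (u ⊗ₜ[K] v)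
  have e3 : nexp K c (β u v) = TensorProduct.lift β (nexp K (A + B) (u ⊗ₜ v)) := by
    rw [e1, e2, map_sum]
    refine sum_congr rfl fun i _ => ?_
    have := LinearMap.congr_fun (hpow i) (u ⊗ₜ v)
    simp only [LinearMap.comp_apply, TensorProduct.lift.tmul] at this
    rw [this, map_smul]
  rw [e3, nexp_add_of_commute K hAB hA hB, ← map_nexp K ha, ← map_nexp K hb]
  rfl

/-- Put f = e^X - 1. Then X times the product is the truncated logarithm g of 1 + f = e^X, and a
geometric sum gives g' = 1 - (-f)^M. As X divides f, this is 1 modulo X^M, and comparing the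
coefficients of g' yields the claim. -/
theorem coeff_expQuot_mul_logQuot (M i : ℕ) (hi : i < M) :
    PowerSeries.coeff i (expQuot K * logQuot K M (PowerSeries.exp K - 1)) =
      PowerSeries.coeff i (1 : PowerSeries K) := by
  set f : PowerSeries K := PowerSeries.exp K - 1 with hf
  have hXf : PowerSeries.X * expQuot K = f := by
    ext n
    cases n with
    | zero => simp [hf]
    | succ n => simp [hf, expQuot, PowerSeries.coeff_succ_X_mul, PowerSeries.coeff_one]
  set g : PowerSeries K := ∑ k ∈ range M, ((-1 : K) ^ k / (k + 1 : ℕ)) • f ^ (k + 1) with hg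
  have hg2 : g = PowerSeries.X * (expQuot K * logQuot K M f) := by
    rw [← mul_assoc, hXf, logQuot, mul_sum, hg]
    refine sum_congr rfl fun k _ => ?_
    rw [pow_succ', mul_smul_comm]
  have hdf : PowerSeries.derivative K f = 1 + f := by
    rw [hf, map_sub, PowerSeries.derivative_exp]
    simp
  have hdg : PowerSeries.derivative K g = 1 - (-f) ^ M := by
    have h1 : PowerSeries.derivative K g = (∑ k ∈ range M, (-f) ^ k) * (1 + f) := by
      rw [hg, map_sum, sum_mul]
      refine sum_congr rfl fun k _ => ?_
      rw [Derivation.map_smul, Derivation.leibniz_pow, hdf]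
      have hk : ((k + 1 : ℕ) : K) ≠ 0 := Nat.cast_ne_zero.mpr (by omega)
      simp only [add_tsub_cancel_right, smul_eq_mul]
      rw [← Nat.cast_smul_eq_nsmul K, smul_smul, div_mul_cancel₀ _ hk, Algebra.smul_def, ← mul_assoc,
        neg_pow f]
      simp
    rw [h1]
    have := geom_sum_mul_neg (-f) M
    rwa [sub_neg_eq_add] at this
  have hdiv : (PowerSeries.X : PowerSeries K) ^ M ∣ (-f) ^ M := by
    apply pow_dvd_pow_of_dvd
    rw [← hXf]
    exact Dvd.intro (-expQuot K) (by ring)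
  have h3 := congrArg (PowerSeries.coeff i) hdg
  rw [map_sub, PowerSeries.X_pow_dvd_iff.mp hdiv i hi, sub_zero, PowerSeries.coeff_derivative,
    hg2, PowerSeries.coeff_succ_X_mul] at h3
  have hi1 : ((i : K) + 1) ≠ 0 := by exact_mod_cast Nat.succ_ne_zero i
  rw [← mul_left_inj' hi1, h3, PowerSeries.coeff_one]
  split_ifs with h0 <;> simp [h0]

theorem nilEval_exp (x : R) {M : ℕ} (hx : x ^ M = 0) :
    nilEval K x hx (PowerSeries.exp K) = nexp K x := by
  rw [nilEval_apply, nexp_eq_sum K hx]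
  simp

theorem nexpQuot_mul_logQuot (x : R) {M : ℕ} (hx : x ^ M = 0) :
    nexpQuot K M x * logQuot K M (nexp K x - 1) = 1 := by
  have h := nilEval_eq_zero K x hx (f := expQuot K * logQuot K M (PowerSeries.exp K - 1) - 1)
    (fun i hi => by rw [map_sub, coeff_expQuot_mul_logQuot K M i hi, sub_self])
  rw [map_sub, map_mul, map_one, nilEval_expQuot, sub_eq_zero] at h
  simpa only [logQuot, map_sum, map_smul, map_pow, map_sub, map_one, nilEval_exp] using h

theorem nexpQuot_mul_eq (x : R) {M : ℕ} (hx : x ^ M = 0) : nexpQuot K M x * x = nexp K x - 1 := by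
  have h : expQuot K * PowerSeries.X = PowerSeries.exp K - 1 := by
    ext n
    cases n with
    | zero => simp
    | succ n => simp [expQuot, PowerSeries.coeff_succ_mul_X, PowerSeries.coeff_one]
  rcases Nat.lt_or_ge 1 M with hM | hM
  · have hX : nilEval K x hx PowerSeries.X = x := by
      rw [nilEval_apply, sum_eq_single 1]
      · simp
      · intro b _ hb; simp [PowerSeries.coeff_X, hb]
      · intro h; exact absurd (mem_range.mpr hM) h
    have := congrArg (nilEval K x hx) h
    rwa [map_mul, nilEval_expQuot, hX, map_sub, map_one, nilEval_exp] at this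
  · have : x = 0 := by
      have h1 := pow_eq_zero_of_le hM hx
      simpa using h1
    subst this
    simp

/-- The logarithm of e^z is z. As the right side depends only on e^z, the exponential is injective
on nilpotent elements, and a vector fixed by e^a is killed by a. -/
theorem eq_logQuot_mul (z : R) {M : ℕ} (hz : z ^ M = 0) :
    z = logQuot K M (nexp K z - 1) * (nexp K z - 1) := by
  have h1 := nexpQuot_mul_logQuot K z hz
  have h2 := nexpQuot_mul_eq K z hz
  have hc : Commute (nexpQuot K M z) (nexp K z - 1) := by
    rw [← h2]
    exact (Commute.refl _).mul_right (Commute.sum_left _ _ _ fun i _ =>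
      ((Commute.refl z).pow_left i).smul_left _)
  have hc2 : Commute (nexpQuot K M z) (logQuot K M (nexp K z - 1)) :=
    Commute.sum_right _ _ _ fun i _ => (hc.pow_right i).smul_right _
  rw [show logQuot K M (nexp K z - 1) * (nexp K z - 1) =
    logQuot K M (nexp K z - 1) * (nexpQuot K M z * z) by rw [h2],
    ← mul_assoc, ← hc2.eq, h1, one_mul]

theorem nexp_injective {x y : R} (hx : IsNilpotent x) (hy : IsNilpotent y)
    (h : nexp K x = nexp K y) : x = y := by
  obtain ⟨k, hk⟩ := hx
  obtain ⟨l, hl⟩ := hy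
  rw [eq_logQuot_mul K x (pow_eq_zero_of_le (le_max_left k l) hk),
    eq_logQuot_mul K y (pow_eq_zero_of_le (le_max_right k l) hl), h]

theorem nexp_apply_eq_self_iff {V : Type*} [AddCommGroup V] [Module K V] {a : Module.End K V}
    (ha : IsNilpotent a) (v : V) : nexp K a v = v ↔ a v = 0 := by
  obtain ⟨k, hk⟩ := ha
  constructor
  · intro h
    rw [eq_logQuot_mul K a hk, Module.End.mul_apply, LinearMap.sub_apply, h, Module.End.one_apply,
      sub_self, map_zero]
  · intro h
    have := congrArg (fun f : Module.End K V => f v) (nexpQuot_mul_eq K a hk)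
    simp only [Module.End.mul_apply, h, map_zero, LinearMap.sub_apply, Module.End.one_apply] at this
    exact (sub_eq_zero.mp this.symm)

/-- The logarithmic derivative of the exponential. -/
theorem derivation_nexp (D : R →ₗ[K] R) (hD : ∀ x y, D (x * y) = D x * y + x * D y) {x : R}
    {M : ℕ} (hx : IsNilpotent x) (hM : inner K x ^ M = 0) :
    D (nexp K x) * nexp K (-x) = nexpQuot K M (inner K x) (D x) := by
  have hD1 : D 1 = 0 := by simpa using hD 1 1
  -- The operator D is conjugated by left multiplication with e^x. Since [Λ, D] is left
  -- multiplication by -D x, the terms of the series e^(ad Λ) D beyond the first are left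
  -- multiplications by -(ad x)^k (D x) / (k+1)!. Applied to 1, where D vanishes, the two
  -- expressions for the conjugate compute e^x D(e^(-x)), which is -D(e^x) e^(-x).
  let Λ : Module.End K R := LinearMap.mulLeft K x
  have hΛ : IsNilpotent Λ := isNilpotent_mulLeft K hx
  have hin : ∀ y : R, inner K Λ (LinearMap.mulLeft K y) = LinearMap.mulLeft K (inner K x y) := by
    intro y; ext z; simp [Λ, sub_mul, mul_assoc]
  have h0 : inner K Λ D = LinearMap.mulLeft K (-D x) := by
    ext z; simp [Λ, hD]
  have hk : ∀ k, (inner K Λ ^ (k + 1)) D = LinearMap.mulLeft K (-((inner K x ^ k) (D x))) := by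
    intro k
    induction k with
    | zero => simpa using h0
    | succ k ih =>
      rw [pow_succ', Module.End.mul_apply, ih, hin, pow_succ', Module.End.mul_apply, map_neg]
  obtain ⟨m, hm⟩ := isNilpotent_inner K hΛ
  have hmm : inner K Λ ^ (max M m + 1) = 0 := pow_eq_zero_of_le (by omega) hm
  have e1 := nexp_inner K hΛ D
  have e2 : nexp K Λ = LinearMap.mulLeft K (nexp K x) := (map_nexp K hx (Algebra.lmul K R)).symm
  have e3 : nexp K (-Λ) = LinearMap.mulLeft K (nexp K (-x)) := by
    have := (map_nexp K hx.neg (Algebra.lmul K R)).symm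
    rw [map_neg] at this
    exact this
  rw [nexp_apply_eq_sum K hmm, sum_range_succ'] at e1
  have e4 := LinearMap.congr_fun e1 1
  rw [e2, e3] at e4
  simp only [hk, LinearMap.add_apply, LinearMap.sum_apply, LinearMap.smul_apply,
    LinearMap.mulLeft_apply, Module.End.mul_apply, mul_one, pow_zero, Module.End.one_apply, hD1,
    smul_zero, add_zero, smul_neg, sum_neg_distrib] at e4
  have e5 : D (nexp K x) * nexp K (-x) = -(nexp K x * D (nexp K (-x))) := by
    have := hD (nexp K x) (nexp K (-x))
    rw [nexp_mul_nexp_neg K hx, hD1] at this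
    exact eq_neg_of_add_eq_zero_left this.symm
  rw [e5, ← e4, neg_neg, nexpQuot, LinearMap.sum_apply]
  symm
  apply sum_subset (range_mono (le_max_left M m))
  intro k _ hk2
  rw [pow_eq_zero_of_le (by simpa using hk2) hM, smul_zero, LinearMap.zero_apply]

end NilpotentExp

/-! ### The Baker–Campbell–Hausdorff product in a nilpotent Lie algebra -/

section LieBch

open Finset Polynomial

/-- The iterated bracket `[x₁, [x₂, […, xₙ]]]`. -/
def lieNest {h : Type*} [LieRing h] : List h → h
  | [] => 0
  | [x] => x
  | x :: y :: l => ⁅x, lieNest (y :: l)⁆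

/-- The adjoint action. -/
def lieAd (K : Type*) [Field K] (h : Type*) [LieRing h] [LieAlgebra K h] :
    h →ₗ[K] Module.End K h :=
  LinearMap.mk₂ K (fun x y => ⁅x, y⁆) (fun x y z => add_lie x y z) (fun c x y => smul_lie c x y)
    (fun x y z => lie_add x y z) (fun c x y => lie_smul c x y)

@[simp]
theorem lieAd_apply (K : Type*) [Field K] {h : Type*} [LieRing h] [LieAlgebra K h] (x y : h) :
    lieAd K h x y = ⁅x, y⁆ := rfl

theorem lieAd_lie (K : Type*) [Field K] {h : Type*} [LieRing h] [LieAlgebra K h] (x y : h) :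
    lieAd K h ⁅x, y⁆ = lieAd K h x * lieAd K h y - lieAd K h y * lieAd K h x :=
  LinearMap.ext fun z => lie_lie x y z

/-- The word `a^r₁ b^s₁ ⋯ a^rₖ b^sₖ`. -/
def pairWord {h : Type*} (a b : h) (w : List {p : ℕ × ℕ // p ≠ 0}) : List h :=
  w.flatMap fun p => List.replicate p.1.1 a ++ List.replicate p.1.2 b

/-- The coefficient of a word in Dynkin's formula. -/
def dynkinCoeff (K : Type*) [Field K] (w : List {p : ℕ × ℕ // p ≠ 0}) : K :=
  (-1 : K) ^ (w.length + 1) / (w.length * (w.map fun p => p.1.1 + p.1.2).sum *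
    (w.map fun p => p.1.1.factorial * p.1.2.factorial).prod : ℕ)

/-- Dynkin's formula for the Baker–Campbell–Hausdorff product. -/
def lieBch (K : Type*) [Field K] {h : Type*} [LieRing h] [LieAlgebra K h] (a b : h) : h :=
  ∑ᶠ w : List {p : ℕ × ℕ // p ≠ 0}, dynkinCoeff K w • lieNest (pairWord a b w)

/-- The pairs `(r, s) ≠ (0, 0)` with entries below `M`. -/
def pairsBelow (M : ℕ) : Finset {p : ℕ × ℕ // p ≠ 0} :=
  (range M ×ˢ range M).subtype (· ≠ 0)

/-- The lists of `k` pairs with entries below `M`. -/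
def wordsBelow (M : ℕ) : ℕ → Finset (List {p : ℕ × ℕ // p ≠ 0})
  | 0 => {[]}
  | k + 1 => (pairsBelow M ×ˢ wordsBelow M k).image fun q => q.1 :: q.2

theorem mem_wordsBelow {M k : ℕ} {w : List {p : ℕ × ℕ // p ≠ 0}} :
    w ∈ wordsBelow M k ↔ w.length = k ∧ ∀ p ∈ w, p ∈ pairsBelow M := by
  induction k generalizing w with
  | zero => cases w <;> simp [wordsBelow]
  | succ k ih =>
    cases w with
    | nil => simp [wordsBelow]
    | cons p w => simp [wordsBelow, ih]; tauto

theorem sum_wordsBelow_succ {A : Type*} [AddCommMonoid A] (M k : ℕ)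
    (F : List {p : ℕ × ℕ // p ≠ 0} → A) : ∑ w ∈ wordsBelow M (k + 1), F w =
      ∑ p ∈ pairsBelow M, ∑ w ∈ wordsBelow M k, F (p :: w) := by
  rw [wordsBelow, sum_image, sum_product]
  rintro ⟨p, w⟩ - ⟨q, z⟩ - h
  simp only [List.cons.injEq] at h
  exact Prod.ext h.1 h.2

theorem length_pairWord {h : Type*} (a b : h) (w : List {p : ℕ × ℕ // p ≠ 0}) :
    (pairWord a b w).length = (w.map fun p => p.1.1 + p.1.2).sum := by
  simp [pairWord, List.length_flatMap]

theorem length_le_length_pairWord {h : Type*} (a b : h) (w : List {p : ℕ × ℕ // p ≠ 0}) :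
    w.length ≤ (pairWord a b w).length := by
  induction w with
  | nil => simp
  | cons p w ih =>
    have : 1 ≤ p.1.1 + p.1.2 := by
      have hp := p.2
      by_contra hc
      exact hp (Prod.ext (by simp; omega) (by simp; omega))
    rw [length_pairWord] at ih ⊢
    simp only [List.length_cons, List.map_cons, List.sum_cons]
    omega

/-- A list of pairs contributes only if it is nonempty and spells fewer than M letters. Every pair
spells at least one letter, so the number of pairs and all exponents are bounded in terms of M. -/
theorem lieBch_eq_sum (K : Type*) [Field K] {h : Type*} [LieRing h] [LieAlgebra K h] {M : ℕ}
    (hM : ∀ l : List h, M ≤ l.length → lieNest l = 0) (a b : h) :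
    lieBch K a b = ∑ k ∈ range M, ∑ w ∈ wordsBelow M (k + 1),
      dynkinCoeff K w • lieNest (pairWord a b w) := by
  rw [← sum_biUnion]
  · apply finsum_eq_sum_of_support_subset
    intro w hw
    rw [Function.mem_support] at hw
    have hl : (pairWord a b w).length < M := by
      by_contra hc
      exact hw (by rw [hM _ (not_lt.mp hc), smul_zero])
    have h0 : w ≠ [] := by
      rintro rfl
      exact hw (by simp [pairWord, lieNest])
    have h1 := length_le_length_pairWord a b w
    have h2 : 0 < w.length := List.length_pos_of_ne_nil h0
    simp only [coe_biUnion, Set.mem_iUnion, mem_coe, mem_range, exists_prop, mem_wordsBelow]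
    refine ⟨w.length - 1, by omega, by omega, fun p hp => ?_⟩
    have h3 : p.1.1 + p.1.2 ≤ (w.map fun p => p.1.1 + p.1.2).sum :=
      List.single_le_sum (by simp) _ (List.mem_map_of_mem hp)
    rw [length_pairWord] at hl
    simp only [pairsBelow, mem_subtype, mem_product, mem_range]
    omega
  · intro i _ j _ hij
    rw [Function.onFun, disjoint_left]
    intro w hw hw'
    have := (mem_wordsBelow.mp hw).1
    have := (mem_wordsBelow.mp hw').1
    omega

theorem lieBch_map (K : Type*) [Field K] {h h' : Type*} [LieRing h] [LieAlgebra K h] [LieRing h']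
    [LieAlgebra K h'] (f : h →ₗ⁅K⁆ h') {M : ℕ}
    (hM : ∀ l : List h, M ≤ l.length → lieNest l = 0)
    (hM' : ∀ l : List h', M ≤ l.length → lieNest l = 0) (a b : h) :
    f (lieBch K a b) = lieBch K (f a) (f b) := by
  have key : ∀ l : List h, f (lieNest l) = lieNest (l.map f) := by
    intro l
    induction l with
    | nil => simp [lieNest]
    | cons x l ih =>
      cases l with
      | nil => simp [lieNest]
      | cons y l => simp only [lieNest, List.map_cons, LieHom.map_lie] at ih ⊢; rw [ih]
  rw [lieBch_eq_sum K hM, lieBch_eq_sum K hM']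
  simp only [map_sum, map_smul, key]
  refine sum_congr rfl fun k _ => sum_congr rfl fun w _ => ?_
  simp [pairWord, List.map_flatMap]

/-! ### Polynomial families in a Lie algebra: K[t] ⊗ h, its Euler derivation and its evaluations. -/

section PolyLift

variable {K : Type*} [Field K] {h : Type*} [LieRing h] [LieAlgebra K h]
  {R : Type*} [Ring R] [Algebra K R]

variable (K h) in
/-- The Lie algebra `K[t] ⊗ h`. -/
def PolyLie : Type _ := K[X] ⊗[K] h

instance : LieRing (PolyLie K h) := inferInstanceAs (LieRing (K[X] ⊗[K] h))

instance : LieAlgebra K (PolyLie K h) := inferInstanceAs (LieAlgebra K (K[X] ⊗[K] h))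

/-- The element `p ⊗ x` of `K[t] ⊗ h`. -/
def PolyLie.mk (p : K[X]) (x : h) : PolyLie K h := p ⊗ₜ[K] x

theorem PolyLie.lie_mk (p q : K[X]) (x y : h) :
    ⁅PolyLie.mk p x, PolyLie.mk q y⁆ = PolyLie.mk (p * q) ⁅x, y⁆ := rfl

theorem PolyLie.induction {P : PolyLie K h → Prop} (zero : P 0)
    (mk : ∀ p x, P (PolyLie.mk p x)) (add : ∀ A B, P A → P B → P (A + B)) (A : PolyLie K h) :
    P A :=
  TensorProduct.induction_on (motive := P) A zero mk add

/-- Linear maps out of `K[t] ⊗ h`. -/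
def PolyLie.lift {V : Type*} [AddCommGroup V] [Module K V] (f : K[X] →ₗ[K] h →ₗ[K] V) :
    PolyLie K h →ₗ[K] V := TensorProduct.lift f

/-- The extension of a linear map `h → R` to `K[t] ⊗ h → R[t]`. -/
def polyLift (ρ : h →ₗ[K] R) : PolyLie K h →ₗ[K] R[X] :=
  PolyLie.lift (LinearMap.mk₂ K (fun p x => p.map (algebraMap K R) * C (ρ x))
    (fun p q x => by simp [add_mul])
    (fun c p x => by
      rw [Polynomial.smul_eq_C_mul, Polynomial.map_mul, Polynomial.map_C, mul_assoc,
        Polynomial.C_mul', algebraMap_smul])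
    (fun p x y => by simp [mul_add])
    (fun c p x => by rw [map_smul, ← Polynomial.smul_C, mul_smul_comm]))

theorem polyLift_mk (ρ : h →ₗ[K] R) (p : K[X]) (x : h) :
    polyLift ρ (PolyLie.mk p x) = p.map (algebraMap K R) * C (ρ x) := rfl

/-- The coefficient of `tⁿ` of an element of `K[t] ⊗ h`. -/
def tcoeff (n : ℕ) : PolyLie K h →ₗ[K] h :=
  PolyLie.lift (LinearMap.mk₂ K (fun p x => p.coeff n • x)
    (fun p q x => by simp [add_smul]) (fun c p x => by simp [mul_smul])
    (fun p x y => by simp) (fun c p x => by rw [smul_comm]))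

theorem tcoeff_mk (n : ℕ) (p : K[X]) (x : h) : tcoeff n (PolyLie.mk p x) = p.coeff n • x := rfl

/-- Identities and divisibility by powers of t in R[t] can thus be checked on coefficients, where
the hypotheses on ρ apply directly. -/
theorem coeff_polyLift (ρ : h →ₗ[K] R) (A : PolyLie K h) (n : ℕ) :
    (polyLift ρ A).coeff n = ρ (tcoeff n A) := by
  induction A using PolyLie.induction with
  | zero => simp
  | add A B hA hB => simp [hA, hB]
  | mk p x =>
    rw [polyLift_mk, tcoeff_mk, coeff_mul_C, coeff_map, map_smul, Algebra.smul_def]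

theorem eq_zero_of_tcoeff {A : PolyLie K h} (hA : ∀ n, tcoeff n A = 0) : A = 0 := by
  let e := TensorProduct.equivFinsuppOfBasisLeft (M := K[X]) (N := h) (Polynomial.basisMonomials K)
  have key : ∀ (n : ℕ) (B : K[X] ⊗[K] h), e B n = tcoeff n (show PolyLie K h from B) := by
    intro n B
    induction B with
    | zero => rw [map_zero]; exact (map_zero (tcoeff n)).symm
    | add A B hA hB =>
      rw [map_add, Finsupp.add_apply, hA, hB]; exact (map_add (tcoeff n) _ _).symm
    | tmul p x =>
      rw [TensorProduct.equivFinsuppOfBasisLeft_apply_tmul_apply]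
      rfl
  apply e.injective
  ext n
  exact (key n A).trans ((hA n).trans ((key n 0).trans (map_zero (tcoeff n))).symm)

theorem tcoeff_lie (n : ℕ) (A B : PolyLie K h) :
    tcoeff n ⁅A, B⁆ = ∑ ij ∈ antidiagonal n, ⁅tcoeff ij.1 A, tcoeff ij.2 B⁆ := by
  induction A using PolyLie.induction with
  | zero => simp
  | add A A' hA hA' => simp [hA, hA', sum_add_distrib]
  | mk p x =>
    induction B using PolyLie.induction with
    | zero => simp
    | add B B' hB hB' => simp only [lie_add, map_add, hB, hB', sum_add_distrib]
    | mk q y =>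
      rw [PolyLie.lie_mk, tcoeff_mk, coeff_mul, sum_smul]
      refine sum_congr rfl fun ij _ => ?_
      simp [tcoeff_mk, smul_smul, mul_comm]

theorem polyLift_mul {ρ σ τ : h →ₗ[K] R} (hρ : ∀ a b, ρ a * σ b = τ ⁅a, b⁆) (A B : PolyLie K h) :
    polyLift ρ A * polyLift σ B = polyLift τ ⁅A, B⁆ := by
  ext n
  simp only [coeff_mul, coeff_polyLift, tcoeff_lie, map_sum, hρ]

theorem polyLift_lie {ρ : h →ₗ[K] R} (hρ : ∀ a b, ρ ⁅a, b⁆ = ρ a * ρ b - ρ b * ρ a)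
    (A B : PolyLie K h) :
    polyLift ρ ⁅A, B⁆ = polyLift ρ A * polyLift ρ B - polyLift ρ B * polyLift ρ A := by
  ext n
  simp only [coeff_sub, coeff_mul, coeff_polyLift, tcoeff_lie, map_sum, hρ, sum_sub_distrib]
  congr 1
  rw [← Nat.sum_antidiagonal_swap]
  rfl

/-- The Euler operator `t d/dt`. -/
def euler (K : Type*) [Field K] (R : Type*) [Ring R] [Algebra K R] : R[X] →ₗ[K] R[X] :=
  LinearMap.mulLeft K X ∘ₗ (derivative (R := R)).restrictScalars K

theorem coeff_euler (p : R[X]) (n : ℕ) : (euler K R p).coeff n = n * p.coeff n := by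
  change (X * derivative p).coeff n = _
  cases n with
  | zero => simp
  | succ n =>
    rw [coeff_X_mul, coeff_derivative]
    exact_mod_cast (Nat.cast_commute (n + 1) (p.coeff (n + 1))).eq.symm

theorem euler_mul (p q : R[X]) : euler K R (p * q) = euler K R p * q + p * euler K R q := by
  change X * derivative (p * q) = X * derivative p * q + p * (X * derivative q)
  rw [derivative_mul, mul_add, ← mul_assoc, ← mul_assoc, X_mul, ← mul_assoc, ← X_mul (p := p)]

/-- The Euler operator on `K[t] ⊗ h`. -/
def teuler : PolyLie K h →ₗ[K] PolyLie K h := show K[X] ⊗[K] h →ₗ[K] K[X] ⊗[K] h from (euler K K).rTensor h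

theorem tcoeff_teuler (n : ℕ) (A : PolyLie K h) : tcoeff n (teuler A) = (n : K) • tcoeff n A := by
  induction A using PolyLie.induction with
  | zero => simp
  | add A B hA hB => simp only [map_add, hA, hB, smul_add]
  | mk p x =>
    change tcoeff n (PolyLie.mk (euler K K p) x) = _
    rw [tcoeff_mk, tcoeff_mk, coeff_euler, smul_smul]

theorem teuler_lie (A B : PolyLie K h) : teuler ⁅A, B⁆ = ⁅teuler A, B⁆ + ⁅A, teuler B⁆ := by
  induction A using PolyLie.induction with
  | zero => simp
  | add A A' hA hA' => simp only [add_lie, map_add, hA, hA']; abel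
  | mk p x =>
    induction B using PolyLie.induction with
    | zero => simp
    | add B B' hB hB' => simp only [lie_add, map_add, hB, hB']; abel
    | mk q y =>
      change (euler K K (p * q) ⊗ₜ[K] ⁅x, y⁆ : K[X] ⊗[K] h) =
        (euler K K p * q) ⊗ₜ[K] ⁅x, y⁆ + (p * euler K K q) ⊗ₜ[K] ⁅x, y⁆
      rw [euler_mul, TensorProduct.add_tmul]

theorem polyLift_teuler (ρ : h →ₗ[K] R) (A : PolyLie K h) :
    polyLift ρ (teuler A) = euler K R (polyLift ρ A) := by
  ext n
  rw [coeff_polyLift, tcoeff_teuler, coeff_euler, coeff_polyLift, map_smul,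
    Nat.cast_smul_eq_nsmul, nsmul_eq_mul]

/-- Evaluation of the polynomial coefficients. -/
def PolyLie.evalLin (e : K[X] →ₐ[K] K) : PolyLie K h →ₗ[K] h :=
  PolyLie.lift (LinearMap.mk₂ K (fun (p : K[X]) (x : h) => e p • x)
    (fun p q x => by simp [add_smul]) (fun c p x => by simp [mul_smul])
    (fun p x y => by simp) (fun c p x => by rw [smul_comm]))

theorem PolyLie.evalLin_mk (e : K[X] →ₐ[K] K) (p : K[X]) (x : h) :
    PolyLie.evalLin e (PolyLie.mk p x) = e p • x := rfl

theorem PolyLie.evalLin_lie (e : K[X] →ₐ[K] K) (A B : PolyLie K h) :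
    PolyLie.evalLin e ⁅A, B⁆ = ⁅PolyLie.evalLin e A, PolyLie.evalLin e B⁆ := by
  induction A using PolyLie.induction with
  | zero => simp
  | add A A' hA hA' => simp only [add_lie, map_add, hA, hA']
  | mk p x =>
    induction B using PolyLie.induction with
    | zero => simp
    | add B B' hB hB' => simp only [lie_add, map_add, hB, hB']
    | mk q y =>
      simp [PolyLie.lie_mk, PolyLie.evalLin_mk, smul_smul, mul_comm]

/-- Evaluation of the polynomial coefficients, as a morphism of Lie algebras. -/
def PolyLie.eval (e : K[X] →ₐ[K] K) : PolyLie K h →ₗ⁅K⁆ h :=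
  { PolyLie.evalLin e with map_lie' := fun {A B} => PolyLie.evalLin_lie e A B }

theorem PolyLie.eval_mk (e : K[X] →ₐ[K] K) (p : K[X]) (x : h) :
    PolyLie.eval e (PolyLie.mk p x) = e p • x := rfl

theorem PolyLie.eval_zero (A : PolyLie K h) : PolyLie.eval (aeval 0) A = tcoeff 0 A := by
  induction A using PolyLie.induction with
  | zero => simp
  | add A B hA hB => simp only [map_add, hA, hB]
  | mk p x => rw [PolyLie.eval_mk, tcoeff_mk, coeff_zero_eq_aeval_zero]

end PolyLift

end LieBch

/-! ### Dynkin's series multiplies exponentials. -/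

section Dynkin

open Finset Polynomial

variable {K : Type*} [Field K] {h : Type*} [LieRing h] [LieAlgebra K h]
  {R : Type*} [Ring R] [Algebra K R]

theorem range_pow_eq_bot {ρ : h →ₗ[K] R} {N : ℕ}
    (hN : ∀ l : List h, N ≤ l.length → (l.map ρ).prod = 0) : LinearMap.range ρ ^ N = ⊥ := by
  rw [Submodule.pow_eq_span_pow_set, Submodule.span_eq_bot]
  intro r hr
  obtain ⟨f, rfl⟩ := Set.mem_pow.mp hr
  choose g hg using fun i => (f i).2
  rw [← hN (List.ofFn g) (by simp), List.map_ofFn]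
  congr 1
  exact congrArg List.ofFn (funext fun i => (hg i).symm)

/-- Each coefficient of the product lies in a power of the subspace ρ(h) whose exponent is the
length of the list, and the N-th power of that subspace is zero. -/
theorem polyLift_prod_eq_zero {ρ : h →ₗ[K] R} {N : ℕ}
    (hN : ∀ l : List h, N ≤ l.length → (l.map ρ).prod = 0) (l : List (PolyLie K h))
    (hl : N ≤ l.length) : (l.map (polyLift ρ)).prod = 0 := by
  have key : ∀ (l : List (PolyLie K h)) (n : ℕ),
      ((l.map (polyLift ρ)).prod).coeff n ∈ LinearMap.range ρ ^ l.length := by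
    intro l
    induction l with
    | nil =>
      intro n
      rw [List.map_nil, List.prod_nil, coeff_one, List.length_nil, pow_zero]
      split_ifs
      · exact Submodule.one_le.mp le_rfl
      · exact zero_mem _
    | cons A l ih =>
      intro n
      rw [List.map_cons, List.prod_cons, List.length_cons, pow_succ', coeff_mul]
      refine sum_mem fun ij _ => Submodule.mul_mem_mul ?_ (ih _)
      rw [coeff_polyLift]
      exact ⟨_, rfl⟩
  ext n
  have := key l n
  rw [← Nat.sub_add_cancel hl, pow_add, range_pow_eq_bot hN, Submodule.mul_bot] at this
  simpa using this

theorem polyLift_pow_eq_zero {ρ : h →ₗ[K] R} {N : ℕ}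
    (hN : ∀ l : List h, N ≤ l.length → (l.map ρ).prod = 0) (A : PolyLie K h) :
    polyLift ρ A ^ N = 0 := by
  simpa using polyLift_prod_eq_zero hN (List.replicate N A) (by simp)

/-- Under v, a bracket nested to the right becomes the product of the operators ρ of all letters but
the last, applied to v of the last one. Long products vanish, and v is injective. -/
theorem lieNest_eq_zero_of_vector {ρ v : h →ₗ[K] R} (hv : ∀ a b, ρ a * v b = v ⁅a, b⁆)
    (hinj : Function.Injective v) {N : ℕ}
    (hN : ∀ l : List h, N ≤ l.length → (l.map ρ).prod = 0) (l : List h) (hl : N + 1 ≤ l.length) :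
    lieNest l = 0 := by
  have key : ∀ (l : List h) (b : h), v (lieNest (l ++ [b])) = (l.map ρ).prod * v b := by
    intro l b
    induction l with
    | nil => simp [lieNest]
    | cons c l ih =>
      have : lieNest (c :: l ++ [b]) = ⁅c, lieNest (l ++ [b])⁆ := by
        cases l <;> rfl
      rw [this, ← hv, ih, List.map_cons, List.prod_cons, mul_assoc]
  apply hinj
  rcases List.eq_nil_or_concat l with rfl | ⟨l', b, rfl⟩
  · simp at hl
  · rw [List.concat_eq_append, key, hN l' (by simpa using hl), zero_mul, map_zero]

/-- The monomial vector attached to a word. -/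
def wordVec (v : h →ₗ[K] R) (l : List h) : R[X] :=
  polyLift v (PolyLie.mk (X ^ l.length) (lieNest l))

theorem wordVec_nil (v : h →ₗ[K] R) : wordVec v [] = 0 := by
  rw [wordVec, polyLift_mk]; simp [lieNest]

theorem wordVec_cons {ρ v : h →ₗ[K] R} (hv : ∀ a b, ρ a * v b = v ⁅a, b⁆) (c : h) {l : List h}
    (hl : l ≠ []) : wordVec v (c :: l) = polyLift ρ (PolyLie.mk X c) * wordVec v l := by
  obtain ⟨d, l, rfl⟩ := List.exists_cons_of_ne_nil hl
  rw [wordVec, wordVec, polyLift_mul hv, PolyLie.lie_mk, ← pow_succ']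
  rfl

theorem wordVec_replicate_append {ρ v : h →ₗ[K] R} (hv : ∀ a b, ρ a * v b = v ⁅a, b⁆) (c : h)
    (n : ℕ) {l : List h} (hl : l ≠ []) :
    wordVec v (List.replicate n c ++ l) = polyLift ρ (PolyLie.mk X c) ^ n * wordVec v l := by
  induction n with
  | zero => simp
  | succ n ih =>
    rw [List.replicate_succ, List.cons_append, wordVec_cons hv c (by simp [hl]), ih, pow_succ',
      mul_assoc]

/-- The innermost bracket is [c, c] = 0. This is what removes most words from Dynkin's formula. -/
theorem wordVec_replicate {ρ v : h →ₗ[K] R} (hv : ∀ a b, ρ a * v b = v ⁅a, b⁆) (c : h)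
    (n : ℕ) : wordVec v (List.replicate (n + 2) c) = 0 := by
  rw [List.replicate_add, wordVec_replicate_append hv _ _ (by simp),
    show List.replicate 2 c = [c, c] from rfl]
  have : wordVec v [c, c] = 0 := by
    rw [wordVec, lieNest, lieNest, lie_self, polyLift_mk]
    simp
  rw [this, mul_zero]

theorem sum_pairsBelow {A : Type*} [AddCommGroup A] (M : ℕ) (F : ℕ × ℕ → A) :
    ∑ p ∈ pairsBelow (M + 1), F p.1 =
      ∑ r ∈ range (M + 1), ∑ s ∈ range (M + 1), F (r, s) - F 0 := by
  rw [pairsBelow, sum_subtype_eq_sum_filter (f := F), ← sum_product', filter_ne', eq_sub_iff_add_eq,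
    sum_erase_add]
  simp

theorem teuler_mk_X_pow (n : ℕ) (z : h) :
    teuler (PolyLie.mk (X ^ n : K[X]) z) = (n : K) • PolyLie.mk (X ^ n) z := by
  have : euler K K (X ^ n) = (n : K) • X ^ n := by
    ext m
    rw [coeff_euler, coeff_smul, coeff_X_pow]
    split_ifs with hm <;> simp [hm]
  change PolyLie.mk (euler K K (X ^ n)) z = _
  rw [this]
  rfl

theorem X_pow_dvd_mul {n : ℕ} {p : R[X]} (hp : X ^ n ∣ p) (q : R[X]) : X ^ n ∣ q * p := by
  obtain ⟨c, rfl⟩ := hp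
  exact ⟨q * c, by rw [← mul_assoc, ← X_pow_mul, mul_assoc]⟩

theorem X_pow_dvd_logQuot_sub {n : ℕ} {p q : R[X]} (hp : X ^ n ∣ p - q) (M : ℕ) :
    X ^ n ∣ logQuot K M p - logQuot K M q := by
  rw [logQuot, logQuot, ← sum_sub_distrib]
  refine dvd_sum fun k hk => ?_
  rw [← smul_sub]
  apply dvd_smul_of_dvd
  clear hk
  induction k with
  | zero => simp
  | succ k ih =>
    rw [show p ^ (k + 1) - q ^ (k + 1) = p ^ k * (p - q) + (p ^ k - q ^ k) * q by
      rw [pow_succ, pow_succ]; noncomm_ring]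
    exact dvd_add (X_pow_dvd_mul hp _) (Dvd.dvd.mul_right ih _)

variable [CharZero K]

/-- Write x = ρ(ta) and y = ρ(tb). The first k pairs of a word act as operators: the sum of x^r y^s
/ (r! s!) over (r, s) ≠ (0, 0) is e^x e^y - 1, once for each of them. The last pair carries the
vector; a word ending in a repeated letter vanishes, so only (1, 0) and the pairs (r, 1) survive,
and these give v(ta) + e^x v(tb). -/
theorem sum_wordsBelow_wordVec {ρ v : h →ₗ[K] R} (hv : ∀ a b, ρ a * v b = v ⁅a, b⁆) (a b : h)
    {M : ℕ} (hM : 2 ≤ M) (ha : polyLift ρ (PolyLie.mk X a) ^ M = 0)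
    (hb : polyLift ρ (PolyLie.mk X b) ^ M = 0) (k : ℕ) :
    ∑ w ∈ wordsBelow M (k + 1),
      ((((w.map fun p => p.1.1.factorial * p.1.2.factorial).prod : ℕ) : K))⁻¹ •
        wordVec v (pairWord a b w) =
      (nexp K (polyLift ρ (PolyLie.mk X a)) * nexp K (polyLift ρ (PolyLie.mk X b)) - 1) ^ k *
        (polyLift v (PolyLie.mk X a) +
          nexp K (polyLift ρ (PolyLie.mk X a)) * polyLift v (PolyLie.mk X b)) := by
  set x := polyLift ρ (PolyLie.mk X a)
  set y := polyLift ρ (PolyLie.mk X b)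
  obtain ⟨M, rfl⟩ := Nat.exists_eq_add_of_le' hM
  have e1 : ∀ c : h, wordVec v [c] = polyLift v (PolyLie.mk X c) := fun c => by
    simp [wordVec, lieNest]
  induction k with
  | zero =>
    rw [sum_wordsBelow_succ, pow_zero, one_mul]
    have : ∀ p ∈ pairsBelow (M + 2), (∑ w ∈ wordsBelow (M + 2) 0,
        (((((p :: w).map fun p => p.1.1.factorial * p.1.2.factorial).prod : ℕ) : K))⁻¹ •
        wordVec v (pairWord a b (p :: w))) = (fun q : ℕ × ℕ =>
          (((q.1.factorial * q.2.factorial : ℕ) : K))⁻¹ •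
          wordVec v (List.replicate q.1 a ++ List.replicate q.2 b)) p.1 := by
      intro p _
      simp [wordsBelow, pairWord]
    rw [sum_congr rfl this, sum_pairsBelow (F := fun q : ℕ × ℕ =>
          (((q.1.factorial * q.2.factorial : ℕ) : K))⁻¹ •
          wordVec v (List.replicate q.1 a ++ List.replicate q.2 b))]
    have hz : wordVec v (List.replicate 0 a ++ List.replicate 0 b) = 0 := wordVec_nil v
    simp only [Prod.fst_zero, Prod.snd_zero, hz, smul_zero, sub_zero]
    -- For fixed r only s = 0 and s = 1 contribute, because s ≥ 2 makes the word end in bb.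
    have hs : ∀ r ∈ range (M + 2), ∑ s ∈ range (M + 2), (((r.factorial * s.factorial : ℕ) : K))⁻¹ •
        wordVec v (List.replicate r a ++ List.replicate s b) =
        ((r.factorial : K))⁻¹ • wordVec v (List.replicate r a) +
          ((r.factorial : K))⁻¹ • x ^ r * wordVec v [b] := by
      intro r _
      rw [sum_range_succ', sum_range_succ', sum_eq_zero]
      · simp only [zero_add, List.replicate_one, List.replicate_zero, List.append_nil,
          Nat.factorial_zero, Nat.factorial_one, mul_one]
        rw [wordVec_replicate_append hv a r (by simp), add_comm, smul_mul_assoc]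
      · intro s _
        rw [wordVec_replicate_append hv a r (by simp), wordVec_replicate hv, mul_zero, smul_zero]
    rw [sum_congr rfl hs, sum_add_distrib, ← sum_mul, ← nexp_eq_sum K ha, e1]
    congr 1
    rw [sum_range_succ', sum_range_succ', sum_eq_zero]
    · simp [wordVec_nil, e1]
    · intro r _
      rw [wordVec_replicate hv, smul_zero]
  | succ k ih =>
    rw [sum_wordsBelow_succ, pow_succ', mul_assoc, ← ih]
    have : ∀ p ∈ pairsBelow (M + 2), (∑ w ∈ wordsBelow (M + 2) (k + 1),
        (((((p :: w).map fun p => p.1.1.factorial * p.1.2.factorial).prod : ℕ) : K))⁻¹ •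
        wordVec v (pairWord a b (p :: w))) = (fun q : ℕ × ℕ =>
          (((q.1.factorial : K))⁻¹ • x ^ q.1) * (((q.2.factorial : K))⁻¹ • y ^ q.2)) p.1 *
          ∑ w ∈ wordsBelow (M + 2) (k + 1),
          ((((w.map fun p => p.1.1.factorial * p.1.2.factorial).prod : ℕ) : K))⁻¹ •
        wordVec v (pairWord a b w) := by
      intro p _
      rw [mul_sum]
      refine sum_congr rfl fun w hw => ?_
      have hw0 : pairWord a b w ≠ [] := by
        have h1 := length_le_length_pairWord a b w
        have h2 := (mem_wordsBelow.mp hw).1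
        intro h0
        rw [h0] at h1
        simp at h1
        simp [h1] at h2
      have : pairWord a b (p :: w) =
          List.replicate p.1.1 a ++ (List.replicate p.1.2 b ++ pairWord a b w) := by
        simp [pairWord]
      rw [this, wordVec_replicate_append hv a _ (by simp [hw0]),
        wordVec_replicate_append hv b _ hw0]
      simp only [List.map_cons, List.prod_cons, Nat.cast_mul, mul_inv, smul_mul_assoc,
        mul_smul_comm, smul_smul, mul_assoc, x, y]
      congr 1
      ring
    rw [sum_congr rfl this, ← sum_mul, sum_pairsBelow (F := fun q : ℕ × ℕ =>
          (((q.1.factorial : K))⁻¹ • x ^ q.1) * (((q.2.factorial : K))⁻¹ • y ^ q.2)),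
      nexp_eq_sum K ha, nexp_eq_sum K hb, sum_mul_sum]
    simp

/-- The Dynkin series, weighted by the powers of `t`. -/
def dynkinPoly (K : Type*) [Field K] {h : Type*} [LieRing h] [LieAlgebra K h] (M : ℕ) (a b : h) :
    PolyLie K h :=
  ∑ k ∈ range M, ∑ w ∈ wordsBelow M (k + 1),
    dynkinCoeff K w • PolyLie.mk (X ^ (pairWord a b w).length) (lieNest (pairWord a b w))

/-- The Euler operator multiplies a word by its length and so cancels the length in the denominator
of Dynkin's coefficient. What remains besides the factorials is (-1)^k / (k+1), the coefficient of
the series log(1 + y) / y. -/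
theorem polyLift_teuler_dynkinPoly {ρ v : h →ₗ[K] R} (hv : ∀ a b, ρ a * v b = v ⁅a, b⁆) (a b : h)
    {M : ℕ} (hM : 2 ≤ M) (ha : polyLift ρ (PolyLie.mk X a) ^ M = 0)
    (hb : polyLift ρ (PolyLie.mk X b) ^ M = 0) :
    polyLift v (teuler (dynkinPoly K M a b)) =
      logQuot K M (nexp K (polyLift ρ (PolyLie.mk X a)) *
        nexp K (polyLift ρ (PolyLie.mk X b)) - 1) *
        (polyLift v (PolyLie.mk X a) +
          nexp K (polyLift ρ (PolyLie.mk X a)) * polyLift v (PolyLie.mk X b)) := by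
  rw [logQuot, sum_mul, dynkinPoly, map_sum, map_sum]
  refine sum_congr rfl fun k _ => ?_
  rw [smul_mul_assoc, ← sum_wordsBelow_wordVec hv a b hM ha hb k, smul_sum, map_sum, map_sum]
  refine sum_congr rfl fun w hw => ?_
  rw [map_smul, map_smul, teuler_mk_X_pow, map_smul, smul_smul, smul_smul]
  change _ • wordVec v _ = _
  congr 1
  have hlen := (mem_wordsBelow.mp hw).1
  have hle := length_le_length_pairWord a b w
  rw [length_pairWord] at hle ⊢
  rw [dynkinCoeff, hlen]
  have h1 : (((w.map fun p => p.1.1 + p.1.2).sum : ℕ) : K) ≠ 0 := by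
    rw [Nat.cast_ne_zero]; omega
  have h2 : (((w.map fun p => p.1.1.factorial * p.1.2.factorial).prod : ℕ) : K) ≠ 0 := by
    rw [Nat.cast_ne_zero]
    apply List.prod_ne_zero
    simp [Nat.factorial_ne_zero]
  have h3 : ((k + 1 : ℕ) : K) ≠ 0 := by rw [Nat.cast_ne_zero]; omega
  rw [Nat.cast_mul, Nat.cast_mul]
  field_simp
  ring

theorem X_pow_dvd_of_euler {n : ℕ} {u : R[X]} (h0 : u.coeff 0 = 0) (hu : X ^ n ∣ euler K R u) :
    X ^ n ∣ u := by
  rw [X_pow_dvd_iff] at hu ⊢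
  intro d hd
  rcases Nat.eq_zero_or_pos d with rfl | hd0
  · exact h0
  · have := hu d hd
    rw [coeff_euler, ← nsmul_eq_mul, ← Nat.cast_smul_eq_nsmul K] at this
    exact (smul_eq_zero.mp this).resolve_left (Nat.cast_ne_zero.mpr (by omega))

/-- Let B be the Dynkin polynomial, β = ρ(B), and let G be the product on the right. For the Euler
operator, e^β has logarithmic derivative ρ(U) and G has logarithmic derivative ρ(w), with U and w in
K[t] ⊗ h. By `polyLift_teuler_dynkinPoly`, v(U) arises from v(w) by applying first log(G) / (G - 1)
and then (e^β - 1) / β, so that e^β = G would give U = w, and conversely. The circle becomes an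
induction on the order in t: v(w) is divisible by t, hence e^β ≡ G modulo t^(n+1) gives U ≡ w modulo
t^(n+2), and integration carries this back to e^β and G. Injectivity of v is what allows the passage
from v(U - w) to ρ(U - w). -/
theorem nexp_polyLift_dynkinPoly {ρ v : h →ₗ[K] R}
    (hρ : ∀ a b, ρ ⁅a, b⁆ = ρ a * ρ b - ρ b * ρ a) (hv : ∀ a b, ρ a * v b = v ⁅a, b⁆)
    (hinj : Function.Injective v) {N M : ℕ} (hM : 2 * N + 2 ≤ M)
    (hN : ∀ l : List h, N ≤ l.length → (l.map ρ).prod = 0) (a b : h) :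
    nexp K (polyLift ρ (dynkinPoly K M a b)) =
      nexp K (polyLift ρ (PolyLie.mk X a)) * nexp K (polyLift ρ (PolyLie.mk X b)) := by
  have hpow : ∀ A, polyLift ρ A ^ N = 0 := polyLift_pow_eq_zero hN
  have hpowM : ∀ A, polyLift ρ A ^ M = 0 := fun A => pow_eq_zero_of_le (by omega) (hpow A)
  have hnil : ∀ A, IsNilpotent (polyLift ρ A) := fun A => ⟨N, hpow A⟩
  -- Left and right multiplication commute and each has vanishing N-th power, so the power 2N - 1 of
  -- their sum is zero; this is the reason for a bound M of size about 2N.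
  have hinn : ∀ A, inner K (polyLift ρ A) ^ M = 0 := fun A => by
    have e : inner K (polyLift ρ A) =
        LinearMap.mulLeft K (polyLift ρ A) + LinearMap.mulRight K (-polyLift ρ A) := by
      ext1 y; simp [sub_eq_add_neg]
    rw [e]
    refine (commute_mulLeft_mulRight K _ _).add_pow_eq_zero_of_add_le_succ_of_pow_eq_zero
      (m := N) (n := N) ?_ ?_ (by omega)
    · rw [LinearMap.pow_mulLeft, hpow, LinearMap.mulLeft_zero_eq_zero]
    · rw [LinearMap.pow_mulRight, neg_pow, hpow, mul_zero, LinearMap.mulRight_zero_eq_zero]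
  have hadρ : ∀ (A E : PolyLie K h) (k : ℕ), polyLift ρ ((lieAd K _ A ^ k) E) =
      (inner K (polyLift ρ A) ^ k) (polyLift ρ E) := by
    intro A E k
    induction k with
    | zero => simp
    | succ k ih =>
      rw [pow_succ', pow_succ', Module.End.mul_apply, Module.End.mul_apply, ← ih, lieAd_apply,
        polyLift_lie hρ]
      rfl
  have hadv : ∀ (A E : PolyLie K h) (k : ℕ), polyLift v ((lieAd K _ A ^ k) E) =
      polyLift ρ A ^ k * polyLift v E := by
    intro A E k
    induction k with
    | zero => simp
    | succ k ih =>
      rw [pow_succ', Module.End.mul_apply, lieAd_apply, ← polyLift_mul hv, ih, pow_succ',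
        mul_assoc]
  set xa : PolyLie K h := PolyLie.mk X a with hxa
  set xb : PolyLie K h := PolyLie.mk X b with hxb
  set B := dynkinPoly K M a b with hBdef
  set x := polyLift ρ xa with hx
  set y := polyLift ρ xb with hy
  set β := polyLift ρ B with hβ
  set G := nexp K x * nexp K y with hG
  set W := polyLift v xa + nexp K x * polyLift v xb with hW
  have hBv : polyLift v (teuler B) = logQuot K M (G - 1) * W :=
    polyLift_teuler_dynkinPoly hv a b (by omega) (hpowM _) (hpowM _)
  -- U is the series (e^(ad B) - 1) / ad B applied to the Euler derivative of B. Keeping it in the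
  -- Lie algebra allows both ρ and v to be applied to it.
  set U : PolyLie K h := ∑ k ∈ range M, (((k + 1).factorial : K))⁻¹ •
    (lieAd K _ B ^ k) (teuler B) with hU
  have hUv : polyLift v U = nexpQuot K M β * polyLift v (teuler B) := by
    rw [hU, map_sum, nexpQuot, sum_mul]
    simp only [map_smul, hadv, smul_mul_assoc, hβ]
  have hUρ : polyLift ρ U = nexpQuot K M (inner K β) (polyLift ρ (teuler B)) := by
    rw [hU, map_sum, nexpQuot, LinearMap.sum_apply]
    simp only [map_smul, hadρ, LinearMap.smul_apply, hβ]
  have hDβ : euler K R (nexp K β) * nexp K (-β) = polyLift ρ U := by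
    rw [derivation_nexp K (euler K R) euler_mul (hnil B) (hinn B), hUρ, polyLift_teuler]
  set w : PolyLie K h := xa + ∑ k ∈ range M, ((k.factorial : K))⁻¹ •
    (lieAd K _ xa ^ k) xb with hw
  have hwv : polyLift v w = W := by
    rw [hw, map_add, map_sum, hW, nexp_eq_sum K (hpowM xa), sum_mul]
    simp only [map_smul, hadv, smul_mul_assoc]
  have hwρ : polyLift ρ w = x + nexp K x * y * nexp K (-x) := by
    rw [hw, map_add, map_sum, ← nexp_inner K (hnil xa), nexp_apply_eq_sum K (hinn xa)]
    simp only [map_smul, hadρ, hx, hy]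
  have hDlin : ∀ c : h, euler K R (nexp K (polyLift ρ (PolyLie.mk X c))) =
      polyLift ρ (PolyLie.mk X c) * nexp K (polyLift ρ (PolyLie.mk X c)) := by
    intro c
    set z := polyLift ρ (PolyLie.mk X c) with hz
    have e1 := derivation_nexp K (euler K R) euler_mul (hnil (PolyLie.mk X c)) (hinn _)
    have e2 : euler K R z = z := by
      rw [hz, ← polyLift_teuler]
      congr 1
      simpa using teuler_mk_X_pow (K := K) 1 c
    rw [← hz, e2] at e1
    have e3 : nexpQuot K M (inner K z) z = z := by
      obtain ⟨M', rfl⟩ : ∃ M', M = M' + 1 := ⟨M - 1, by omega⟩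
      rw [nexpQuot, LinearMap.sum_apply, sum_range_succ', sum_eq_zero]
      · simp
      · intro k _
        rw [pow_succ, LinearMap.smul_apply, Module.End.mul_apply, inner_apply, sub_self, map_zero,
          smul_zero]
    rw [e3] at e1
    calc euler K R (nexp K z) = euler K R (nexp K z) * (nexp K (-z) * nexp K z) := by
          rw [nexp_neg_mul_nexp K (hnil _), mul_one]
      _ = z * nexp K z := by rw [← mul_assoc, e1]
  have hDG : euler K R G = polyLift ρ w * G := by
    rw [hG, euler_mul, hDlin, hDlin, hwρ]
    have := nexp_neg_mul_nexp K (hnil xa)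
    rw [add_mul]
    congr 1
    · rw [mul_assoc]
    · rw [mul_assoc (nexp K x * y), ← mul_assoc (nexp K (-x)), this, one_mul, mul_assoc]
  have hXx : ∀ (σ : h →ₗ[K] R) (c : h), X ∣ polyLift σ (PolyLie.mk X c) := fun σ c => by
    rw [polyLift_mk, Polynomial.map_X]
    exact dvd_mul_right _ _
  have hXW : X ∣ W := by
    refine dvd_add (hXx v a) ?_
    have := X_pow_dvd_mul (n := 1) (by simpa using hXx v b) (nexp K x)
    simpa using this
  have hXexp : ∀ A, X ∣ polyLift ρ A → X ∣ nexp K (polyLift ρ A) - 1 := fun A hA => by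
    rw [← nexpQuot_mul_eq K _ (hpowM A)]
    have := X_pow_dvd_mul (n := 1) (by simpa using hA) (nexpQuot K M (polyLift ρ A))
    simpa using this
  have hXβ : X ∣ β := by
    rw [hβ, hBdef, dynkinPoly, map_sum]
    refine dvd_sum fun k _ => ?_
    rw [map_sum]
    refine dvd_sum fun w hw => ?_
    rw [map_smul]
    apply dvd_smul_of_dvd
    rw [polyLift_mk, Polynomial.map_pow, Polynomial.map_X]
    refine Dvd.dvd.mul_right (dvd_pow_self _ ?_) _
    have h1 := length_le_length_pairWord a b w
    have h2 := (mem_wordsBelow.mp hw).1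
    omega
  have key : ∀ n, X ^ (n + 1) ∣ nexp K β - G := by
    intro n
    induction n with
    | zero =>
      rw [zero_add, pow_one, show nexp K β - G =
        (nexp K β - 1) - ((nexp K x - 1) * nexp K y + (nexp K y - 1)) by rw [hG]; noncomm_ring]
      exact dvd_sub (hXexp B hXβ) (dvd_add (Dvd.dvd.mul_right (hXexp xa (hXx _ _)) _)
        (hXexp xb (hXx _ _)))
    | succ n ih =>
      -- One order is gained here: the two truncated logarithms agree modulo t^(n+1), and they are
      -- applied to W, which is itself divisible by t.
      have h1 : X ^ (n + 2) ∣ polyLift v (U - w) := by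
        have e : polyLift v (U - w) = nexpQuot K M β *
            ((logQuot K M (G - 1) - logQuot K M (nexp K β - 1)) * W) := by
          rw [map_sub, hUv, hBv, hwv, sub_mul, mul_sub, ← mul_assoc, ← mul_assoc,
            nexpQuot_mul_logQuot K β (hpowM B), one_mul]
        rw [e]
        apply X_pow_dvd_mul
        have hd : X ^ (n + 1) ∣ logQuot K M (G - 1) - logQuot K M (nexp K β - 1) := by
          apply X_pow_dvd_logQuot_sub
          rw [sub_sub_sub_cancel_right, ← neg_sub]
          exact (dvd_neg).mpr ih
        obtain ⟨c, hc⟩ := hd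
        obtain ⟨W', hW'⟩ := hXW
        rw [hc, hW']
        refine ⟨c * W', ?_⟩
        rw [pow_succ X (n + 1), mul_assoc, ← mul_assoc c, ← X_mul (p := c), mul_assoc, mul_assoc]
      have h2 : X ^ (n + 2) ∣ polyLift ρ (w - U) := by
        rw [X_pow_dvd_iff] at h1 ⊢
        intro d hd
        have h3 := h1 d hd
        rw [coeff_polyLift, map_eq_zero_iff v hinj] at h3
        rw [coeff_polyLift, ← neg_sub, map_neg, h3, neg_zero, map_zero]
      have hinv := nexp_neg_mul_nexp K (hnil B)
      have hinv' := nexp_mul_nexp_neg K (hnil B)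
      rw [← hβ] at hinv hinv'
      have hDneg : euler K R (nexp K (-β)) = -(nexp K (-β) * polyLift ρ U) := by
        have e1 := congrArg (euler K R) hinv
        have e0 : euler K R 1 = 0 := by
          change X * derivative (1 : R[X]) = 0
          simp
        rw [euler_mul, e0] at e1
        have e2 := congrArg (· * nexp K (-β)) (eq_neg_of_add_eq_zero_left e1)
        simp only [mul_assoc, hinv', mul_one, neg_mul, hDβ] at e2
        exact e2
      -- Variation of constants: e^(-β) e^β = 1 has zero derivative, so only the derivative of
      -- e^(-β) G is left.
      have hDu : euler K R (nexp K (-β) * (G - nexp K β)) =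
          nexp K (-β) * (polyLift ρ (w - U) * G) := by
        have e0 : euler K R 1 = 0 := by
          change X * derivative (1 : R[X]) = 0
          simp
        rw [mul_sub, hinv, map_sub, e0, sub_zero, euler_mul, hDneg, hDG, map_sub]
        noncomm_ring
      -- The Euler operator multiplies the coefficient of t^d by d, hence detects divisibility by
      -- powers of t once the constant coefficient is known to vanish; the induction hypothesis
      -- supplies that.
      have h3 : X ^ (n + 2) ∣ nexp K (-β) * (G - nexp K β) := by
        apply X_pow_dvd_of_euler (K := K)
        · have : X ^ (n + 1) ∣ nexp K (-β) * (G - nexp K β) := by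
            apply X_pow_dvd_mul
            rw [← neg_sub]
            exact dvd_neg.mpr ih
          exact X_pow_dvd_iff.mp this 0 (by omega)
        · rw [hDu]
          exact X_pow_dvd_mul (Dvd.dvd.mul_right h2 _) _
      have h4 := X_pow_dvd_mul h3 (nexp K β)
      rw [← mul_assoc, hinv', one_mul, ← neg_sub] at h4
      exact dvd_neg.mp h4
  rw [← sub_eq_zero]
  ext n
  exact X_pow_dvd_iff.mp (key n) n (by omega)

/-- This is the polynomial identity at t = 1. Brackets of length N + 1 vanish, so with M = 2N + 2
the truncated Dynkin series specialises to the full one. -/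
theorem nexp_lieBch_of_vector {ρ v : h →ₗ[K] R}
    (hρ : ∀ a b, ρ ⁅a, b⁆ = ρ a * ρ b - ρ b * ρ a) (hv : ∀ a b, ρ a * v b = v ⁅a, b⁆)
    (hinj : Function.Injective v) {N : ℕ}
    (hN : ∀ l : List h, N ≤ l.length → (l.map ρ).prod = 0) (a b : h) :
    nexp K (ρ (lieBch K a b)) = nexp K (ρ a) * nexp K (ρ b) := by
  have hnil : ∀ A, IsNilpotent (polyLift ρ A) := fun A =>
    ⟨N, polyLift_pow_eq_zero hN A⟩
  let ev : R[X] →ₐ[K] R := eval₂AlgHom (AlgHom.id K R) 1 fun _ => Commute.one_right _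
  have hev : ∀ A : PolyLie K h, ev (polyLift ρ A) = ρ (PolyLie.eval (aeval 1) A) := by
    intro A
    induction A using PolyLie.induction with
    | zero => simp
    | add A B hA hB => simp only [map_add, hA, hB]
    | mk p z =>
      rw [polyLift_mk, map_mul, PolyLie.eval_mk, map_smul, Algebra.smul_def]
      congr 1
      · change eval₂ _ _ _ = _
        rw [eval₂_map, aeval_def]
        simp [eval₂_eq_sum_range]
      · change eval₂ _ _ _ = _
        simp
  have e := congrArg ev (nexp_polyLift_dynkinPoly hρ hv hinj le_rfl hN a b)
  rw [map_mul, map_nexp K (hnil _), map_nexp K (hnil _), map_nexp K (hnil _), hev, hev, hev,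
    PolyLie.eval_mk, PolyLie.eval_mk, aeval_X, one_smul, one_smul] at e
  rw [← e]
  congr 2
  rw [lieBch_eq_sum K (M := 2 * N + 2) fun l hl =>
    lieNest_eq_zero_of_vector hv hinj hN l (by omega), dynkinPoly, map_sum]
  refine sum_congr rfl fun k _ => ?_
  rw [map_sum]
  refine sum_congr rfl fun w _ => ?_
  rw [map_smul, PolyLie.eval_mk, map_pow, aeval_X, one_pow, one_smul]

end Dynkin

/-! ### The group law on a nilpotent Lie algebra. -/

section LieGroup

open Finset Polynomial

theorem nexp_intertwine {K : Type*} [Field K] [CharZero K] {V W : Type*} [AddCommGroup V]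
    [Module K V] [AddCommGroup W] [Module K W] (f : V →ₗ[K] W) {a : Module.End K V}
    {b : Module.End K W} (ha : IsNilpotent a) (hb : IsNilpotent b) (h : ∀ v, f (a v) = b (f v))
    (v : V) : f (nexp K a v) = nexp K b (f v) := by
  obtain ⟨k, hk⟩ := ha
  obtain ⟨l, hl⟩ := hb
  rw [nexp_apply_eq_sum K (pow_eq_zero_of_le (le_max_left k l) hk),
    nexp_apply_eq_sum K (pow_eq_zero_of_le (le_max_right k l) hl), map_sum]
  refine sum_congr rfl fun i _ => ?_
  rw [map_smul]
  congr 1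
  clear * - h
  induction i with
  | zero => simp
  | succ i ih => rw [pow_succ', pow_succ', Module.End.mul_apply, Module.End.mul_apply, h, ih]

variable {K : Type*} [Field K] {h : Type*} [LieRing h] [LieAlgebra K h]
  {V : Type*} [AddCommGroup V] [Module K V]

/-- The affine action `(x, c) ↦ (a x - c δ(a), 0)` attached to a linear action and a cocycle `δ`. -/
def affRep (act : h →ₗ[K] Module.End K V) (δ : h →ₗ[K] V) : h →ₗ[K] Module.End K (V × K) where
  toFun a := LinearMap.inl K V K ∘ₗ
    (act a ∘ₗ LinearMap.fst K V K - LinearMap.toSpanSingleton K V (δ a) ∘ₗ LinearMap.snd K V K)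
  map_add' a b := by ext <;> simp; abel
  map_smul' c a := by ext <;> simp

theorem affRep_apply (act : h →ₗ[K] Module.End K V) (δ : h →ₗ[K] V) (a : h) (p : V × K) :
    affRep act δ a p = (act a p.1 - p.2 • δ a, 0) := rfl

theorem affRep_lie {act : h →ₗ[K] Module.End K V} {δ : h →ₗ[K] V}
    (hact : ∀ a b, act ⁅a, b⁆ = act a * act b - act b * act a)
    (hδ : ∀ a b, δ ⁅a, b⁆ = act a (δ b) - act b (δ a)) (a b : h) :
    affRep act δ ⁅a, b⁆ = affRep act δ a * affRep act δ b - affRep act δ b * affRep act δ a := by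
  refine LinearMap.ext fun p => ?_
  simp only [LinearMap.sub_apply, Module.End.mul_apply, affRep_apply, hact, hδ]
  ext
  · simp only [map_sub, map_smul, smul_sub, zero_smul, sub_zero, Prod.fst_sub]; abel
  · simp

/-- The rightmost factor moves everything into V × 0, where the other factors act through `act`;
hence the shift from N to N + 1. -/
theorem affRep_prod_eq_zero {act : h →ₗ[K] Module.End K V} (δ : h →ₗ[K] V) {N : ℕ}
    (hN : ∀ l : List h, N ≤ l.length → (l.map act).prod = 0) (l : List h) (hl : N + 1 ≤ l.length) :
    (l.map (affRep act δ)).prod = 0 := by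
  have key : ∀ (l : List h) (y : V),
      (l.map (affRep act δ)).prod (y, 0) = ((l.map act).prod y, 0) := by
    intro l y
    induction l with
    | nil => simp
    | cons a l ih => simp [ih, affRep_apply]
  refine LinearMap.ext fun p => ?_
  rcases List.eq_nil_or_concat l with rfl | ⟨l', b, rfl⟩
  · simp at hl
  · rw [List.concat_eq_append, List.map_append, List.prod_append, Module.End.mul_apply,
      List.map_singleton, List.prod_singleton, affRep_apply, key, hN l' (by simpa using hl)]
    rfl

theorem lieNest_append_singleton (l : List h) (x : h) :
    lieNest (l ++ [x]) = (l.map (fun a => lieAd K h a)).prod x := by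
  induction l with
  | nil => simp [lieNest]
  | cons c l ih =>
    have : lieNest (c :: l ++ [x]) = ⁅c, lieNest (l ++ [x])⁆ := by cases l <;> rfl
    rw [this, ih]
    simp

theorem ad_prod_eq_zero {N : ℕ} (hN : ∀ l : List h, N ≤ l.length → lieNest l = 0) (l : List h)
    (hl : N ≤ l.length) :
    (l.map (lieAd K h)).prod = 0 := by
  refine LinearMap.ext fun x => ?_
  exact (lieNest_append_singleton l x).symm.trans (hN _ (by simp; omega))

theorem isNilpotent_of_prod_eq_zero {R : Type*} [Ring R] [Algebra K R] {θ : h →ₗ[K] R} {N : ℕ}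
    (hN : ∀ l : List h, N ≤ l.length → (l.map θ).prod = 0) (a : h) : IsNilpotent (θ a) :=
  ⟨N, by simpa using hN (List.replicate N a) (by simp)⟩

/-- The vector `b`, as an endomorphism of `h × K`. -/
def vecEnd : h →ₗ[K] Module.End K (h × K) where
  toFun b := LinearMap.inl K h K ∘ₗ LinearMap.toSpanSingleton K h b ∘ₗ LinearMap.snd K h K
  map_add' a b := by ext <;> simp
  map_smul' c a := by ext <;> simp

/-- The adjoint representation on `h × K`, acting trivially on `K`. -/
def adRep : h →ₗ[K] Module.End K (h × K) :=
  affRep (lieAd K h) 0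

theorem adRep_apply (a : h) (p : h × K) : adRep a p = (⁅a, p.1⁆, 0) := by
  simp [adRep, affRep_apply]

theorem adRep_lie (a b : h) :
    (adRep ⁅a, b⁆ : Module.End K (h × K)) = adRep a * adRep b - adRep b * adRep a := by
  exact affRep_lie (lieAd_lie K) (by simp) a b

theorem adRep_mul_vecEnd (a b : h) :
    (adRep a * vecEnd b : Module.End K (h × K)) = vecEnd ⁅a, b⁆ := by
  refine LinearMap.ext fun p => ?_
  rw [Module.End.mul_apply, adRep_apply]
  simp [vecEnd]

theorem vecEnd_injective : Function.Injective (vecEnd : h →ₗ[K] Module.End K (h × K)) := by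
  intro a b hab
  simpa [vecEnd] using LinearMap.congr_fun hab (0, 1)

/-- Nilpotency is transferred to K[t] ⊗ h through operators: the adjoint representation on h × K and
the injective map `vecEnd` extend coefficientwise to polynomials. The affine extension and the
innermost letter account for the two extra letters. -/
theorem PolyLie.lieNest_eq_zero {N : ℕ} (hN : ∀ l : List h, N ≤ l.length → lieNest l = 0)
    (l : List (PolyLie K h)) (hl : N + 2 ≤ l.length) : lieNest l = 0 := by
  have hp : ∀ l : List h, N + 1 ≤ l.length → (l.map (adRep (K := K))).prod = 0 :=
    affRep_prod_eq_zero (0 : h →ₗ[K] h) (ad_prod_eq_zero (K := K) hN)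
  have hinj : Function.Injective (polyLift (K := K) (vecEnd (K := K) (h := h))) := ?_
  · exact lieNest_eq_zero_of_vector (K := K) (R := (Module.End K (h × K))[X])
      (fun A B => polyLift_mul adRep_mul_vecEnd A B) hinj (polyLift_prod_eq_zero hp) l hl
  intro A B hAB
  rw [← sub_eq_zero]
  refine eq_zero_of_tcoeff fun n => vecEnd_injective (K := K) ?_
  rw [← coeff_polyLift, map_sub, hAB, sub_self, coeff_zero, map_zero]

/-- The affine representation of `K[t] ⊗ h` given by the Euler derivation. -/
def eulerRep (K : Type*) [Field K] (h : Type*) [LieRing h] [LieAlgebra K h] :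
    PolyLie K h →ₗ[K] Module.End K (PolyLie K h × K) :=
  affRep (lieAd K (PolyLie K h)) teuler

theorem eulerRep_lie (A B : PolyLie K h) :
    eulerRep K h ⁅A, B⁆ = eulerRep K h A * eulerRep K h B - eulerRep K h B * eulerRep K h A := by
  apply affRep_lie (lieAd_lie K)
  intro a b
  rw [teuler_lie, ← lie_skew]
  change -⁅b, teuler a⁆ + ⁅a, teuler b⁆ = ⁅a, teuler b⁆ - ⁅b, teuler a⁆
  abel

theorem lieBch_zero_zero : lieBch K (0 : h) 0 = 0 := by
  rw [lieBch]
  refine finsum_eq_zero_of_forall_eq_zero fun w => ?_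
  have : ∀ l : List h, (∀ x ∈ l, x = 0) → lieNest l = 0 := by
    intro l hl
    match l with
    | [] => rfl
    | [x] => simpa [lieNest] using hl x
    | x :: y :: l => rw [lieNest, hl x (by simp), zero_lie]
  rw [this, smul_zero]
  simp only [pairWord, List.mem_flatMap, List.mem_append, List.mem_replicate]
  rintro x ⟨_, _, h | h⟩ <;> exact h.2

theorem eulerRep_prod_eq_zero {N : ℕ} (hN : ∀ l : List h, N ≤ l.length → lieNest l = 0)
    (l : List (PolyLie K h)) (hl : N + 3 ≤ l.length) :
    (l.map (eulerRep K h)).prod = 0 :=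
  affRep_prod_eq_zero _ (ad_prod_eq_zero (PolyLie.lieNest_eq_zero hN)) l (by omega)

theorem isNilpotent_eulerRep {N : ℕ} (hN : ∀ l : List h, N ≤ l.length → lieNest l = 0)
    (A : PolyLie K h) : IsNilpotent (eulerRep K h A) :=
  isNilpotent_of_prod_eq_zero (eulerRep_prod_eq_zero hN) A

theorem eval_lieBch {N : ℕ} (hN : ∀ l : List h, N ≤ l.length → lieNest l = 0)
    (e : K[X] →ₐ[K] K) (A B : PolyLie K h) :
    PolyLie.eval e (lieBch K A B) = lieBch K (PolyLie.eval e A) (PolyLie.eval e B) :=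
  lieBch_map K (PolyLie.eval e) (M := N + 2) (PolyLie.lieNest_eq_zero hN)
    (fun l hl => hN l (by omega)) A B

theorem tcoeff_zero_lieBch {N : ℕ} (hN : ∀ l : List h, N ≤ l.length → lieNest l = 0)
    {A B : PolyLie K h} (hA : tcoeff 0 A = 0) (hB : tcoeff 0 B = 0) :
    tcoeff 0 (lieBch K A B) = 0 := by
  rw [← PolyLie.eval_zero] at hA hB ⊢
  rw [eval_lieBch hN, hA, hB, lieBch_zero_zero]

theorem tcoeff_zero_mk_X (a : h) : tcoeff 0 (PolyLie.mk (X : K[X]) a) = 0 := by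
  rw [tcoeff_mk, coeff_X_zero, zero_smul]

theorem eval_one_mk_X (a : h) : PolyLie.eval (aeval 1) (PolyLie.mk (X : K[X]) a) = a := by
  rw [PolyLie.eval_mk, aeval_X, one_smul]

theorem isNilpotent_ad {N : ℕ} (hN : ∀ l : List h, N ≤ l.length → lieNest l = 0)
    (a : h) : IsNilpotent (lieAd K h a) :=
  isNilpotent_of_prod_eq_zero (ad_prod_eq_zero (K := K) hN) a

variable [CharZero K]

/-- The Baker–Campbell–Hausdorff formula in a nilpotent representation. -/
theorem nexp_lieBch {R : Type*} [Ring R] [Algebra K R] {θ : h →ₗ[K] R}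
    (hθ : ∀ a b, θ ⁅a, b⁆ = θ a * θ b - θ b * θ a) {N M : ℕ}
    (hN : ∀ l : List h, N ≤ l.length → lieNest l = 0)
    (hM : ∀ l : List h, M ≤ l.length → (l.map θ).prod = 0) (a b : h) :
    nexp K (θ (lieBch K a b)) = nexp K (θ a) * nexp K (θ b) := by
  -- The representation θ need not be faithful. Adjoining the adjoint representation as a second
  -- factor provides the injective v, and the result is then projected to R.
  let ρ : h →ₗ[K] Module.End K (h × K) × R := adRep.prod θ
  let v : h →ₗ[K] Module.End K (h × K) × R := vecEnd.prod 0
  have hp := affRep_prod_eq_zero (0 : h →ₗ[K] h) (ad_prod_eq_zero (K := K) hN)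
  have hprod : ∀ l : List h, max (N + 1) M ≤ l.length → (l.map ρ).prod = 0 := by
    intro l hl
    have e1 : (l.map ρ).prod.1 = (l.map adRep).prod := by
      rw [← RingHom.coe_fst, map_list_prod, List.map_map]; rfl
    have e2 : (l.map ρ).prod.2 = (l.map θ).prod := by
      rw [← RingHom.coe_snd, map_list_prod, List.map_map]; rfl
    refine Prod.ext ?_ ?_
    · rw [e1]; exact hp l ((le_max_left _ _).trans hl)
    · rw [e2]; exact hM l ((le_max_right _ _).trans hl)
  have key := nexp_lieBch_of_vector (K := K) (ρ := ρ) (v := v)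
    (fun a b => Prod.ext (adRep_lie a b) (hθ a b))
    (fun a b => Prod.ext (adRep_mul_vecEnd a b) (mul_zero _))
    (fun a b hab => vecEnd_injective (congrArg Prod.fst hab)) hprod a b
  have hnil := isNilpotent_of_prod_eq_zero hprod
  have e := congrArg (AlgHom.snd K (Module.End K (h × K)) R) key
  rwa [map_mul, map_nexp K (hnil _), map_nexp K (hnil _), map_nexp K (hnil _)] at e

/-- On the vector (0, 1) the affine representation returns minus the Euler derivative, which
determines all coefficients except the constant one. Unlike the adjoint representation, it therefore
does not lose the centre. -/
theorem PolyLie.eq_of_nexp_eulerRep {A B : PolyLie K h} (hA : IsNilpotent (eulerRep K h A))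
    (hB : IsNilpotent (eulerRep K h B)) (hA0 : tcoeff 0 A = 0) (hB0 : tcoeff 0 B = 0)
    (e : nexp K (eulerRep K h A) = nexp K (eulerRep K h B)) : A = B := by
  have e1 := nexp_injective K hA hB e
  have e2 := congrArg Prod.fst (LinearMap.congr_fun e1 (0, 1))
  simp only [eulerRep, affRep_apply, map_zero, one_smul, zero_sub, neg_inj] at e2
  rw [← sub_eq_zero]
  refine eq_zero_of_tcoeff fun n => ?_
  rcases Nat.eq_zero_or_pos n with rfl | hn
  · rw [map_sub, hA0, hB0, sub_self]
  · have e3 := congrArg (tcoeff n) e2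
    rw [tcoeff_teuler, tcoeff_teuler, ← sub_eq_zero, ← smul_sub, ← map_sub] at e3
    exact (smul_eq_zero.mp e3).resolve_left (Nat.cast_ne_zero.mpr hn.ne')

theorem nexp_eulerRep_lieBch {N : ℕ} (hN : ∀ l : List h, N ≤ l.length → lieNest l = 0)
    (A B : PolyLie K h) : nexp K (eulerRep K h (lieBch K A B)) =
    nexp K (eulerRep K h A) * nexp K (eulerRep K h B) :=
  nexp_lieBch eulerRep_lie (PolyLie.lieNest_eq_zero hN) (eulerRep_prod_eq_zero hN) A B

/-- For the families ta, tb, tc both sides have the same exponential in `eulerRep` and vanish at t =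
0, so they agree; then t is set to 1. The unit, inverse and conjugation laws below follow the same
pattern. -/
theorem lieBch_assoc {N : ℕ} (hN : ∀ l : List h, N ≤ l.length → lieNest l = 0)
    (a b c : h) :
    lieBch K (lieBch K a b) c = lieBch K a (lieBch K b c) := by
  have key : lieBch K (lieBch K (PolyLie.mk (X : K[X]) a) (PolyLie.mk X b)) (PolyLie.mk X c) =
      lieBch K (PolyLie.mk X a) (lieBch K (PolyLie.mk X b) (PolyLie.mk X c)) := by
    have h0 := fun a : h => tcoeff_zero_mk_X (K := K) a
    refine PolyLie.eq_of_nexp_eulerRep (isNilpotent_eulerRep hN _) (isNilpotent_eulerRep hN _)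
      (tcoeff_zero_lieBch hN (tcoeff_zero_lieBch hN (h0 a) (h0 b)) (h0 c))
      (tcoeff_zero_lieBch hN (h0 a) (tcoeff_zero_lieBch hN (h0 b) (h0 c))) ?_
    simp only [nexp_eulerRep_lieBch hN, mul_assoc]
  have e := congrArg (PolyLie.eval (aeval 1)) key
  simpa only [eval_lieBch hN, eval_one_mk_X] using e

theorem lieBch_zero {N : ℕ} (hN : ∀ l : List h, N ≤ l.length → lieNest l = 0)
    (a : h) : lieBch K a 0 = a := by
  have key : lieBch K (PolyLie.mk (X : K[X]) a) 0 = PolyLie.mk X a := by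
    refine PolyLie.eq_of_nexp_eulerRep (isNilpotent_eulerRep hN _) (isNilpotent_eulerRep hN _)
      (tcoeff_zero_lieBch hN (tcoeff_zero_mk_X a) (map_zero _)) (tcoeff_zero_mk_X a) ?_
    rw [nexp_eulerRep_lieBch hN, map_zero, nexp_zero, mul_one]
  have e := congrArg (PolyLie.eval (aeval 1)) key
  simpa only [eval_lieBch hN, eval_one_mk_X, map_zero] using e

theorem zero_lieBch {N : ℕ} (hN : ∀ l : List h, N ≤ l.length → lieNest l = 0)
    (a : h) : lieBch K 0 a = a := by
  have key : lieBch K 0 (PolyLie.mk (X : K[X]) a) = PolyLie.mk X a := by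
    refine PolyLie.eq_of_nexp_eulerRep (isNilpotent_eulerRep hN _) (isNilpotent_eulerRep hN _)
      (tcoeff_zero_lieBch hN (map_zero _) (tcoeff_zero_mk_X a)) (tcoeff_zero_mk_X a) ?_
    rw [nexp_eulerRep_lieBch hN, map_zero, nexp_zero, one_mul]
  have e := congrArg (PolyLie.eval (aeval 1)) key
  simpa only [eval_lieBch hN, eval_one_mk_X, map_zero] using e

theorem neg_lieBch {N : ℕ} (hN : ∀ l : List h, N ≤ l.length → lieNest l = 0)
    (a : h) : lieBch K (-a) a = 0 := by
  have h0 : tcoeff 0 (-PolyLie.mk (X : K[X]) a) = 0 := by rw [map_neg, tcoeff_zero_mk_X, neg_zero]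
  have key : lieBch K (-PolyLie.mk (X : K[X]) a) (PolyLie.mk X a) = 0 := by
    refine PolyLie.eq_of_nexp_eulerRep (isNilpotent_eulerRep hN _) (isNilpotent_eulerRep hN _)
      (tcoeff_zero_lieBch hN h0 (tcoeff_zero_mk_X a)) (map_zero _) ?_
    rw [nexp_eulerRep_lieBch hN, map_neg, map_zero, nexp_zero,
      nexp_neg_mul_nexp K (isNilpotent_eulerRep hN _)]
  have e := congrArg (PolyLie.eval (aeval 1)) key
  simpa only [eval_lieBch hN, eval_one_mk_X, map_zero, map_neg] using e

theorem nexp_conj {R : Type*} [Ring R] [Algebra K R] {x y : R} (hx : IsNilpotent x)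
    (hy : IsNilpotent y) :
    nexp K (nexp K x * y * nexp K (-x)) = nexp K x * nexp K y * nexp K (-x) := by
  have h1 := nexp_neg_mul_nexp K hx
  have h2 := nexp_mul_nexp_neg K hx
  have hp : ∀ k, (nexp K x * y * nexp K (-x)) ^ k = nexp K x * y ^ k * nexp K (-x) := by
    intro k
    induction k with
    | zero => simp [h2]
    | succ k ih =>
      rw [pow_succ, ih, pow_succ]
      calc _ = nexp K x * y ^ k * (nexp K (-x) * nexp K x) * y * nexp K (-x) := by noncomm_ring
        _ = _ := by rw [h1, mul_one, ← mul_assoc]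
  obtain ⟨k, hk⟩ := hy
  rw [nexp_eq_sum K hk, nexp_eq_sum K (a := nexp K x * y * nexp K (-x)) (k := k)
    (by rw [hp, hk, mul_zero, zero_mul]), mul_sum, sum_mul]
  refine sum_congr rfl fun i _ => ?_
  rw [hp, mul_smul_comm, smul_mul_assoc]

/-- In a representation ρ both sides have the exponential e^(ρ a) e^(ρ b) e^(-ρ a): on the right
because ρ intertwines ad a with the inner derivation of ρ a, whose exponential is conjugation. -/
theorem lieBch_conj {N : ℕ} (hN : ∀ l : List h, N ≤ l.length → lieNest l = 0)
    (a b : h) : lieBch K (lieBch K a b) (-a) = nexp K (lieAd K h a) b := by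
  have hN' := PolyLie.lieNest_eq_zero (K := K) hN
  have hα := fun A => isNilpotent_eulerRep (K := K) hN A
  have h0 := fun a : h => tcoeff_zero_mk_X (K := K) a
  have h0' : tcoeff 0 (-PolyLie.mk (X : K[X]) a) = 0 := by rw [map_neg, h0, neg_zero]
  have hev : ∀ (e : K[X] →ₐ[K] K) (A B : PolyLie K h), PolyLie.eval e (nexp K (lieAd K _ A) B) =
      nexp K (lieAd K h (PolyLie.eval e A)) (PolyLie.eval e B) := fun e A B =>
    nexp_intertwine (PolyLie.evalLin e) (isNilpotent_ad hN' A)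
      (isNilpotent_ad hN (PolyLie.evalLin e A)) (fun B => PolyLie.evalLin_lie e A B) B
  have key : lieBch K (lieBch K (PolyLie.mk (X : K[X]) a) (PolyLie.mk X b)) (-PolyLie.mk X a) =
      nexp K (lieAd K _ (PolyLie.mk X a)) (PolyLie.mk X b) := by
    refine PolyLie.eq_of_nexp_eulerRep (isNilpotent_eulerRep hN _) (isNilpotent_eulerRep hN _)
      (tcoeff_zero_lieBch hN (tcoeff_zero_lieBch hN (h0 a) (h0 b)) h0') ?_ ?_
    · rw [← PolyLie.eval_zero, hev, PolyLie.eval_zero (PolyLie.mk X b), h0, map_zero]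
    · rw [nexp_eulerRep_lieBch hN, nexp_eulerRep_lieBch hN, map_neg,
        nexp_intertwine (eulerRep K h) (isNilpotent_ad hN' _) (isNilpotent_inner K (hα (PolyLie.mk X a)))
          (fun B => by rw [lieAd_apply, eulerRep_lie]; rfl), nexp_inner K (hα _),
        nexp_conj (hα _) (hα _)]
  have e := congrArg (PolyLie.eval (aeval 1)) key
  simpa only [eval_lieBch hN, eval_one_mk_X, map_neg, hev] using e

end LieGroup

/-! ### Gauge action and Baker–Campbell–Hausdorff product of a nilpotent DGLA -/

namespace DGLA

open Finset

variable {K : Type u} [Field K] (M : DGLA K)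

/-- The action of degree zero elements by brackets. -/
def act (j : ℤ) : M.X 0 →ₗ[K] Module.End K (M.X j) := M.br 0 j j (zero_add j)

/-- Degree zero elements act nilpotently. -/
class NilAct : Prop where
  prod_eq_zero : ∃ N : ℕ, ∀ (j : ℤ) (l : List (M.X 0)), N ≤ l.length → (l.map (M.act j)).prod = 0

theorem act_prod_mem_tensFil (L : DGLA K) (A : Art K) (j : ℤ) (l : List ((L.tens A).X 0))
    (x : (L.tens A).X j) : (l.map ((L.tens A).act j)).prod x ∈ L.tensFil A (l.length + 1) j := by
  induction l with
  | nil => exact L.mem_tensFil_one A j x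
  | cons a l ih =>
    have := L.br_mem_tensFil A 0 j j (zero_add j) (L.mem_tensFil_one A 0 a) ih
    rw [add_comm] at this
    rwa [List.map_cons, List.prod_cons, List.length_cons, Module.End.mul_apply]

instance nilAct_tens (L : DGLA K) (A : Art K) : (L.tens A).NilAct := by
  obtain ⟨N, hN⟩ := A.isNilpotent_max
  exact ⟨N, fun j l hl => LinearMap.ext fun x =>
    L.tensFil_eq_zero A hN (by omega) j (L.act_prod_mem_tensFil A j l x)⟩

theorem act_br (j : ℤ) (a b : M.X 0) :
    M.act j (M.br 0 0 0 (zero_add 0) a b) = M.act j a * M.act j b - M.act j b * M.act j a := by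
  refine LinearMap.ext fun x => ?_
  have := M.jacobi 0 0 j 0 j j j (zero_add 0) (zero_add j) (zero_add j) (zero_add j) (zero_add j)
    (zero_add j) a b x
  rw [mul_zero, zpow_zero, one_smul] at this
  exact eq_sub_of_add_eq this.symm

theorem d_br_zero (j k : ℤ) (h : j + 1 = k) (a : M.X 0) (x : M.X j) :
    M.d j k h (M.act j a x) =
      M.br 1 j k (by omega) (M.d 0 1 (zero_add 1) a) x + M.act k a (M.d j k h x) := by
  have := M.leibniz 0 j j 1 k k (zero_add j) (zero_add 1) h h (by omega) (zero_add k) a x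
  rwa [zpow_zero, one_smul] at this

theorem act_br_apply (i j k : ℤ) (h : i + j = k) (a : M.X 0) (x : M.X i) (y : M.X j) :
    M.act k a (M.br i j k h x y) = M.br i j k h (M.act i a x) y + M.br i j k h x (M.act j a y) := by
  have := M.jacobi 0 i j i k j k (zero_add i) h (zero_add j) (zero_add k) h h a x y
  rwa [zero_mul, zpow_zero, one_smul] at this

theorem br_one_comm (x y : M.X 1) :
    M.br 1 1 2 (by norm_num) x y = M.br 1 1 2 (by norm_num) y x := by
  have := M.br_symm 1 1 2 (by norm_num) (by norm_num) x y
  simpa using this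

/-- The curvature `dx + ½[x, x]`. -/
def curv (x : M.X 1) : M.X 2 :=
  M.d 1 2 (by norm_num) x + (2⁻¹ : K) • M.br 1 1 2 (by norm_num) x x

/-- The twisted differential `d + [x, -]`. -/
def dtw (x : M.X 1) (i j : ℤ) (h : i + 1 = j) : M.X i →ₗ[K] M.X j :=
  M.d i j h + M.br 1 i j (by omega) x

theorem dtw_apply (x : M.X 1) (i j : ℤ) (h : i + 1 = j) (n : M.X i) :
    M.dtw x i j h n = M.d i j h n + M.br 1 i j (by omega) x n := rfl

theorem irrStab_iff (x : M.X 1) (a : M.X 0) :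
    M.IrrStab x a ↔ a ∈ LinearMap.range (M.dtw x (-1) 0 (by norm_num)) :=
  ⟨fun ⟨n, hn⟩ => ⟨n, hn.symm⟩, fun ⟨n, hn⟩ => ⟨n, hn.symm⟩⟩

theorem isMC_iff {M : DGLA K} (x : M.X 1) : M.IsMC x ↔ M.curv x = 0 := Iff.rfl

theorem IrrStab.neg {M : DGLA K} {x : M.X 1} {b : M.X 0} (hb : M.IrrStab x b) : M.IrrStab x (-b) := by
  rw [irrStab_iff] at hb ⊢
  exact neg_mem hb

theorem irrStab_zero {M : DGLA K} (x : M.X 1) : M.IrrStab x 0 := by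
  rw [irrStab_iff]; exact zero_mem _

/-- The twisted differential is a derivation by the Leibniz rule and the Jacobi identity; the
Maurer–Cartan equation plays no role. -/
theorem dtw_br (x : M.X 1) (n : M.X (-1)) (v : M.X 0) :
    M.dtw x (-1) 0 (by norm_num) (M.br (-1) 0 (-1) (by norm_num) n v) =
      M.br 0 0 0 (by norm_num) (M.dtw x (-1) 0 (by norm_num) n) v -
        M.br (-1) 1 0 (by norm_num) n (M.dtw x 0 1 (by norm_num) v) := by
  have h1 := M.leibniz (-1) 0 (-1) 0 1 0 (by norm_num) (by norm_num) (by norm_num) (by norm_num)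
    (by norm_num) (by norm_num) n v
  have h2 := M.jacobi 1 (-1) 0 0 (-1) 1 0 (by norm_num) (by norm_num) (by norm_num) (by norm_num)
    (by norm_num) (by norm_num) x n v
  simp only [dtw_apply, map_add, LinearMap.add_apply, h1, h2]
  simp
  abel

variable [CharZero K]

/-- For x of odd degree the Jacobi identity gives [x, [x, n]] = ½[[x, x], n], and the Leibniz rule
cancels the mixed terms. -/
theorem dtw_dtw (x : M.X 1) (i j k : ℤ) (h : i + 1 = j) (h' : j + 1 = k) (n : M.X i) :
    M.dtw x j k h' (M.dtw x i j h n) = M.br 2 i k (by omega) (M.curv x) n := by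
  have h1 := M.leibniz 1 i j 2 j k (by omega) (by norm_num) h h' (by omega) (by omega) x n
  have h2 := M.jacobi 1 1 i 2 j j k (by norm_num) (by omega) (by omega) (by omega) (by omega)
    (by omega) x x n
  simp only [dtw_apply, map_add, LinearMap.add_apply, M.d_d, h1, curv, map_smul,
    LinearMap.smul_apply, mul_one, zpow_one, neg_smul, one_smul] at h2 ⊢
  have h3 : M.br 1 j k (by omega) x (M.br 1 i j (by omega) x n) =
      (2⁻¹ : K) • M.br 2 i k (by omega) (M.br 1 1 2 (by norm_num) x x) n := by
    rw [eq_inv_smul_iff₀ two_ne_zero, two_smul]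
    exact eq_sub_iff_add_eq.mp (h2.trans (sub_eq_add_neg _ _).symm)
  rw [h3]
  abel

/-- The Lie ring of degree zero elements. -/
abbrev lieRing : LieRing (M.X 0) :=
  { M.addCommGroup 0 with
    bracket := fun x y => M.br 0 0 0 (zero_add 0) x y
    add_lie := fun x y z => by
      change M.br 0 0 0 _ (x + y) z = M.br 0 0 0 _ x z + M.br 0 0 0 _ y z
      rw [map_add, LinearMap.add_apply]
    lie_add := fun x y z => map_add _ _ _
    lie_self := fun x => by
      have h := M.br_symm 0 0 0 (zero_add 0) (zero_add 0) x x
      rw [mul_zero, zpow_zero, one_smul] at h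
      have h2 : (2 : K) • M.br 0 0 0 (zero_add 0) x x = 0 := by
        rw [two_smul]; exact eq_neg_iff_add_eq_zero.mp h
      exact (smul_eq_zero.mp h2).resolve_left two_ne_zero
    leibniz_lie := fun x y z => by
      have h := M.jacobi 0 0 0 0 0 0 0 (zero_add 0) (zero_add 0) (zero_add 0) (zero_add 0)
        (zero_add 0) (zero_add 0) x y z
      rwa [mul_zero, zpow_zero, one_smul] at h }

attribute [local instance] lieRing

/-- The Lie algebra of degree zero elements. -/
abbrev lieAlgebra : LieAlgebra K (M.X 0) :=
  { M.module 0 with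
    lie_smul := fun c x y => (M.br 0 0 0 (zero_add 0) x).map_smul c y }

attribute [local instance] lieAlgebra

theorem nest_eq_lieNest (l : List (M.X 0)) : M.nest l = lieNest l := by
  induction l with
  | nil => rfl
  | cons x l ih =>
    cases l with
    | nil => rfl
    | cons y l => rw [nest, ih]; rfl

theorem bch_eq_lieBch (a b : M.X 0) : M.bch a b = lieBch K a b := by
  rw [bch, lieBch]
  refine finsum_congr fun w => ?_
  rw [nest_eq_lieNest]
  rfl

theorem exists_lieNest_eq_zero [hM : M.NilAct] :
    ∃ N : ℕ, ∀ l : List (M.X 0), N ≤ l.length → lieNest l = 0 := by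
  obtain ⟨N, hN⟩ := hM.prod_eq_zero
  refine ⟨N + 1, fun l hl => ?_⟩
  rcases List.eq_nil_or_concat l with rfl | ⟨l', b, rfl⟩
  · simp at hl
  · rw [List.concat_eq_append, lieNest_append_singleton (K := K)]
    exact LinearMap.congr_fun (hN 0 l' (by simpa using hl)) b

/-! ### The group of degree zero elements, the gauge action and irrelevant stabilizers. -/

section Group

variable {M}

variable (M) in
/-- The affine action `(x, c) ↦ ([a, x] - c da, 0)`. -/
def gaugeRep : M.X 0 →ₗ[K] Module.End K (M.X 1 × K) := affRep (M.act 1) (M.d 0 1 (zero_add 1))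

theorem gaugeRep_apply (a : M.X 0) (p : M.X 1 × K) :
    M.gaugeRep a p = (M.act 1 a p.1 - p.2 • M.d 0 1 (zero_add 1) a, 0) := rfl

theorem gaugeRep_lie (a b : M.X 0) : M.gaugeRep ⁅a, b⁆ =
    M.gaugeRep a * M.gaugeRep b - M.gaugeRep b * M.gaugeRep a := by
  refine affRep_lie (M.act_br 1) ?_ a b
  intro a b
  refine (M.d_br_zero 0 1 (zero_add 1) a b).trans ?_
  have := M.br_symm 1 0 1 (by norm_num) (by norm_num) (M.d 0 1 (zero_add 1) a) b
  rw [mul_zero, zpow_zero, one_smul] at this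
  rw [this, sub_eq_add_neg, add_comm]
  rfl

/-- For a Maurer–Cartan element, d_x squares to zero and [d_x n, d_x n'] = d_x [n, d_x n']. So the
image of d_x in degree zero is closed under brackets, and the product is a linear combination of
nested brackets. -/
theorem IrrStab.bch {x : M.X 1} (hx : M.IsMC x) {a b : M.X 0} (ha : M.IrrStab x a)
    (hb : M.IrrStab x b) : M.IrrStab x (M.bch a b) := by
  rw [irrStab_iff] at ha hb ⊢
  set S := LinearMap.range (M.dtw x (-1) 0 (by norm_num))
  have hbr : ∀ u ∈ S, ∀ v ∈ S, M.br 0 0 0 (by norm_num) u v ∈ S := by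
    rintro _ ⟨n, rfl⟩ _ ⟨n', rfl⟩
    refine ⟨M.br (-1) 0 (-1) (by norm_num) n (M.dtw x (-1) 0 (by norm_num) n'), ?_⟩
    rw [dtw_br, dtw_dtw, (isMC_iff x).mp hx, map_zero, LinearMap.zero_apply, map_zero, sub_zero]
  have hnest : ∀ l : List (M.X 0), (∀ u ∈ l, u ∈ S) → M.nest l ∈ S := by
    intro l hl
    induction l with
    | nil => exact zero_mem _
    | cons u l ih =>
      cases l with
      | nil => exact hl u (by simp)
      | cons v l =>
        exact hbr u (hl u (by simp)) _ (ih fun w hw => hl w (List.mem_cons_of_mem _ hw))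
  rw [DGLA.bch]
  refine finsum_induction (· ∈ S) (zero_mem _) (fun _ _ => add_mem) fun w => ?_
  refine S.smul_mem _ (hnest _ fun u hu => ?_)
  simp only [List.mem_flatMap, List.mem_append, List.mem_replicate] at hu
  obtain ⟨_, _, h | h⟩ := hu
  · rw [h.2]; exact ha
  · rw [h.2]; exact hb

variable [hM : M.NilAct]

theorem bch_assoc (a b c : M.X 0) : M.bch (M.bch a b) c = M.bch a (M.bch b c) := by
  obtain ⟨N, hN⟩ := M.exists_lieNest_eq_zero
  simp only [bch_eq_lieBch]
  exact lieBch_assoc hN a b c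

theorem bch_zero (a : M.X 0) : M.bch a 0 = a := by
  obtain ⟨N, hN⟩ := M.exists_lieNest_eq_zero
  rw [bch_eq_lieBch]
  exact lieBch_zero hN a

theorem zero_bch (a : M.X 0) : M.bch 0 a = a := by
  obtain ⟨N, hN⟩ := M.exists_lieNest_eq_zero
  rw [bch_eq_lieBch]
  exact zero_lieBch hN a

theorem neg_bch (a : M.X 0) : M.bch (-a) a = 0 := by
  obtain ⟨N, hN⟩ := M.exists_lieNest_eq_zero
  rw [bch_eq_lieBch]
  exact neg_lieBch hN a

theorem bch_conj (a b : M.X 0) : M.bch (M.bch a b) (-a) = nexp K (M.act 0 a) b := by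
  obtain ⟨N, hN⟩ := M.exists_lieNest_eq_zero
  rw [bch_eq_lieBch, bch_eq_lieBch]
  exact lieBch_conj hN a b

variable (M) in
/-- The group of degree zero elements under the Baker–Campbell–Hausdorff product. -/
def ExpGroup (_ : M.NilAct) : Type u := M.X 0

/-- Identities between iterated products thereby become instances of identities valid in every
group, and the irrelevant stabilizer can be treated as a subgroup. -/
instance : Group (ExpGroup M hM) where
  mul a b := M.bch a b
  one := (0 : M.X 0)
  inv := fun a : M.X 0 => -a
  mul_assoc := bch_assoc (M := M)
  one_mul := zero_bch (M := M)
  mul_one := bch_zero (M := M)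
  inv_mul_cancel := neg_bch (M := M)

theorem bch_neg (a : M.X 0) : M.bch a (-a) = 0 :=
  mul_inv_cancel (G := ExpGroup M hM) a

theorem isNilpotent_act (j : ℤ) (a : M.X 0) : IsNilpotent (M.act j a) := by
  obtain ⟨N, hN⟩ := hM.prod_eq_zero
  exact isNilpotent_of_prod_eq_zero (hN j) a

theorem gaugeRep_prod_eq_zero :
    ∃ N : ℕ, ∀ l : List (M.X 0), N ≤ l.length → (l.map M.gaugeRep).prod = 0 := by
  obtain ⟨N, hN⟩ := hM.prod_eq_zero
  exact ⟨N + 1, affRep_prod_eq_zero _ (hN 1)⟩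

theorem isNilpotent_gaugeRep (a : M.X 0) : IsNilpotent (M.gaugeRep a) := by
  obtain ⟨N, hN⟩ := gaugeRep_prod_eq_zero (M := M)
  exact isNilpotent_of_prod_eq_zero hN a

/-- The first application of the affine operator to (x, 1) gives ([a, x] - da, 0), and from then on
it acts by [a, -]; its exponential series is the gauge formula. The gauge action is thus the
exponential of a representation, to which the Baker–Campbell–Hausdorff formula applies. -/
theorem nexp_gaugeRep (a : M.X 0) (x : M.X 1) : nexp K (M.gaugeRep a) (x, 1) = (M.gauge a x, 1) := by
  obtain ⟨k, hk⟩ := isNilpotent_gaugeRep a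
  obtain ⟨l, hl⟩ := isNilpotent_act 1 a
  have hp : ∀ n, (M.gaugeRep a ^ (n + 1)) (x, 1) =
      ((M.act 1 a ^ n) (M.act 1 a x - M.d 0 1 (zero_add 1) a), 0) := by
    intro n
    induction n with
    | zero => simp [gaugeRep_apply]
    | succ n ih =>
      rw [pow_succ', Module.End.mul_apply, ih, gaugeRep_apply, pow_succ' _ n, Module.End.mul_apply]
      simp
  rw [nexp_apply_eq_sum K (pow_eq_zero_of_le (show k ≤ k + l + 1 by omega) hk), sum_range_succ',
    gauge, finsum_eq_sum_of_support_subset (s := range (k + l))]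
  · simp only [hp, pow_zero, Nat.factorial_zero, Nat.cast_one, inv_one, one_smul,
      Module.End.one_apply]
    rw [add_comm]
    ext
    · simp [Prod.fst_sum]; rfl
    · simp [Prod.snd_sum]
  · intro n hn
    simp only [coe_range, Set.mem_Iio]
    by_contra hc
    apply hn
    have : (M.ad₁ a) ^ n = 0 := pow_eq_zero_of_le (by omega) hl
    simp only [this, LinearMap.zero_apply, smul_zero]

theorem gauge_bch (a b : M.X 0) (x : M.X 1) : M.gauge (M.bch a b) x = M.gauge a (M.gauge b x) := by
  obtain ⟨N, hN⟩ := M.exists_lieNest_eq_zero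
  obtain ⟨N', hN'⟩ := gaugeRep_prod_eq_zero (M := M)
  have h := nexp_lieBch (K := K) gaugeRep_lie hN hN' a b
  rw [← bch_eq_lieBch] at h
  have h2 := LinearMap.congr_fun h (x, 1)
  rw [Module.End.mul_apply, nexp_gaugeRep, nexp_gaugeRep, nexp_gaugeRep] at h2
  exact congrArg Prod.fst h2

theorem gauge_zero (x : M.X 1) : M.gauge 0 x = x := by
  have h := nexp_gaugeRep (M := M) 0 x
  rw [map_zero, nexp_zero] at h
  exact (congrArg Prod.fst h).symm

theorem gauge_neg_gauge (a : M.X 0) (x : M.X 1) : M.gauge (-a) (M.gauge a x) = x := by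
  rw [← gauge_bch, neg_bch, gauge_zero]

/-- A vector is fixed by the exponential of a nilpotent operator exactly when the operator kills it,
and here the operator sends (x, 1) to (-d_x a, 0). -/
theorem gauge_eq_self_iff (a : M.X 0) (x : M.X 1) :
    M.gauge a x = x ↔ M.dtw x 0 1 (zero_add 1) a = 0 := by
  have h1 := nexp_apply_eq_self_iff K (isNilpotent_gaugeRep a) (x, 1)
  rw [nexp_gaugeRep, gaugeRep_apply] at h1
  have h2 := M.br_symm 0 1 1 (by norm_num) (by norm_num) a x
  rw [zero_mul, zpow_zero, one_smul] at h2
  have h3 : M.act 1 a x - M.d 0 1 (zero_add 1) a = -M.dtw x 0 1 (zero_add 1) a := by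
    rw [dtw_apply]
    change M.br 0 1 1 _ a x - _ = _
    rw [h2]
    abel
  simpa [h3] using h1

/-- Twice the curvature is the value at ((x, 1), (x, 1)) of a bilinear form Q on pairs (y, c),
obtained by homogenising and polarising. The infinitesimal affine action is compatible with Q and
the bracket action, so `nexp_bilin` gives the statement for exponentials. -/
theorem curv_gauge (a : M.X 0) (x : M.X 1) :
    M.curv (M.gauge a x) = nexp K (M.act 2 a) (M.curv x) := by
  let Q : (M.X 1 × K) →ₗ[K] (M.X 1 × K) →ₗ[K] M.X 2 :=
    LinearMap.mk₂ K (fun u v => M.br 1 1 2 (by norm_num) u.1 v.1 +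
      (u.2 • M.d 1 2 (by norm_num) v.1 + v.2 • M.d 1 2 (by norm_num) u.1))
      (fun u u' v => by simp only [Prod.fst_add, Prod.snd_add, map_add, LinearMap.add_apply,
        add_smul, smul_add]; abel)
      (fun c u v => by
        simp only [Prod.smul_fst, Prod.smul_snd, map_smul, LinearMap.smul_apply, smul_add, smul_smul,
          smul_eq_mul, mul_comm c])
      (fun u v v' => by simp only [Prod.fst_add, Prod.snd_add, map_add, add_smul, smul_add]; abel)
      (fun c u v => by
        simp only [Prod.smul_fst, Prod.smul_snd, map_smul, smul_add, smul_smul,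
          smul_eq_mul, mul_comm c])
  have hQ : ∀ y : M.X 1, Q (y, 1) (y, 1) = (2 : K) • M.curv y := by
    intro y
    simp only [Q, LinearMap.mk₂_apply, curv, one_smul, smul_add, smul_smul, two_smul]
    rw [mul_inv_cancel₀ two_ne_zero, one_smul]
    abel
  have h := nexp_bilin K Q (isNilpotent_gaugeRep a) (isNilpotent_gaugeRep a) (isNilpotent_act 2 a)
    (fun u v => by
      simp only [Q, LinearMap.mk₂_apply, gaugeRep_apply, map_add, map_sub, map_smul,
        LinearMap.sub_apply, LinearMap.smul_apply, M.act_br_apply 1 1 2 (by norm_num), M.d_d,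
        M.d_br_zero 1 2 (by norm_num), smul_zero, sub_zero, zero_smul, zero_add, smul_add,
        M.br_one_comm u.1 (M.d 0 1 (zero_add 1) a)]
      abel) (x, 1) (x, 1)
  rw [nexp_gaugeRep, hQ, hQ, map_smul] at h
  exact (smul_right_injective (M.X 2) (two_ne_zero (α := K)) h).symm

theorem isMC_gauge (a : M.X 0) {x : M.X 1} (hx : M.IsMC x) : M.IsMC (M.gauge a x) := by
  rw [isMC_iff] at hx ⊢
  rw [curv_gauge, hx, map_zero]

/-- The argument is that for the curvature, with the bilinear map ((u, c), n) ↦ c dn + [u, n], whose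
value at u = x, c = 1 is the twisted differential. -/
theorem nexp_act_dtw (a : M.X 0) (x : M.X 1) (i j : ℤ) (h : i + 1 = j) (n : M.X i) :
    nexp K (M.act j a) (M.dtw x i j h n) = M.dtw (M.gauge a x) i j h (nexp K (M.act i a) n) := by
  let Q : (M.X 1 × K) →ₗ[K] M.X i →ₗ[K] M.X j :=
    LinearMap.mk₂ K (fun u n => u.2 • M.d i j h n + M.br 1 i j (by omega) u.1 n)
      (fun u u' v => by
        simp only [Prod.fst_add, Prod.snd_add, map_add, LinearMap.add_apply, add_smul]
        abel_nf)
      (fun c u v => by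
        simp only [Prod.smul_fst, Prod.smul_snd, map_smul, LinearMap.smul_apply, smul_add, smul_smul,
          smul_eq_mul])
      (fun u v v' => by simp only [map_add, smul_add]; abel)
      (fun c u v => by
        simp only [map_smul, smul_add, smul_smul, mul_comm c])
  have hh := nexp_bilin K Q (isNilpotent_gaugeRep a) (isNilpotent_act i a) (isNilpotent_act j a)
    (fun u v => by
      simp only [Q, LinearMap.mk₂_apply, gaugeRep_apply, map_add, map_sub, map_smul,
        LinearMap.sub_apply, LinearMap.smul_apply, M.act_br_apply 1 i j (by omega),
        M.d_br_zero i j h, zero_smul, zero_add, smul_add]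
      abel) (x, 1) n
  rw [nexp_gaugeRep] at hh
  simp only [Q, LinearMap.mk₂_apply, one_smul] at hh
  exact hh

theorem IrrStab.conj {x : M.X 1} {b : M.X 0} (hb : M.IrrStab x b) (a : M.X 0) :
    M.IrrStab (M.gauge a x) (M.bch (M.bch a b) (-a)) := by
  rw [irrStab_iff] at hb ⊢
  obtain ⟨n, rfl⟩ := hb
  exact ⟨nexp K (M.act (-1) a) n, by rw [bch_conj, nexp_act_dtw]⟩

/-- An element d_x n is killed by d_x, and so it fixes x; this is the reason for the word
stabilizer. -/
theorem IrrStab.gauge_eq {x : M.X 1} (hx : M.IsMC x) {b : M.X 0} (hb : M.IrrStab x b) :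
    M.gauge b x = x := by
  rw [irrStab_iff] at hb
  obtain ⟨n, rfl⟩ := hb
  rw [gauge_eq_self_iff, dtw_dtw, (isMC_iff x).mp hx, map_zero, LinearMap.zero_apply]

end Group

end DGLA

/-! ### Coefficientwise solution of linear problems -/

section Contraction

variable {K : Type*} [Field K] {V W m : Type*} [AddCommGroup V] [Module K V] [AddCommGroup W]
  [Module K W] [AddCommGroup m] [Module K m]

/-- Contraction of `V ⊗ m` with a linear form on `m`. -/
def contr (φ : Module.Dual K m) : V ⊗[K] m →ₗ[K] V := TensorProduct.rid K V ∘ₗ φ.lTensor V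

@[simp]
theorem contr_tmul (φ : Module.Dual K m) (v : V) (a : m) : contr φ (v ⊗ₜ[K] a) = φ a • v := rfl

theorem contr_rTensor (φ : Module.Dual K m) (f : V →ₗ[K] W) (z : V ⊗[K] m) :
    contr φ (f.rTensor m z) = f (contr φ z) := by
  induction z with
  | zero => simp
  | add x y hx hy => simp only [map_add, hx, hy]
  | tmul x a => simp

theorem equivFinsuppOfBasisRight_apply_eq_contr {ι : Type*} [DecidableEq ι] (b : Module.Basis ι K m)
    (z : V ⊗[K] m) (i : ι) :
    TensorProduct.equivFinsuppOfBasisRight b z i = contr (b.coord i) z :=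
  TensorProduct.equivFinsuppOfBasisRight_apply b z i

theorem sum_contr_coord {ι : Type*} [DecidableEq ι] (b : Module.Basis ι K m) (T : Finset ι) (z : V ⊗[K] m)
    (hT : (TensorProduct.equivFinsuppOfBasisRight b z).support ⊆ T) :
    ∑ i ∈ T, contr (b.coord i) z ⊗ₜ[K] b i = z := by
  conv_rhs => rw [← (TensorProduct.equivFinsuppOfBasisRight b).symm_apply_apply z,
    TensorProduct.equivFinsuppOfBasisRight_symm_apply, Finsupp.sum]
  simp only [equivFinsuppOfBasisRight_apply_eq_contr]
  symm
  refine Finset.sum_subset hT fun i _ hi => ?_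
  rw [← equivFinsuppOfBasisRight_apply_eq_contr, Finsupp.notMem_support_iff.mp hi,
    TensorProduct.zero_tmul]

/-- A system of linear equations that can be solved over `K` can be solved with coefficients. -/
theorem exists_tensor_of_forall_contr {S : Type*} [Finite S] {U V₀ : Type*} [AddCommGroup U]
    [Module K U] [AddCommGroup V₀] [Module K V₀] {V : S → Type*} [∀ s, AddCommGroup (V s)]
    [∀ s, Module K (V s)] (f₀ : U →ₗ[K] V₀) (f : ∀ s, U →ₗ[K] V s) (R : V₀ → (∀ s, V s) → Prop)
    (hR : ∀ v₀ v, R v₀ v → ∃ u, f₀ u = v₀ ∧ ∀ s, f s u = v s)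
    (z₀ : V₀ ⊗[K] m) (z : ∀ s, V s ⊗[K] m)
    (hz : ∀ φ : Module.Dual K m, R (contr φ z₀) fun s => contr φ (z s)) :
    ∃ u : U ⊗[K] m, f₀.rTensor m u = z₀ ∧ ∀ s, (f s).rTensor m u = z s := by
  classical
  -- The system is solved for each coordinate of the data in a basis of m, only finitely many
  -- coordinates being nonzero. For this reason R may be any relation, not necessarily a linear one.
  let b := Module.Basis.ofVectorSpace K m
  choose u hu₀ hu using fun i => hR _ _ (hz (b.coord i))
  have := Fintype.ofFinite S
  let T := (TensorProduct.equivFinsuppOfBasisRight b z₀).support ∪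
    Finset.univ.biUnion fun s => (TensorProduct.equivFinsuppOfBasisRight b (z s)).support
  refine ⟨∑ i ∈ T, u i ⊗ₜ b i, ?_, fun s => ?_⟩
  · rw [map_sum, ← sum_contr_coord b T z₀ Finset.subset_union_left]
    exact Finset.sum_congr rfl fun i _ => by rw [LinearMap.rTensor_tmul, hu₀]
  · rw [map_sum, ← sum_contr_coord b T (z s) ((Finset.subset_biUnion_of_mem
      (fun s => (TensorProduct.equivFinsuppOfBasisRight b (z s)).support)
      (Finset.mem_univ s)).trans Finset.subset_union_right)]
    exact Finset.sum_congr rfl fun i _ => by rw [LinearMap.rTensor_tmul, hu]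

theorem exists_proj (F : Submodule K m) :
    ∃ P : m →ₗ[K] m, (∀ a, P a ∈ F) ∧ ∀ a ∈ F, P a = a := by
  obtain ⟨g, hg⟩ := LinearMap.exists_leftInverse_of_injective F.subtype (by simp)
  refine ⟨F.subtype ∘ₗ g, fun a => (g a).2, fun a ha => ?_⟩
  exact congrArg Subtype.val (LinearMap.congr_fun hg ⟨a, ha⟩)

/-- The difference of a projection to F and a projection to G picks out a complement of G in F. With
F = 𝔪ᵏ and G = 𝔪ᵏ⁺¹ it extracts leading terms. -/
theorem exists_graded_proj {F G : Submodule K m} (h : G ≤ F) : ∃ P : m →ₗ[K] m,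
    (∀ a, P a ∈ F) ∧ (∀ a ∈ G, P a = 0) ∧ ∀ a ∈ F, P a - a ∈ G := by
  obtain ⟨P, hP, hP'⟩ := exists_proj F
  obtain ⟨Q, hQ, hQ'⟩ := exists_proj G
  refine ⟨P - Q ∘ₗ P, fun a => sub_mem (hP a) (h (hQ _)), fun a ha => ?_, fun a ha => ?_⟩
  · simp [hP' a (h ha), hQ' a ha]
  · simpa [hP' a ha] using hQ a

end Contraction

/-! ### Solving equations over A by induction on the powers of 𝔪_A. -/

namespace DGLA

variable {K : Type u} [Field K] {L M : DGLA K} {A : Art K}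

theorem tensFil_mono {k l : ℕ} (h : k ≤ l) (i : ℤ) : L.tensFil A l i ≤ L.tensFil A k i := by
  refine Submodule.span_mono ?_
  rintro t ⟨x, a, ha, rfl⟩
  exact ⟨x, a, Ideal.pow_le_pow_right h ha, rfl⟩

theorem map_mem_tensFil {k : ℕ} {i j : ℤ} (f : L.X i →ₗ[K] M.X j) {t : (L.tens A).X i}
    (ht : t ∈ L.tensFil A k i) : (f.rTensor A.max t : (M.tens A).X j) ∈ M.tensFil A k j := by
  have : L.tensFil A k i ≤ (M.tensFil A k j).comap (f.rTensor A.max) := by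
    refine Submodule.span_le.mpr ?_
    rintro t ⟨x, a, ha, rfl⟩
    exact Submodule.subset_span ⟨f x, a, ha, rfl⟩
  exact this ht

theorem d_mem_tensFil {k : ℕ} {i j : ℤ} (h : i + 1 = j) {t : (L.tens A).X i}
    (ht : t ∈ L.tensFil A k i) : (L.tens A).d i j h t ∈ L.tensFil A k j :=
  map_mem_tensFil (L.d i j h) ht

theorem br_mem_tensFil_right {k : ℕ} {i j l : ℤ} (h : i + j = l) (s : (L.tens A).X i)
    {t : (L.tens A).X j} (ht : t ∈ L.tensFil A k j) :
    (L.tens A).br i j l h s t ∈ L.tensFil A (k + 1) l := by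
  rw [add_comm]
  exact L.br_mem_tensFil A i j l h (L.mem_tensFil_one A i s) ht

theorem br_mem_tensFil_left {k : ℕ} {i j l : ℤ} (h : i + j = l) {s : (L.tens A).X i}
    (t : (L.tens A).X j) (hs : s ∈ L.tensFil A k i) :
    (L.tens A).br i j l h s t ∈ L.tensFil A (k + 1) l :=
  L.br_mem_tensFil A i j l h hs (L.mem_tensFil_one A j t)

variable (A) in
/-- The part of `𝔪` in `𝔪ᵏ`. -/
def maxPow (k : ℕ) : Submodule K A.max :=
  ((A.max ^ k).restrictScalars K).comap (A.max.subtype.restrictScalars K)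

theorem lTensor_mem_tensFil {k : ℕ} {i : ℤ} {P : A.max →ₗ[K] A.max} (hP : ∀ a, P a ∈ maxPow A k)
    (t : L.X i ⊗[K] A.max) : P.lTensor (L.X i) t ∈ L.tensFil A k i := by
  induction t with
  | zero => rw [map_zero]; exact zero_mem _
  | add x y hx hy => rw [map_add]; exact add_mem hx hy
  | tmul x a => exact Submodule.subset_span ⟨x, P a, hP a, rfl⟩

theorem lTensor_eq_of_mem_tensFil {k : ℕ} {i : ℤ} {P Q : A.max →ₗ[K] A.max}
    (hP : ∀ a ∈ maxPow A k, P a = Q a) {t : L.X i ⊗[K] A.max} (ht : t ∈ L.tensFil A k i) :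
    P.lTensor (L.X i) t = Q.lTensor (L.X i) t := by
  induction ht using Submodule.span_induction with
  | zero => exact (map_zero (P.lTensor (L.X i))).trans (map_zero (Q.lTensor (L.X i))).symm
  | add x y _ _ hx hy =>
    exact (map_add (P.lTensor (L.X i)) x y).trans
      ((congrArg₂ (· + ·) hx hy).trans (map_add (Q.lTensor (L.X i)) x y).symm)
  | smul c x _ hx =>
    exact (map_smul (P.lTensor (L.X i)) c x).trans
      ((congrArg (c • ·) hx).trans (map_smul (Q.lTensor (L.X i)) c x).symm)
  | mem t ht =>
    obtain ⟨x, a, ha, rfl⟩ := ht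
    exact congrArg (x ⊗ₜ[K] ·) (hP a ha)

theorem lTensor_sub_mem_tensFil {k l : ℕ} {i : ℤ} {P : A.max →ₗ[K] A.max}
    (hP : ∀ a ∈ maxPow A k, P a - a ∈ maxPow A l) {t : L.X i ⊗[K] A.max}
    (ht : t ∈ L.tensFil A k i) : P.lTensor (L.X i) t - t ∈ L.tensFil A l i := by
  have : L.tensFil A k i ≤ (L.tensFil A l i).comap (P.lTensor (L.X i) - LinearMap.id) := by
    refine Submodule.span_le.mpr ?_
    rintro t ⟨x, a, ha, rfl⟩
    exact Submodule.subset_span ⟨x, P a - a, hP a ha, (TensorProduct.tmul_sub x (P a) a).symm⟩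
  exact this ht

theorem rTensor_lTensor_comm {V W m n : Type*} [AddCommGroup V] [Module K V] [AddCommGroup W]
    [Module K W] [AddCommGroup m] [Module K m] [AddCommGroup n] [Module K n] (f : V →ₗ[K] W)
    (P : m →ₗ[K] n) (t : V ⊗[K] m) :
    f.rTensor n (P.lTensor V t) = P.lTensor W (f.rTensor m t) := by
  rw [← LinearMap.comp_apply, ← LinearMap.comp_apply, LinearMap.rTensor_comp_lTensor,
    LinearMap.lTensor_comp_rTensor]

theorem tensMap_id_f (φ : Hom L M) (i : ℤ) (t : L.X i ⊗[K] A.max) :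
    (tensMap φ (𝟙 A)).f i t = (φ.f i).rTensor A.max t := by
  change TensorProduct.map (φ.f i) (Art.maxMap (𝟙 A)) t = _
  rw [Art.maxMap_id]
  rfl

/-- The vanishing of `Hⁱ` of the common kernel of a family of morphisms. -/
def KerAcyclic {S : Type*} {Q : S → DGLA K} (π : ∀ s, Hom L (Q s)) (i : ℤ) : Prop :=
  ∀ z : L.X i, L.d i (i + 1) rfl z = 0 → (∀ s, (π s).f i z = 0) →
    ∃ u : L.X (i - 1), L.d (i - 1) i (sub_add_cancel i 1) u = z ∧ ∀ s, (π s).f (i - 1) u = 0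

section Solve

variable {S : Type*} [Finite S] {Q : S → DGLA K} {π : ∀ s, Hom L (Q s)} {i h j : ℤ}

/-- One step of the induction. The leading term of z is an honest cocycle in the common kernel, so
the acyclicity over K gives a primitive coefficient by coefficient; a projection of 𝔪_A to its part
in 𝔪ᵏ puts the primitive into the right step of the filtration. -/
theorem exists_approx (hπ : KerAcyclic π i) (hi : h + 1 = i) (hj : i + 1 = j) {k : ℕ}
    {z : (L.tens A).X i} (hz : z ∈ L.tensFil A k i)
    (hd : (L.tens A).d i j hj z ∈ L.tensFil A (k + 1) j)
    (hz0 : ∀ s, (tensMap (π s) (𝟙 A)).f i z = 0) :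
    ∃ u ∈ L.tensFil A k h, (L.tens A).d h i hi u - z ∈ L.tensFil A (k + 1) i ∧
      ∀ s, (tensMap (π s) (𝟙 A)).f h u = 0 := by
  obtain rfl : h = i - 1 := by omega
  subst hj
  have hle : maxPow A (k + 1) ≤ maxPow A k := fun a ha => Ideal.pow_le_pow_right (Nat.le_succ k) ha
  obtain ⟨P, hP1, hP2, hP3⟩ := exists_graded_proj hle
  obtain ⟨P', hP1', hP2'⟩ := exists_proj (maxPow A k)
  change L.X i ⊗[K] A.max at z
  -- P commutes with d and kills 𝔪ᵏ⁺¹, where the coefficients of dz lie.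
  have hPd : (L.d i (i + 1) rfl).rTensor A.max (P.lTensor (L.X i) z) = 0 := by
    rw [rTensor_lTensor_comm]
    refine (lTensor_eq_of_mem_tensFil (P := P) (Q := 0) (fun a ha => by simpa using hP2 a ha)
      hd).trans ?_
    rw [LinearMap.lTensor_zero]
    rfl
  have hPπ : ∀ s, ((π s).f i).rTensor A.max (P.lTensor (L.X i) z) = 0 := fun s => by
    rw [rTensor_lTensor_comm, ← tensMap_id_f, hz0 s]
    exact map_zero _
  obtain ⟨u, hu, hus⟩ := exists_tensor_of_forall_contr (L.d (i - 1) i hi)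
    (fun s => (π s).f (i - 1))
    (fun v₀ v => L.d i (i + 1) rfl v₀ = 0 ∧ (∀ s, (π s).f i v₀ = 0) ∧ ∀ s, v s = 0)
    (fun v₀ v hv => by
      obtain ⟨u, hu1, hu2⟩ := hπ v₀ hv.1 hv.2.1
      exact ⟨u, hu1, fun s => (hu2 s).trans (hv.2.2 s).symm⟩)
    (P.lTensor (L.X i) z) (fun s => 0)
    (fun φ => ⟨by rw [← contr_rTensor, hPd, map_zero],
      fun s => by rw [← contr_rTensor, hPπ, map_zero], fun s => map_zero _⟩)
  refine ⟨P'.lTensor _ u, lTensor_mem_tensFil hP1' u, ?_, fun s => ?_⟩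
  · have h1 : (L.d (i - 1) i hi).rTensor A.max u = P.lTensor (L.X i) z := hu
    have h2 : (L.d (i - 1) i hi).rTensor A.max (P'.lTensor _ u) = P.lTensor (L.X i) z := by
      rw [rTensor_lTensor_comm, h1]
      have := lTensor_eq_of_mem_tensFil (P := P') (Q := LinearMap.id) (fun a ha => hP2' a ha)
        (lTensor_mem_tensFil hP1 z)
      simpa using this
    change (L.d (i - 1) i hi).rTensor A.max (P'.lTensor _ u) - z ∈ _
    rw [h2]
    exact lTensor_sub_mem_tensFil hP3 hz
  · have h1 : ((π s).f (i - 1)).rTensor A.max u = 0 := hus s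
    rw [tensMap_id_f, rTensor_lTensor_comm, h1]
    exact map_zero _

/-- The error d_c u - z is closed for d_c, and bracketing with c raises the filtration, so it is
closed for d to leading order and can be reduced by one step. Nilpotency of 𝔪_A ends the process. -/
theorem exists_d_eq (hπ : KerAcyclic π i) (hi : h + 1 = i) (hj : i + 1 = j)
    {c : (L.tens A).X 1} (hc : (L.tens A).IsMC c) {z : (L.tens A).X i} [CharZero K]
    (hd : (L.tens A).dtw c i j hj z = 0) (hz0 : ∀ s, (tensMap (π s) (𝟙 A)).f i z = 0) :
    ∃ u, (L.tens A).dtw c h i hi u = z ∧ ∀ s, (tensMap (π s) (𝟙 A)).f h u = 0 := by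
  have key : ∀ k : ℕ, ∃ u, (L.tens A).dtw c h i hi u - z ∈ L.tensFil A (k + 1) i ∧
      ∀ s, (tensMap (π s) (𝟙 A)).f h u = 0 := by
    intro k
    induction k with
    | zero => exact ⟨0, L.mem_tensFil_one A _ _, fun s => map_zero _⟩
    | succ k ih =>
      obtain ⟨u, hu1, hu2⟩ := ih
      have hdz : (L.tens A).dtw c i j hj ((L.tens A).dtw c h i hi u - z) = 0 := by
        rw [map_sub, hd, dtw_dtw, (isMC_iff c).mp hc, map_zero, LinearMap.zero_apply, sub_zero]
      obtain ⟨v, hv1, hv2, hv3⟩ := exists_approx hπ hi hj hu1 (by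
        rw [dtw_apply] at hdz
        rw [eq_neg_of_add_eq_zero_left hdz]
        exact neg_mem (br_mem_tensFil_right _ _ hu1)) (fun s => by
        rw [map_sub, hz0, sub_zero, dtw_apply, map_add, Hom.map_d, Hom.map_br, hu2, map_zero,
          map_zero, add_zero])
      refine ⟨u - v, ?_, fun s => by rw [map_sub, hu2, hv3, sub_zero]⟩
      have e : (L.tens A).dtw c h i hi (u - v) - z = -((L.tens A).d h i hi v -
          ((L.tens A).dtw c h i hi u - z)) - (L.tens A).br 1 h i (by omega) c v := by
        rw [map_sub, dtw_apply _ _ _ _ _ v]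
        abel
      rw [e]
      exact sub_mem (neg_mem hv2) (br_mem_tensFil_right _ _ hv1)
  obtain ⟨N, hN⟩ := A.isNilpotent_max
  obtain ⟨u, hu1, hu2⟩ := key N
  exact ⟨u, sub_eq_zero.mp (L.tensFil_eq_zero A hN (Nat.le_succ N) i hu1), hu2⟩

/-- To leading order the gauge action of a is translation by -da, since every bracket with a or with
an element of 𝔪_A gains a power. -/
theorem gauge_sub_mem_tensFil [CharZero K] {k : ℕ} {a : (L.tens A).X 0}
    (ha : a ∈ L.tensFil A k 0) (x : (L.tens A).X 1) :
    (L.tens A).gauge a x - (x - (L.tens A).d 0 1 (by norm_num) a) ∈ L.tensFil A (k + 1) 1 := by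
  have h1 : (L.tens A).ad₁ a x ∈ L.tensFil A (k + 1) 1 := br_mem_tensFil_left _ _ ha
  have h2 : (L.tens A).d 0 1 (by norm_num) a ∈ L.tensFil A k 1 := d_mem_tensFil _ ha
  have h0 : (L.tens A).ad₁ a x - (L.tens A).d 0 1 (by norm_num) a ∈ L.tensFil A k 1 :=
    sub_mem (tensFil_mono (Nat.le_succ k) _ h1) h2
  have hn : ∀ n, ((L.tens A).ad₁ a ^ (n + 1)) ((L.tens A).ad₁ a x -
      (L.tens A).d 0 1 (by norm_num) a) ∈ L.tensFil A (k + 1) 1 := by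
    intro n
    induction n with
    | zero => rw [zero_add, pow_one]; exact br_mem_tensFil_right _ _ h0
    | succ n ih =>
      rw [pow_succ', Module.End.mul_apply]
      exact tensFil_mono (Nat.le_succ _) _ (br_mem_tensFil_right _ _ ih)
  obtain ⟨N, hN⟩ := (L.tens_nilp A).ad
  -- The extra term in the range guarantees that the summand [a, x] - da can be split off; all other
  -- summands lie one step deeper.
  rw [gauge, finsum_eq_sum_of_support_subset (s := Finset.range (N + 1)), Finset.sum_range_succ']
  · simp only [pow_zero, zero_add, Nat.factorial_one, Nat.cast_one, inv_one, one_smul,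
      Module.End.one_apply]
    rw [show ∀ p s q r : (L.tens A).X 1, p + (s + (q - r)) - (p - r) = s + q by intros; abel]
    exact add_mem (sum_mem fun n _ => Submodule.smul_mem _ _ (hn n)) h1
  · intro n hn
    simp only [Finset.coe_range, Set.mem_Iio]
    by_contra hc
    exact hn (by simp only; rw [hN _ _ _ (by omega), smul_zero])

/-- Suppose that the transform x' of x agrees with y to some order. The difference of the two
Maurer–Cartan equations shows that x' - y is closed to leading order; a primitive v in the common
kernel, used as a further gauge transformation, improves the agreement by one order. -/
theorem exists_gauge_eq [CharZero K] (hπ : KerAcyclic π 1) {x y : (L.tens A).X 1}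
    (hx : (L.tens A).IsMC x) (hy : (L.tens A).IsMC y)
    (hxy : ∀ s, (tensMap (π s) (𝟙 A)).f 1 x = (tensMap (π s) (𝟙 A)).f 1 y) :
    ∃ a, (L.tens A).gauge a x = y ∧ ∀ s, (tensMap (π s) (𝟙 A)).f 0 a = 0 := by
  have key : ∀ k : ℕ, ∃ a, (L.tens A).gauge a x - y ∈ L.tensFil A (k + 1) 1 ∧
      ∀ s, (tensMap (π s) (𝟙 A)).f 0 a = 0 := by
    intro k
    induction k with
    | zero => exact ⟨0, L.mem_tensFil_one A _ _, fun s => map_zero _⟩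
    | succ k ih =>
      obtain ⟨a, ha1, ha2⟩ := ih
      set x' := (L.tens A).gauge a x with hx'
      have hmc : (L.tens A).IsMC x' := isMC_gauge a hx
      have hcurv : (L.tens A).d 1 2 (by norm_num) (x' - y) =
          -((2⁻¹ : K) • ((L.tens A).br 1 1 2 (by norm_num) x' (x' - y) +
            (L.tens A).br 1 1 2 (by norm_num) (x' - y) y)) := by
        have e1 := eq_neg_of_add_eq_zero_left hmc
        have e2 := eq_neg_of_add_eq_zero_left hy
        rw [map_sub, e1, e2, map_sub, map_sub, LinearMap.sub_apply, sub_add_sub_cancel, smul_sub]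
        abel
      obtain ⟨v, hv1, hv2, hv3⟩ := exists_approx hπ (zero_add 1) one_add_one_eq_two ha1 (by
        rw [hcurv]
        exact neg_mem (Submodule.smul_mem _ _ (add_mem (br_mem_tensFil_right _ _ ha1)
          (br_mem_tensFil_left _ _ ha1)))) (fun s => by
        rw [map_sub, hx', Hom.map_gauge _ (L.tens_nilp A), ha2, gauge_zero, hxy, sub_self])
      refine ⟨(L.tens A).bch v a, ?_, fun s => by
        rw [Hom.map_bch _ (L.tens_nilp A), hv3, ha2, zero_bch]⟩
      rw [gauge_bch, ← hx']
      have e : (L.tens A).gauge v x' - y = ((L.tens A).gauge v x' -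
          (x' - (L.tens A).d 0 1 (by norm_num) v)) - ((L.tens A).d 0 1 (zero_add 1) v - (x' - y)) := by
        abel
      rw [e]
      exact sub_mem (gauge_sub_mem_tensFil hv1 x') hv2
  obtain ⟨N, hN⟩ := A.isNilpotent_max
  obtain ⟨a, ha1, ha2⟩ := key N
  exact ⟨a, sub_eq_zero.mp (L.tensFil_eq_zero A hN (Nat.le_succ N) 1 ha1), ha2⟩

end Solve

/-- The Bianchi identity. The Jacobi identity gives 3[x, [x, x]] = 0, and the terms with [x, dx]
cancel. -/
theorem dtw_curv [CharZero K] (M : DGLA K) (x : M.X 1) :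
    M.dtw x 2 3 (by norm_num) (M.curv x) = 0 := by
  have h1 := M.leibniz 1 1 2 2 2 3 (by norm_num) (by norm_num) (by norm_num) (by norm_num)
    (by norm_num) (by norm_num) x x
  have h2 := M.br_symm 2 1 3 (by norm_num) (by norm_num) (M.d 1 2 (by norm_num) x) x
  have h3 := M.jacobi 1 1 1 2 2 2 3 (by norm_num) (by norm_num) (by norm_num) (by norm_num)
    (by norm_num) (by norm_num) x x x
  have h4 := M.br_symm 2 1 3 (by norm_num) (by norm_num) (M.br 1 1 2 (by norm_num) x x) x
  norm_num at h1 h2 h3 h4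
  rw [h4] at h3
  rw [h2] at h1
  have h5 : (3 : K) • M.br 1 2 3 (by norm_num) x (M.br 1 1 2 (by norm_num) x x) = 0 := by
    rw [show (3 : K) = 1 + 1 + 1 by norm_num, add_smul, add_smul, one_smul]
    nth_rewrite 1 [h3]
    abel
  have h6 := (smul_eq_zero.mp h5).resolve_left three_ne_zero
  rw [dtw_apply, curv, map_add, map_add, M.d_d, map_smul, map_smul, h6, h1, zero_add, smul_zero,
    add_zero]
  rw [← two_smul K, smul_smul, inv_mul_cancel₀ two_ne_zero, one_smul]
  exact neg_add_cancel _

theorem curv_sub (M : DGLA K) (x u : M.X 1) : M.curv (x - u) = M.curv x -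
    M.d 1 2 one_add_one_eq_two u - (2⁻¹ : K) • (M.br 1 1 2 one_add_one_eq_two x u +
      M.br 1 1 2 one_add_one_eq_two u (x - u)) := by
  simp only [curv, map_sub, LinearMap.sub_apply, smul_sub, smul_add]
  abel

theorem Hom.map_curv (φ : Hom L M) (x : L.X 1) : φ.f 2 (L.curv x) = M.curv (φ.f 1 x) := by
  rw [curv, map_add, map_smul, φ.map_d, φ.map_br]
  rfl

/-- The curvature lies in the common kernel and, by the Bianchi identity, is closed to leading
order. Subtracting a primitive of its leading term moves it one step down the filtration without
changing the images under the π_s. -/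
theorem exists_isMC {S : Type*} [Finite S] {Q : S → DGLA K} {π : ∀ s, Hom L (Q s)} [CharZero K]
    (hπ : KerAcyclic π 2) {x : (L.tens A).X 1}
    (hx : ∀ s, ((Q s).tens A).IsMC ((tensMap (π s) (𝟙 A)).f 1 x)) :
    ∃ y, (L.tens A).IsMC y ∧
      ∀ s, (tensMap (π s) (𝟙 A)).f 1 y = (tensMap (π s) (𝟙 A)).f 1 x := by
  have key : ∀ k : ℕ, ∃ y, (L.tens A).curv y ∈ L.tensFil A (k + 1) 2 ∧
      ∀ s, (tensMap (π s) (𝟙 A)).f 1 y = (tensMap (π s) (𝟙 A)).f 1 x := by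
    intro k
    induction k with
    | zero => exact ⟨x, L.mem_tensFil_one A _ _, fun s => rfl⟩
    | succ k ih =>
      obtain ⟨y, hy1, hy2⟩ := ih
      obtain ⟨v, hv1, hv2, hv3⟩ := exists_approx (j := 3) hπ one_add_one_eq_two (by norm_num) hy1 (by
        have := (L.tens A).dtw_curv y
        rw [dtw_apply] at this
        rw [eq_neg_of_add_eq_zero_left this]
        exact neg_mem (br_mem_tensFil_right _ _ hy1)) (fun s => by
        rw [Hom.map_curv, hy2]
        exact hx s)
      refine ⟨y - v, ?_, fun s => by rw [map_sub, hv3, sub_zero, hy2]⟩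
      rw [curv_sub, ← neg_sub ((L.tens A).d 1 2 one_add_one_eq_two v)]
      refine sub_mem (neg_mem hv2) (Submodule.smul_mem _ _
        (add_mem (br_mem_tensFil_right _ _ hv1) (br_mem_tensFil_left _ _ hv1)))
  obtain ⟨N, hN⟩ := A.isNilpotent_max
  obtain ⟨y, hy1, hy2⟩ := key N
  exact ⟨y, L.tensFil_eq_zero A hN (Nat.le_succ N) 2 hy1, hy2⟩

end DGLA

/-! ### Pull-back of forms along maps of vertices, and extension from the boundary -/

section Extension

/-- The faces are corrected one at a time. Adding e_r(y_r - δ_r x) repairs face r; on a face i that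
is already right it changes x by E(ρ_{ri}(y_r - δ_r x)), which is zero because y_r and δ_r x both
restrict on the common subface to what y_i restricts to. -/
theorem exists_of_compatible {K ι A B C : Type*} [Field K] [Fintype ι] [AddCommGroup A] [Module K A]
    [AddCommGroup B] [Module K B] [AddCommGroup C] [Module K C] {δ : ι → A →ₗ[K] B}
    {e : ι → B →ₗ[K] A} {ρ : ι → ι → B →ₗ[K] C} (h1 : ∀ r z, δ r (e r z) = z)
    (h2 : ∀ r i, i ≠ r → ∃ E : C →ₗ[K] B, δ i ∘ₗ e r = E ∘ₗ ρ r i)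
    (h3 : ∀ r i, i ≠ r → ∀ x, ρ r i (δ r x) = ρ i r (δ i x)) (y : ι → B)
    (hy : ∀ r i, i ≠ r → ρ r i (y r) = ρ i r (y i)) : ∃ x, ∀ i, δ i x = y i := by
  classical
  have key : ∀ s : Finset ι, ∃ x, ∀ i ∈ s, δ i x = y i := by
    intro s
    induction s using Finset.induction_on with
    | empty => exact ⟨0, by simp⟩
    | insert r s _ ih =>
      obtain ⟨x, hx⟩ := ih
      refine ⟨x + e r (y r - δ r x), fun i hi => ?_⟩
      by_cases hir : i = r
      · rw [hir, map_add, h1]; abel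
      · have his : i ∈ s := (Finset.mem_insert.mp hi).resolve_left hir
        obtain ⟨E, hE⟩ := h2 r i hir
        have h0 : δ i (e r (y r - δ r x)) = E (ρ r i (y r - δ r x)) := LinearMap.congr_fun hE _
        rw [map_add, h0, map_sub, hy r i hir, h3 r i hir, hx i his, sub_self, map_zero, add_zero]
  obtain ⟨x, hx⟩ := key Finset.univ
  exact ⟨x, fun i => hx i (Finset.mem_univ i)⟩

theorem comp_linear_sum {K ι A B C : Type*} [Field K] [AddCommGroup A] [Module K A]
    [AddCommGroup B] [Module K B] [AddCommGroup C] [Module K C] (g : B →ₗ[K] C)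
    (f : ι → A →ₗ[K] B) (s : Finset ι) : g ∘ₗ (∑ i ∈ s, f i) = ∑ i ∈ s, g ∘ₗ f i :=
  map_sum (LinearMap.llcomp K A B C g) f s

theorem linear_sum_comp {K ι A B C : Type*} [Field K] [AddCommGroup A] [Module K A]
    [AddCommGroup B] [Module K B] [AddCommGroup C] [Module K C] (g : A →ₗ[K] B)
    (f : ι → B →ₗ[K] C) (s : Finset ι) : (∑ i ∈ s, f i) ∘ₗ g = ∑ i ∈ s, f i ∘ₗ g :=
  map_sum (LinearMap.lcomp K C g) f s

variable (K : Type u) [Field K]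

theorem sum_bary (n : ℕ) : ∑ i, bary K n i = 1 := by
  rw [Fin.sum_univ_succ]; simp [bary]

theorem sum_dbary (n : ℕ) : ∑ i, dbary K n i = 0 := by
  rw [Fin.sum_univ_succ]; simp [dbary]

/-- Pull-back of functions along an affine map given by a map of vertices. -/
def pullPoly {m n : ℕ} (f : Fin (m + 1) → Fin (n + 1)) :
    MvPolynomial (Fin n) K →ₐ[K] MvPolynomial (Fin m) K :=
  MvPolynomial.aeval fun i => ∑ j with f j = i.succ, bary K m j

/-- Pull-back of constant one-forms along an affine map given by a map of vertices. -/
def pullLin {m n : ℕ} (f : Fin (m + 1) → Fin (n + 1)) : (Fin n → K) →ₗ[K] (Fin m → K) :=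
  Fintype.linearCombination K fun i => ∑ j with f j = i.succ, dbary K m j

theorem sum_fiber {A : Type*} [AddCommGroup A] {m n : ℕ} (f : Fin (m + 1) → Fin (n + 1))
    (b : Fin (m + 1) → A) :
    ∑ j with f j = 0, b j + ∑ i : Fin n, ∑ j with f j = i.succ, b j = ∑ j, b j := by
  rw [← Fin.sum_univ_succ (f := fun i => ∑ j with f j = i, b j)]
  exact Finset.sum_fiberwise _ _ _

theorem pullPoly_bary {m n : ℕ} (f : Fin (m + 1) → Fin (n + 1)) (i : Fin (n + 1)) :
    pullPoly K f (bary K n i) = ∑ j with f j = i, bary K m j := by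
  induction i using Fin.cases with
  | zero =>
    rw [bary, Fin.cons_zero, map_sub, map_one, map_sum]
    simp only [pullPoly, MvPolynomial.aeval_X]
    rw [← sum_bary K m, ← sum_fiber f, add_sub_cancel_right]
  | succ i => rw [bary, Fin.cons_succ, pullPoly, MvPolynomial.aeval_X]

theorem pullLin_dbary {m n : ℕ} (f : Fin (m + 1) → Fin (n + 1)) (i : Fin (n + 1)) :
    pullLin K f (dbary K n i) = ∑ j with f j = i, dbary K m j := by
  have hs : ∀ i : Fin n, pullLin K f (Pi.single i 1) = ∑ j with f j = i.succ, dbary K m j := by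
    intro i
    rw [pullLin, Fintype.linearCombination_apply_single, one_smul]
  induction i using Fin.cases with
  | zero =>
    rw [dbary, Fin.cons_zero, map_neg, map_sum]
    simp only [hs]
    rw [eq_comm, eq_neg_iff_add_eq_zero, sum_fiber f (dbary K m), sum_dbary]
  | succ i => rw [dbary, Fin.cons_succ, hs]

theorem sum_filter_fiber {A : Type*} [AddCommGroup A] {l m n : ℕ} (f : Fin (m + 1) → Fin (n + 1))
    (g : Fin (l + 1) → Fin (m + 1)) (b : Fin (l + 1) → A) (i : Fin (n + 1)) :
    ∑ j with f j = i, ∑ k with g k = j, b k = ∑ k with f (g k) = i, b k := by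
  have h : ∀ j : Fin (m + 1), (if f j = i then ∑ k, if g k = j then b k else 0 else 0) =
      ∑ k, if g k = j then (if f j = i then b k else 0) else 0 := by
    intro j
    split_ifs <;> simp
  simp only [Finset.sum_filter]
  rw [Finset.sum_congr rfl fun j _ => h j, Finset.sum_comm]
  refine Finset.sum_congr rfl fun k _ => ?_
  rw [Finset.sum_eq_single (g k)]
  · simp
  · intro j _ hj
    simp [hj.symm]
  · simp

theorem pullPoly_X {m n : ℕ} (f : Fin (m + 1) → Fin (n + 1)) (i : Fin n) :
    pullPoly K f (MvPolynomial.X i) = ∑ j with f j = i.succ, bary K m j :=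
  MvPolynomial.aeval_X _ _

theorem pullPoly_comp {l m n : ℕ} (f : Fin (m + 1) → Fin (n + 1)) (g : Fin (l + 1) → Fin (m + 1)) :
    (pullPoly K g).comp (pullPoly K f) = pullPoly K (f ∘ g) := by
  ext1 i
  rw [AlgHom.comp_apply, pullPoly_X, map_sum, pullPoly_X]
  simp only [pullPoly_bary]
  exact sum_filter_fiber f g (bary K l) i.succ

theorem pullLin_comp {l m n : ℕ} (f : Fin (m + 1) → Fin (n + 1)) (g : Fin (l + 1) → Fin (m + 1)) :
    pullLin K g ∘ₗ pullLin K f = pullLin K (f ∘ g) := by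
  refine LinearMap.pi_ext' fun i => LinearMap.ext_ring ?_
  have hs : ∀ {m n : ℕ} (f : Fin (m + 1) → Fin (n + 1)) (i : Fin n),
      pullLin K f (Pi.single i 1) = ∑ j with f j = i.succ, dbary K m j := by
    intro m n f i
    rw [pullLin, Fintype.linearCombination_apply_single, one_smul]
  simp only [LinearMap.comp_apply, LinearMap.coe_single, hs, map_sum, pullLin_dbary]
  exact sum_filter_fiber f g (dbary K l) i.succ

/-- Pull-back of forms along an affine map given by a map of vertices. -/
def pull {m n : ℕ} (f : Fin (m + 1) → Fin (n + 1)) (p : ℕ) : OmegaX K n p →ₗ[K] OmegaX K m p :=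
  TensorProduct.map (pullPoly K f).toLinearMap (exteriorPower.map p (pullLin K f))

theorem pull_comp {l m n : ℕ} (f : Fin (m + 1) → Fin (n + 1)) (g : Fin (l + 1) → Fin (m + 1))
    (p : ℕ) : pull K g p ∘ₗ pull K f p = pull K (f ∘ g) p := by
  rw [pull, pull, ← TensorProduct.map_comp, ← exteriorPower.map_comp, pullLin_comp, pull,
    ← pullPoly_comp]
  rfl

theorem pull_id (n p : ℕ) : pull K (id : Fin (n + 1) → Fin (n + 1)) p = LinearMap.id := by
  have h1 : pullPoly K (id : Fin (n + 1) → Fin (n + 1)) = AlgHom.id K _ := by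
    ext1 i
    simp [pullPoly, Finset.filter_eq', bary]
  have h2 : pullLin K (id : Fin (n + 1) → Fin (n + 1)) = LinearMap.id := by
    refine LinearMap.pi_ext' fun i => LinearMap.ext_ring ?_
    simp only [LinearMap.comp_apply, LinearMap.coe_single]
    rw [pullLin, Fintype.linearCombination_apply_single, one_smul]
    simp [Finset.filter_eq', dbary]
  rw [pull, h1, h2, exteriorPower.map_id]
  exact TensorProduct.map_id

theorem insertNth_eq_sum {A : Type*} [AddCommGroup A] {n : ℕ} (k : Fin (n + 2))
    (b : Fin (n + 1) → A) (i : Fin (n + 2)) :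
    (k.insertNth 0 b : Fin (n + 2) → A) i = ∑ j with k.succAbove j = i, b j := by
  induction i using Fin.succAboveCases k with
  | x => simp
  | p i => simp [Finset.filter_eq']

theorem facePoly_eq (n : ℕ) (k : Fin (n + 2)) : facePoly K n k = pullPoly K k.succAbove := by
  ext1 i
  rw [facePoly, pullPoly, MvPolynomial.aeval_X, MvPolynomial.aeval_X, insertNth_eq_sum]

/-- Face maps are pull-backs along inclusions of vertices, so their identities reduce to identities
between maps of finite sets. -/
theorem omegaFace_eq (n : ℕ) (k : Fin (n + 2)) (p : ℕ) :
    (omegaFace K n k).f p = pull K k.succAbove p := by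
  have h2 : faceLin K n k = pullLin K k.succAbove := by
    rw [faceLin, pullLin]
    congr 1
    funext i
    exact insertNth_eq_sum k (dbary K n) i.succ
  change TensorProduct.map _ _ = _
  rw [facePoly_eq, h2]
  rfl

/-- Multiplication of forms by a function. -/
def mulPoly {n : ℕ} (f : MvPolynomial (Fin n) K) (p : ℕ) : OmegaX K n p →ₗ[K] OmegaX K n p :=
  (LinearMap.mulLeft K f).rTensor _

theorem pull_mulPoly {m n : ℕ} (f : Fin (m + 1) → Fin (n + 1)) (a : MvPolynomial (Fin n) K)
    (p : ℕ) : pull K f p ∘ₗ mulPoly K a p = mulPoly K (pullPoly K f a) p ∘ₗ pull K f p := by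
  refine TensorProduct.ext' fun x y => ?_
  simp [pull, mulPoly]

/-- Extension of a form from the `r`-th face. -/
def faceExt (n : ℕ) (r : Fin (n + 2)) (p : ℕ) : OmegaX K n p →ₗ[K] OmegaX K (n + 1) p :=
  ∑ c, mulPoly K (bary K (n + 1) (r.succAbove c)) p ∘ₗ
    pull K (r.insertNth c id : Fin (n + 2) → Fin (n + 1)) p

/-- Each map of vertices that collapses r to a vertex c of the face is a retraction onto the face,
and the weights restrict to the barycentric coordinates there, whose sum is 1. -/
theorem pull_faceExt (n : ℕ) (r : Fin (n + 2)) (p : ℕ) :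
    pull K r.succAbove p ∘ₗ faceExt K n r p = LinearMap.id := by
  have h1 : ∀ c : Fin (n + 1), (r.insertNth c id : Fin (n + 2) → Fin (n + 1)) ∘ r.succAbove = id :=
    fun c => funext fun j => by simp
  have h2 : ∀ c : Fin (n + 1), pullPoly K r.succAbove (bary K (n + 1) (r.succAbove c)) =
      bary K n c := fun c => by rw [pullPoly_bary]; simp [Finset.filter_eq']
  simp only [faceExt, comp_linear_sum, ← LinearMap.comp_assoc, pull_mulPoly]
  simp only [LinearMap.comp_assoc, pull_comp, h1, h2, pull_id, LinearMap.comp_id]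
  refine TensorProduct.ext' fun x y => ?_
  simp only [LinearMap.sum_apply, mulPoly, LinearMap.rTensor_tmul, LinearMap.mulLeft_apply,
    ← TensorProduct.sum_tmul, ← Finset.sum_mul, sum_bary, one_mul, LinearMap.id_apply]

theorem pull_faceExt_term (n : ℕ) (r i : Fin (n + 2)) (c : Fin (n + 1)) (p : ℕ) :
    pull K i.succAbove p ∘ₗ (mulPoly K (bary K (n + 1) (r.succAbove c)) p ∘ₗ
      pull K (r.insertNth c id : Fin (n + 2) → Fin (n + 1)) p) =
    mulPoly K (pullPoly K i.succAbove (bary K (n + 1) (r.succAbove c))) p ∘ₗ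
      pull K ((r.insertNth c id : Fin (n + 2) → Fin (n + 1)) ∘ i.succAbove) p := by
  rw [← LinearMap.comp_assoc, pull_mulPoly, LinearMap.comp_assoc, pull_comp]

theorem pull_faceExt_self (n : ℕ) (r : Fin (n + 2)) (c : Fin (n + 1)) (p : ℕ) :
    pull K (r.succAbove c).succAbove p ∘ₗ (mulPoly K (bary K (n + 1) (r.succAbove c)) p ∘ₗ
      pull K (r.insertNth c id : Fin (n + 2) → Fin (n + 1)) p) = 0 := by
  have : pullPoly K (r.succAbove c).succAbove (bary K (n + 1) (r.succAbove c)) = 0 := by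
    rw [pullPoly_bary]
    refine Finset.sum_eq_zero fun j hj => ?_
    exact absurd (Finset.mem_filter.mp hj).2 (Fin.succAbove_ne _ _)
  rw [pull_faceExt_term, this, mulPoly]
  simp [LinearMap.mulLeft_zero_eq_zero]

theorem pull_faceExt_zero (r i : Fin 2) (h : i ≠ r) (p : ℕ) :
    pull K i.succAbove p ∘ₗ faceExt K 0 r p = 0 := by
  obtain ⟨c, rfl⟩ := Fin.exists_succAbove_eq h
  rw [faceExt, comp_linear_sum]
  refine Finset.sum_eq_zero fun c' _ => ?_
  rw [show c' = c from Subsingleton.elim (α := Fin 1) c' c]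
  exact pull_faceExt_self K 0 r c p

/-- On the face opposite to the vertex `r.succAbove c`, the summand that collapses r to c drops out,
because its weight vanishes there. The other collapses map this face into the subface opposite to c,
so their summands depend only on the restriction to that subface. This is the condition needed in
`exists_of_compatible`. -/
theorem pull_faceExt_succ (n : ℕ) (r : Fin (n + 3)) (c : Fin (n + 2)) (p : ℕ) :
    ∃ E : OmegaX K n p →ₗ[K] OmegaX K (n + 1) p,
      pull K (r.succAbove c).succAbove p ∘ₗ faceExt K (n + 1) r p = E ∘ₗ pull K c.succAbove p := by
  have key : ∀ c' : Fin (n + 2), ∃ E : OmegaX K n p →ₗ[K] OmegaX K (n + 1) p,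
      pull K (r.succAbove c).succAbove p ∘ₗ (mulPoly K (bary K (n + 2) (r.succAbove c')) p ∘ₗ
        pull K (r.insertNth c' id : Fin (n + 3) → Fin (n + 2)) p) = E ∘ₗ pull K c.succAbove p := by
    intro c'
    by_cases hc : c' = c
    · subst hc
      exact ⟨0, by rw [pull_faceExt_self, LinearMap.zero_comp]⟩
    · have hne : ∀ v, (r.insertNth c' id : Fin (n + 3) → Fin (n + 2))
          ((r.succAbove c).succAbove v) ≠ c := by
        intro v
        have hv := Fin.succAbove_ne (r.succAbove c) v
        generalize (r.succAbove c).succAbove v = w at hv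
        induction w using Fin.succAboveCases r with
        | x => simpa using hc
        | p w =>
          simp only [Fin.insertNth_apply_succAbove, id]
          rintro rfl
          exact hv rfl
      choose t ht using fun v => Fin.exists_succAbove_eq (hne v)
      have hf : (r.insertNth c' id : Fin (n + 3) → Fin (n + 2)) ∘ (r.succAbove c).succAbove =
          c.succAbove ∘ t := funext fun v => (ht v).symm
      exact ⟨_, by rw [pull_faceExt_term, hf, ← pull_comp, ← LinearMap.comp_assoc]⟩
  choose E hE using key
  refine ⟨∑ c', E c', ?_⟩
  rw [faceExt, comp_linear_sum, linear_sum_comp]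
  exact Finset.sum_congr rfl fun c' _ => hE c'

end Extension

/-! ### Combinatorics of faces of codimension two. -/

section FaceIndex

/-- The index of the face `i` of a simplex within its face `r`. -/
def faceIdx {n : ℕ} (r i : Fin (n + 2)) : Fin (n + 1) :=
  if h : i ≠ r then (Fin.exists_succAbove_eq h).choose else 0

theorem succAbove_faceIdx {n : ℕ} {r i : Fin (n + 2)} (h : i ≠ r) : r.succAbove (faceIdx r i) = i := by
  rw [faceIdx, dif_pos h]
  exact (Fin.exists_succAbove_eq h).choose_spec

theorem faceIdx_eq {n : ℕ} {r i : Fin (n + 2)} {c : Fin (n + 1)} (h : r.succAbove c = i) :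
    faceIdx r i = c :=
  Fin.succAbove_right_injective
    ((succAbove_faceIdx (by rw [← h]; exact Fin.succAbove_ne r c)).trans h.symm)

/-- A pair of distinct faces is brought, up to order, into the form l ≤ k in which the cosimplicial
identities are stated. -/
theorem faceIdx_cases {n : ℕ} {r i : Fin (n + 2)} (h : i ≠ r) :
    ∃ l k : Fin (n + 1), l ≤ k ∧
      (r = k.succ ∧ i = l.castSucc ∧ faceIdx r i = l ∧ faceIdx i r = k ∨
        i = k.succ ∧ r = l.castSucc ∧ faceIdx i r = l ∧ faceIdx r i = k) := by
  have key : ∀ r i : Fin (n + 2), i < r → ∃ l k : Fin (n + 1), l ≤ k ∧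
      (r = k.succ ∧ i = l.castSucc ∧ faceIdx r i = l ∧ faceIdx i r = k) := by
    intro r i hlt
    obtain ⟨k, rfl⟩ := Fin.exists_succ_eq.mpr (Fin.ne_zero_of_lt hlt)
    obtain ⟨l, rfl⟩ := Fin.exists_castSucc_eq.mpr (Fin.ne_last_of_lt hlt)
    have hle : l ≤ k := Fin.castSucc_lt_succ_iff.mp hlt
    exact ⟨l, k, hle, rfl, rfl, faceIdx_eq (Fin.succAbove_of_castSucc_lt _ _ hlt),
      faceIdx_eq (Fin.succAbove_of_le_castSucc _ _ (Fin.castSucc_le_castSucc_iff.mpr hle))⟩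
  rcases lt_or_gt_of_ne h with hlt | hlt
  · obtain ⟨l, k, h1, h2⟩ := key r i hlt
    exact ⟨l, k, h1, Or.inl h2⟩
  · obtain ⟨l, k, h1, h2⟩ := key i r hlt
    exact ⟨l, k, h1, Or.inr h2⟩

theorem succAbove_comp_succAbove {n : ℕ} {l k : Fin (n + 2)} (h : l ≤ k) :
    k.succ.succAbove ∘ l.succAbove = l.castSucc.succAbove ∘ k.succAbove := by
  funext j
  apply Fin.ext
  simp only [Function.comp_apply, Fin.succAbove, Fin.lt_def, Fin.le_def] at *
  split_ifs <;> simp at * <;> omega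

end FaceIndex

/-! ### The radial homotopy on polynomial forms -/

section Contraction

variable {K : Type u} [Field K] {V W : Type u} [AddCommGroup V] [Module K V] [AddCommGroup W]
  [Module K W]

theorem contractLeft_mem (φ : Module.Dual K V) {q : ℕ} {x : ExteriorAlgebra K V}
    (hx : x ∈ ⋀[K]^q V) : ∀ p, q = p + 1 →
      CliffordAlgebra.contractLeft (Q := (0 : QuadraticForm K V)) φ x ∈ ⋀[K]^p V := by
  induction hx using Submodule.pow_induction_on_left' with
  | algebraMap r => exact fun p hp => absurd hp (by omega)
  | add x y i hx hy h1 h2 =>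
    intro p hp
    rw [map_add]
    exact add_mem (h1 p hp) (h2 p hp)
  | mem_mul m hm i x hx h =>
    intro p hp
    obtain ⟨v, rfl⟩ := hm
    obtain rfl : i = p := by omega
    rw [CliffordAlgebra.contractLeft_ι_mul]
    refine sub_mem (Submodule.smul_mem _ _ hx) ?_
    cases i with
    | zero =>
      have : x ∈ (1 : Submodule K (ExteriorAlgebra K V)) := by simpa using hx
      obtain ⟨r, rfl⟩ := Submodule.mem_one.mp this
      rw [CliffordAlgebra.contractLeft_algebraMap, mul_zero]
      exact zero_mem _
    | succ i =>
      exact ((extVec v i (i + 1) rfl) ⟨_, h i rfl⟩).2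

/-- Contraction of an exterior form with a covector. -/
def extContr (φ : Module.Dual K V) (p : ℕ) : ⋀[K]^(p + 1) V →ₗ[K] ⋀[K]^p V :=
  (CliffordAlgebra.contractLeft (Q := (0 : QuadraticForm K V)) φ).restrict
    fun _ hx => contractLeft_mem φ hx p rfl

theorem extContr_coe (φ : Module.Dual K V) (p : ℕ) (x : ⋀[K]^(p + 1) V) :
    (extContr φ p x : ExteriorAlgebra K V) =
      CliffordAlgebra.contractLeft (Q := (0 : QuadraticForm K V)) φ x.1 := rfl

theorem extContr_extVec (φ : Module.Dual K V) (v : V) (p : ℕ) (x : ⋀[K]^(p + 1) V) :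
    extContr φ (p + 1) (extVec v (p + 1) (p + 2) rfl x) =
      φ v • x - extVec v p (p + 1) rfl (extContr φ p x) := by
  apply Subtype.ext
  rw [extContr_coe, extVec_coe]
  exact CliffordAlgebra.contractLeft_ι_mul _ _ _

theorem extContr_extVec_zero (φ : Module.Dual K V) (v : V) (x : ⋀[K]^0 V) :
    extContr φ 0 (extVec v 0 1 rfl x) = φ v • x := by
  apply Subtype.ext
  have : x.1 ∈ (1 : Submodule K (ExteriorAlgebra K V)) := by simpa using x.2
  obtain ⟨r, hr⟩ := Submodule.mem_one.mp this
  rw [extContr_coe, extVec_coe]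
  refine (CliffordAlgebra.contractLeft_ι_mul _ _ _).trans ?_
  rw [← hr, CliffordAlgebra.contractLeft_algebraMap, mul_zero, sub_zero, hr]
  rfl

theorem contractLeft_map (f : V →ₗ[K] W) (φ : Module.Dual K W) (x : ExteriorAlgebra K V) :
    CliffordAlgebra.contractLeft (Q := (0 : QuadraticForm K W)) φ (ExteriorAlgebra.map f x) =
      ExteriorAlgebra.map f
        (CliffordAlgebra.contractLeft (Q := (0 : QuadraticForm K V)) (φ ∘ₗ f) x) := by
  induction x using CliffordAlgebra.left_induction with
  | algebraMap r =>
    rw [CliffordAlgebra.contractLeft_algebraMap, map_zero]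
    refine (congrArg (CliffordAlgebra.contractLeft (Q := (0 : QuadraticForm K W)) φ)
      ((ExteriorAlgebra.map f).commutes r)).trans ?_
    exact CliffordAlgebra.contractLeft_algebraMap _ φ r
  | add x y hx hy => simp only [map_add, hx, hy]
  | ι_mul x v hx =>
    rw [map_mul]
    have h := ExteriorAlgebra.map_apply_ι (R := K) f v
    refine (congrArg (fun t => CliffordAlgebra.contractLeft (Q := (0 : QuadraticForm K W)) φ
      (t * ExteriorAlgebra.map f x)) h).trans ?_
    rw [CliffordAlgebra.contractLeft_ι_mul, CliffordAlgebra.contractLeft_ι_mul, map_sub, map_smul,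
      map_mul, ← hx]
    exact congrArg (fun t => _ - t * _) h.symm

/-- Contracting and wedging back is a derivation in x and the identity on vectors, so the sum counts
the degree. -/
theorem sum_extVec_extContr {n p : ℕ} (x : ⋀[K]^(p + 1) (Fin n → K)) :
    ∑ i, extVec (Pi.single i 1) p (p + 1) rfl (extContr (LinearMap.proj i) p x) =
      ((p + 1 : ℕ) : K) • x := by
  have key : ∀ {q : ℕ} {x : ExteriorAlgebra K (Fin n → K)}, x ∈ ⋀[K]^q (Fin n → K) →
      ∑ i, ExteriorAlgebra.ι K (Pi.single i 1 : Fin n → K) *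
        CliffordAlgebra.contractLeft (Q := (0 : QuadraticForm K (Fin n → K)))
          (LinearMap.proj i) x = (q : K) • x := by
    intro q x hx
    induction hx using Submodule.pow_induction_on_left' with
    | algebraMap r => simp
    | add x y i hx hy h1 h2 => simp only [map_add, mul_add, Finset.sum_add_distrib, h1, h2, smul_add]
    | mem_mul m hm i x hx h =>
      obtain ⟨v, rfl⟩ := hm
      have e : ∀ j : Fin n, ExteriorAlgebra.ι K (Pi.single j 1 : Fin n → K) *
          CliffordAlgebra.contractLeft (Q := (0 : QuadraticForm K (Fin n → K)))
            (LinearMap.proj j) (ExteriorAlgebra.ι K v * x) =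
          ExteriorAlgebra.ι K (Pi.single j (v j)) * x +
            ExteriorAlgebra.ι K v * (ExteriorAlgebra.ι K (Pi.single j 1 : Fin n → K) *
              CliffordAlgebra.contractLeft (Q := (0 : QuadraticForm K (Fin n → K)))
                (LinearMap.proj j) x) := by
        intro j
        have h1 := ExteriorAlgebra.ι_add_mul_swap (R := K) (Pi.single j 1 : Fin n → K) v
        have h2 : (Pi.single j (v j) : Fin n → K) = v j • Pi.single j 1 := by
          rw [← Pi.single_smul', smul_eq_mul, mul_one]
        rw [← mul_assoc (ExteriorAlgebra.ι K v), eq_neg_of_add_eq_zero_right h1, h2, map_smul]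
        refine (congrArg _ (CliffordAlgebra.contractLeft_ι_mul _ _ _)).trans ?_
        rw [mul_sub, mul_smul_comm, smul_mul_assoc, neg_mul, mul_assoc, sub_eq_add_neg]
        rfl
      simp only [e, Finset.sum_add_distrib, ← Finset.mul_sum, ← Finset.sum_mul, ← map_sum, h,
        Finset.univ_sum_single]
      rw [mul_smul_comm, Nat.succ_eq_add_one, Nat.cast_succ, add_smul, one_smul, add_comm]
  apply Subtype.ext
  rw [Submodule.coe_sum]
  exact key x.2

end Contraction

section Radial

variable (K : Type u) [Field K]

/-- Division of the homogeneous component of degree `D` by `D + q`. -/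
def scaleInv (n q : ℕ) : MvPolynomial (Fin n) K →ₗ[K] MvPolynomial (Fin n) K :=
  (MvPolynomial.basisMonomials (Fin n) K).constr K fun m =>
    ((m.degree + q : ℕ) : K)⁻¹ • MvPolynomial.monomial m 1

theorem scaleInv_monomial (n q : ℕ) (m : Fin n →₀ ℕ) (c : K) :
    scaleInv K n q (MvPolynomial.monomial m c) =
      ((m.degree + q : ℕ) : K)⁻¹ • MvPolynomial.monomial m c := by
  have h : MvPolynomial.monomial m c = c • MvPolynomial.basisMonomials (Fin n) K m := by
    simp [MvPolynomial.smul_monomial]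
  rw [h, map_smul, scaleInv, Module.Basis.constr_basis, smul_comm]
  simp

theorem scaleInv_of_isHomogeneous {n q D : ℕ} {f : MvPolynomial (Fin n) K}
    (hf : f.IsHomogeneous D) : scaleInv K n q f = ((D + q : ℕ) : K)⁻¹ • f := by
  conv_lhs => rw [f.as_sum, map_sum]
  conv_rhs => rw [f.as_sum, Finset.smul_sum]
  refine Finset.sum_congr rfl fun m hm => ?_
  rw [scaleInv_monomial]
  have : m.degree = D := hf.degree_eq_sum_deg_support hm ▸ rfl
  rw [this]

theorem poly_induction {n : ℕ} {P : MvPolynomial (Fin n) K → Prop}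
    (add : ∀ f g, P f → P g → P (f + g)) (hom : ∀ D f, f.IsHomogeneous D → P f)
    (f : MvPolynomial (Fin n) K) : P f :=
  f.induction_on' (fun _ c => hom _ _ (MvPolynomial.isHomogeneous_monomial c rfl))
    fun f g => add f g

/-- A derivative lowers the polynomial degree by one, and the shift of q compensates this in the
divisor. -/
theorem scaleInv_pderiv [CharZero K] {n : ℕ} (q : ℕ) (j : Fin n) (f : MvPolynomial (Fin n) K) :
    scaleInv K n (q + 1) (MvPolynomial.pderiv j f) =
      MvPolynomial.pderiv j (scaleInv K n q f) := by
  induction f using poly_induction with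
  | add f g hf hg => simp only [map_add, hf, hg]
  | hom D f hf =>
    rw [scaleInv_of_isHomogeneous K hf, Derivation.map_smul, scaleInv_of_isHomogeneous K hf.pderiv]
    cases D with
    | zero =>
      have : MvPolynomial.pderiv j f = 0 := by
        rw [MvPolynomial.totalDegree_eq_zero_iff_eq_C.mp
          ((MvPolynomial.totalDegree_zero_iff_isHomogeneous (p := f)).mpr hf), MvPolynomial.pderiv_C]
      rw [this, smul_zero, smul_zero]
    | succ D => rw [Nat.add_sub_cancel, add_right_comm]; rfl

theorem scaleInv_euler [CharZero K] {n : ℕ} (q : ℕ) (f : MvPolynomial (Fin n) K) :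
    ∑ i, MvPolynomial.X i * MvPolynomial.pderiv i (scaleInv K n (q + 1) f) +
      ((q + 1 : ℕ) : K) • scaleInv K n (q + 1) f = f := by
  induction f using poly_induction with
  | add f g hf hg =>
    conv_rhs => rw [← hf, ← hg]
    simp only [map_add, mul_add, Finset.sum_add_distrib, smul_add]
    abel
  | hom D f hf =>
    rw [scaleInv_of_isHomogeneous K hf]
    simp only [Derivation.map_smul, mul_smul_comm]
    rw [← Finset.smul_sum, hf.sum_X_mul_pderiv, ← Nat.cast_smul_eq_nsmul K, smul_comm, ← add_smul,
      ← Nat.cast_add, smul_smul, mul_inv_cancel₀, one_smul]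
    exact_mod_cast (by omega : D + (q + 1) ≠ 0)

theorem scaleInv_euler_zero [CharZero K] {n : ℕ} (f : MvPolynomial (Fin n) K) :
    ∑ i, MvPolynomial.X i * scaleInv K n 1 (MvPolynomial.pderiv i f) =
      f - MvPolynomial.C (MvPolynomial.constantCoeff f) := by
  induction f using poly_induction with
  | add f g hf hg => simp only [map_add, mul_add, Finset.sum_add_distrib, hf, hg]; abel
  | hom D f hf =>
    simp only [scaleInv_pderiv K 0]
    rw [scaleInv_of_isHomogeneous K hf]
    simp only [Derivation.map_smul, mul_smul_comm]
    rw [← Finset.smul_sum, hf.sum_X_mul_pderiv, ← Nat.cast_smul_eq_nsmul K, smul_smul, add_zero]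
    cases D with
    | zero =>
      have := MvPolynomial.totalDegree_eq_zero_iff_eq_C.mp
          ((MvPolynomial.totalDegree_zero_iff_isHomogeneous (p := f)).mpr hf)
      rw [Nat.cast_zero, mul_zero, zero_smul, eq_comm, sub_eq_zero]
      exact this
    | succ D =>
      have : MvPolynomial.constantCoeff f = 0 := hf.coeff_eq_zero (by simp)
      rw [this, inv_mul_cancel₀ (by exact_mod_cast D.succ_ne_zero), one_smul, map_zero, sub_zero]

theorem scaleInv_aeval {m n : ℕ} (q : ℕ) (φ : Fin n → MvPolynomial (Fin m) K)
    (hφ : ∀ i, (φ i).IsHomogeneous 1) (f : MvPolynomial (Fin n) K) :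
    scaleInv K m q (MvPolynomial.aeval φ f) = MvPolynomial.aeval φ (scaleInv K n q f) := by
  induction f using poly_induction with
  | add f g hf hg => simp only [map_add, hf, hg]
  | hom D f hf =>
    rw [scaleInv_of_isHomogeneous K hf, map_smul]
    have := scaleInv_of_isHomogeneous K (q := q) (hf.aeval φ hφ)
    rw [one_mul] at this
    exact this

/-- The radial homotopy centred at the zeroth vertex. -/
def radial (n p : ℕ) : OmegaX K n (p + 1) →ₗ[K] OmegaX K n p :=
  ∑ i, TensorProduct.map (LinearMap.mulLeft K (MvPolynomial.X i) ∘ₗ scaleInv K n (p + 1))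
    (extContr (LinearMap.proj i) p)

theorem radial_tmul {n p : ℕ} (f : MvPolynomial (Fin n) K) (a : ⋀[K]^(p + 1) (Fin n → K)) :
    radial K n p (f ⊗ₜ a) = ∑ i, (MvPolynomial.X i * scaleInv K n (p + 1) f) ⊗ₜ[K]
      extContr (LinearMap.proj i) p a := by
  simp [radial, LinearMap.sum_apply]

/-- Cartan's formula for the Euler vector field: its Lie derivative multiplies a form with
homogeneous coefficients of degree D and form degree p + 1 by D + p + 1, the number by which
`scaleInv` has divided. -/
theorem omegaD_radial [CharZero K] (n p : ℕ) (ω : OmegaX K n (p + 1)) :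
    omegaD K n p (p + 1) rfl (radial K n p ω) +
      radial K n (p + 1) (omegaD K n (p + 1) (p + 2) rfl ω) = ω := by
  induction ω using TensorProduct.induction_on with
  | zero => simp
  | add x y hx hy =>
    conv_rhs => rw [← hx, ← hy]
    simp only [map_add]
    abel
  | tmul f a =>
    simp only [omegaD_tmul, radial_tmul, map_sum, scaleInv_pderiv, extContr_extVec]
    set g := scaleInv K n (p + 1) f with hg
    rw [Finset.sum_comm, ← Finset.sum_add_distrib]
    -- The terms with i ≠ j cancel between d after the homotopy and the homotopy after d; the
    -- diagonal gives the Euler identities for forms and for functions.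
    have e : ∀ j : Fin n, (∑ i, MvPolynomial.pderiv j (MvPolynomial.X i * g) ⊗ₜ[K]
          extVec (Pi.single j 1) p (p + 1) rfl (extContr (LinearMap.proj i) p a)) +
        ∑ i, (MvPolynomial.X i * MvPolynomial.pderiv j g) ⊗ₜ[K]
          ((LinearMap.proj i : (Fin n → K) →ₗ[K] K) (Pi.single j 1) • a -
            extVec (Pi.single j 1) p (p + 1) rfl (extContr (LinearMap.proj i) p a)) =
        g ⊗ₜ extVec (Pi.single j 1) p (p + 1) rfl (extContr (LinearMap.proj j) p a) +
          (MvPolynomial.X j * MvPolynomial.pderiv j g) ⊗ₜ a := by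
      intro j
      rw [← Finset.sum_add_distrib, Finset.sum_eq_single j]
      · simp only [Derivation.leibniz, MvPolynomial.pderiv_X_self, LinearMap.proj_apply,
          Pi.single_eq_same, one_smul, smul_eq_mul, mul_one, TensorProduct.add_tmul,
          TensorProduct.tmul_sub]
        abel
      · intro i _ hij
        simp only [Derivation.leibniz, MvPolynomial.pderiv_X_of_ne hij, LinearMap.proj_apply,
          Pi.single_eq_of_ne hij, zero_smul, mul_zero, add_zero, zero_sub, smul_eq_mul,
          TensorProduct.tmul_neg, add_neg_cancel]
      · simp
    rw [Finset.sum_congr rfl fun j _ => e j, Finset.sum_add_distrib, ← TensorProduct.tmul_sum,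
      sum_extVec_extContr, ← TensorProduct.sum_tmul, TensorProduct.tmul_smul,
      TensorProduct.smul_tmul', ← TensorProduct.add_tmul, add_comm (_ • g), hg, scaleInv_euler]

/-- The coefficient of an exterior form of degree zero. -/
def extAug (n : ℕ) : ⋀[K]^0 (Fin n → K) →ₗ[K] K :=
  (ExteriorAlgebra.algebraMapInv (R := K) (M := Fin n → K)).toLinearMap ∘ₗ Submodule.subtype _

theorem coe_eq_extAug {n : ℕ} (a : ⋀[K]^0 (Fin n → K)) :
    (a : ExteriorAlgebra K (Fin n → K)) = algebraMap K _ (extAug K n a) := by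
  have : a.1 ∈ (1 : Submodule K (ExteriorAlgebra K (Fin n → K))) := by simpa using a.2
  obtain ⟨r, hr⟩ := Submodule.mem_one.mp this
  have h := ExteriorAlgebra.algebraMap_leftInverse (R := K) (Fin n → K) r
  change a.1 = algebraMap K _ (ExteriorAlgebra.algebraMapInv a.1)
  rw [← hr, h]

/-- The value of a form of degree zero at the zeroth vertex. -/
def originVal (n : ℕ) : OmegaX K n 0 →ₗ[K] K :=
  LinearMap.mul' K K ∘ₗ TensorProduct.map (MvPolynomial.aeval 0).toLinearMap (extAug K n)

/-- The constant function `1` as a form. -/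
def omegaOne (n : ℕ) : OmegaX K n 0 := (omega K n).one

/-- In form degree zero the divisor is the polynomial degree alone, so the constant term, the value
at the centre, is lost. -/
theorem radial_omegaD [CharZero K] (n : ℕ) (ω : OmegaX K n 0) :
    radial K n 0 (omegaD K n 0 1 rfl ω) = ω - originVal K n ω • omegaOne K n := by
  induction ω using TensorProduct.induction_on with
  | zero => simp
  | add x y hx hy => simp only [map_add, hx, hy, add_smul]; abel
  | tmul f a =>
    simp only [omegaD_tmul, radial_tmul, map_sum, extContr_extVec_zero]
    rw [Finset.sum_comm]
    have e : ∀ i : Fin n, (∑ j, (MvPolynomial.X i * scaleInv K n 1 (MvPolynomial.pderiv j f)) ⊗ₜ[K]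
        ((LinearMap.proj i : (Fin n → K) →ₗ[K] K) (Pi.single j 1) • a)) =
        (MvPolynomial.X i * scaleInv K n 1 (MvPolynomial.pderiv i f)) ⊗ₜ[K] a := by
      intro i
      rw [Finset.sum_eq_single i]
      · simp
      · intro j _ hij
        simp [Pi.single_eq_of_ne hij.symm]
      · simp
    rw [Finset.sum_congr rfl fun i _ => e i, ← TensorProduct.sum_tmul, scaleInv_euler_zero,
      TensorProduct.sub_tmul]
    congr 1
    have h1 : a = extAug K n a • ⟨1, (pow_zero (LinearMap.range
        (ExteriorAlgebra.ι K (M := Fin n → K)))).ge (Submodule.one_le.mp le_rfl)⟩ :=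
      Subtype.ext ((coe_eq_extAug K a).trans (Algebra.algebraMap_eq_smul_one _))
    have h2 : MvPolynomial.C (MvPolynomial.constantCoeff f) =
        MvPolynomial.aeval (0 : Fin n → K) f • (1 : MvPolynomial (Fin n) K) := by
      rw [MvPolynomial.aeval_zero, Algebra.algebraMap_self, RingHom.id_apply,
        MvPolynomial.smul_eq_C_mul, mul_one]
    conv_lhs => rw [h1, h2]
    rw [TensorProduct.tmul_smul, ← TensorProduct.smul_tmul', smul_smul, mul_comm]
    rfl

/-- These are the faces through the zeroth vertex, the centre of the homotopy. Restriction to them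
is a homogeneous linear substitution, so it respects polynomial degrees and the Euler field. On the
face 0 this fails. -/
theorem radial_face (n p : ℕ) (k : Fin (n + 1)) (ω : OmegaX K (n + 1) (p + 1)) :
    (omegaFace K n k.succ).f p (radial K (n + 1) p ω) =
      radial K n p ((omegaFace K n k.succ).f (p + 1) ω) := by
  have hX : ∀ i : Fin (n + 1), (k.succ.insertNth 0 (bary K n) : Fin (n + 2) → _) i.succ =
      ∑ j, faceLin K n k.succ (Pi.single i 1) j • MvPolynomial.X j := by
    intro i
    rw [faceLin, Fintype.linearCombination_apply_single, one_smul]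
    by_cases hik : i = k
    · subst hik
      simp
    · obtain ⟨j, hj⟩ := Fin.exists_succAbove_eq (x := i.succ) (y := k.succ) (by simpa using hik)
      rw [← hj, Fin.insertNth_apply_succAbove, Fin.insertNth_apply_succAbove]
      cases j using Fin.cases with
      | zero => rw [Fin.succ_succAbove_zero] at hj; exact absurd hj (Fin.succ_ne_zero i).symm
      | succ j => simp [bary, dbary, Pi.single_apply]
  have hh : ∀ i : Fin (n + 1),
      ((k.succ.insertNth 0 (bary K n) : Fin (n + 2) → _) i.succ).IsHomogeneous 1 := by
    intro i
    rw [hX]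
    refine MvPolynomial.IsHomogeneous.sum _ _ _ fun j _ => ?_
    rw [MvPolynomial.smul_eq_C_mul]
    exact MvPolynomial.isHomogeneous_C_mul_X _ _
  have hc : ∀ (j : Fin n) (a : ⋀[K]^(p + 1) (Fin (n + 1) → K)),
      extContr (LinearMap.proj j) p (exteriorPower.map (p + 1) (faceLin K n k.succ) a) =
        ∑ i, faceLin K n k.succ (Pi.single i 1) j •
          exteriorPower.map p (faceLin K n k.succ) (extContr (LinearMap.proj i) p a) := by
    intro j a
    apply Subtype.ext
    rw [extContr_coe, extMap_coe, contractLeft_map]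
    have : (LinearMap.proj j : (Fin n → K) →ₗ[K] K) ∘ₗ faceLin K n k.succ =
        ∑ i, faceLin K n k.succ (Pi.single i 1) j •
          (LinearMap.proj i : (Fin (n + 1) → K) →ₗ[K] K) := by
      refine LinearMap.pi_ext' fun l => LinearMap.ext_ring ?_
      simp [Pi.single_apply]
    rw [this, map_sum, LinearMap.sum_apply, map_sum]
    simp only [Submodule.coe_sum, Submodule.coe_smul, extMap_coe, extContr_coe, map_smul,
      LinearMap.smul_apply]
  change OmegaX K (n + 1) (p + 1) at ω
  change TensorProduct.map (facePoly K n k.succ).toLinearMap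
    (exteriorPower.map p (faceLin K n k.succ)) (radial K (n + 1) p ω) =
      radial K n p (TensorProduct.map (facePoly K n k.succ).toLinearMap
        (exteriorPower.map (p + 1) (faceLin K n k.succ)) ω)
  induction ω using TensorProduct.induction_on with
  | zero => simp
  | add x y hx hy => simp only [map_add, hx, hy]
  | tmul f a =>
    simp only [radial_tmul, map_sum, TensorProduct.map_tmul, AlgHom.toLinearMap_apply, map_mul, hc]
    have hs : scaleInv K n (p + 1) (facePoly K n k.succ f) =
        facePoly K n k.succ (scaleInv K (n + 1) (p + 1) f) := scaleInv_aeval K _ _ hh f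
    have hfX : ∀ i, facePoly K n k.succ (MvPolynomial.X i) =
      ∑ j, faceLin K n k.succ (Pi.single i 1) j • MvPolynomial.X j :=
        fun i => (MvPolynomial.aeval_X _ _).trans (hX i)
    simp only [hs, hfX, TensorProduct.tmul_sum, Finset.sum_mul, TensorProduct.sum_tmul,
      TensorProduct.tmul_smul, TensorProduct.smul_tmul', smul_mul_assoc]
    rw [Finset.sum_comm]

end Radial

/-! ### Operators on `Ω ⊗ L` induced by operators on `Ω` -/

namespace CDGA

variable {K : Type u} [Field K]

/-- The map `Ω ⊗ L → Ω' ⊗ L` induced by linear maps `Ωᵖ → Ω'ᵖ`. -/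
def tlin {Ω Ω' : CDGA K} (θ : ∀ p, Ω.X p →ₗ[K] Ω'.X p) (L : DGLA K) (k : ℤ) :
    TensorX Ω L k →ₗ[K] TensorX Ω' L k :=
  DirectSum.toModule K _ (TensorX Ω' L k) fun s =>
    incl Ω' L s.1.1 s.1.2 k s.2 ∘ₗ (θ s.1.1).rTensor (L.X s.1.2)

theorem tlin_incl {Ω Ω' : CDGA K} (θ : ∀ p, Ω.X p →ₗ[K] Ω'.X p) (L : DGLA K) {k : ℤ} (p : ℕ)
    (j : ℤ) (h : (p : ℤ) + j = k) (ω : Ω.X p) (x : L.X j) :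
    tlin θ L k (incl Ω L p j k h (ω ⊗ₜ x)) = incl Ω' L p j k h (θ p ω ⊗ₜ x) := by
  rw [tlin]
  conv_lhs => rw [incl, DirectSum.toModule_lof]
  rfl

theorem tensorX_hom_ext {Ω : CDGA K} {L : DGLA K} {k : ℤ} {M : Type*} [AddCommGroup M] [Module K M]
    {f g : TensorX Ω L k →ₗ[K] M} (h : ∀ (p : ℕ) (j : ℤ) (e : (p : ℤ) + j = k) (ω : Ω.X p)
      (x : L.X j), f (incl Ω L p j k e (ω ⊗ₜ x)) = g (incl Ω L p j k e (ω ⊗ₜ x))) : f = g := by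
  refine LinearMap.ext fun z => ?_
  induction z using tensor_induction with
  | zero => simp
  | add x y hx hy => simp only [map_add, hx, hy]
  | incl p j e ω x => exact h p j e ω x

theorem tlin_comp {Ω Ω' Ω'' : CDGA K} (θ : ∀ p, Ω.X p →ₗ[K] Ω'.X p)
    (η : ∀ p, Ω'.X p →ₗ[K] Ω''.X p) (L : DGLA K) (k : ℤ) :
    tlin η L k ∘ₗ tlin θ L k = tlin (fun p => η p ∘ₗ θ p) L k :=
  tensorX_hom_ext fun p j e ω x => by simp only [LinearMap.comp_apply, tlin_incl]

theorem tlin_id {Ω : CDGA K} (L : DGLA K) (k : ℤ) :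
    tlin (Ω := Ω) (fun _ => LinearMap.id) L k = LinearMap.id :=
  tensorX_hom_ext fun p j e ω x => by rw [tlin_incl]; rfl

theorem tensorMapX_eq_tlin {Ω Ω' : CDGA K} (σ : Hom Ω Ω') (L : DGLA K) (k : ℤ) :
    tensorMapX σ (DGLA.Hom.id L) k = tlin σ.f L k :=
  tensorX_hom_ext fun p j e ω x => by rw [tlin_incl, tensorMapX_incl]; rfl

/-- The map `Ω ⊗ L → Ω' ⊗ L` of degree `-1` induced by linear maps `Ω^(p+1) → Ω'ᵖ`. -/
def tlinDown {Ω Ω' : CDGA K} (θ : ∀ p, Ω.X (p + 1) →ₗ[K] Ω'.X p) (L : DGLA K) (k k' : ℤ)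
    (h : k' + 1 = k) : TensorX Ω L k →ₗ[K] TensorX Ω' L k' :=
  DirectSum.toModule K _ (TensorX Ω' L k') fun s => match s with
    | ⟨(0, _), _⟩ => 0
    | ⟨(p + 1, j), hs⟩ => incl Ω' L p j k' (by push_cast at hs; omega) ∘ₗ (θ p).rTensor (L.X j)

theorem tlinDown_incl_zero {Ω Ω' : CDGA K} (θ : ∀ p, Ω.X (p + 1) →ₗ[K] Ω'.X p) (L : DGLA K)
    {k k' : ℤ} (h : k' + 1 = k) (j : ℤ) (e : ((0 : ℕ) : ℤ) + j = k) (ω : Ω.X 0) (x : L.X j) :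
    tlinDown θ L k k' h (incl Ω L 0 j k e (ω ⊗ₜ x)) = 0 := by
  rw [tlinDown]
  conv_lhs => rw [incl, DirectSum.toModule_lof]
  rfl

theorem tlinDown_incl_succ {Ω Ω' : CDGA K} (θ : ∀ p, Ω.X (p + 1) →ₗ[K] Ω'.X p) (L : DGLA K)
    {k k' : ℤ} (h : k' + 1 = k) (p : ℕ) (j : ℤ) (e : ((p + 1 : ℕ) : ℤ) + j = k)
    (e' : (p : ℤ) + j = k') (ω : Ω.X (p + 1)) (x : L.X j) :
    tlinDown θ L k k' h (incl Ω L (p + 1) j k e (ω ⊗ₜ x)) = incl Ω' L p j k' e' (θ p ω ⊗ₜ x) := by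
  rw [tlinDown]
  conv_lhs => rw [incl, DirectSum.toModule_lof]
  rfl

/-- The map `Ω ⊗ L → L` induced by a linear form on `Ωⁿ`. -/
def valX {Ω : CDGA K} {n : ℕ} (ε : Ω.X n →ₗ[K] K) (L : DGLA K) (j k : ℤ) (h : (n : ℤ) + j = k) :
    TensorX Ω L k →ₗ[K] L.X j :=
  (TensorProduct.lid K (L.X j)).toLinearMap ∘ₗ ε.rTensor (L.X j) ∘ₗ
    DirectSum.component K {s : ℕ × ℤ // (s.1 : ℤ) + s.2 = k} (fun s => Ω.X s.1.1 ⊗[K] L.X s.1.2)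
      ⟨(n, j), h⟩

theorem valX_incl {Ω : CDGA K} {n : ℕ} (ε : Ω.X n →ₗ[K] K) (L : DGLA K) {j k : ℤ}
    (h : (n : ℤ) + j = k) (ω : Ω.X n) (x : L.X j) :
    valX ε L j k h (incl Ω L n j k h (ω ⊗ₜ x)) = ε ω • x := by
  simp only [valX, incl, LinearMap.comp_apply]
  rw [DirectSum.component.lof_self]
  rfl

theorem valX_incl_of_ne {Ω : CDGA K} {n : ℕ} (ε : Ω.X n →ₗ[K] K) (L : DGLA K) {j k : ℤ}
    (h : (n : ℤ) + j = k) {p : ℕ} (hp : p ≠ n) {i : ℤ} (e : (p : ℤ) + i = k) (ω : Ω.X p)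
    (x : L.X i) : valX ε L j k h (incl Ω L p i k e (ω ⊗ₜ x)) = 0 := by
  simp only [valX, incl, LinearMap.comp_apply]
  rw [DirectSum.component.of, dif_neg, map_zero, map_zero]
  intro heq
  exact hp (congrArg (fun s : {s : ℕ × ℤ // (s.1 : ℤ) + s.2 = k} => s.1.1) heq)

theorem valX_tlin {Ω Ω' : CDGA K} (θ : ∀ p, Ω.X p →ₗ[K] Ω'.X p) {n : ℕ} (ε : Ω'.X n →ₗ[K] K)
    (L : DGLA K) {j k : ℤ} (h : (n : ℤ) + j = k) (z : TensorX Ω L k) :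
    valX ε L j k h (tlin θ L k z) = valX (ε ∘ₗ θ n) L j k h z := by
  induction z using tensor_induction with
  | zero => simp
  | add x y hx hy => simp only [map_add, hx, hy]
  | incl p i e ω x =>
    rw [tlin_incl]
    by_cases hp : p = n
    · subst hp
      obtain rfl : i = j := by omega
      rw [valX_incl, valX_incl]
      rfl
    · rw [valX_incl_of_ne _ _ _ hp, valX_incl_of_ne _ _ _ hp]

theorem valX_tlinDown {Ω Ω' : CDGA K} (θ : ∀ p, Ω.X (p + 1) →ₗ[K] Ω'.X p) {n : ℕ}
    (ε : Ω'.X n →ₗ[K] K) (L : DGLA K) {j k k' : ℤ} (hk : k' + 1 = k) (h : (n : ℤ) + j = k')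
    (h' : ((n + 1 : ℕ) : ℤ) + j = k) (z : TensorX Ω L k) :
    valX ε L j k' h (tlinDown θ L k k' hk z) = valX (ε ∘ₗ θ n) L j k h' z := by
  induction z using tensor_induction with
  | zero => simp
  | add x y hx hy => simp only [map_add, hx, hy]
  | incl p i e ω x =>
    cases p with
    | zero => rw [tlinDown_incl_zero, map_zero, valX_incl_of_ne _ _ _ (by omega)]
    | succ p =>
      rw [tlinDown_incl_succ _ _ _ p i e (by push_cast at e; omega)]
      by_cases hp : p = n
      · subst hp
        obtain rfl : i = j := by omega
        rw [valX_incl, valX_incl]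
        rfl
      · rw [valX_incl_of_ne _ _ _ hp, valX_incl_of_ne _ _ _ (by omega)]

theorem tensorMapX_tlinDown {Ω Ω' : CDGA K} (σ : Hom Ω Ω') (θ : ∀ p, Ω.X (p + 1) →ₗ[K] Ω.X p)
    (θ' : ∀ p, Ω'.X (p + 1) →ₗ[K] Ω'.X p)
    (hθ : ∀ p ω, σ.f p (θ p ω) = θ' p (σ.f (p + 1) ω)) (L : DGLA K) {k k' : ℤ} (h : k' + 1 = k)
    (z : TensorX Ω L k) : tensorMapX σ (DGLA.Hom.id L) k' (tlinDown θ L k k' h z) =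
      tlinDown θ' L k k' h (tensorMapX σ (DGLA.Hom.id L) k z) := by
  induction z using tensor_induction with
  | zero => simp
  | add x y hx hy => simp only [map_add, hx, hy]
  | incl p j e ω x =>
    cases p with
    | zero => rw [tlinDown_incl_zero, tensorMapX_incl, tlinDown_incl_zero, map_zero]
    | succ p =>
      rw [tlinDown_incl_succ _ _ _ p j e (by push_cast at e; omega), tensorMapX_incl,
        tensorMapX_incl, tlinDown_incl_succ _ _ _ p j e (by push_cast at e; omega), hθ]

/-- The homotopy formula on Ω carries over to Ω ⊗ L: since θ lowers the form degree by one, the two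
contributions of the differential of L have opposite signs. -/
theorem tensorD_tlinDown {Ω : CDGA K} (θ : ∀ p, Ω.X (p + 1) →ₗ[K] Ω.X p) (ε : Ω.X 0 →ₗ[K] K)
    (h0 : ∀ ω, θ 0 (Ω.d 0 1 rfl ω) = ω - ε ω • Ω.one)
    (h1 : ∀ p ω, Ω.d p (p + 1) rfl (θ p ω) + θ (p + 1) (Ω.d (p + 1) (p + 2) rfl ω) = ω)
    (L : DGLA K) {k k' k'' : ℤ} (h : k' + 1 = k) (h' : k + 1 = k'') (z : TensorX Ω L k) :
    tensorD Ω L k' k h (tlinDown θ L k k' h z) + tlinDown θ L k'' k h' (tensorD Ω L k k'' h' z) =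
      z - incl Ω L 0 k k (by simp) (Ω.one ⊗ₜ valX ε L k k (by simp) z) := by
  induction z using tensor_induction with
  | zero => simp
  | add x y hx hy =>
    simp only [map_add, TensorProduct.tmul_add]
    rw [add_add_add_comm, hx, hy]; abel
  | incl p j e ω x =>
    cases p with
    | zero =>
      obtain rfl : j = k := by simpa using e
      rw [tlinDown_incl_zero, map_zero, zero_add,
        tensorD_incl _ _ h' rfl rfl e (by push_cast; omega) (by push_cast; omega),
        map_add, map_smul, tlinDown_incl_zero, smul_zero, add_zero,
        tlinDown_incl_succ _ _ _ 0 j _ e, valX_incl, h0, TensorProduct.tmul_smul,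
        TensorProduct.sub_tmul, map_sub, TensorProduct.smul_tmul']
    | succ p =>
      rw [tlinDown_incl_succ _ _ _ p j e (by push_cast at e; omega),
        tensorD_incl _ _ h rfl rfl _ e (by push_cast at e; omega),
        tensorD_incl _ _ h' rfl rfl e (by push_cast at e ⊢; omega) (by push_cast at e ⊢; omega),
        map_add, map_smul, tlinDown_incl_succ _ _ _ (p + 1) j _ (by push_cast at e ⊢; omega),
        tlinDown_incl_succ _ _ _ p (j + 1) _ (by push_cast at e ⊢; omega),
        valX_incl_of_ne _ _ _ (by omega), TensorProduct.tmul_zero, map_zero, sub_zero]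
      conv_rhs => rw [← h1 p ω, TensorProduct.add_tmul, map_add]
      have hn : ∀ t : TensorX Ω L k, (-1 : K) ^ (p + 1) • t = -((-1 : K) ^ p • t) := fun t => by
        rw [pow_succ, mul_neg_one]; exact neg_smul ((-1 : K) ^ p) t
      rw [hn]
      abel

theorem valX_tensorMapX {Ω : CDGA K} {n : ℕ} (ε : Ω.X n →ₗ[K] K) {L L' : DGLA K}
    (φ : DGLA.Hom L L') {j k : ℤ} (h : (n : ℤ) + j = k) (z : TensorX Ω L k) :
    valX ε L' j k h (tensorMapX (Hom.id Ω) φ k z) = φ.f j (valX ε L j k h z) := by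
  induction z using tensor_induction with
  | zero => simp
  | add x y hx hy => simp only [map_add, hx, hy]
  | incl p i e ω x =>
    rw [tensorMapX_incl]
    by_cases hp : p = n
    · subst hp
      obtain rfl : i = j := by omega
      rw [valX_incl, valX_incl, map_smul]
      rfl
    · rw [valX_incl_of_ne _ _ _ hp, valX_incl_of_ne _ _ _ hp, map_zero]

theorem valX_add {Ω : CDGA K} {n : ℕ} (ε η : Ω.X n →ₗ[K] K) (L : DGLA K) {j k : ℤ}
    (h : (n : ℤ) + j = k) (z : TensorX Ω L k) :
    valX (ε + η) L j k h z = valX ε L j k h z + valX η L j k h z := by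
  induction z using tensor_induction with
  | zero => simp
  | add x y hx hy => simp only [map_add, hx, hy]; abel
  | incl p i e ω x =>
    by_cases hp : p = n
    · subst hp
      obtain rfl : i = j := by omega
      rw [valX_incl, valX_incl, valX_incl, LinearMap.add_apply, add_smul]
    · rw [valX_incl_of_ne _ _ _ hp, valX_incl_of_ne _ _ _ hp, valX_incl_of_ne _ _ _ hp, add_zero]

theorem valX_smul {Ω : CDGA K} {n : ℕ} (c : K) (ε : Ω.X n →ₗ[K] K) (L : DGLA K) {j k : ℤ}
    (h : (n : ℤ) + j = k) (z : TensorX Ω L k) :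
    valX (c • ε) L j k h z = c • valX ε L j k h z := by
  induction z using tensor_induction with
  | zero => simp
  | add x y hx hy => simp only [map_add, hx, hy, smul_add]
  | incl p i e ω x =>
    by_cases hp : p = n
    · subst hp
      obtain rfl : i = j := by omega
      rw [valX_incl, valX_incl, LinearMap.smul_apply, smul_smul, smul_eq_mul]
    · rw [valX_incl_of_ne _ _ _ hp, valX_incl_of_ne _ _ _ hp, smul_zero]

theorem valX_sum {Ω : CDGA K} {n : ℕ} {ι : Type*} (s : Finset ι) (ε : ι → Ω.X n →ₗ[K] K)
    (L : DGLA K) {j k : ℤ} (h : (n : ℤ) + j = k) (z : TensorX Ω L k) :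
    valX (∑ i ∈ s, ε i) L j k h z = ∑ i ∈ s, valX (ε i) L j k h z := by
  classical
  induction s using Finset.induction_on with
  | empty =>
    have := valX_smul 0 (0 : Ω.X n →ₗ[K] K) L h z
    rwa [zero_smul, zero_smul] at this
  | insert a s ha ih => rw [Finset.sum_insert ha, Finset.sum_insert ha, valX_add, ih]

theorem valX_tensorD_succ {Ω : CDGA K} {n : ℕ} (ε : Ω.X (n + 1) →ₗ[K] K) (L : DGLA K)
    {j j' k k' : ℤ} (h : ((n + 1 : ℕ) : ℤ) + j' = k') (hj : j + 1 = j') (hk : k + 1 = k')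
    (h1 : (n : ℤ) + j' = k) (h2 : ((n + 1 : ℕ) : ℤ) + j = k) (z : TensorX Ω L k) :
    valX ε L j' k' h (tensorD Ω L k k' hk z) = valX (ε ∘ₗ Ω.d n (n + 1) rfl) L j' k h1 z +
      (-1 : K) ^ (n + 1) • L.d j j' hj (valX ε L j k h2 z) := by
  induction z using tensor_induction with
  | zero => simp
  | add x y hx hy => simp only [map_add, hx, hy, smul_add]; abel
  | incl p i e ω x =>
    rw [tensorD_incl Ω L hk rfl rfl e (by push_cast; omega) (by omega), map_add, map_smul]
    by_cases hp : p = n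
    · subst hp
      obtain rfl : i = j' := by omega
      rw [valX_incl, valX_incl, valX_incl_of_ne _ _ _ (by omega), valX_incl_of_ne _ _ _ (by omega),
        map_zero, smul_zero, smul_zero]
      rfl
    · rw [valX_incl_of_ne _ _ _ (by omega), valX_incl_of_ne _ _ _ hp]
      by_cases hp' : p = n + 1
      · subst hp'
        obtain rfl : i = j := by omega
        subst hj
        rw [valX_incl, valX_incl, map_smul]
      · rw [valX_incl_of_ne _ _ _ hp', valX_incl_of_ne _ _ _ hp', map_zero, smul_zero, smul_zero]

theorem valX_tensorD_zero {Ω : CDGA K} (ε : Ω.X 0 →ₗ[K] K) (L : DGLA K) {j j' k k' : ℤ}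
    (h : ((0 : ℕ) : ℤ) + j' = k') (hj : j + 1 = j') (hk : k + 1 = k')
    (h2 : ((0 : ℕ) : ℤ) + j = k) (z : TensorX Ω L k) :
    valX ε L j' k' h (tensorD Ω L k k' hk z) = L.d j j' hj (valX ε L j k h2 z) := by
  induction z using tensor_induction with
  | zero => simp
  | add x y hx hy => simp only [map_add, hx, hy]
  | incl p i e ω x =>
    rw [tensorD_incl Ω L hk rfl rfl e (by push_cast; omega) (by omega), map_add, map_smul,
      valX_incl_of_ne _ _ _ (by omega), zero_add]
    by_cases hp : p = 0
    · subst hp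
      obtain rfl : i = j := by omega
      subst hj
      rw [valX_incl, valX_incl, map_smul, pow_zero, one_smul]
    · rw [valX_incl_of_ne _ _ _ hp, valX_incl_of_ne _ _ _ hp, map_zero, smul_zero]

/-- The morphism `Ω ⊗ L → L` induced by a multiplicative linear form on `Ω⁰`. -/
def evHom {Ω : CDGA K} (ε : Ω.X 0 →ₗ[K] K)
    (hε : ∀ a b, ε (Ω.mul 0 0 0 rfl a b) = ε a * ε b) (L : DGLA K) :
    DGLA.Hom (Ω.tensor L) L where
  f k := valX ε L k k (by simp)
  map_d i j h z := valX_tensorD_zero ε L _ h h _ z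
  map_br k l m h z w := by
    revert z w
    suffices H : ∀ (z : TensorX Ω L k) (w : TensorX Ω L l),
        valX ε L m m (by simp) (tensorBr Ω L k l m h z w) =
          L.br k l m h (valX ε L k k (by simp) z) (valX ε L l l (by simp) w) from H
    intro z w
    induction z using tensor_induction with
    | zero => simp
    | add x x' hx hx' => simp only [map_add, LinearMap.add_apply, hx, hx']
    | incl p a hs ω x =>
      induction w using tensor_induction with
      | zero => simp
      | add y y' hy hy' => simp only [map_add, hy, hy']
      | incl q b ht η y =>
        rw [tensorBr_incl Ω L h rfl rfl hs ht (by push_cast; omega), map_smul]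
        by_cases hp : p = 0
        · by_cases hq : q = 0
          · subst hp hq
            obtain rfl : a = k := by simpa using hs
            obtain rfl : b = l := by simpa using ht
            subst h
            rw [valX_incl, valX_incl, valX_incl]
            refine (congrArg (fun c : K => _ • c • _) (hε ω η)).trans ?_
            rw [map_smul, map_smul, LinearMap.smul_apply, smul_smul, smul_smul, _root_.mul_comm (ε ω)]
            simp
          · rw [valX_incl_of_ne _ _ _ (by omega), valX_incl_of_ne _ _ _ hq, map_zero, smul_zero]
        · rw [valX_incl_of_ne _ _ _ (by omega), valX_incl_of_ne _ _ _ hp, map_zero, smul_zero,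
            LinearMap.zero_apply]

theorem d_one (Ω : CDGA K) : Ω.d 0 1 rfl Ω.one = 0 := by
  have h := Ω.leibniz 0 0 0 1 1 1 rfl rfl rfl rfl rfl rfl Ω.one Ω.one
  rw [Ω.mul_comm 1 0 1 rfl rfl, Ω.one_mul 0 rfl, Ω.one_mul 1 rfl] at h
  simpa using h

/-- The morphism `L → Ω ⊗ L`, `x ↦ 1 ⊗ x`. -/
def constHom (Ω : CDGA K) (L : DGLA K) : DGLA.Hom L (Ω.tensor L) where
  f k := incl Ω L 0 k k (by simp) ∘ₗ TensorProduct.mk K (Ω.X 0) (L.X k) Ω.one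
  map_d i j h x := by
    subst h
    change incl Ω L 0 (i + 1) (i + 1) _ (Ω.one ⊗ₜ L.d i (i + 1) rfl x) =
      tensorD Ω L i (i + 1) rfl (incl Ω L 0 i i _ (Ω.one ⊗ₜ x))
    rw [tensorD_incl Ω L rfl rfl rfl _ (by push_cast; omega) (by simp), d_one,
      TensorProduct.zero_tmul, map_zero]
    simp
  map_br i j k h x y := by
    subst h
    change incl Ω L 0 (i + j) (i + j) _ (Ω.one ⊗ₜ L.br i j (i + j) rfl x y) =
      tensorBr Ω L i j (i + j) rfl (incl Ω L 0 i i _ (Ω.one ⊗ₜ x))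
        (incl Ω L 0 j j _ (Ω.one ⊗ₜ y))
    rw [tensorBr_incl Ω L rfl rfl rfl _ _ (by simp), Ω.one_mul]
    simp

theorem constHom_f (Ω : CDGA K) (L : DGLA K) (k : ℤ) (x : L.X k) :
    (constHom Ω L).f k x = incl Ω L 0 k k (by simp) (Ω.one ⊗ₜ x) := rfl

theorem evHom_constHom {Ω : CDGA K} (ε : Ω.X 0 →ₗ[K] K)
    (hε : ∀ a b, ε (Ω.mul 0 0 0 rfl a b) = ε a * ε b) (h1 : ε Ω.one = 1) (L : DGLA K) (k : ℤ)
    (x : L.X k) : (evHom ε hε L).f k ((constHom Ω L).f k x) = x := by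
  have := valX_incl ε L (j := k) (k := k) (by simp) Ω.one x
  rw [h1, one_smul] at this
  exact this

theorem tensorMapX_constHom {Ω Ω' : CDGA K} (σ : Hom Ω Ω') {L L' : DGLA K} (φ : DGLA.Hom L L')
    (k : ℤ) (x : L.X k) :
    tensorMapX σ φ k ((constHom Ω L).f k x) = (constHom Ω' L').f k (φ.f k x) := by
  rw [constHom_f, tensorMapX_incl, σ.map_one]
  rfl

end CDGA

/-! ### Forms on simplices with coefficients in a DGLA -/

/-- The pairs (k + 1, l) and (l, k) with l ≤ k exhaust all indices, carry equal values, and have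
opposite signs. -/
theorem alternating_sum_eq_zero {K M : Type*} [Field K] [AddCommGroup M] [Module K M] {n : ℕ}
    (F : Fin (n + 3) → Fin (n + 2) → M)
    (hF : ∀ l k : Fin (n + 2), l ≤ k → F k.succ l = F l.castSucc k) :
    ∑ k : Fin (n + 3), ∑ l : Fin (n + 2), (-1 : K) ^ (k : ℕ) • (-1 : K) ^ (l : ℕ) • F k l = 0 := by
  rw [← Finset.sum_product']
  let τ : Fin (n + 3) × Fin (n + 2) → Fin (n + 3) × Fin (n + 2) := fun s =>
    if h : s.2.castSucc < s.1 then (s.2.castSucc, s.1.pred (Fin.ne_zero_of_lt h))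
    else (s.2.succ, s.1.castLT (by have := s.2.2; simp [Fin.lt_def] at h; omega))
  have hτ : ∀ l k : Fin (n + 2), l ≤ k → τ (k.succ, l) = (l.castSucc, k) := by
    intro l k h
    have : l.castSucc < k.succ := Fin.castSucc_lt_succ_iff.mpr h
    simp [τ, this]
  have hτ' : ∀ l k : Fin (n + 2), l ≤ k → τ (l.castSucc, k) = (k.succ, l) := by
    intro l k h
    have : ¬ k.castSucc < l.castSucc := by simpa using h
    simp only [τ, dif_neg this]
    exact Prod.ext rfl (Fin.ext rfl)
  have cases : ∀ s : Fin (n + 3) × Fin (n + 2), ∃ l k : Fin (n + 2), l ≤ k ∧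
      (s = (k.succ, l) ∨ s = (l.castSucc, k)) := by
    rintro ⟨a, b⟩
    by_cases h : b.castSucc < a
    · obtain ⟨k, rfl⟩ := Fin.exists_succ_eq.mpr (Fin.ne_zero_of_lt h)
      exact ⟨b, k, Fin.castSucc_lt_succ_iff.mp h, Or.inl rfl⟩
    · have hlt : (a : ℕ) < n + 2 := by have := b.2; simp [Fin.lt_def] at h; omega
      exact ⟨⟨a, hlt⟩, b, by simpa [Fin.lt_def, Fin.le_def] using h, Or.inr rfl⟩
  have sgn : ∀ l k : Fin (n + 2), l ≤ k →
      (-1 : K) ^ (k.succ : ℕ) • (-1 : K) ^ (l : ℕ) • F k.succ l +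
        (-1 : K) ^ (l.castSucc : ℕ) • (-1 : K) ^ (k : ℕ) • F l.castSucc k = 0 := by
    intro l k h
    rw [hF l k h, smul_smul, smul_smul, ← add_smul, Fin.val_succ, Fin.val_castSucc, pow_succ]
    convert zero_smul K _ using 2
    ring
  refine Finset.sum_involution (fun s _ => τ s) ?_ ?_ (by simp) ?_
  · intro s _
    obtain ⟨l, k, h, rfl | rfl⟩ := cases s
    · rw [hτ l k h]; exact sgn l k h
    · rw [hτ' l k h, add_comm]; exact sgn l k h
  · intro s _ _
    obtain ⟨l, k, h, rfl | rfl⟩ := cases s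
    · rw [hτ l k h]
      intro he
      have h1 : (l : ℕ) = k + 1 :=
        congrArg (fun s : Fin (n + 3) × Fin (n + 2) => (s.1 : ℕ)) he
      have h2 : (l : ℕ) ≤ k := h
      omega
    · rw [hτ' l k h]
      intro he
      have h1 : (k : ℕ) + 1 = l :=
        congrArg (fun s : Fin (n + 3) × Fin (n + 2) => (s.1 : ℕ)) he
      have h2 : (l : ℕ) ≤ k := h
      omega
  · intro s _
    obtain ⟨l, k, h, rfl | rfl⟩ := cases s
    · rw [hτ l k h, hτ' l k h]
    · rw [hτ' l k h, hτ l k h]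

section Vertices

variable (K : Type u) [Field K]

theorem extAug_map {m n : ℕ} (f : (Fin n → K) →ₗ[K] (Fin m → K)) (a : ⋀[K]^0 (Fin n → K)) :
    extAug K m (exteriorPower.map 0 f a) = extAug K n a := by
  change ExteriorAlgebra.algebraMapInv (exteriorPower.map 0 f a).1 = _
  rw [extMap_coe, coe_eq_extAug, AlgHom.commutes]
  exact ExteriorAlgebra.algebraMap_leftInverse _ _

/-- The value of a form of degree zero at the `i`-th vertex. -/
def vtxForm (n : ℕ) (i : Fin (n + 1)) : OmegaX K n 0 →ₗ[K] K :=
  originVal K 0 ∘ₗ pull K (fun _ : Fin 1 => i) 0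

theorem vtxForm_pull {m n : ℕ} (f : Fin (m + 1) → Fin (n + 1)) (i : Fin (m + 1)) :
    vtxForm K m i ∘ₗ pull K f 0 = vtxForm K n (f i) := by
  rw [vtxForm, LinearMap.comp_assoc, pull_comp]
  rfl

/-- The zeroth vertex is the origin of the coordinates t_1, …, t_n, hence the centre of the radial
homotopy. -/
theorem vtxForm_zero (n : ℕ) : vtxForm K n 0 = originVal K n := by
  refine TensorProduct.ext' fun f a => ?_
  have h : (MvPolynomial.aeval (0 : Fin 0 → K)).comp (pullPoly K (fun _ : Fin 1 => (0 : Fin (n + 1)))) =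
      MvPolynomial.aeval (0 : Fin n → K) := by
    ext i
    rw [AlgHom.comp_apply, pullPoly_X, Finset.sum_eq_zero, map_zero, MvPolynomial.aeval_X]
    · rfl
    · intro j hj
      exact absurd (Finset.mem_filter.mp hj).2 (Fin.succ_ne_zero i).symm
  change MvPolynomial.aeval (0 : Fin 0 → K) (pullPoly K _ f) * extAug K 0 (exteriorPower.map 0 _ a) =
    MvPolynomial.aeval (0 : Fin n → K) f * extAug K n a
  rw [extAug_map, ← h]
  rfl

theorem vtxForm_tmul (n : ℕ) (i : Fin (n + 1)) (f : MvPolynomial (Fin n) K)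
    (a : ⋀[K]^0 (Fin n → K)) : vtxForm K n i (f ⊗ₜ a) =
      MvPolynomial.aeval (0 : Fin 0 → K) (pullPoly K (fun _ : Fin 1 => i) f) * extAug K n a := by
  change MvPolynomial.aeval (0 : Fin 0 → K) (pullPoly K _ f) * extAug K 0 (exteriorPower.map 0 _ a) = _
  rw [extAug_map]

theorem vtxForm_mul (n : ℕ) (i : Fin (n + 1)) (x y : (omega K n).X 0) :
    vtxForm K n i ((omega K n).mul 0 0 0 rfl x y) = vtxForm K n i x * vtxForm K n i y := by
  revert x y
  suffices H : ∀ x y : OmegaX K n 0, vtxForm K n i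
      (TensorProduct.map₂ (LinearMap.mul K _) (extMul 0 0 0 rfl) x y) =
        vtxForm K n i x * vtxForm K n i y from H
  intro x y
  induction x using TensorProduct.induction_on with
  | zero => simp
  | add x x' hx hx' => simp only [map_add, LinearMap.add_apply, hx, hx', add_mul]
  | tmul f a =>
    induction y using TensorProduct.induction_on with
    | zero => simp
    | add y y' hy hy' => simp only [map_add, hy, hy', mul_add]
    | tmul g b =>
      have h : extAug K n (extMul 0 0 0 rfl a b) = extAug K n a * extAug K n b :=
        map_mul (ExteriorAlgebra.algebraMapInv (R := K) (M := Fin n → K)) a.1 b.1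
      rw [DGLA.map₂_tmul_tmul, vtxForm_tmul, vtxForm_tmul, vtxForm_tmul, h, LinearMap.mul_apply',
        map_mul, map_mul]
      ring

theorem vtxForm_one (n : ℕ) (i : Fin (n + 1)) : vtxForm K n i (omega K n).one = 1 := by
  change vtxForm K n i (1 ⊗ₜ _) = 1
  rw [vtxForm_tmul, map_one, map_one, one_mul]
  exact map_one (ExteriorAlgebra.algebraMapInv (R := K) (M := Fin n → K))

variable {K}

/-- Evaluation `Ωₙ ⊗ L → L` at the `i`-th vertex. -/
def vtxHom (n : ℕ) (i : Fin (n + 1)) (L : DGLA K) : DGLA.Hom ((omega K n).tensor L) L :=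
  CDGA.evHom (vtxForm K n i) (vtxForm_mul K n i) L

/-- Restriction `Ωₙ₊₁ ⊗ L → Ωₙ ⊗ L` to the `k`-th face. -/
def faceHom (n : ℕ) (k : Fin (n + 2)) (L : DGLA K) :
    DGLA.Hom ((omega K (n + 1)).tensor L) ((omega K n).tensor L) :=
  CDGA.tensorMap (omegaFace K n k) (DGLA.Hom.id L)

/-- The morphism `Ωₙ ⊗ L → Ωₙ ⊗ M` induced by `L → M`. -/
def coefHom (n : ℕ) {L M : DGLA K} (φ : DGLA.Hom L M) :
    DGLA.Hom ((omega K n).tensor L) ((omega K n).tensor M) :=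
  CDGA.tensorMap (CDGA.Hom.id _) φ

theorem faceHom_eq (n : ℕ) (k : Fin (n + 2)) (L : DGLA K) (j : ℤ) :
    (faceHom n k L).f j = CDGA.tlin (Ω := omega K (n + 1)) (Ω' := omega K n)
      (pull K k.succAbove) L j := by
  refine (CDGA.tensorMapX_eq_tlin _ _ _).trans ?_
  congr 1
  funext p
  exact omegaFace_eq K n k p

theorem tlin_pull_comp {l m n : ℕ} (f : Fin (m + 1) → Fin (n + 1)) (g : Fin (l + 1) → Fin (m + 1))
    (L : DGLA K) (j : ℤ) :
    CDGA.tlin (Ω := omega K m) (Ω' := omega K l) (pull K g) L j ∘ₗ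
      CDGA.tlin (Ω := omega K n) (Ω' := omega K m) (pull K f) L j =
        CDGA.tlin (Ω := omega K n) (Ω' := omega K l) (pull K (f ∘ g)) L j :=
  (CDGA.tlin_comp _ _ L j).trans (congrArg (fun θ => CDGA.tlin (Ω := omega K n) (Ω' := omega K l)
    θ L j) (funext fun p => pull_comp K f g p))

theorem faceHom_faceHom {n : ℕ} {l k : Fin (n + 2)} (h : l ≤ k) (L : DGLA K) (j : ℤ)
    (z : ((omega K (n + 2)).tensor L).X j) :
    (faceHom n l L).f j ((faceHom (n + 1) k.succ L).f j z) =
      (faceHom n k L).f j ((faceHom (n + 1) l.castSucc L).f j z) := by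
  rw [faceHom_eq, faceHom_eq, faceHom_eq, faceHom_eq]
  refine (LinearMap.congr_fun (tlin_pull_comp k.succ.succAbove l.succAbove L j) z).trans ?_
  rw [succAbove_comp_succAbove h]
  exact (LinearMap.congr_fun (tlin_pull_comp l.castSucc.succAbove k.succAbove L j) z).symm

theorem vtxHom_faceHom (n : ℕ) (k : Fin (n + 2)) (i : Fin (n + 1)) (L : DGLA K) (j : ℤ)
    (z : ((omega K (n + 1)).tensor L).X j) :
    (vtxHom n i L).f j ((faceHom n k L).f j z) = (vtxHom (n + 1) (k.succAbove i) L).f j z := by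
  rw [faceHom_eq]
  refine (CDGA.valX_tlin _ _ _ _ _).trans ?_
  exact congrArg (fun ε => CDGA.valX (Ω := omega K (n + 1)) ε L j j (by simp) z)
    (vtxForm_pull K k.succAbove i)

theorem vtxHom_coefHom (n : ℕ) (i : Fin (n + 1)) {L M : DGLA K} (φ : DGLA.Hom L M) (j : ℤ)
    (z : ((omega K n).tensor L).X j) :
    (vtxHom n i M).f j ((coefHom n φ).f j z) = φ.f j ((vtxHom n i L).f j z) :=
  CDGA.valX_tensorMapX _ _ _ _

theorem vtxHom_constHom (n : ℕ) (i : Fin (n + 1)) (L : DGLA K) (j : ℤ) (x : L.X j) :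
    (vtxHom n i L).f j ((CDGA.constHom (omega K n) L).f j x) = x :=
  CDGA.evHom_constHom _ _ (vtxForm_one K n i) _ _ _

theorem faceHom_constHom (n : ℕ) (k : Fin (n + 2)) (L : DGLA K) (j : ℤ) (x : L.X j) :
    (faceHom n k L).f j ((CDGA.constHom (omega K (n + 1)) L).f j x) =
      (CDGA.constHom (omega K n) L).f j x :=
  CDGA.tensorMapX_constHom _ _ _ _

theorem coefHom_constHom (n : ℕ) {L M : DGLA K} (φ : DGLA.Hom L M) (j : ℤ) (x : L.X j) :
    (coefHom n φ).f j ((CDGA.constHom (omega K n) L).f j x) =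
      (CDGA.constHom (omega K n) M).f j (φ.f j x) :=
  CDGA.tensorMapX_constHom _ _ _ _

theorem faceHom_coefHom (n : ℕ) (k : Fin (n + 2)) {L M : DGLA K} (φ : DGLA.Hom L M) (j : ℤ)
    (z : ((omega K (n + 1)).tensor L).X j) :
    (faceHom n k M).f j ((coefHom (n + 1) φ).f j z) =
      (coefHom n φ).f j ((faceHom n k L).f j z) :=
  CDGA.tensorMapX_comm (omegaFace K n k) φ j z

theorem coefHom_coefHom (n : ℕ) {L M N : DGLA K} (φ : DGLA.Hom L M) (ψ : DGLA.Hom M N) (j : ℤ)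
    (z : ((omega K n).tensor L).X j) :
    (coefHom n ψ).f j ((coefHom n φ).f j z) = (coefHom n (φ.comp ψ)).f j z :=
  CDGA.tensorMapX_comp φ ψ j z

/-! #### Extension from the boundary -/

/-- Forms given on all faces that agree on subfaces of codimension two extend:
`exists_of_compatible` applies with the extension operators `faceExt`. -/
theorem exists_extension {n : ℕ} (L : DGLA K) (j : ℤ)
    (y : Fin (n + 3) → ((omega K (n + 1)).tensor L).X j)
    (hy : ∀ l k : Fin (n + 2), l ≤ k →
      (faceHom n l L).f j (y k.succ) = (faceHom n k L).f j (y l.castSucc)) :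
    ∃ x : ((omega K (n + 2)).tensor L).X j, ∀ k, (faceHom (n + 1) k L).f j x = y k := by
  refine exists_of_compatible (K := K) (C := ((omega K n).tensor L).X j)
    (δ := fun k => (faceHom (n + 1) k L).f j)
    (e := fun r => CDGA.tlin (Ω := omega K (n + 1)) (Ω' := omega K (n + 2))
      (faceExt K (n + 1) r) L j)
    (ρ := fun r i => (faceHom n (faceIdx r i) L).f j) ?_ ?_ ?_ y ?_
  · intro r z
    rw [faceHom_eq]
    refine (LinearMap.congr_fun (CDGA.tlin_comp _ _ L j) z).trans ?_
    have : (fun p => pull K r.succAbove p ∘ₗ faceExt K (n + 1) r p) = fun p => LinearMap.id :=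
      funext fun p => pull_faceExt K _ _ _
    refine (LinearMap.congr_fun (congrArg (fun θ => CDGA.tlin (Ω := omega K (n + 1))
      (Ω' := omega K (n + 1)) θ L j) this) z).trans ?_
    exact LinearMap.congr_fun (CDGA.tlin_id L j) z
  · intro r i hi
    have hE := fun p => pull_faceExt_succ K n r (faceIdx r i) p
    rw [succAbove_faceIdx hi] at hE
    choose E hE using hE
    refine ⟨CDGA.tlin (Ω := omega K n) (Ω' := omega K (n + 1)) E L j, ?_⟩
    rw [faceHom_eq, faceHom_eq]
    refine (CDGA.tlin_comp _ _ L j).trans (Eq.trans ?_ (CDGA.tlin_comp _ _ L j).symm)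
    congr 1
    exact funext hE
  · intro r i hi x
    obtain ⟨l, k, hlk, ⟨rfl, rfl, h1, h2⟩ | ⟨rfl, rfl, h1, h2⟩⟩ := faceIdx_cases hi
    · rw [h1, h2]; exact faceHom_faceHom hlk L j x
    · rw [h1, h2]; exact (faceHom_faceHom hlk L j x).symm
  · intro r i hi
    obtain ⟨l, k, hlk, ⟨rfl, rfl, h1, h2⟩ | ⟨rfl, rfl, h1, h2⟩⟩ := faceIdx_cases hi
    · rw [h1, h2]; exact hy l k hlk
    · rw [h1, h2]; exact (hy l k hlk).symm

/-- The two ends of an interval have no common face, so the space of common restrictions is trivial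
and no compatibility is required. -/
theorem exists_extension_interval (L : DGLA K) (j : ℤ)
    (y : Fin 2 → ((omega K 0).tensor L).X j) :
    ∃ x : ((omega K 1).tensor L).X j, ∀ k, (faceHom 0 k L).f j x = y k := by
  refine exists_of_compatible (K := K) (C := PUnit) (δ := fun k => (faceHom 0 k L).f j)
    (e := fun r => CDGA.tlin (Ω := omega K 0) (Ω' := omega K 1) (faceExt K 0 r) L j)
    (ρ := fun r i => 0) ?_ ?_ (fun _ _ _ _ => rfl) y (fun _ _ _ => rfl)
  · intro r z
    rw [faceHom_eq]
    refine (LinearMap.congr_fun (CDGA.tlin_comp _ _ L j) z).trans ?_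
    have : (fun p => pull K r.succAbove p ∘ₗ faceExt K 0 r p) = fun p => LinearMap.id :=
      funext fun p => pull_faceExt K _ _ _
    refine (LinearMap.congr_fun (congrArg (fun θ => CDGA.tlin (Ω := omega K 0)
      (Ω' := omega K 0) θ L j) this) z).trans ?_
    exact LinearMap.congr_fun (CDGA.tlin_id L j) z
  · intro r i hi
    refine ⟨0, ?_⟩
    rw [faceHom_eq, LinearMap.zero_comp]
    refine (CDGA.tlin_comp _ _ L j).trans (CDGA.tensorX_hom_ext fun p a e ω x => ?_)
    rw [CDGA.tlin_incl]
    have h := LinearMap.congr_fun (pull_faceExt_zero K r i hi p) ω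
    refine (congrArg (fun t => CDGA.incl (omega K 0) L p a j e (t ⊗ₜ[K] x)) h).trans ?_
    exact (congrArg _ (TensorProduct.zero_tmul _ _)).trans (map_zero _)

end Vertices

/-! ### Poincaré lemma and integration over simplices -/

section Integration

variable {K : Type u} [Field K]

/-- The radial homotopy on `Ωₙ ⊗ L`. -/
def radialT (n : ℕ) (L : DGLA K) (k k' : ℤ) (h : k' + 1 = k) :
    ((omega K n).tensor L).X k →ₗ[K] ((omega K n).tensor L).X k' :=
  CDGA.tlinDown (Ω := omega K n) (Ω' := omega K n) (radial K n) L k k' h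

theorem d_radialT [CharZero K] (n : ℕ) (L : DGLA K) {k k' k'' : ℤ} (h : k' + 1 = k)
    (h' : k + 1 = k'') (z : ((omega K n).tensor L).X k) :
    ((omega K n).tensor L).d k' k h (radialT n L k k' h z) +
      radialT n L k'' k h' (((omega K n).tensor L).d k k'' h' z) =
        z - (CDGA.constHom (omega K n) L).f k ((vtxHom n 0 L).f k z) := by
  exact CDGA.tensorD_tlinDown (Ω := omega K n) (radial K n) (vtxForm K n 0)
    (fun ω => by rw [vtxForm_zero]; exact radial_omegaD K n ω)
    (fun p ω => omegaD_radial K n p ω) L h h' z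

theorem radialT_zero (L : DGLA K) {k k' : ℤ} (h : k' + 1 = k) (z : ((omega K 0).tensor L).X k) :
    radialT 0 L k k' h z = 0 := by
  have : radialT 0 L k k' h = 0 := by
    refine CDGA.tensorX_hom_ext fun p j e ω x => ?_
    cases p with
    | zero => exact CDGA.tlinDown_incl_zero _ _ _ _ _ _ _
    | succ p =>
      refine (CDGA.tlinDown_incl_succ _ _ h p j e (by push_cast at e; omega) ω x).trans ?_
      have : radial K 0 p ω = 0 := by
        rw [radial, Finset.univ_eq_empty, Finset.sum_empty]; rfl
      refine (congrArg (fun t => CDGA.incl (omega K 0) L p j k' _ (t ⊗ₜ[K] x)) this).trans ?_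
      exact (congrArg _ (TensorProduct.zero_tmul _ _)).trans (map_zero _)
  rw [this]; rfl

theorem faceHom_radialT (n : ℕ) (i : Fin (n + 1)) (L : DGLA K) {k k' : ℤ} (h : k' + 1 = k)
    (z : ((omega K (n + 1)).tensor L).X k) :
    (faceHom n i.succ L).f k' (radialT (n + 1) L k k' h z) =
      radialT n L k k' h ((faceHom n i.succ L).f k z) := by
  exact CDGA.tensorMapX_tlinDown (omegaFace K n i.succ) (radial K (n + 1)) (radial K n)
    (fun p ω => radial_face K n p i ω) L h z

/-- On a point the radial homotopy is zero, so the homotopy formula says that every form is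
constant. -/
theorem constHom_vtxHom [CharZero K] (L : DGLA K) (k : ℤ) (z : ((omega K 0).tensor L).X k) :
    (CDGA.constHom (omega K 0) L).f k ((vtxHom 0 0 L).f k z) = z := by
  have h := d_radialT 0 L (k' := k - 1) (by ring) rfl z
  rw [radialT_zero, radialT_zero, map_zero, add_zero] at h
  exact (sub_eq_zero.mp h.symm).symm

theorem vtxHom_injective [CharZero K] (L : DGLA K) (k : ℤ) :
    Function.Injective ((vtxHom 0 0 L).f k) := fun z w h => by
  rw [← constHom_vtxHom L k z, h, constHom_vtxHom]

/-- The radial homotopy gives a primitive of z up to the constant value of z at vertex 0.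
Subtracting from it its own value at vertex i makes it vanish there, and at the same time removes
that constant. -/
theorem kerAcyclic_vtxHom [CharZero K] (n : ℕ) (i : Fin (n + 1)) (L : DGLA K) (k k' k'' : ℤ)
    (h : k' + 1 = k) (h' : k + 1 = k'') (z : ((omega K n).tensor L).X k)
    (hz : ((omega K n).tensor L).d k k'' h' z = 0) (hv : (vtxHom n i L).f k z = 0) :
    ∃ u : ((omega K n).tensor L).X k', ((omega K n).tensor L).d k' k h u = z ∧
      (vtxHom n i L).f k' u = 0 := by
  have key := d_radialT n L h h' z
  rw [hz, map_zero, add_zero] at key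
  have e := congrArg ((vtxHom n i L).f k) key
  rw [(vtxHom n i L).map_d, map_sub, hv, zero_sub, vtxHom_constHom] at e
  refine ⟨radialT n L k k' h z - (CDGA.constHom _ L).f k' ((vtxHom n i L).f k' (radialT n L k k' h z)),
    ?_, ?_⟩
  · rw [map_sub, key, ← (CDGA.constHom _ L).map_d, e, map_neg]
    abel
  · rw [map_sub, vtxHom_constHom, sub_self]

variable (K) in
/-- Integration of top forms over the simplex. -/
def integ : ∀ n : ℕ, OmegaX K n n →ₗ[K] K
  | 0 => vtxForm K 0 0
  | n + 1 => ∑ k : Fin (n + 2), (-1 : K) ^ (k : ℕ) •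
      (integ n ∘ₗ (omegaFace K n k).f n ∘ₗ radial K (n + 1) n : OmegaX K (n + 1) (n + 1) →ₗ[K] K)

theorem integ_succ (n : ℕ) (ω : OmegaX K (n + 1) (n + 1)) : integ K (n + 1) ω =
    ∑ k : Fin (n + 2), (-1 : K) ^ (k : ℕ) •
      integ K n ((omegaFace K n k).f n (radial K (n + 1) n ω)) := by
  rw [integ, LinearMap.sum_apply]
  rfl

theorem omegaFace_omegaFace {n : ℕ} {l k : Fin (n + 2)} (h : l ≤ k) (p : ℕ)
    (ω : (omega K (n + 2)).X p) :
    (omegaFace K n l).f p ((omegaFace K (n + 1) k.succ).f p ω) =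
      (omegaFace K n k).f p ((omegaFace K (n + 1) l.castSucc).f p ω) := by
  rw [omegaFace_eq, omegaFace_eq, omegaFace_eq, omegaFace_eq]
  refine (LinearMap.congr_fun (pull_comp K k.succ.succAbove l.succAbove p) ω).trans ?_
  rw [succAbove_comp_succAbove h]
  exact (LinearMap.congr_fun (pull_comp K l.castSucc.succAbove k.succAbove p) ω).symm

/-- Stokes' formula. The integral is defined as the boundary integral of the radial primitive; the
radial primitive of dω differs from ω by an exact form, whose boundary integral is by induction an
alternating sum over faces of codimension two, hence zero. For n = 0 the two differ by a constant,
which cancels between the end points. -/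
theorem integ_omegaD [CharZero K] : ∀ (n : ℕ) (ω : OmegaX K (n + 1) n),
    integ K (n + 1) (omegaD K (n + 1) n (n + 1) rfl ω) =
      ∑ k : Fin (n + 2), (-1 : K) ^ (k : ℕ) • integ K n ((omegaFace K n k).f n ω)
  | 0, ω => by
    rw [integ_succ, radial_omegaD, Fin.sum_univ_two, Fin.sum_univ_two]
    have h1 : ∀ k : Fin 2, integ K 0 ((omegaFace K 0 k).f 0
        (ω - originVal K 1 ω • omegaOne K 1)) =
          integ K 0 ((omegaFace K 0 k).f 0 ω) - originVal K 1 ω := by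
      intro k
      refine (congrArg _ (map_sub ((omegaFace K 0 k).f 0) _ _)).trans ?_
      refine (map_sub (integ K 0) _ _).trans ?_
      congr 1
      refine (congrArg _ (map_smul ((omegaFace K 0 k).f 0) _ _)).trans ?_
      refine (map_smul (integ K 0) _ _).trans ?_
      have h2 : integ K 0 ((omegaFace K 0 k).f 0 (omegaOne K 1)) = 1 :=
        (congrArg (integ K 0) (omegaFace K 0 k).map_one).trans (vtxForm_one K 0 0)
      rw [h2, smul_eq_mul, mul_one]
    rw [h1, h1]
    simp only [Fin.val_zero, Fin.val_one, pow_zero, pow_one, one_smul, neg_smul]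
    abel
  | n + 1, ω => by
    rw [integ_succ]
    have h1 : radial K (n + 2) (n + 1) (omegaD K (n + 2) (n + 1) (n + 2) rfl ω) =
        ω - omegaD K (n + 2) n (n + 1) rfl (radial K (n + 2) n ω) :=
      eq_sub_of_add_eq' (omegaD_radial K (n + 2) n ω)
    have h2 : ∀ k : Fin (n + 3), integ K (n + 1) ((omegaFace K (n + 1) k).f (n + 1)
        (radial K (n + 2) (n + 1) (omegaD K (n + 2) (n + 1) (n + 2) rfl ω))) =
        integ K (n + 1) ((omegaFace K (n + 1) k).f (n + 1) ω) -
          ∑ l : Fin (n + 2), (-1 : K) ^ (l : ℕ) • integ K n ((omegaFace K n l).f n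
            ((omegaFace K (n + 1) k).f n (radial K (n + 2) n ω))) := by
      intro k
      rw [h1]
      refine (congrArg _ (map_sub ((omegaFace K (n + 1) k).f (n + 1)) _ _)).trans ?_
      refine (map_sub (integ K (n + 1)) _ _).trans ?_
      congr 1
      exact (congrArg _ ((omegaFace K (n + 1) k).map_d n (n + 1) rfl _)).trans
        (integ_omegaD n ((omegaFace K (n + 1) k).f n (radial K (n + 2) n ω)))
    simp only [h2, smul_sub, Finset.sum_sub_distrib, Finset.smul_sum]
    rw [alternating_sum_eq_zero, sub_zero]
    intro l k hlk
    exact congrArg (integ K n) (omegaFace_omegaFace hlk n (radial K (n + 2) n ω))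

/-- Integration `Ωₙ ⊗ L → L`. -/
def integT (n : ℕ) (L : DGLA K) (j k : ℤ) (h : (n : ℤ) + j = k) :
    ((omega K n).tensor L).X k →ₗ[K] L.X j :=
  CDGA.valX (Ω := omega K n) (integ K n) L j k h

theorem integT_coefHom (n : ℕ) {L M : DGLA K} (φ : DGLA.Hom L M) {j k : ℤ} (h : (n : ℤ) + j = k)
    (z : ((omega K n).tensor L).X k) :
    integT n M j k h ((coefHom n φ).f k z) = φ.f j (integT n L j k h z) :=
  CDGA.valX_tensorMapX _ _ _ _

theorem integT_faceHom (n : ℕ) (i : Fin (n + 2)) (L : DGLA K) {j k : ℤ} (h : (n : ℤ) + j = k)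
    (z : ((omega K (n + 1)).tensor L).X k) :
    integT n L j k h ((faceHom n i L).f k z) =
      CDGA.valX (Ω := omega K (n + 1)) (integ K n ∘ₗ (omegaFace K n i).f n) L j k h z :=
  (congrArg _ (LinearMap.congr_fun (CDGA.tensorMapX_eq_tlin (omegaFace K n i) L k) z)).trans
    (CDGA.valX_tlin _ _ _ _ _)

theorem integT_d [CharZero K] (n : ℕ) (L : DGLA K) {j j' k k' : ℤ} (hk : k + 1 = k')
    (hj : j + 1 = j') (h : ((n + 1 : ℕ) : ℤ) + j' = k') (h1 : (n : ℤ) + j' = k)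
    (h2 : ((n + 1 : ℕ) : ℤ) + j = k) (z : ((omega K (n + 1)).tensor L).X k) :
    integT (n + 1) L j' k' h (((omega K (n + 1)).tensor L).d k k' hk z) =
      ∑ i : Fin (n + 2), (-1 : K) ^ (i : ℕ) • integT n L j' k h1 ((faceHom n i L).f k z) +
        (-1 : K) ^ (n + 1) • L.d j j' hj (integT (n + 1) L j k h2 z) := by
  refine (CDGA.valX_tensorD_succ _ L h hj hk h1 h2 z).trans ?_
  congr 1
  have : integ K (n + 1) ∘ₗ (omega K (n + 1)).d n (n + 1) rfl =
      ∑ i : Fin (n + 2), (-1 : K) ^ (i : ℕ) •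
        (integ K n ∘ₗ (omegaFace K n i).f n : (omega K (n + 1)).X n →ₗ[K] K) := by
    refine LinearMap.ext fun ω => (integ_omegaD n ω).trans ?_
    rw [LinearMap.sum_apply]
    rfl
  refine (congrArg (fun ε => CDGA.valX (Ω := omega K (n + 1)) ε L j' k h1 z) this).trans ?_
  refine (CDGA.valX_sum _ _ _ _ _).trans (Finset.sum_congr rfl fun i _ => ?_)
  rw [integT_faceHom]
  exact CDGA.valX_smul _ _ _ _ _

theorem integT_d_zero (L : DGLA K) {j j' k k' : ℤ} (hk : k + 1 = k')
    (hj : j + 1 = j') (h : ((0 : ℕ) : ℤ) + j' = k')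
    (h2 : ((0 : ℕ) : ℤ) + j = k) (z : ((omega K 0).tensor L).X k) :
    integT 0 L j' k' h (((omega K 0).tensor L).d k k' hk z) = L.d j j' hj (integT 0 L j k h2 z) :=
  CDGA.valX_tensorD_zero _ _ h hj hk h2 z

theorem integT_succ (n : ℕ) (L : DGLA K) {j k k' : ℤ} (h : ((n + 1 : ℕ) : ℤ) + j = k)
    (hk : k' + 1 = k) (h' : (n : ℤ) + j = k') (z : ((omega K (n + 1)).tensor L).X k) :
    integT (n + 1) L j k h z = ∑ i : Fin (n + 2), (-1 : K) ^ (i : ℕ) •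
      integT n L j k' h' ((faceHom n i L).f k' (radialT (n + 1) L k k' hk z)) := by
  have h1 : ∀ i : Fin (n + 2), integT n L j k' h'
      ((faceHom n i L).f k' (radialT (n + 1) L k k' hk z)) = CDGA.valX (Ω := omega K (n + 1))
        ((integ K n ∘ₗ (omegaFace K n i).f n) ∘ₗ radial K (n + 1) n) L j k h z := fun i =>
    (integT_faceHom n i L h' _).trans (CDGA.valX_tlinDown (Ω := omega K (n + 1))
      (Ω' := omega K (n + 1)) (radial K (n + 1)) _ L hk h' h z)
  simp only [h1]
  have h2 : integ K (n + 1) = ∑ i : Fin (n + 2), (-1 : K) ^ (i : ℕ) •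
      ((integ K n ∘ₗ (omegaFace K n i).f n) ∘ₗ radial K (n + 1) n :
        (omega K (n + 1)).X (n + 1) →ₗ[K] K) := rfl
  refine (congrArg (fun ε => CDGA.valX (Ω := omega K (n + 1)) ε L j k h z) h2).trans ?_
  refine (CDGA.valX_sum _ _ _ _ _).trans (Finset.sum_congr rfl fun i _ => ?_)
  exact CDGA.valX_smul _ _ _ _ _

/-- The vanishing of all restrictions to faces. -/
def IsRel : ∀ (n : ℕ) {L : DGLA K} {j : ℤ}, ((omega K n).tensor L).X j → Prop
  | 0, _, _, _ => True
  | n + 1, L, j, z => ∀ k : Fin (n + 2), (faceHom n k L).f j z = 0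

-- A volume form of face 0, extended by zero to the other faces, has a differential with the
-- required properties; its integral is computed by Stokes' formula. The condition on faces is
-- stated for n = m + 1, as a point has none.
variable (K) in
theorem exists_volume [CharZero K] : ∀ n : ℕ, ∃ ω : OmegaX K n n, integ K n ω = 1 ∧
    omegaD K n n (n + 1) rfl ω = 0 ∧
      ∀ (m : ℕ) (hm : n = m + 1) (k : Fin (m + 2)), pull K k.succAbove n (hm ▸ ω) = 0
  | 0 => ⟨omegaOne K 0, vtxForm_one K 0 0, CDGA.d_one (omega K 0), fun m hm => by omega⟩
  | n + 1 => by
    obtain ⟨ω, h1, h2, h3⟩ := exists_volume n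
    have hW0 : (omegaFace K n 0).f n (faceExt K n 0 n ω) = ω := by
      rw [omegaFace_eq]
      exact LinearMap.congr_fun (pull_faceExt K n 0 n) ω
    have hWk : ∀ k : Fin (n + 2), k ≠ 0 → (omegaFace K n k).f n (faceExt K n 0 n ω) = 0 := by
      intro k hk
      rw [omegaFace_eq]
      cases n with
      | zero => exact LinearMap.congr_fun (pull_faceExt_zero K 0 k hk 0) ω
      | succ n =>
        obtain ⟨c, rfl⟩ := Fin.exists_succAbove_eq hk
        obtain ⟨E, hE⟩ := pull_faceExt_succ K n 0 c (n + 1)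
        refine (LinearMap.congr_fun hE ω).trans ?_
        rw [LinearMap.comp_apply]
        exact (congrArg E (h3 n rfl c)).trans (map_zero _)
    refine ⟨omegaD K (n + 1) n (n + 1) rfl (faceExt K n 0 n ω), ?_,
      (omega K (n + 1)).d_d n (n + 1) (n + 2) rfl rfl _, ?_⟩
    · rw [integ_omegaD, Finset.sum_eq_single 0, hW0, h1]
      · simp
      · intro k _ hk
        rw [hWk k hk]
        exact (congrArg _ (map_zero (integ K n))).trans (smul_zero _)
      · simp
    · intro m hm k
      obtain rfl : n = m := by omega
      change pull K k.succAbove (n + 1) (omegaD K (n + 1) n (n + 1) rfl (faceExt K n 0 n ω)) = 0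
      have h4 := (omegaFace K n k).map_d n (n + 1) rfl (faceExt K n 0 n ω)
      rw [omegaFace_eq] at h4
      refine h4.trans ?_
      by_cases hk : k = 0
      · subst hk
        exact (congrArg _ hW0).trans h2
      · exact (congrArg _ (hWk k hk)).trans (map_zero _)

end Integration

theorem CDGA.tensorD_incl_eq_zero {K : Type u} [Field K] (Ω : CDGA K) (L : DGLA K) {k k' : ℤ}
    (h : k + 1 = k') {p p' : ℕ} {j j' : ℤ} (hp : p + 1 = p') (hj : j + 1 = j')
    (hs : (p : ℤ) + j = k) {ω : Ω.X p} {x : L.X j} (hω : Ω.d p p' hp ω = 0)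
    (hx : L.d j j' hj x = 0) : tensorD Ω L k k' h (incl Ω L p j k hs (ω ⊗ₜ x)) = 0 := by
  rw [tensorD_incl Ω L h hp hj hs (by omega) (by omega), hω, hx, TensorProduct.zero_tmul,
    TensorProduct.tmul_zero, map_zero, map_zero, smul_zero, add_zero]

/-! ### Forms vanishing on the boundary of a simplex. -/

section Relative

variable {K : Type u} [Field K]

theorem exists_closed_with_integral [CharZero K] (n : ℕ) (L : DGLA K) {j j' k k' : ℤ} (h : (n : ℤ) + j = k)
    (hj : j + 1 = j') (hk : k + 1 = k') (c : L.X j) (hc : L.d j j' hj c = 0) :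
    ∃ e : ((omega K n).tensor L).X k, ((omega K n).tensor L).d k k' hk e = 0 ∧ IsRel n e ∧
      integT n L j k h e = c := by
  obtain ⟨ω, h1, h2, h3⟩ := exists_volume K n
  refine ⟨CDGA.incl (omega K n) L n j k h (ω ⊗ₜ c), ?_, ?_, ?_⟩
  · exact CDGA.tensorD_incl_eq_zero (omega K n) L hk rfl hj h h2 hc
  · cases n with
    | zero => trivial
    | succ n =>
      intro i
      refine (CDGA.tensorMapX_incl (omegaFace K n i) (DGLA.Hom.id L) (n + 1) j h ω c).trans ?_
      have h4 : (omegaFace K n i).f (n + 1) ω = 0 := by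
        rw [omegaFace_eq]
        exact h3 n rfl i
      rw [h4, TensorProduct.zero_tmul, map_zero]
      rfl
  · exact (CDGA.valX_incl (Ω := omega K n) (integ K n) L h ω c).trans
      ((congrArg (fun r : K => r • c) h1).trans (one_smul _ _))

theorem vtxHom_eq_zero_of_isRel (n : ℕ) (L : DGLA K) {j : ℤ}
    {z : ((omega K (n + 1)).tensor L).X j} (hz : IsRel (n + 1) z) (i : Fin (n + 2)) :
    (vtxHom (n + 1) i L).f j z = 0 := by
  obtain ⟨k, hk⟩ := exists_ne i
  obtain ⟨c, rfl⟩ := Fin.exists_succAbove_eq hk.symm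
  rw [← vtxHom_faceHom, hz k, map_zero]

/-- A form that vanishes on the boundary of face 0 is compatible with zero on the neighbouring
faces. -/
theorem exists_extension_zero : ∀ (n : ℕ) (L : DGLA K) (j : ℤ) (y : ((omega K n).tensor L).X j),
    IsRel n y → ∃ x : ((omega K (n + 1)).tensor L).X j, (faceHom n 0 L).f j x = y ∧
      ∀ i : Fin (n + 1), (faceHom n i.succ L).f j x = 0
  | 0, L, j, y, _ => by
    obtain ⟨x, hx⟩ := exists_extension_interval L j (Fin.cons y fun _ => 0)
    exact ⟨x, hx 0, fun i => hx i.succ⟩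
  | n + 1, L, j, y, hy => by
    obtain ⟨x, hx⟩ := exists_extension L j (Fin.cons y fun _ => 0) fun l k hlk => by
      rw [Fin.cons_succ, map_zero]
      cases l using Fin.cases with
      | zero => rw [Fin.castSucc_zero, Fin.cons_zero, hy k]
      | succ l => rw [← Fin.succ_castSucc, Fin.cons_succ, map_zero]
    exact ⟨x, hx 0, fun i => hx i.succ⟩

/-- A relative cocycle whose integral is exact is the differential of a relative cochain with
prescribed integral. -/
theorem exists_relative_primitive [CharZero K] : ∀ (n : ℕ) (L : DGLA K) {j j' k k' k'' : ℤ} (hk : k' + 1 = k)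
    (hk' : k + 1 = k'') (hj : j' + 1 = j) (h : (n : ℤ) + j = k) (h' : (n : ℤ) + j' = k')
    (z : ((omega K n).tensor L).X k), ((omega K n).tensor L).d k k'' hk' z = 0 → IsRel n z →
    ∀ y : L.X j', integT n L j k h z = (-1 : K) ^ n • L.d j' j hj y →
    ∃ w : ((omega K n).tensor L).X k', ((omega K n).tensor L).d k' k hk w = z ∧ IsRel n w ∧
      integT n L j' k' h' w = y
  | 0, L, j, j', k, k', k'', hk, hk', hj, h, h', z, _, _, y, hy => by
    obtain rfl : j = k := by simpa using h
    obtain rfl : j' = k' := by simpa using h'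
    rw [pow_zero, one_smul] at hy
    refine ⟨(CDGA.constHom _ L).f j' y, ?_, trivial, vtxHom_constHom 0 0 L j' y⟩
    rw [← (CDGA.constHom _ L).map_d, ← hy]
    exact constHom_vtxHom L j z
  | n + 1, L, j, j', k, k', k'', hk, hk', hj, h, h', z, hz, hrel, y, hy => by
    -- The radial primitive vanishes on all faces through vertex 0, since the homotopy commutes with
    -- restriction to them. Only face 0 has to be corrected.
    set u := radialT (n + 1) L k k' hk z with hu
    have hdu : ((omega K (n + 1)).tensor L).d k' k hk u = z := by
      have := d_radialT (n + 1) L hk hk' z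
      rwa [hz, map_zero, add_zero, vtxHom_eq_zero_of_isRel n L hrel, map_zero, sub_zero] at this
    have hus : ∀ i : Fin (n + 1), (faceHom n i.succ L).f k' u = 0 := fun i => by
      rw [hu, faceHom_radialT, hrel, map_zero]
    have hnk : (n : ℤ) + j = k' := by push_cast at h; omega
    -- By the recursive definition, the integral of z is the integral of u over face 0. The change
    -- of sign from (-1)^(n+1) to (-1)^n is absorbed by -y.
    have hint : integT n L j k' hnk ((faceHom n 0 L).f k' u) = (-1 : K) ^ n • L.d j' j hj (-y) := by
      rw [integT_succ n L h hk hnk z, Fin.sum_univ_succ] at hy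
      simp only [← hu, hus, map_zero, smul_zero, Finset.sum_const_zero, add_zero, Fin.val_zero,
        pow_zero, one_smul] at hy
      rw [hy, map_neg, pow_succ, mul_neg_one, neg_smul, smul_neg]
    have hvrel : IsRel n ((faceHom n 0 L).f k' u) := by
      cases n with
      | zero => trivial
      | succ n =>
        intro l
        have := faceHom_faceHom (Fin.zero_le l) L k' u
        rw [hus, map_zero, Fin.castSucc_zero] at this
        exact this.symm
    have hvd : ((omega K n).tensor L).d k' k hk ((faceHom n 0 L).f k' u) = 0 := by
      rw [← (faceHom n 0 L).map_d, hdu, hrel]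
    obtain ⟨w', hw1, hw2, -⟩ := exists_relative_primitive n L (k' := k' - 1) (by ring) hk hj hnk
      (by omega) _ hvd hvrel (-y) hint
    -- On face 0, u is the differential of a relative form w'. With w' extended by zero to W, the
    -- form u - dW is relative and still a primitive of z.
    obtain ⟨W, hW0, hWs⟩ := exists_extension_zero n L (k' - 1) w' hw2
    set w := u - ((omega K (n + 1)).tensor L).d (k' - 1) k' (by ring) W with hw
    have hdw : ((omega K (n + 1)).tensor L).d k' k hk w = z := by
      rw [hw, map_sub, hdu, DGLA.d_d, sub_zero]
    have hwrel : IsRel (n + 1) w := by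
      intro i
      rw [hw, map_sub, (faceHom n i L).map_d]
      cases i using Fin.cases with
      | zero => rw [hW0, hw1, sub_self]
      | succ i => rw [hus, hWs, map_zero, sub_zero]
    -- By Stokes' formula without boundary terms, the integral of w has the same differential as y.
    -- The closed defect is then the integral of a closed relative form, which is added to w.
    have hcl : L.d j' j hj (y - integT (n + 1) L j' k' h' w) = 0 := by
      have := integT_d n L hk hj h hnk h' w
      rw [hdw, hy] at this
      have h0 : ∑ i : Fin (n + 2), (-1 : K) ^ (i : ℕ) • integT n L j k' hnk ((faceHom n i L).f k' w) =
          0 := Finset.sum_eq_zero fun i _ => by rw [hwrel i, map_zero, smul_zero]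
      rw [h0, zero_add] at this
      have hne : (-1 : K) ^ (n + 1) ≠ 0 := pow_ne_zero _ (by simp)
      rw [map_sub, smul_right_injective _ hne this, sub_self]
    obtain ⟨e, he1, he2, he3⟩ := exists_closed_with_integral (n + 1) L h' hj hk _ hcl
    refine ⟨w + e, by rw [map_add, hdw, he1, add_zero], fun i => ?_, ?_⟩
    · rw [map_add, hwrel i, he2 i, add_zero]
    · rw [map_add, he3]; abel

end Relative

/-! ### The comparison of the Thom–Whitney complex with the total complex -/

theorem exists_dependent_seq {X : ℕ → Type*} (Q : ∀ n, X n → Prop) (R : ∀ n, X n → X (n + 1) → Prop)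
    (h0 : ∃ x, Q 0 x) (hs : ∀ n x, Q n x → ∃ y, Q (n + 1) y ∧ R n x y) :
    ∃ f : ∀ n, X n, (∀ n, Q n (f n)) ∧ ∀ n, R n (f n) (f (n + 1)) := by
  choose g hg1 hg2 using hs
  obtain ⟨x0, hx0⟩ := h0
  let F : ∀ n, {x : X n // Q n x} := fun n =>
    Nat.rec ⟨x0, hx0⟩ (fun n x => ⟨g n x.1 x.2, hg1 n x.1 x.2⟩) n
  exact ⟨fun n => (F n).1, fun n => (F n).2, fun n => hg2 n (F n).1 (F n).2⟩

namespace SemicosimplicialDGLA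

variable {K : Type u} [Field K]

theorem restr_eq (g : SemicosimplicialDGLA K) (n : ℕ) (k : Fin (n + 2)) :
    g.restr n k = faceHom n k (g.obj (n + 1)) := rfl

theorem face_face_apply (g : SemicosimplicialDGLA K) {n : ℕ} {l k : Fin (n + 2)} (h : l ≤ k)
    (j : ℤ) (x : (g.obj n).X j) : (g.face (n + 1) k.succ).f j ((g.face n l).f j x) =
      (g.face (n + 1) l.castSucc).f j ((g.face n k).f j x) :=
  congrArg (fun ψ : DGLA.Hom _ _ => ψ.f j x) (g.face_face n l k h)

theorem coface_compatible (g : SemicosimplicialDGLA K) {n : ℕ} {j : ℤ}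
    {x : ((omega K n).tensor (g.obj n)).X j} {y : ((omega K (n + 1)).tensor (g.obj (n + 1))).X j}
    (hxy : ∀ k, (g.restr n k).f j y = (g.coface n k).f j x) (l k : Fin (n + 2)) (h : l ≤ k) :
    (faceHom n l (g.obj (n + 2))).f j ((g.coface (n + 1) k.succ).f j y) =
      (faceHom n k (g.obj (n + 2))).f j ((g.coface (n + 1) l.castSucc).f j y) := by
  have e : ∀ (a : Fin (n + 2)) (b : Fin (n + 3)),
      (faceHom n a (g.obj (n + 2))).f j ((g.coface (n + 1) b).f j y) =
        (coefHom n ((g.face n a).comp (g.face (n + 1) b))).f j x := by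
    intro a b
    refine (faceHom_coefHom n a (g.face (n + 1) b) j y).trans ?_
    rw [← coefHom_coefHom]
    exact congrArg _ (hxy a)
  rw [e, e, g.face_face n l k h]

/-- The forms ∂_k x on the faces agree on their common subfaces because x itself restricts to
cofaces of a form one level below. The hypothesis records just this, and is void in level 0. -/
theorem exists_coface_extension (g : SemicosimplicialDGLA K) {n : ℕ} {j : ℤ}
    (x : ((omega K n).tensor (g.obj n)).X j)
    (hx : ∀ m (_ : n = m + 1), ∃ x' : ((omega K m).tensor (g.obj m)).X j,
      ∀ k, (g.restr m k).f j (‹n = m + 1› ▸ x) = (g.coface m k).f j x') :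
    ∃ y : ((omega K (n + 1)).tensor (g.obj (n + 1))).X j,
      ∀ k, (g.restr n k).f j y = (g.coface n k).f j x := by
  cases n with
  | zero => exact exists_extension_interval _ j fun k => (g.coface 0 k).f j x
  | succ n =>
    obtain ⟨x', hx'⟩ := hx n rfl
    exact exists_extension _ j (fun k => (g.coface (n + 1) k).f j x)
      fun l k h => g.coface_compatible hx' l k h

/-- Integration `Tot_TW → Tot`. -/
def twInt (g : SemicosimplicialDGLA K) (k : ℤ) : g.totTW.X k →ₗ[K] g.Tot k :=
  LinearMap.pi fun s => integT s.1.1 (g.obj s.1.1) s.1.2 k s.2 ∘ₗ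
    LinearMap.proj s.1.1 ∘ₗ Submodule.subtype (g.twX k)

theorem twInt_apply (g : SemicosimplicialDGLA K) (k : ℤ) (x : g.totTW.X k) (n : ℕ) (j : ℤ)
    (h : (n : ℤ) + j = k) : g.twInt k x ⟨(n, j), h⟩ = integT n (g.obj n) j k h (x.1 n) := rfl

theorem totD_zero (g : SemicosimplicialDGLA K) {k k' : ℤ} (h : k + 1 = k') (t : g.Tot k)
    {j j' : ℤ} (hj : j + 1 = j') (e : ((0 : ℕ) : ℤ) + j = k) (e' : ((0 : ℕ) : ℤ) + j' = k') :
    g.totD k k' h t ⟨(0, j'), e'⟩ = (g.obj 0).d j j' hj (t ⟨(0, j), e⟩) := by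
  obtain rfl : j = j' - 1 := by omega
  rfl

theorem totD_succ (g : SemicosimplicialDGLA K) {k k' : ℤ} (h : k + 1 = k') (t : g.Tot k) (n : ℕ)
    {j j' : ℤ} (hj : j + 1 = j') (e : ((n + 1 : ℕ) : ℤ) + j = k) (e' : ((n + 1 : ℕ) : ℤ) + j' = k')
    (e'' : (n : ℤ) + j' = k) : g.totD k k' h t ⟨(n + 1, j'), e'⟩ =
      ∑ i : Fin (n + 2), (-1 : K) ^ (i : ℕ) • g.δ n i j' (t ⟨(n, j'), e''⟩) +
        (-1 : K) ^ (n + 1) • (g.obj (n + 1)).d j j' hj (t ⟨(n + 1, j), e⟩) := by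
  obtain rfl : j = j' - 1 := by omega
  change (∑ i : Fin (n + 2), (-1 : K) ^ (i : ℕ) • g.δ n i j') (t ⟨(n, j'), e''⟩) + _ = _
  rw [LinearMap.sum_apply]
  rfl

variable [CharZero K]

/-- Stokes' formula on each simplex: the matching conditions of Tot_TW turn the boundary terms into
the cofaces of the integrals one level below. -/
theorem twInt_d (g : SemicosimplicialDGLA K) {k k' : ℤ} (h : k + 1 = k') (x : g.totTW.X k) :
    g.twInt k' (g.totTW.d k k' h x) = g.totD k k' h (g.twInt k x) := by
  funext s
  obtain ⟨⟨n, j⟩, hs⟩ := s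
  cases n with
  | zero =>
    rw [totD_zero g h _ (j := j - 1) (by ring) (by simp at hs ⊢; omega)]
    exact integT_d_zero _ h _ _ _ _
  | succ n =>
    rw [totD_succ g h _ n (j := j - 1) (by ring) (by push_cast at hs ⊢; omega) _
      (by push_cast at hs ⊢; omega)]
    refine (integT_d n (g.obj (n + 1)) (j := j - 1) h (by ring) hs (by push_cast at hs ⊢; omega)
      (by push_cast at hs ⊢; omega) (x.1 (n + 1))).trans ?_
    congr 1
    refine Finset.sum_congr rfl fun i _ => ?_
    rw [twInt_apply]
    have := x.2 n i
    rw [restr_eq] at this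
    rw [this]
    exact congrArg _ (integT_coefHom n (g.face n i) _ (x.1 n))

/-- Cochains of the Thom–Whitney complex with prescribed differential and integral. -/
theorem exists_twInt_eq (g : SemicosimplicialDGLA K) {k k' : ℤ} (h : k' + 1 = k)
    (z : g.totTW.X k) (hz : g.totTW.d k (k + 1) rfl z = 0) (t : g.Tot k')
    (ht : g.totD k' k h t = g.twInt k z) (N : ℕ) (hzN : ∀ n < N, z.1 n = 0)
    (htN : ∀ n j e, n < N → t ⟨(n, j), e⟩ = 0) :
    ∃ w : g.totTW.X k', g.totTW.d k' k h w = z ∧ g.twInt k' w = t ∧ ∀ n < N, w.1 n = 0 := by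
  have hzn : ∀ n, ((omega K n).tensor (g.obj n)).d k (k + 1) rfl (z.1 n) = 0 := fun n =>
    congrFun (congrArg Subtype.val hz) n
  -- The last clause says that x matches some element of the previous level. It belongs to the
  -- invariant because it is what makes an extension to the next level possible.
  let Q : ∀ n, ((omega K n).tensor (g.obj n)).X k' → Prop := fun n x =>
    ((omega K n).tensor (g.obj n)).d k' k h x = z.1 n ∧
      (∀ j e, integT n (g.obj n) j k' e x = t ⟨(n, j), e⟩) ∧ (n < N → x = 0) ∧
      ∀ m (_ : n = m + 1), ∃ x' : ((omega K m).tensor (g.obj m)).X k',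
        ∀ k, (g.restr m k).f k' (‹n = m + 1› ▸ x) = (g.coface m k).f k' x'
  have h0 : ∃ x, Q 0 x := by
    by_cases hN : 0 < N
    · exact ⟨0, by rw [map_zero, hzN 0 hN], fun j e => by rw [map_zero, htN 0 j e hN],
        fun _ => rfl, fun m hm => by omega⟩
    · have e1 := congrFun ht ⟨(0, k), by simp⟩
      rw [g.totD_zero h t h (by simp), twInt_apply] at e1
      obtain ⟨w, hw1, -, hw3⟩ := exists_relative_primitive 0 (g.obj 0) h rfl h (by simp) (by simp)
        (z.1 0) (hzn 0) trivial (t ⟨(0, k'), by simp⟩) (by rw [← e1, pow_zero, one_smul])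
      refine ⟨w, hw1, fun j e => ?_, fun hN' => absurd hN' hN, fun m hm => by omega⟩
      obtain rfl : j = k' := by simpa using e
      exact hw3
  have hs : ∀ n x, Q n x → ∃ y, Q (n + 1) y ∧ ∀ i, (g.restr n i).f k' y = (g.coface n i).f k' x := by
    rintro n x ⟨hx1, hx2, hx3, hx4⟩
    by_cases hN : n + 1 < N
    · have hr : ∀ i, (g.restr n i).f k' 0 = (g.coface n i).f k' x := fun i => by
        rw [hx3 (by omega), map_zero, map_zero]
      exact ⟨0, ⟨by rw [map_zero, hzN _ hN], fun j e => by rw [map_zero, htN _ j e hN],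
        fun _ => rfl, fun m hm => by obtain rfl : n = m := by omega
                                     exact ⟨x, hr⟩⟩, hr⟩
    -- Any extension y has the right boundary values. Its differential and its integral are then
    -- corrected by a relative form, which does not affect the boundary.
    · obtain ⟨y, hy⟩ := g.exists_coface_extension x hx4
      have hr : ((n + 1 : ℕ) : ℤ) + (k - (n + 1)) = k := by push_cast; ring
      have hr' : ((n + 1 : ℕ) : ℤ) + (k' - (n + 1)) = k' := by push_cast; ring
      have hrj : k' - (n + 1) + 1 = k - (n + 1) := by omega
      have hr'' : (n : ℤ) + (k - (n + 1)) = k' := by omega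
      have hrel : IsRel (n + 1) (z.1 (n + 1) -
          ((omega K (n + 1)).tensor (g.obj (n + 1))).d k' k h y) := by
        intro i
        have h1 := z.2 n i
        rw [restr_eq] at h1
        have h2 := hy i
        rw [restr_eq] at h2
        rw [map_sub, (faceHom n i _).map_d, h2, h1, ← (g.coface n i).map_d, hx1, sub_self]
      have hcl : ((omega K (n + 1)).tensor (g.obj (n + 1))).d k (k + 1) rfl (z.1 (n + 1) -
          ((omega K (n + 1)).tensor (g.obj (n + 1))).d k' k h y) = 0 := by
        rw [map_sub, hzn, DGLA.d_d, sub_zero]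
      -- This is the component at level n + 1 of the equation Dt = ∫z. Stokes' formula for y
      -- produces its coface terms, which cancel, and the rest is the condition for a relative
      -- primitive with integral t - ∫y.
      have hint : integT (n + 1) (g.obj (n + 1)) (k - (n + 1)) k hr (z.1 (n + 1) -
          ((omega K (n + 1)).tensor (g.obj (n + 1))).d k' k h y) = (-1 : K) ^ (n + 1) •
            (g.obj (n + 1)).d (k' - (n + 1)) (k - (n + 1)) hrj (t ⟨(n + 1, k' - (n + 1)), hr'⟩ -
              integT (n + 1) (g.obj (n + 1)) (k' - (n + 1)) k' hr' y) := by
        have e1 := congrFun ht ⟨(n + 1, k - (n + 1)), hr⟩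
        rw [g.totD_succ h t n hrj hr' hr hr'', twInt_apply] at e1
        have e2 : ∀ i : Fin (n + 2), integT n (g.obj (n + 1)) (k - (n + 1)) k' hr''
            ((faceHom n i (g.obj (n + 1))).f k' y) =
            g.δ n i (k - (n + 1)) (t ⟨(n, k - (n + 1)), hr''⟩) := by
          intro i
          have h2 := hy i
          rw [restr_eq] at h2
          rw [h2, ← hx2 _ hr'']
          exact integT_coefHom n (g.face n i) hr'' x
        rw [map_sub, integT_d n (g.obj (n + 1)) h hrj hr hr'' hr' y, ← e1, map_sub, smul_sub,
          Finset.sum_congr rfl fun i _ => congrArg _ (e2 i)]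
        abel
      obtain ⟨w, hw1, hw2, hw3⟩ := exists_relative_primitive (n + 1) (g.obj (n + 1)) h rfl hrj hr hr'
        _ hcl hrel _ hint
      have hyw : ∀ i, (g.restr n i).f k' (y + w) = (g.coface n i).f k' x := fun i => by
        rw [map_add, hy i, restr_eq, hw2 i, add_zero]
      refine ⟨y + w, ⟨by rw [map_add, hw1]; abel, fun j e => ?_, fun hN' => absurd hN' hN,
        fun m hm => ?_⟩, hyw⟩
      · obtain rfl : j = k' - (n + 1) := by push_cast at e; omega
        rw [map_add, hw3]; abel
      · obtain rfl : n = m := by omega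
        exact ⟨x, hyw⟩
  obtain ⟨f, hf1, hf2⟩ := exists_dependent_seq Q
    (fun n x y => ∀ i, (g.restr n i).f k' y = (g.coface n i).f k' x) h0 hs
  refine ⟨⟨f, hf2⟩, Subtype.ext (funext fun n => (hf1 n).1), ?_, fun n hn => (hf1 n).2.2.1 hn⟩
  funext s
  exact (hf1 s.1.1).2.1 s.1.2 s.2

end SemicosimplicialDGLA

theorem DGLA.exists_d_eq_of_subsingleton {K : Type u} [Field K] {L : DGLA K} {i : ℤ}
    (h : Subsingleton (L.H i)) (x : L.X i) (hx : L.d i (i + 1) rfl x = 0) :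
    ∃ y, L.d (i - 1) i (sub_add_cancel i 1) y = x := by
  have := (Submodule.Quotient.mk_eq_zero _).mp (Subsingleton.elim
    (Submodule.Quotient.mk (⟨x, hx⟩ : LinearMap.ker (L.d i (i + 1) rfl)) : L.H i) 0)
  exact this

/-! ### Acyclicity of the part of Tot_TW above a given level. -/

namespace SemicosimplicialDGLA

variable {K : Type u} [Field K]

theorem sum_face_face (g : SemicosimplicialDGLA K) (n : ℕ) (j : ℤ) (x : (g.obj n).X j) :
    ∑ k : Fin (n + 3), (-1 : K) ^ (k : ℕ) • g.δ (n + 1) k j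
      (∑ l : Fin (n + 2), (-1 : K) ^ (l : ℕ) • g.δ n l j x) = 0 := by
  simp only [map_sum, map_smul, Finset.smul_sum]
  exact alternating_sum_eq_zero (fun k l => g.δ (n + 1) k j (g.δ n l j x))
    fun l k h => g.face_face_apply h j x

theorem totD_totD (g : SemicosimplicialDGLA K) {k k' k'' : ℤ} (h : k + 1 = k') (h' : k' + 1 = k'')
    (t : g.Tot k) : g.totD k' k'' h' (g.totD k k' h t) = 0 := by
  funext s
  obtain ⟨⟨n, j⟩, hs⟩ := s
  match n with
  | 0 =>
    rw [totD_zero g h' _ (j := j - 1) (by ring) (by simp at hs ⊢; omega),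
      totD_zero g h _ (j := j - 1 - 1) (by ring) (by simp at hs ⊢; omega), DGLA.d_d]
    rfl
  | 1 =>
    rw [totD_succ g h' _ 0 (j := j - 1) (by ring) (by simp at hs ⊢; omega) hs
        (by simp at hs ⊢; omega),
      totD_zero g h _ (j := j - 1) (by ring) (by simp at hs ⊢; omega),
      totD_succ g h _ 0 (j := j - 1 - 1) (by ring) (by simp at hs ⊢; omega) (by simp at hs ⊢; omega)
        (by simp at hs ⊢; omega), map_add, map_smul, DGLA.d_d, smul_zero]
    simp only [add_zero, map_sum, map_smul, (g.face 0 _).map_d]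
    refine (congrArg _ ((congrArg (· • _) (pow_one (-1 : K))).trans (neg_one_smul K _))).trans (add_neg_cancel _)
  | n + 2 =>
    rw [totD_succ g h' _ (n + 1) (j := j - 1) (by ring) (by push_cast at hs ⊢; omega) hs
        (by push_cast at hs ⊢; omega),
      totD_succ g h _ n (j := j - 1) (by ring) (by push_cast at hs ⊢; omega)
        (by push_cast at hs ⊢; omega) (by push_cast at hs ⊢; omega),
      totD_succ g h _ (n + 1) (j := j - 1 - 1) (by ring) (by push_cast at hs ⊢; omega)
        (by push_cast at hs ⊢; omega) (by push_cast at hs ⊢; omega), map_add, map_smul, DGLA.d_d,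
      smul_zero]
    simp only [add_zero, map_add, smul_add, Finset.sum_add_distrib]
    rw [sum_face_face]
    simp only [zero_add, map_sum, map_smul, (g.face (n + 1) _).map_d]
    rw [pow_succ _ (n + 1), mul_neg_one, neg_smul, Finset.smul_sum]
    refine (congrArg₂ (· + ·) (Finset.sum_congr rfl fun i _ => smul_comm _ _ _) rfl).trans ?_
    exact add_neg_cancel _

theorem totD_congr (g : SemicosimplicialDGLA K) {k k' : ℤ} (h : k + 1 = k') {t t' : g.Tot k} (N : ℕ)
    (htt : ∀ s, s.1.1 ≤ N → t s = t' s) (s : {s : ℕ × ℤ // (s.1 : ℤ) + s.2 = k'})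
    (hsN : s.1.1 ≤ N) : g.totD k k' h t s = g.totD k k' h t' s := by
  obtain ⟨⟨n, j⟩, hs⟩ := s
  cases n with
  | zero =>
    rw [totD_zero g h _ (j := j - 1) (by ring) (by simp at hs ⊢; omega),
      totD_zero g h _ (j := j - 1) (by ring) (by simp at hs ⊢; omega), htt _ (Nat.zero_le _)]
  | succ n =>
    rw [totD_succ g h _ n (j := j - 1) (by ring) (by push_cast at hs ⊢; omega) hs
        (by push_cast at hs ⊢; omega),
      totD_succ g h _ n (j := j - 1) (by ring) (by push_cast at hs ⊢; omega) hs
        (by push_cast at hs ⊢; omega), htt ⟨(n, j), _⟩ ((Nat.le_succ n).trans hsN), htt _ hsN]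

/-- If a cocycle of Tot vanishes below level n, then its component at level n is closed for the
internal differential. A primitive of that component, with the sign (-1)ⁿ of the total differential,
removes it. -/
theorem exists_tot_step (g : SemicosimplicialDGLA K) {k k' : ℤ} (h : k' + 1 = k) (e : g.Tot k)
    (he : g.totD k (k + 1) rfl e = 0) (n : ℕ) (hn : ∀ s, s.1.1 < n → e s = 0)
    (hex : ∀ j, (n : ℤ) + j = k → ∀ x : (g.obj n).X j, (g.obj n).d j (j + 1) rfl x = 0 →
      ∃ y, (g.obj n).d (j - 1) j (sub_add_cancel j 1) y = x) :
    ∃ t : g.Tot k', (∀ s, s.1.1 ≠ n → t s = 0) ∧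
      ∀ s, s.1.1 = n → g.totD k' k h t s = e s := by
  set j := k - n with hj
  have hjn : (n : ℤ) + j = k := by omega
  have hcl : (g.obj n).d j (j + 1) rfl (e ⟨(n, j), hjn⟩) = 0 := by
    have h1 := congrFun he ⟨(n, j + 1), by push_cast; omega⟩
    cases n with
    | zero => rwa [totD_zero g rfl _ (j := j) rfl hjn] at h1
    | succ n =>
      rw [totD_succ g rfl _ n (j := j) rfl hjn _ (by push_cast at hjn; omega),
        hn ⟨(n, j + 1), _⟩ (Nat.lt_succ_self n)] at h1
      simp only [map_zero, smul_zero, Finset.sum_const_zero, zero_add] at h1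
      exact (smul_eq_zero.mp h1).resolve_left (pow_ne_zero _ (by simp))
  obtain ⟨y, hy⟩ := hex j hjn _ hcl
  have hjn' : (n : ℤ) + (j - 1) = k' := by omega
  refine ⟨Pi.single ⟨(n, j - 1), hjn'⟩ ((-1 : K) ^ n • y), fun s hs => ?_, fun s hs => ?_⟩
  · exact Pi.single_eq_of_ne (fun hss => hs (by rw [hss])) _
  · obtain ⟨⟨n', j'⟩, hs'⟩ := s
    obtain rfl : n' = n := hs
    obtain rfl : j' = j := by simp only at hs'; omega
    cases n' with
    | zero =>
      rw [totD_zero g h _ (j := j - 1) (by ring) hjn', Pi.single_eq_same, pow_zero, one_smul]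
      exact hy
    | succ n =>
      rw [totD_succ g h _ n (j := j - 1) (by ring) hjn' hjn (by push_cast at hjn; omega),
        Pi.single_eq_same, Pi.single_eq_of_ne (fun hss => by simp at hss), map_smul, hy, smul_smul,
        ← mul_pow]
      simp

/-- A cocycle of the total complex that starts in level `N` is exact, when its levels are acyclic
from there on. -/
theorem exists_tot_primitive (g : SemicosimplicialDGLA K) {k k' : ℤ} (h : k' + 1 = k) (c : g.Tot k)
    (hc : g.totD k (k + 1) rfl c = 0) (N : ℕ) (hcN : ∀ s, s.1.1 < N → c s = 0)
    (hex : ∀ n, N ≤ n → Subsingleton ((g.obj n).H (k - n))) :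
    ∃ t : g.Tot k', g.totD k' k h t = c ∧ ∀ s, s.1.1 < N → t s = 0 := by
  let Q : ℕ → g.Tot k' → Prop := fun n t =>
    (∀ s, s.1.1 < n → g.totD k' k h t s = c s) ∧ ∀ s, s.1.1 < N → t s = 0
  obtain ⟨f, hf1, hf2⟩ := exists_dependent_seq Q (fun n t t' => ∀ s, s.1.1 < n → t' s = t s)
    ⟨0, fun s hs => absurd hs (Nat.not_lt_zero _), fun s _ => rfl⟩ (by
      rintro n t ⟨ht1, ht2⟩
      by_cases hn : n < N
      · refine ⟨t, ⟨fun s hs => ?_, ht2⟩, fun s _ => rfl⟩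
        rw [hcN s (by omega), totD_congr g h (t' := 0) s.1.1
          (fun s' hs' => by rw [ht2 s' (by omega)]; rfl) s le_rfl, map_zero]
        rfl
      · obtain ⟨y, hy1, hy2⟩ := g.exists_tot_step h (c - g.totD k' k h t)
          (by rw [map_sub, hc, totD_totD, sub_zero]) n
          (fun s hs => by rw [Pi.sub_apply, ht1 s hs, sub_self]) fun j hj x hx => by
            obtain rfl : j = k - n := by omega
            exact DGLA.exists_d_eq_of_subsingleton (hex n (by omega)) x hx
        have hty : ∀ s, s.1.1 < n → (t + y) s = t s := fun s hs => by
          rw [Pi.add_apply, hy1 s (by omega), add_zero]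
        refine ⟨t + y, ⟨fun s hs => ?_, fun s hs => ?_⟩, hty⟩
        · by_cases hsn : s.1.1 = n
          · rw [map_add, Pi.add_apply, hy2 s hsn, Pi.sub_apply, add_sub_cancel]
          · rw [totD_congr g h s.1.1 (fun s' hs' => hty s' (by omega)) s le_rfl, ht1 s (by omega)]
        · rw [hty s (by omega), ht2 s hs])
  -- Every component is stationary from the stage after its level, so the infinite sum of
  -- corrections makes sense in the product.
  have hf3 : ∀ (s : {s : ℕ × ℤ // (s.1 : ℤ) + s.2 = k'}) (m : ℕ), f (s.1.1 + 1 + m) s = f (s.1.1 + 1) s := by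
    intro s m
    induction m with
    | zero => rfl
    | succ m ih => exact (hf2 (s.1.1 + 1 + m) s (by omega)).trans ih
  refine ⟨fun s => f (s.1.1 + 1) s, funext fun s => ?_, fun s hs => (hf1 _).2 s hs⟩
  rw [← (hf1 (s.1.1 + 1)).1 s (Nat.lt_succ_self _)]
  refine totD_congr g h s.1.1 (fun s' hs' => ?_) s le_rfl
  obtain ⟨m, hm⟩ := Nat.exists_eq_add_of_le hs'
  rw [show s.1.1 + 1 = s'.1.1 + 1 + m by omega, hf3]

/-- The projection of the Thom–Whitney DGLA to its `n`-th component. -/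
def twProj (g : SemicosimplicialDGLA K) (n : ℕ) :
    DGLA.Hom g.totTW ((omega K n).tensor (g.obj n)) where
  f j := LinearMap.proj n ∘ₗ Submodule.subtype (g.twX j)
  map_d _ _ _ _ := rfl
  map_br _ _ _ _ _ _ := rfl

/-- The integral of a cocycle that vanishes below level N is a cocycle of Tot that starts in level
N, so it has a primitive that also starts there; `exists_twInt_eq` lifts this primitive back to
Tot_TW. Here the hypotheses on cohomology enter: N = 2, i = 1 is used for injectivity and N = 3, i =
2 for surjectivity of the comparison. -/
theorem kerAcyclic_twProj [CharZero K] (g : SemicosimplicialDGLA K) (N : ℕ) (i : ℤ)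
    (hex : ∀ n, N ≤ n → Subsingleton ((g.obj n).H (i - n))) :
    DGLA.KerAcyclic (fun n : Fin N => g.twProj n) i := by
  intro z hz hzN
  have hzN' : ∀ n < N, z.1 n = 0 := fun n hn => hzN ⟨n, hn⟩
  obtain ⟨t, ht1, ht2⟩ := g.exists_tot_primitive (sub_add_cancel i 1) (g.twInt i z)
    (by rw [← twInt_d, hz, map_zero]) N
    (fun s hs => by
      rw [show s = ⟨(s.1.1, s.1.2), s.2⟩ from rfl, twInt_apply, hzN' _ hs, map_zero]) hex
  obtain ⟨w, hw1, -, hw3⟩ := g.exists_twInt_eq (sub_add_cancel i 1) z hz t ht1 N hzN'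
    fun n j e hn => ht2 ⟨(n, j), e⟩ hn
  exact ⟨w, hw1, fun s => hw3 s s.2⟩

/-- Extension from the boundary is unobstructed at each level, so a matching family up to level N
can always be continued. -/
theorem exists_tw_extension (g : SemicosimplicialDGLA K) (N : ℕ) (j : ℤ)
    (x : ∀ n, ((omega K n).tensor (g.obj n)).X j)
    (hx : ∀ n < N, ∀ k, (g.restr n k).f j (x (n + 1)) = (g.coface n k).f j (x n)) :
    ∃ w : g.totTW.X j, ∀ n ≤ N, w.1 n = x n := by
  let Q : ∀ n, ((omega K n).tensor (g.obj n)).X j → Prop := fun n y =>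
    (n ≤ N → y = x n) ∧ ∀ m (_ : n = m + 1), ∃ y' : ((omega K m).tensor (g.obj m)).X j,
        ∀ k, (g.restr m k).f j (‹n = m + 1› ▸ y) = (g.coface m k).f j y'
  obtain ⟨f, hf1, hf2⟩ := exists_dependent_seq Q
    (fun n y y' => ∀ k, (g.restr n k).f j y' = (g.coface n k).f j y)
    ⟨x 0, fun _ => rfl, fun m hm => by omega⟩ (by
      rintro n y ⟨hy1, hy2⟩
      by_cases hn : n + 1 ≤ N
      · have hr : ∀ k, (g.restr n k).f j (x (n + 1)) = (g.coface n k).f j y := by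
          rw [hy1 (by omega)]; exact hx n hn
        exact ⟨x (n + 1), ⟨fun _ => rfl, fun m hm => by obtain rfl : n = m := by omega
                                                        exact ⟨y, hr⟩⟩, hr⟩
      · obtain ⟨y', hy'⟩ := g.exists_coface_extension y hy2
        exact ⟨y', ⟨fun h => absurd h hn, fun m hm => by obtain rfl : n = m := by omega
                                                         exact ⟨y, hy'⟩⟩, hy'⟩)
  exact ⟨⟨f, hf2⟩, fun n hn => (hf1 n).1 hn⟩

end SemicosimplicialDGLA

/-! ### Gauge transformations over simplices with coefficients in 𝔪_A. -/

namespace DGLA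

variable {K : Type u} [Field K] {L M N P : DGLA K} {A : Art K}

/-- The morphism `L ⊗ 𝔪_A → M ⊗ 𝔪_A` induced by `L → M`. -/
abbrev Hom.tn (φ : Hom L M) (A : Art K) : Hom (L.tens A) (M.tens A) := tensMap φ (𝟙 A)

theorem tn_comp_apply {φ : Hom L M} {ψ : Hom M N} {χ : Hom L N}
    (h : ∀ j x, ψ.f j (φ.f j x) = χ.f j x) {j : ℤ} (x : (L.tens A).X j) :
    (ψ.tn A).f j ((φ.tn A).f j x) = (χ.tn A).f j x := by
  obtain rfl : φ.comp ψ = χ := Hom.ext (funext fun j => LinearMap.ext fun x => h j x)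
  have := tensMap_comp φ ψ (𝟙 A) (𝟙 A)
  rw [Category.comp_id] at this
  exact congrArg (fun χ : Hom _ _ => χ.f j x) this.symm

theorem tn_comm_apply {φ : Hom L M} {ψ : Hom M N} {φ' : Hom L P} {ψ' : Hom P N}
    (h : ∀ j x, ψ.f j (φ.f j x) = ψ'.f j (φ'.f j x)) {j : ℤ} (x : (L.tens A).X j) :
    (ψ.tn A).f j ((φ.tn A).f j x) = (ψ'.tn A).f j ((φ'.tn A).f j x) :=
  (tn_comp_apply (χ := φ'.comp ψ') h x).trans (tn_comp_apply (fun _ _ => rfl) x).symm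

theorem tn_retract_apply {φ : Hom L M} {ψ : Hom M L} (h : ∀ j x, ψ.f j (φ.f j x) = x) {j : ℤ}
    (x : (L.tens A).X j) : (ψ.tn A).f j ((φ.tn A).f j x) = x := by
  refine (tn_comp_apply (χ := Hom.id L) h x).trans ?_
  exact congrArg (fun χ : Hom _ _ => χ.f j x) (tensMap_id L A)

theorem tn_gauge (φ : Hom L M) (a : (L.tens A).X 0) (x : (L.tens A).X 1) :
    (φ.tn A).f 1 ((L.tens A).gauge a x) = (M.tens A).gauge ((φ.tn A).f 0 a) ((φ.tn A).f 1 x) :=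
  (φ.tn A).map_gauge (L.tens_nilp A) a x

theorem tn_bch (φ : Hom L M) (a b : (L.tens A).X 0) :
    (φ.tn A).f 0 ((L.tens A).bch a b) = (M.tens A).bch ((φ.tn A).f 0 a) ((φ.tn A).f 0 b) :=
  (φ.tn A).map_bch (L.tens_nilp A) a b

theorem Hom.map_dtw (φ : Hom L M) (x : L.X 1) (i j : ℤ) (h : i + 1 = j) (n : L.X i) :
    φ.f j (L.dtw x i j h n) = M.dtw (φ.f 1 x) i j h (φ.f i n) := by
  rw [dtw_apply, dtw_apply, map_add, φ.map_d, φ.map_br]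

theorem contr_tn_eq {φ : Hom L N} {ψ : Hom M N} {j : ℤ} {x : (L.tens A).X j} {y : (M.tens A).X j}
    (h : (φ.tn A).f j x = (ψ.tn A).f j y) (f : Module.Dual K A.max) :
    φ.f j (contr (V := L.X j) f x) = ψ.f j (contr (V := M.X j) f y) :=
  ((contr_rTensor f (φ.f j) x).symm.trans (congrArg (contr f)
    ((tensMap_id_f φ j x).symm.trans (h.trans (tensMap_id_f ψ j y))))).trans
      (contr_rTensor f (ψ.f j) y)

/-- The irrelevant stabilizer of a Maurer–Cartan element, as a subgroup. -/
def irrSubgroup [CharZero K] {M : DGLA K} [hM : M.NilAct] (x : M.X 1) (hx : M.IsMC x) :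
    Subgroup (ExpGroup M hM) where
  carrier := {a | M.IrrStab x a}
  mul_mem' ha hb := IrrStab.bch hx ha hb
  one_mem' := irrStab_zero x
  inv_mem' ha := IrrStab.neg ha

theorem vtx_face (n : ℕ) (k : Fin (n + 2)) (i : Fin (n + 1)) (L : DGLA K) {j : ℤ}
    (x : (((omega K (n + 1)).tensor L).tens A).X j) :
    ((vtxHom n i L).tn A).f j (((faceHom n k L).tn A).f j x) =
      ((vtxHom (n + 1) (k.succAbove i) L).tn A).f j x :=
  tn_comp_apply (fun j x => vtxHom_faceHom n k i L j x) x

theorem vtx_const (n : ℕ) (i : Fin (n + 1)) {j : ℤ} (x : (L.tens A).X j) :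
    ((vtxHom n i L).tn A).f j (((CDGA.constHom (omega K n) L).tn A).f j x) = x :=
  tn_retract_apply (fun j x => vtxHom_constHom n i L j x) x

theorem const_vtx [CharZero K] {j : ℤ} (z : (((omega K 0).tensor L).tens A).X j) :
    ((CDGA.constHom (omega K 0) L).tn A).f j (((vtxHom 0 0 L).tn A).f j z) = z :=
  tn_retract_apply (fun j x => constHom_vtxHom L j x) z

theorem face_const (n : ℕ) (k : Fin (n + 2)) {j : ℤ} (x : (L.tens A).X j) :
    ((faceHom n k L).tn A).f j (((CDGA.constHom (omega K (n + 1)) L).tn A).f j x) =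
      ((CDGA.constHom (omega K n) L).tn A).f j x :=
  tn_comp_apply (fun j x => faceHom_constHom n k L j x) x

theorem coef_const (n : ℕ) (φ : Hom L M) {j : ℤ} (x : (L.tens A).X j) :
    ((coefHom n φ).tn A).f j (((CDGA.constHom (omega K n) L).tn A).f j x) =
      ((CDGA.constHom (omega K n) M).tn A).f j ((φ.tn A).f j x) :=
  tn_comm_apply (fun j x => coefHom_constHom n φ j x) x

theorem vtx_coef (n : ℕ) (i : Fin (n + 1)) (φ : Hom L M) {j : ℤ}
    (x : (((omega K n).tensor L).tens A).X j) :
    ((vtxHom n i M).tn A).f j (((coefHom n φ).tn A).f j x) =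
      (φ.tn A).f j (((vtxHom n i L).tn A).f j x) :=
  tn_comm_apply (fun j x => vtxHom_coefHom n i φ j x) x

theorem kerAcyclic_vtx [CharZero K] (n : ℕ) (i : Fin (n + 1)) (L : DGLA K) (k : ℤ) :
    KerAcyclic (fun _ : Unit => vtxHom n i L) k := by
  intro z hz hv
  obtain ⟨u, hu1, hu2⟩ := kerAcyclic_vtxHom n i L k (k - 1) (k + 1) _ _ z hz (hv ())
  exact ⟨u, hu1, fun _ => hu2⟩

/-- If two elements of the gauge group over a simplex transform a constant Maurer–Cartan element
in the same way, then they differ at all vertices by the irrelevant stabilizer as soon as they do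
at one. -/
theorem irrStab_vtx [CharZero K] (n : ℕ) (i i' : Fin (n + 1)) {c : (L.tens A).X 1} (hc : (L.tens A).IsMC c)
    {p q : (((omega K n).tensor L).tens A).X 0}
    (hpq : (((omega K n).tensor L).tens A).gauge p (((CDGA.constHom _ L).tn A).f 1 c) =
      (((omega K n).tensor L).tens A).gauge q (((CDGA.constHom _ L).tn A).f 1 c))
    (hi : (L.tens A).IrrStab c
      ((L.tens A).bch (-((vtxHom n i L).tn A).f 0 q) (((vtxHom n i L).tn A).f 0 p))) :
    (L.tens A).IrrStab c
      ((L.tens A).bch (-((vtxHom n i' L).tn A).f 0 q) (((vtxHom n i' L).tn A).f 0 p)) := by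
  set r := (L.tens A).bch (-((vtxHom n i L).tn A).f 0 q) (((vtxHom n i L).tn A).f 0 p) with hr
  set C := ((CDGA.constHom (omega K n) L).tn A).f 1 c with hC
  set R := ((CDGA.constHom (omega K n) L).tn A).f 0 r with hR
  let M := ((omega K n).tensor L).tens A
  have hCmc : M.IsMC C := Hom.map_isMC _ hc
  have hRC : M.gauge R C = C := by
    rw [hR, hC, ← tn_gauge, IrrStab.gauge_eq hc hi]
  -- The constant R accounts for the difference of p and q at vertex i, so s is trivial there, and
  -- it fixes C. Hence d_C s = 0, and s = d_C u because the kernel of evaluation at vertex i is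
  -- acyclic; the value of s at any other vertex is then of the form du + [c, u].
  let s := M.bch (-R) (M.bch (-q) p)
  have hs : M.gauge s C = C := by
    change M.gauge (M.bch (-R) (M.bch (-q) p)) C = C
    rw [gauge_bch, gauge_bch, hpq, gauge_neg_gauge]
    conv_lhs => rw [← hRC]
    exact gauge_neg_gauge _ _
  have hsv : ∀ v, ((vtxHom n v L).tn A).f 0 s = (L.tens A).bch (-r) ((L.tens A).bch
      (-((vtxHom n v L).tn A).f 0 q) (((vtxHom n v L).tn A).f 0 p)) := by
    intro v
    refine (tn_bch _ _ _).trans ?_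
    rw [tn_bch, map_neg, map_neg, hR, vtx_const]
  obtain ⟨u, hu, -⟩ := exists_d_eq (h := -1) (j := 1) (kerAcyclic_vtx n i L 0) (by norm_num) (zero_add 1)
    hCmc ((gauge_eq_self_iff s C).mp hs) (fun _ => by rw [hsv, ← hr]; exact neg_bch r)
  have h1 : (L.tens A).IrrStab c (((vtxHom n i' L).tn A).f 0 s) := by
    rw [irrStab_iff]
    refine ⟨((vtxHom n i' L).tn A).f (-1) u, ?_⟩
    rw [← hu, Hom.map_dtw, hC, vtx_const]
  have h2 := IrrStab.bch hc hi h1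
  rw [hsv, ← bch_assoc, bch_neg, zero_bch] at h2
  exact h2

theorem exists_interval_eq {j : ℤ} (v₀ v₁ : (L.tens A).X j) :
    ∃ p : (((omega K 1).tensor L).tens A).X j, ((vtxHom 1 0 L).tn A).f j p = v₀ ∧
      ((vtxHom 1 1 L).tn A).f j p = v₁ := by
  obtain ⟨u, hu, hu'⟩ := exists_tensor_of_forall_contr (m := A.max) ((vtxHom 1 0 L).f j)
    (fun _ : Unit => (vtxHom 1 1 L).f j) (fun _ _ => True) (fun a b _ => by
      obtain ⟨x, hx⟩ := exists_extension_interval L j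
        -- Face k omits vertex k: face 0 is vertex 1, and face 1 is vertex 0.
        ![(CDGA.constHom _ L).f j (b ()), (CDGA.constHom _ L).f j a]
      refine ⟨x, ?_, fun _ => ?_⟩
      · have := vtxHom_faceHom 0 1 0 L j x
        rw [hx 1] at this
        exact this.symm.trans (vtxHom_constHom 0 0 L j a)
      · have := vtxHom_faceHom 0 0 0 L j x
        rw [hx 0] at this
        exact this.symm.trans (vtxHom_constHom 0 0 L j (b ()))) v₀ (fun _ => v₁) (fun _ => trivial)
  exact ⟨u, (tensMap_id_f _ _ _).trans hu, (tensMap_id_f _ _ _).trans (hu' ())⟩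

theorem exists_triangle_eq [CharZero K] {j : ℤ} (y : Fin 3 → (((omega K 1).tensor L).tens A).X j)
    (h0 : ((vtxHom 1 0 L).tn A).f j (y 1) = ((vtxHom 1 0 L).tn A).f j (y 2))
    (h1 : ((vtxHom 1 0 L).tn A).f j (y 0) = ((vtxHom 1 1 L).tn A).f j (y 2))
    (h2 : ((vtxHom 1 1 L).tn A).f j (y 0) = ((vtxHom 1 1 L).tn A).f j (y 1)) :
    ∃ p : (((omega K 2).tensor L).tens A).X j, ∀ k, ((faceHom 1 k L).tn A).f j p = y k := by
  obtain ⟨u, -, hu⟩ := exists_tensor_of_forall_contr (m := A.max)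
    (U := ((omega K 2).tensor L).X j) (V₀ := ((omega K 2).tensor L).X j) 0
    (fun k : Fin 3 => (faceHom 1 k L).f j) (fun v₀ v => v₀ = 0 ∧
      (vtxHom 1 0 L).f j (v 1) = (vtxHom 1 0 L).f j (v 2) ∧
      (vtxHom 1 0 L).f j (v 0) = (vtxHom 1 1 L).f j (v 2) ∧
      (vtxHom 1 1 L).f j (v 0) = (vtxHom 1 1 L).f j (v 1)) (fun v₀ v hv => by
      obtain ⟨x, hx⟩ := exists_extension (n := 0) L j v fun l k hlk => by
        apply vtxHom_injective L j
        rw [vtxHom_faceHom, vtxHom_faceHom]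
        fin_cases l <;> fin_cases k
        · exact hv.2.2.2.symm
        · exact hv.2.2.1.symm
        · exact absurd hlk (by decide)
        · exact hv.2.1.symm
      exact ⟨x, hv.1.symm, hx⟩) 0 y (fun φ => ⟨map_zero _, contr_tn_eq h0 φ,
        contr_tn_eq h1 φ, contr_tn_eq h2 φ⟩)
  exact ⟨u, fun k => (tensMap_id_f _ _ _).trans (hu k)⟩

end DGLA

namespace SemicosimplicialDGLA

variable {K : Type u} [Field K] {A : Art K}

theorem twProj_face (g : SemicosimplicialDGLA K) (n : ℕ) (k : Fin (n + 2)) {j : ℤ}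
    (x : (g.totTW.tens A).X j) :
    ((faceHom n k (g.obj (n + 1))).tn A).f j (((g.twProj (n + 1)).tn A).f j x) =
      ((coefHom n (g.face n k)).tn A).f j (((g.twProj n).tn A).f j x) :=
  DGLA.tn_comm_apply (fun j (x : g.twX j) => x.2 n k) x

theorem exists_tw_eq (g : SemicosimplicialDGLA K) (N : ℕ) {j : ℤ}
    (x : ∀ n, (((omega K n).tensor (g.obj n)).tens A).X j)
    (hx : ∀ n < N, ∀ k, ((faceHom n k (g.obj (n + 1))).tn A).f j (x (n + 1)) =
      ((coefHom n (g.face n k)).tn A).f j (x n)) :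
    ∃ w : (g.totTW.tens A).X j, ∀ n ≤ N, ((g.twProj n).tn A).f j w = x n := by
  classical
  obtain ⟨u, -, hu⟩ := exists_tensor_of_forall_contr (m := A.max)
    (U := g.totTW.X j) (V₀ := g.totTW.X j) 0
    (fun n : Fin (N + 1) => (g.twProj n).f j) (fun v₀ v => v₀ = 0 ∧
      ∀ n (hn : n < N) k, (g.restr n k).f j (v ⟨n + 1, by omega⟩) =
        (g.coface n k).f j (v ⟨n, by omega⟩)) (fun v₀ v hv => by
      obtain ⟨w, hw⟩ := g.exists_tw_extension N j
        (fun n => if h : n < N + 1 then v ⟨n, h⟩ else 0) fun n hn k => by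
          rw [dif_pos (by omega), dif_pos (by omega)]
          exact hv.2 n hn k
      refine ⟨w, hv.1.symm, fun s => ?_⟩
      have := hw s (by omega)
      rw [dif_pos s.2] at this
      exact this) 0 (fun n => x n) (fun φ => ⟨map_zero _, fun n hn k =>
        DGLA.contr_tn_eq (hx n hn k) φ⟩)
  exact ⟨u, fun n hn => (DGLA.tensMap_id_f _ _ _).trans (hu ⟨n, by omega⟩)⟩

end SemicosimplicialDGLA

/-! ### Maurer–Cartan elements of Tot_TW and pairs (l, m). -/

namespace SemicosimplicialDGLA

variable {K : Type u} [Field K] {A : Art K} (g : SemicosimplicialDGLA K)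

open DGLA

theorem face_twProj_vtx (n : ℕ) (k : Fin (n + 2)) (i : Fin (n + 1)) {j : ℤ}
    (x : (g.totTW.tens A).X j) :
    ((g.face n k).tn A).f j (((vtxHom n i (g.obj n)).tn A).f j (((g.twProj n).tn A).f j x)) =
      ((vtxHom (n + 1) (k.succAbove i) (g.obj (n + 1))).tn A).f j
        (((g.twProj (n + 1)).tn A).f j x) := by
  rw [← vtx_face, twProj_face, vtx_coef]

theorem face_face_tn {n : ℕ} {l k : Fin (n + 2)} (h : l ≤ k) {j : ℤ} (x : ((g.obj n).tens A).X j) :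
    ((g.face (n + 1) k.succ).tn A).f j (((g.face n l).tn A).f j x) =
      ((g.face (n + 1) l.castSucc).tn A).f j (((g.face n k).tn A).f j x) :=
  tn_comm_apply (fun j x => g.face_face_apply h j x) x

/-- The pair `(l, m)` is associated with `x`: `l` is the value of `x` at the vertices, and `m` is
the value at the start of a gauge transformation along the edge that trivializes `x` and is
trivial at the end. -/
structure Assoc (x : (g.totTW.tens A).X 1) (l : ((g.obj 0).tens A).X 1)
    (m : ((g.obj 1).tens A).X 0) : Prop where
  vtx : ((vtxHom 0 0 (g.obj 0)).tn A).f 1 (((g.twProj 0).tn A).f 1 x) = l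
  path : ∃ p : (((omega K 1).tensor (g.obj 1)).tens A).X 0,
    ((vtxHom 1 0 (g.obj 1)).tn A).f 0 p = m ∧ ((vtxHom 1 1 (g.obj 1)).tn A).f 0 p = 0 ∧
    (((omega K 1).tensor (g.obj 1)).tens A).gauge p
      (((CDGA.constHom (omega K 1) (g.obj 1)).tn A).f 1 (((g.face 0 0).tn A).f 1 l)) =
        ((g.twProj 1).tn A).f 1 x

variable {g}

/-- At vertex 1 of the edge, x_1 and the constant ∂_0 l agree. Evaluation there has acyclic kernel,
so they are gauge equivalent by an element that is trivial at this vertex. -/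
theorem exists_assoc [CharZero K] {x : (g.totTW.tens A).X 1} (hx : (g.totTW.tens A).IsMC x) :
    ∃ l m, g.Assoc x l m := by
  set l := ((vtxHom 0 0 (g.obj 0)).tn A).f 1 (((g.twProj 0).tn A).f 1 x) with hl
  have hmc : ((g.obj 0).tens A).IsMC l := Hom.map_isMC _ (Hom.map_isMC _ hx)
  obtain ⟨p, hp1, hp2⟩ := exists_gauge_eq (kerAcyclic_vtx 1 1 (g.obj 1) 1)
    (x := ((CDGA.constHom (omega K 1) (g.obj 1)).tn A).f 1 (((g.face 0 0).tn A).f 1 l))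
    (y := ((g.twProj 1).tn A).f 1 x)
    (Hom.map_isMC _ (Hom.map_isMC _ hmc)) (Hom.map_isMC _ hx) (fun _ => by
      rw [vtx_const, hl]
      exact g.face_twProj_vtx 0 0 0 x)
  exact ⟨l, _, rfl, p, rfl, hp2 (), hp1⟩

/-- The gluing condition is the value of the path at vertex 0. For the cocycle condition, x_2 is
trivialised on the triangle by an element P that is zero at vertex 2. On each edge P is compared
with the coface image of p; by `irrStab_vtx`, agreement modulo the irrelevant stabilizer spreads
along the edges from vertex 2 to vertices 1 and 0, and from 1 to 0. The two resulting descriptions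
of P at vertex 0 give the condition. -/
theorem Assoc.isZ1 [CharZero K] {x : (g.totTW.tens A).X 1} (hx : (g.totTW.tens A).IsMC x)
    {l : ((g.obj 0).tens A).X 1} {m : ((g.obj 1).tens A).X 0} (h : g.Assoc x l m) :
    (g.tens A).IsZ1 l m := by
  obtain ⟨hl, p, hp0, hp1, hp⟩ := h
  have hmc : ((g.obj 0).tens A).IsMC l := hl ▸ Hom.map_isMC _ (Hom.map_isMC _ hx)
  have glue : ((g.face 0 1).tn A).f 1 l =
      ((g.obj 1).tens A).gauge m (((g.face 0 0).tn A).f 1 l) := by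
    have h1 := congrArg (((vtxHom 1 0 (g.obj 1)).tn A).f 1) hp
    rw [tn_gauge, vtx_const, hp0] at h1
    rw [h1, ← hl]
    exact g.face_twProj_vtx 0 1 0 x
  refine ⟨hmc, glue, ?_⟩
  set c : ((g.obj 2).tens A).X 1 := ((g.face 1 0).tn A).f 1 (((g.face 0 0).tn A).f 1 l) with hc
  have hcmc : ((g.obj 2).tens A).IsMC c := Hom.map_isMC _ (Hom.map_isMC _ hmc)
  obtain ⟨P, hP, hP2⟩ := exists_gauge_eq (kerAcyclic_vtx 2 2 (g.obj 2) 1)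
    (x := ((CDGA.constHom (omega K 2) (g.obj 2)).tn A).f 1 c) (y := ((g.twProj 2).tn A).f 1 x)
    (Hom.map_isMC _ hcmc) (Hom.map_isMC _ hx) (fun _ => by
      rw [vtx_const, hc, ← hl]
      refine (congrArg _ (g.face_twProj_vtx 0 0 0 x)).trans ?_
      exact g.face_twProj_vtx 1 0 1 x)
  -- On edge k both gauge elements produce the restriction of x_2, which by the matching condition
  -- is the coface image of x_1.
  have hface : ∀ k : Fin 3, (((omega K 1).tensor (g.obj 2)).tens A).gauge
      (((faceHom 1 k (g.obj 2)).tn A).f 0 P) (((CDGA.constHom _ (g.obj 2)).tn A).f 1 c) =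
      (((omega K 1).tensor (g.obj 2)).tens A).gauge (((coefHom 1 (g.face 1 k)).tn A).f 0 p)
        (((CDGA.constHom _ (g.obj 2)).tn A).f 1
          (((g.face 1 k).tn A).f 1 (((g.face 0 0).tn A).f 1 l))) := by
    intro k
    have h1 := g.twProj_face 1 k x
    rw [← hp, tn_gauge, coef_const] at h1
    refine Eq.trans ?_ h1
    refine (congrArg _ (face_const 1 k c).symm).trans ((tn_gauge _ _ _).symm.trans ?_)
    exact congrArg _ hP
  have hv : ∀ (k : Fin 3) (i : Fin 2), ((vtxHom 1 i (g.obj 2)).tn A).f 0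
      (((coefHom 1 (g.face 1 k)).tn A).f 0 p) =
        ((g.face 1 k).tn A).f 0 (((vtxHom 1 i (g.obj 1)).tn A).f 0 p) := fun k i => vtx_coef _ _ _ _
  let P' : Fin 3 → ((g.obj 2).tens A).X 0 := fun i => ((vtxHom 2 i (g.obj 2)).tn A).f 0 P
  have hPv : ∀ (k : Fin 3) (i : Fin 2), ((vtxHom 1 i (g.obj 2)).tn A).f 0
      (((faceHom 1 k (g.obj 2)).tn A).f 0 P) = P' (k.succAbove i) := fun k i => vtx_face _ _ _ _ _
  have e10 : ((g.face 1 1).tn A).f 1 (((g.face 0 0).tn A).f 1 l) = c := g.face_face_tn (le_refl 0) l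
  have e20 : ((g.face 1 2).tn A).f 1 (((g.face 0 0).tn A).f 1 l) =
      ((g.obj 2).tens A).gauge (((g.face 1 0).tn A).f 0 m) c := by
    rw [hc, ← tn_gauge, ← glue]
    exact g.face_face_tn (Fin.zero_le 1) l
  let m' : Fin 3 → ((g.obj 2).tens A).X 0 := fun k => ((g.face 1 k).tn A).f 0 m
  have hP2' : P' 2 = 0 := hP2 ()
  have h0 : ((g.obj 2).tens A).IrrStab c (((g.obj 2).tens A).bch (-m' 0) (P' 1)) := by
    have := irrStab_vtx 1 1 0 hcmc (hface 0) (by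
      rw [hv, hp1, map_zero, neg_zero, zero_bch, hPv]
      exact hP2' ▸ irrStab_zero c)
    rwa [hv, hp0, hPv] at this
  have h1 : ((g.obj 2).tens A).IrrStab c (((g.obj 2).tens A).bch (-m' 1) (P' 0)) := by
    have hf := hface 1
    rw [e10] at hf
    have := irrStab_vtx 1 1 0 hcmc hf (by
      rw [hv, hp1, map_zero, neg_zero, zero_bch, hPv]
      exact hP2' ▸ irrStab_zero c)
    rwa [hv, hp0, hPv] at this
  -- On the edge from 0 to 1 the coface image of p starts from the constant e^(m' 0) * c instead of
  -- c, so it is composed with the constant m' 0.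
  have h2 : ((g.obj 2).tens A).IrrStab c
      (((g.obj 2).tens A).bch (-((g.obj 2).tens A).bch (m' 2) (m' 0)) (P' 0)) := by
    have hf := hface 2
    rw [e20, tn_gauge, ← gauge_bch] at hf
    have := irrStab_vtx 1 1 0 hcmc hf (by
      rw [tn_bch, hv, hp1, map_zero, zero_bch, vtx_const, hPv]
      exact h0)
    rwa [tn_bch, hv, hp0, vtx_const, hPv] at this
  have hG : ∀ {G : Type u} [Group G] (S : Subgroup G) (m₀ m₁ m₂ p : G), m₁⁻¹ * p ∈ S →
      (m₂ * m₀)⁻¹ * p ∈ S → m₁⁻¹ * (m₂ * m₀) ∈ S := by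
    intro G _ S m₀ m₁ m₂ p h1 h2
    simpa using S.mul_mem h1 (S.inv_mem h2)
  have h3 : ((g.obj 2).tens A).IrrStab c (((g.obj 2).tens A).bch (-m' 1)
      (((g.obj 2).tens A).bch (m' 2) (m' 0))) := hG (irrSubgroup c hcmc) (m' 0) (m' 1) (m' 2) (P' 0) h1 h2
  -- Conjugation by m' 0 puts the factors in the order of the definition and moves the base point
  -- from c to e^(m' 0) * c, which is ∂_2 ∂_0 l.
  have h4 := IrrStab.conj h3 (m' 0)
  have e4 : ((g.obj 2).tens A).bch (((g.obj 2).tens A).bch (m' 0) (((g.obj 2).tens A).bch (-m' 1)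
      (((g.obj 2).tens A).bch (m' 2) (m' 0)))) (-m' 0) =
      ((g.obj 2).tens A).bch (((g.obj 2).tens A).bch (m' 0) (-m' 1)) (m' 2) := by
    simp only [bch_assoc, bch_neg, bch_zero]
  rw [e4] at h4
  exact e20 ▸ h4

/-- On the edge, a_1 • p and p' • ∂_0 a_0 both carry the constant ∂_0 l to x'_1, and they agree at
vertex 1. By `irrStab_vtx` they differ at vertex 0 by the irrelevant stabilizer, and the inverse of
this difference is the expression in the relation. -/
theorem Assoc.rel [CharZero K] {x x' : (g.totTW.tens A).X 1} (hx : (g.totTW.tens A).IsMC x)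
    {l l' : ((g.obj 0).tens A).X 1} {m m' : ((g.obj 1).tens A).X 0} (h : g.Assoc x l m)
    (h' : g.Assoc x' l' m') {a : (g.totTW.tens A).X 0} (ha : (g.totTW.tens A).gauge a x = x') :
    ∃ a : ((g.obj 0).tens A).X 0, ((g.obj 0).tens A).gauge a l = l' ∧
      ((g.obj 1).tens A).IrrStab (((g.face 0 0).tn A).f 1 l)
        (((g.obj 1).tens A).bch (((g.obj 1).tens A).bch (((g.obj 1).tens A).bch (-m)
          (-((g.face 0 1).tn A).f 0 a)) m') (((g.face 0 0).tn A).f 0 a)) := by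
  obtain ⟨hl, p, hp0, hp1, hp⟩ := h
  obtain ⟨hl', p', hp0', hp1', hp'⟩ := h'
  have hmc : ((g.obj 0).tens A).IsMC l := hl ▸ Hom.map_isMC _ (Hom.map_isMC _ hx)
  set a₀ := ((vtxHom 0 0 (g.obj 0)).tn A).f 0 (((g.twProj 0).tn A).f 0 a) with ha₀
  have hll : ((g.obj 0).tens A).gauge a₀ l = l' := by
    rw [← hl, ha₀, ← tn_gauge, ← tn_gauge, ha, hl']
  refine ⟨a₀, hll, ?_⟩
  set c := ((g.face 0 0).tn A).f 1 l with hc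
  have hcmc : ((g.obj 1).tens A).IsMC c := Hom.map_isMC _ hmc
  have hpq : (((omega K 1).tensor (g.obj 1)).tens A).gauge
      ((((omega K 1).tensor (g.obj 1)).tens A).bch (((g.twProj 1).tn A).f 0 a) p)
        (((CDGA.constHom _ (g.obj 1)).tn A).f 1 c) =
      (((omega K 1).tensor (g.obj 1)).tens A).gauge
      ((((omega K 1).tensor (g.obj 1)).tens A).bch p'
        (((CDGA.constHom _ (g.obj 1)).tn A).f 0 (((g.face 0 0).tn A).f 0 a₀)))
        (((CDGA.constHom _ (g.obj 1)).tn A).f 1 c) := by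
    rw [gauge_bch, gauge_bch, hp, ← tn_gauge, ← tn_gauge, hc, ← tn_gauge, ha, hll, hp']
  have ha1 : ((vtxHom 1 1 (g.obj 1)).tn A).f 0 (((g.twProj 1).tn A).f 0 a) =
      ((g.face 0 0).tn A).f 0 a₀ := (g.face_twProj_vtx 0 0 0 a).symm
  have ha0 : ((vtxHom 1 0 (g.obj 1)).tn A).f 0 (((g.twProj 1).tn A).f 0 a) =
      ((g.face 0 1).tn A).f 0 a₀ := (g.face_twProj_vtx 0 1 0 a).symm
  have key := irrStab_vtx 1 1 0 hcmc hpq (by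
    rw [tn_bch, tn_bch, hp1, hp1', ha1, vtx_const, zero_bch, bch_zero, neg_bch]
    exact irrStab_zero c)
  rw [tn_bch, tn_bch, hp0, hp0', ha0, vtx_const] at key
  have hG : ∀ {G : Type u} [Group G] (a b c d : G), (((a * b)⁻¹ * (c * d)))⁻¹ =
      d⁻¹ * c⁻¹ * a * b := fun a b c d => by group
  exact (congrArg (((g.obj 1).tens A).IrrStab c)
    (hG (G := ExpGroup ((g.obj 1).tens A) inferInstance) m' _ _ m)).mp key.neg

theorem face_eq_const [CharZero K] {L : DGLA K} (k : Fin 2) {j : ℤ}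
    (x : (((omega K 1).tensor L).tens A).X j) (v : (L.tens A).X j)
    (h : ((vtxHom 1 (k.succAbove 0) L).tn A).f j x = v) :
    ((faceHom 0 k L).tn A).f j x = ((CDGA.constHom (omega K 0) L).tn A).f j v := by
  rw [← const_vtx (((faceHom 0 k L).tn A).f j x), vtx_face, h]

/-- An equivalence of pairs determines a gauge transformation in levels 0 and 1. After extending it
to all levels, the elements agree in these two, and the acyclicity of the kernel in degree one
yields a gauge transformation for the rest. -/
theorem Assoc.exists_gauge_eq [CharZero K] (hH : ∀ n : ℕ, 2 ≤ n → Subsingleton ((g.obj n).H (1 - n)))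
    {x x' : (g.totTW.tens A).X 1} (hx : (g.totTW.tens A).IsMC x) (hx' : (g.totTW.tens A).IsMC x')
    {l l' : ((g.obj 0).tens A).X 1} {m m' : ((g.obj 1).tens A).X 0} (h : g.Assoc x l m)
    (h' : g.Assoc x' l' m') {a : ((g.obj 0).tens A).X 0} (ha : ((g.obj 0).tens A).gauge a l = l')
    (hs : ((g.obj 1).tens A).IrrStab (((g.face 0 0).tn A).f 1 l)
        (((g.obj 1).tens A).bch (((g.obj 1).tens A).bch (((g.obj 1).tens A).bch (-m)
          (-((g.face 0 1).tn A).f 0 a)) m') (((g.face 0 0).tn A).f 0 a))) :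
    ∃ w, (g.totTW.tens A).gauge w x = x' := by
  obtain ⟨hl, p, hp0, hp1, hp⟩ := h
  obtain ⟨hl', p', hp0', hp1', hp'⟩ := h'
  have hmc : ((g.obj 0).tens A).IsMC l := hl ▸ Hom.map_isMC _ (Hom.map_isMC _ hx)
  set c := ((g.face 0 0).tn A).f 1 l with hc
  have hcmc : ((g.obj 1).tens A).IsMC c := Hom.map_isMC _ hmc
  obtain ⟨b, hb⟩ := (irrStab_iff _ _ _).mp hs
  -- A path in the irrelevant stabilizer of the constant C is produced from a path between b and 0
  -- in degree -1. It fixes C, so it can adjust the end values of a gauge transformation without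
  -- changing its effect.
  obtain ⟨B, hB0, hB1⟩ := exists_interval_eq b 0
  let M := ((omega K 1).tensor (g.obj 1)).tens A
  set C : M.X 1 := ((CDGA.constHom _ (g.obj 1)).tn A).f 1 c with hC
  set s : M.X 0 := M.dtw C (-1) 0 (by norm_num) B with hsdef
  have hsC : M.IrrStab C s := (irrStab_iff _ _ _).mpr ⟨B, rfl⟩
  have hs0 : ((vtxHom 1 0 (g.obj 1)).tn A).f 0 s = ((g.obj 1).tens A).bch (((g.obj 1).tens A).bch
      (((g.obj 1).tens A).bch (-m) (-((g.face 0 1).tn A).f 0 a)) m') (((g.face 0 0).tn A).f 0 a) := by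
    rw [← hb]
    refine (Hom.map_dtw _ _ _ _ _ _).trans ?_
    rw [hB0, hC, vtx_const]
  have hs1 : ((vtxHom 1 1 (g.obj 1)).tn A).f 0 s = 0 := by
    refine (Hom.map_dtw _ _ _ _ _ _).trans ?_
    rw [hB1, map_zero]
  -- From right to left: undo p, apply the harmless s⁻¹, pass from ∂_0 l to ∂_0 l', then follow p'.
  -- The factor s⁻¹ makes the value at vertex 0 equal to ∂_1 a, as matching with level 0 demands.
  set a₁ : M.X 0 := M.bch (M.bch p' (((CDGA.constHom _ (g.obj 1)).tn A).f 0 (((g.face 0 0).tn A).f 0 a)))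
    (M.bch (-s) (-p)) with ha₁
  have hgauge : M.gauge a₁ (((g.twProj 1).tn A).f 1 x) = ((g.twProj 1).tn A).f 1 x' := by
    rw [← hp, ha₁, gauge_bch, gauge_bch, gauge_bch, gauge_neg_gauge,
      IrrStab.gauge_eq (Hom.map_isMC _ hcmc) hsC.neg]
    refine Eq.trans (congrArg _ ((tn_gauge _ _ _).symm.trans (congrArg _ ?_))) hp'
    rw [hc, ← ha, tn_gauge]
  have hv1 : ((vtxHom 1 1 (g.obj 1)).tn A).f 0 a₁ = ((g.face 0 0).tn A).f 0 a := by
    refine (tn_bch _ _ _).trans ?_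
    rw [tn_bch, tn_bch, map_neg, map_neg, hp1, hp1', hs1, neg_zero, zero_bch, bch_zero, bch_zero,
      vtx_const]
  have hv0 : ((vtxHom 1 0 (g.obj 1)).tn A).f 0 a₁ = ((g.face 0 1).tn A).f 0 a := by
    refine (tn_bch _ _ _).trans ?_
    rw [tn_bch, tn_bch, map_neg, map_neg, hp0, hp0', hs0, vtx_const]
    have hG : ∀ {G : Type u} [Group G] (m m' a b : G),
        (m' * a) * ((m⁻¹ * b⁻¹ * m' * a)⁻¹ * m⁻¹) = b := fun m m' a b => by group
    exact hG (G := ExpGroup ((g.obj 1).tens A) inferInstance) m m' _ _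
  let y : ∀ n, (((omega K n).tensor (g.obj n)).tens A).X 0 := fun n => match n with
    | 0 => ((CDGA.constHom _ (g.obj 0)).tn A).f 0 a
    | 1 => a₁
    | _ + 2 => 0
  obtain ⟨w, hw⟩ := g.exists_tw_eq 1 y fun n hn k => by
    obtain rfl : n = 0 := by omega
    refine Eq.trans ?_ (coef_const 0 (g.face 0 k) a).symm
    refine face_eq_const k a₁ _ ?_
    fin_cases k
    · exact hv1
    · exact hv0
  obtain ⟨e, he, -⟩ := DGLA.exists_gauge_eq (g.kerAcyclic_twProj 2 1 hH) (isMC_gauge w hx) hx'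
    fun n => by
      rw [tn_gauge, hw n (by omega)]
      match n with
      | 0 =>
        have h1 := congrArg (((CDGA.constHom (omega K 0) (g.obj 0)).tn A).f 1) ha
        rw [tn_gauge, ← hl, ← hl', const_vtx, const_vtx] at h1
        exact h1
      | 1 => exact hgauge
  exact ⟨(g.totTW.tens A).bch e w, by rw [gauge_bch, he]⟩

/-- The element is built in levels 0, 1 and 2 as the constant l, its transform along a path from m
to 0, and a transform over a triangle with suitable edges. An arbitrary extension to higher levels
is then corrected to a Maurer–Cartan element, since the kernel of the projection to these levels has
no H². -/
theorem exists_isMC_assoc [CharZero K] (hH : ∀ n : ℕ, 3 ≤ n → Subsingleton ((g.obj n).H (2 - n)))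
    {l : ((g.obj 0).tens A).X 1} {m : ((g.obj 1).tens A).X 0} (h : (g.tens A).IsZ1 l m) :
    ∃ x, (g.totTW.tens A).IsMC x ∧ g.Assoc x l m := by
  obtain ⟨hmc, hglue, hcoc⟩ := h
  change ((g.obj 0).tens A).IsMC l at hmc
  have glue : ((g.face 0 1).tn A).f 1 l =
      ((g.obj 1).tens A).gauge m (((g.face 0 0).tn A).f 1 l) := hglue
  let M := (g.obj 2).tens A
  set c : M.X 1 := ((g.face 1 0).tn A).f 1 (((g.face 0 0).tn A).f 1 l) with hc
  let m' : Fin 3 → M.X 0 := fun k => ((g.face 1 k).tn A).f 0 m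
  have hcmc : M.IsMC c := Hom.map_isMC _ (Hom.map_isMC _ hmc)
  have e10 : ((g.face 1 1).tn A).f 1 (((g.face 0 0).tn A).f 1 l) = c := g.face_face_tn (le_refl 0) l
  have e20 : ((g.face 1 2).tn A).f 1 (((g.face 0 0).tn A).f 1 l) = M.gauge (m' 0) c := by
    refine Eq.trans ?_ (tn_gauge (g.face 1 0) m _)
    rw [← glue]
    exact g.face_face_tn (Fin.zero_le 1) l
  have hst : M.IrrStab c (M.bch (-m' 1) (M.bch (m' 2) (m' 0))) := by
    have h1 : M.IrrStab (((g.face 1 2).tn A).f 1 (((g.face 0 0).tn A).f 1 l))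
      (M.bch (M.bch (m' 0) (-m' 1)) (m' 2)) := hcoc
    rw [e20] at h1
    have h2 := h1.conj (-m' 0)
    rw [gauge_neg_gauge] at h2
    have hG : ∀ {G : Type u} [Group G] (a b c : G),
        (a⁻¹ * (a * b * c)) * a⁻¹⁻¹ = b * (c * a) := fun a b c => by group
    exact (congrArg (M.IrrStab c) (hG (G := ExpGroup M inferInstance) _ _ _)).mp h2
  obtain ⟨b, hb⟩ := (irrStab_iff _ _ _).mp hst
  obtain ⟨B, hB0, hB1⟩ := exists_interval_eq b 0
  obtain ⟨p, hp0, hp1⟩ := exists_interval_eq m 0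
  let M1 := ((omega K 1).tensor (g.obj 2)).tens A
  set C : M1.X 1 := ((CDGA.constHom _ (g.obj 2)).tn A).f 1 c with hC
  set s : M1.X 0 := M1.dtw C (-1) 0 (by norm_num) B with hsdef
  have hsC : M1.IrrStab C s := (irrStab_iff _ _ _).mpr ⟨B, rfl⟩
  have hs0 : ((vtxHom 1 0 (g.obj 2)).tn A).f 0 s = M.bch (-m' 1) (M.bch (m' 2) (m' 0)) := by
    rw [← hb]
    refine (Hom.map_dtw _ _ _ _ _ _).trans ?_
    rw [hB0, hC, vtx_const]
  have hs1 : ((vtxHom 1 1 (g.obj 2)).tn A).f 0 s = 0 := by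
    refine (Hom.map_dtw _ _ _ _ _ _).trans ?_
    rw [hB1, map_zero]
  have hv : ∀ (k : Fin 3) (i : Fin 2), ((vtxHom 1 i (g.obj 2)).tn A).f 0
      (((coefHom 1 (g.face 1 k)).tn A).f 0 p) =
        ((g.face 1 k).tn A).f 0 (((vtxHom 1 i (g.obj 1)).tn A).f 0 p) := fun k i => vtx_coef _ _ _ _
  -- The third edge of the triangle. The path s in the irrelevant stabilizer has no effect on C but
  -- changes the value at vertex 0 from m' 2 • m' 0 to m' 1, so that the three edges close up; this
  -- is where the cocycle condition is used.
  let q : M1.X 0 := M1.bch (M1.bch (((coefHom 1 (g.face 1 2)).tn A).f 0 p)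
    (((CDGA.constHom _ (g.obj 2)).tn A).f 0 (m' 0))) (-s)
  have hq1 : ((vtxHom 1 1 (g.obj 2)).tn A).f 0 q = m' 0 := by
    refine (tn_bch _ _ _).trans ?_
    rw [tn_bch, hv, hp1, map_zero, zero_bch, vtx_const, map_neg, hs1, neg_zero, bch_zero]
  have hq0 : ((vtxHom 1 0 (g.obj 2)).tn A).f 0 q = m' 1 := by
    refine (tn_bch _ _ _).trans ?_
    rw [tn_bch, hv, hp0, vtx_const, map_neg, hs0]
    have hG : ∀ {G : Type u} [Group G] (a b c : G),
        b * c * (a⁻¹ * (b * c))⁻¹ = a := fun a b c => by group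
    exact hG (G := ExpGroup M inferInstance) _ _ _
  obtain ⟨P, hP⟩ := exists_triangle_eq (A := A) (L := g.obj 2) ![((coefHom 1 (g.face 1 0)).tn A).f 0 p,
      ((coefHom 1 (g.face 1 1)).tn A).f 0 p, q]
    (((hv 1 0).trans (congrArg _ hp0)).trans hq0.symm)
    (((hv 0 0).trans (congrArg _ hp0)).trans hq1.symm)
    (((hv 0 1).trans ((congrArg _ hp1).trans (map_zero _))).trans
      ((hv 1 1).trans ((congrArg _ hp1).trans (map_zero _))).symm)
  let x₁ : (((omega K 1).tensor (g.obj 1)).tens A).X 1 :=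
    (((omega K 1).tensor (g.obj 1)).tens A).gauge p
      (((CDGA.constHom (omega K 1) (g.obj 1)).tn A).f 1 (((g.face 0 0).tn A).f 1 l))
  let x₂ : (((omega K 2).tensor (g.obj 2)).tens A).X 1 :=
    (((omega K 2).tensor (g.obj 2)).tens A).gauge P (((CDGA.constHom (omega K 2) (g.obj 2)).tn A).f 1 c)
  let y : ∀ n, (((omega K n).tensor (g.obj n)).tens A).X 1 := fun n => match n with
    | 0 => ((CDGA.constHom _ (g.obj 0)).tn A).f 1 l
    | 1 => x₁
    | 2 => x₂
    | _ + 3 => 0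
  have hx₁ : ∀ k : Fin 2, ((faceHom 0 k (g.obj 1)).tn A).f 1 x₁ =
      ((coefHom 0 (g.face 0 k)).tn A).f 1 (((CDGA.constHom _ (g.obj 0)).tn A).f 1 l) := by
    intro k
    rw [coef_const]
    refine face_eq_const k x₁ _ ?_
    refine (tn_gauge _ _ _).trans ?_
    rw [vtx_const]
    fin_cases k
    · refine (congrArg (fun a => ((g.obj 1).tens A).gauge a _) hp1).trans (gauge_zero _)
    · refine (congrArg (fun a => ((g.obj 1).tens A).gauge a _) hp0).trans glue.symm
  have hx₂ : ∀ k : Fin 3, ((faceHom 1 k (g.obj 2)).tn A).f 1 x₂ =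
      ((coefHom 1 (g.face 1 k)).tn A).f 1 x₁ := by
    intro k
    refine (tn_gauge _ _ _).trans (Eq.trans ?_ (tn_gauge _ _ _).symm)
    rw [hP, face_const, coef_const]
    match k with
    | 0 => rfl
    | 1 => exact congrArg (fun e => M1.gauge _ (((CDGA.constHom _ (g.obj 2)).tn A).f 1 e)) e10.symm
    | 2 =>
      refine Eq.trans ?_
        (congrArg (fun e => M1.gauge _ (((CDGA.constHom _ (g.obj 2)).tn A).f 1 e)) e20.symm)
      change M1.gauge (M1.bch (M1.bch _ _) (-s)) C = _
      rw [gauge_bch, gauge_bch, IrrStab.gauge_eq (Hom.map_isMC _ hcmc) hsC.neg, tn_gauge]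
  obtain ⟨w, hw⟩ := g.exists_tw_eq 2 y fun n hn k => by
    match n with
    | 0 => exact hx₁ k
    | 1 => exact hx₂ k
  -- In levels 0 to 2, w is a gauge transform of a constant Maurer–Cartan element; in higher levels
  -- nothing is known about it, and nothing is needed.
  obtain ⟨x, hx, hxw⟩ := DGLA.exists_isMC (g.kerAcyclic_twProj 3 2 hH) (x := w) fun n => by
    rw [hw n (by omega)]
    match n with
    | 0 => exact Hom.map_isMC _ hmc
    | 1 => exact isMC_gauge _ (Hom.map_isMC _ (Hom.map_isMC _ hmc))
    | 2 => exact isMC_gauge _ (Hom.map_isMC _ hcmc)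
  refine ⟨x, hx, ?_, p, hp0, hp1, ?_⟩
  · have h1 := (hxw 0).trans (hw 0 (by omega))
    exact (congrArg _ h1).trans (vtx_const 0 0 l)
  · exact ((hxw 1).trans (hw 1 (by omega))).symm

end SemicosimplicialDGLA

/-! ### Naturality and bijectivity of the comparison. -/

namespace DGLA

variable {K : Type u} [Field K] {L M N P : DGLA K} {A B : Art K}

theorem tensMap_comm_apply {φ : Hom L M} {ψ : Hom M N} {φ' : Hom L P} {ψ' : Hom P N}
    (h : ∀ j x, ψ.f j (φ.f j x) = ψ'.f j (φ'.f j x)) (f : A ⟶ B) {j : ℤ} (x : (L.tens A).X j) :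
    (ψ.tn B).f j ((tensMap φ f).f j x) = (tensMap ψ' f).f j ((φ'.tn A).f j x) := by
  have e : φ.comp ψ = φ'.comp ψ' := Hom.ext (funext fun j => LinearMap.ext fun x => h j x)
  have h1 := tensMap_comp φ ψ f (𝟙 B)
  have h2 := tensMap_comp φ' ψ' (𝟙 A) f
  rw [Category.comp_id, e] at h1
  rw [Category.id_comp] at h2
  exact congrArg (fun χ : Hom _ _ => χ.f j x) (h1.symm.trans h2)

theorem coefHom_id (n : ℕ) (L : DGLA K) (j : ℤ) (x : ((omega K n).tensor L).X j) :
    (coefHom n (Hom.id L)).f j x = x := by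
  change CDGA.tensorMapX (CDGA.Hom.id (omega K n)) (Hom.id L) j x = x
  induction x using CDGA.tensor_induction with
  | zero => exact map_zero _
  | add x y hx hy => rw [map_add, hx, hy]
  | incl p a h ω x => exact CDGA.tensorMapX_incl _ _ _ _ _ _ _

theorem subsingleton_H {i : ℤ} (h : ∀ x, L.d i (i + 1) rfl x = 0 →
    ∃ y, L.d (i - 1) i (sub_add_cancel i 1) y = x) : Subsingleton (L.H i) := by
  refine subsingleton_of_forall_eq 0 fun x => ?_
  obtain ⟨⟨x, hx⟩, rfl⟩ := Submodule.Quotient.mk_surjective _ x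
  exact (Submodule.Quotient.mk_eq_zero _).mpr (h x hx)

end DGLA

namespace SemicosimplicialDGLA

variable {K : Type u} [Field K] {A B : Art K} {g h : SemicosimplicialDGLA K}

open DGLA

theorem Assoc.map (φ : Hom g h) {ψ : DGLA.Hom g.totTW h.totTW}
    (hψ : ∀ n j x, (h.twProj n).f j (ψ.f j x) = (coefHom n (φ.app n)).f j ((g.twProj n).f j x))
    (f : A ⟶ B) {x : (g.totTW.tens A).X 1} {l : ((g.obj 0).tens A).X 1}
    {m : ((g.obj 1).tens A).X 0} (hx : g.Assoc x l m) :
    h.Assoc ((DGLA.tensMap ψ f).f 1 x) ((DGLA.tensMap (φ.app 0) f).f 1 l)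
      ((DGLA.tensMap (φ.app 1) f).f 0 m) := by
  obtain ⟨hl, p, hp0, hp1, hp⟩ := hx
  have e : ∀ n, ((h.twProj n).tn B).f 1 ((DGLA.tensMap ψ f).f 1 x) =
      (DGLA.tensMap (coefHom n (φ.app n)) f).f 1 (((g.twProj n).tn A).f 1 x) := fun n =>
    tensMap_comm_apply (hψ n) f x
  have hv : ∀ n (i : Fin (n + 1)) (j : ℤ) (y : (((omega K n).tensor (g.obj n)).tens A).X j),
      ((vtxHom n i (h.obj n)).tn B).f j ((DGLA.tensMap (coefHom n (φ.app n)) f).f j y) =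
        (DGLA.tensMap (φ.app n) f).f j (((vtxHom n i (g.obj n)).tn A).f j y) := fun n i j y =>
    tensMap_comm_apply (fun j x => vtxHom_coefHom n i (φ.app n) j x) f y
  refine ⟨?_, (DGLA.tensMap (coefHom 1 (φ.app 1)) f).f 0 p, ?_, ?_, ?_⟩
  · rw [e, hv, hl]
  · rw [hv, hp0]
  · rw [hv, hp1, map_zero]
  · rw [e, ← hp, (DGLA.tensMap (coefHom 1 (φ.app 1)) f).map_gauge (DGLA.tens_nilp _ A)]
    congr 1
    have h1 : ((h.face 0 0).tn B).f 1 ((DGLA.tensMap (φ.app 0) f).f 1 l) =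
        (DGLA.tensMap (φ.app 1) f).f 1 (((g.face 0 0).tn A).f 1 l) :=
      tensMap_comm_apply (fun j x => (φ.comm_apply 0 0 j x).symm) f l
    rw [h1]
    have h2 : ∀ y : ((g.obj 1).tens A).X 1, ((CDGA.constHom (omega K 1) (h.obj 1)).tn B).f 1
        ((DGLA.tensMap (φ.app 1) f).f 1 y) = (DGLA.tensMap (coefHom 1 (φ.app 1)) f).f 1
          (((CDGA.constHom (omega K 1) (g.obj 1)).tn A).f 1 y) := fun y =>
      tensMap_comm_apply (fun j x => (coefHom_constHom 1 (φ.app 1) j x).symm) f y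
    exact h2 _

variable [CharZero K]

theorem Assoc.rel_of_gauge {x x' : (g.totTW.tens A).X 1} (hx : (g.totTW.tens A).IsMC x)
    {z z' : (g.tens A).Z1} (h : g.Assoc x z.1.1 z.1.2) (h' : g.Assoc x' z'.1.1 z'.1.2)
    (ha : ∃ a, (g.totTW.tens A).gauge a x = x') : Z1.Rel (g.tens A) z z' := by
  obtain ⟨a, ha⟩ := ha
  exact h.rel hx h' ha

theorem exists_assoc_Z1 (x : {x // (g.totTW.tens A).IsMC x}) :
    ∃ z : (g.tens A).Z1, g.Assoc x.1 z.1.1 z.1.2 := by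
  obtain ⟨l, m, hlm⟩ := exists_assoc x.2
  exact ⟨⟨(l, m), hlm.isZ1 x.2⟩, hlm⟩

variable (g A) in
/-- The comparison map `Def_{Tot_TW}(A) → H¹_sc(A)`. -/
def compare : (g.totTW.tens A).DefSet → (g.tens A).H1Set :=
  Quot.lift (fun x => Quot.mk _ (exists_assoc_Z1 x).choose) fun x x' h =>
    Quot.sound (Assoc.rel_of_gauge x.2 (exists_assoc_Z1 x).choose_spec
      (exists_assoc_Z1 x').choose_spec h)

/-- The class does not depend on the chosen path: two pairs associated with x are related by
`Assoc.rel` for the gauge transformation 0. Hence any convenient associated pair computes the map.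
-/
theorem compare_mk (x : {x // (g.totTW.tens A).IsMC x}) (z : (g.tens A).Z1)
    (h : g.Assoc x.1 z.1.1 z.1.2) : g.compare A (Quot.mk _ x) = Quot.mk _ z :=
  Quot.sound (Assoc.rel_of_gauge x.2 (exists_assoc_Z1 x).choose_spec h ⟨0, gauge_zero _⟩)

theorem compare_map (φ : Hom g h) {ψ : DGLA.Hom g.totTW h.totTW}
    (hψ : ∀ n j x, (h.twProj n).f j (ψ.f j x) = (coefHom n (φ.app n)).f j ((g.twProj n).f j x))
    (f : A ⟶ B) (x : (g.totTW.tens A).DefSet) :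
    h.compare B (DefSet.map (DGLA.tensMap ψ f) (DGLA.tens_nilp _ A) x) =
      h1Map φ f (g.compare A x) := by
  induction x using Quot.ind with
  | mk x =>
    obtain ⟨z, hz⟩ := exists_assoc_Z1 x
    rw [compare_mk x z hz]
    exact compare_mk _ ⟨_, _⟩ (hz.map φ hψ f)

/-- The inverse sends a pair to the class of any Maurer–Cartan element associated with it. An
explicit inverse avoids the question whether the defining relations are equivalence relations. -/
theorem compare_bijective (h1 : ∀ n : ℕ, 2 ≤ n → Subsingleton ((g.obj n).H (1 - n)))
    (h2 : ∀ n : ℕ, 3 ≤ n → Subsingleton ((g.obj n).H (2 - n))) :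
    Function.Bijective (g.compare A) := by
  refine Function.bijective_iff_has_inverse.mpr ?_
  choose x hx hxz using fun z : (g.tens A).Z1 => exists_isMC_assoc h2 z.2
  refine ⟨Quot.lift (fun z => Quot.mk _ ⟨x z, hx z⟩) ?_, ?_, ?_⟩
  · rintro z z' ⟨a, ha, hs⟩
    exact Quot.sound ((hxz z).exists_gauge_eq h1 (hx z) (hx z') (hxz z') ha hs)
  · intro y
    induction y using Quot.ind with
    | mk y =>
      obtain ⟨z, hz⟩ := exists_assoc_Z1 y
      rw [compare_mk y z hz]
      refine Quot.sound ?_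
      -- Reflexivity of the relation at z, obtained from the trivial gauge transformation of y.
      obtain ⟨a, ha, hs⟩ := hz.rel y.2 hz (gauge_zero _)
      exact (hxz z).exists_gauge_eq h1 (hx z) y.2 hz ha hs
  · intro z
    induction z using Quot.ind with
    | mk z => exact compare_mk ⟨x z, hx z⟩ z (hxz z)

variable (g) in
/-- The isomorphism of functors `Def_{Tot_TW} ≅ H¹_sc`. -/
def compareIso (h1 : ∀ n : ℕ, 2 ≤ n → Subsingleton ((g.obj n).H (1 - n)))
    (h2 : ∀ n : ℕ, 3 ≤ n → Subsingleton ((g.obj n).H (2 - n))) : g.totTW.defFunctor ≅ g.h1sc :=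
  NatIso.ofComponents
    (fun A => (Equiv.ofBijective (g.compare A) (compare_bijective h1 h2)).toIso) fun {A B} f => by
      ext x
      exact compare_map (Hom.id g) (fun n j x => (coefHom_id n (g.obj n) j _).symm) f x

theorem compareIso_natural (hg1 hg2 hh1 hh2) (φ : Hom g h) :
    DGLA.defMap (totTWMap φ) ≫ (h.compareIso hh1 hh2).hom =
      (g.compareIso hg1 hg2).hom ≫ h1scMap φ := by
  ext A x
  exact compare_map φ (fun _ _ _ => rfl) (𝟙 A) x

end SemicosimplicialDGLA

/-! ### Truncation at level two. -/

namespace DGLA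

variable {K : Type u} [Field K] {L M : DGLA K}

theorem tn_bijective {φ : Hom L M} (hφ : ∀ j, Function.Bijective (φ.f j)) (A : Art K) (j : ℤ) :
    Function.Bijective ((φ.tn A).f j) := by
  have h : ((φ.tn A).f j : L.X j ⊗[K] A.max → M.X j ⊗[K] A.max) =
      (LinearEquiv.ofBijective (φ.f j) (hφ j)).rTensor A.max :=
    funext fun x => tensMap_id_f φ j x
  exact (congrArg Function.Bijective h).mpr (LinearEquiv.bijective _)

theorem Hom.isMC_of_injective (φ : Hom L M) (hφ : Function.Injective (φ.f 2)) {x : L.X 1}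
    (hx : M.IsMC (φ.f 1 x)) : L.IsMC x := by
  apply hφ
  rw [map_zero, ← hx, map_add, map_smul, φ.map_d, φ.map_br]

theorem Hom.irrStab_of_bijective (φ : Hom L M) (hφ : ∀ j, Function.Bijective (φ.f j)) {x : L.X 1}
    {a : L.X 0} (h : M.IrrStab (φ.f 1 x) (φ.f 0 a)) : L.IrrStab x a := by
  obtain ⟨n, hn⟩ := h
  obtain ⟨n, rfl⟩ := (hφ _).2 n
  refine ⟨n, (hφ 0).1 ?_⟩
  rw [hn, map_add, φ.map_d, φ.map_br]

open Classical in
/-- The projection `L → cut P L`, which is the identity if `P` holds and `0` otherwise. -/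
def toCut (P : Prop) (L : DGLA K) : Hom L (cut P L) where
  f i := LinearMap.codRestrict _ (if P then LinearMap.id else 0) fun x hP => by rw [if_neg hP]; rfl
  map_d i j h x := by
    by_cases hP : P
    · apply Subtype.ext
      change (if P then LinearMap.id else 0) (L.d i j h x) = L.d i j h ((if P then LinearMap.id else 0) x)
      rw [if_pos hP, if_pos hP]
      rfl
    · exact cut_eq hP _ _
  map_br i j k h x y := by
    by_cases hP : P
    · apply Subtype.ext
      change (if P then LinearMap.id else 0) (L.br i j k h x y) =
        L.br i j k h ((if P then LinearMap.id else 0) x) ((if P then LinearMap.id else 0) y)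
      rw [if_pos hP, if_pos hP, if_pos hP]
      rfl
    · exact cut_eq hP _ _

theorem toCut_coe {P : Prop} (hP : P) (L : DGLA K) (i : ℤ) (x : L.X i) :
    ((toCut P L).f i x).1 = x := by
  classical
  change (if P then LinearMap.id else 0 : L.X i →ₗ[K] L.X i) x = x
  rw [if_pos hP]
  rfl

theorem toCut_bijective {P : Prop} (hP : P) (L : DGLA K) (i : ℤ) :
    Function.Bijective ((toCut P L).f i) := by
  refine ⟨fun x y hxy => ?_, fun y => ⟨y.1, Subtype.ext (toCut_coe hP L i _)⟩⟩
  rw [← toCut_coe hP L i x, ← toCut_coe hP L i y, hxy]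

theorem subsingleton_H_cut {P : Prop} {i : ℤ} (h : P → Subsingleton (L.H i)) :
    Subsingleton ((cut P L).H i) := by
  refine subsingleton_H fun x hx => ?_
  by_cases hP : P
  · obtain ⟨y, hy⟩ := exists_d_eq_of_subsingleton (h hP) x.1 (congrArg Subtype.val hx)
    exact ⟨⟨y, fun h => absurd hP h⟩, Subtype.ext hy⟩
  · exact ⟨0, cut_eq hP _ _⟩

end DGLA

namespace SemicosimplicialDGLA

variable {K : Type u} [Field K] {g h : SemicosimplicialDGLA K}

open DGLA

/-- All conditions and relations that define H¹_sc take place in levels 0, 1 and 2, and isomorphisms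
reflect them. The inverse is constructed, since equality of classes need not come from a single
instance of the relation. -/
theorem H1Set.map_bijective {G G' : SemicosimplicialDGLA K} (φ : Hom G G')
    (hG : ∀ n, (G.obj n).Nilp) (hφ : ∀ n ≤ 2, ∀ j, Function.Bijective ((φ.app n).f j)) :
    Function.Bijective (H1Set.map φ hG) := by
  have h0 := hφ 0 (by omega)
  have h1 := hφ 1 (by omega)
  have h2 := hφ 2 (by omega)
  have reflect : ∀ (l : (G.obj 0).X 1) (m : (G.obj 1).X 0),
      G'.IsZ1 ((φ.app 0).f 1 l) ((φ.app 1).f 0 m) → G.IsZ1 l m := by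
    rintro l m ⟨hmc, hglue, hcoc⟩
    refine ⟨(φ.app 0).isMC_of_injective (h0 2).1 hmc, (h1 1).1 ?_, ?_⟩
    · rw [(φ.app 1).map_gauge (hG 1), φ.comm_apply, φ.comm_apply, hglue]
    · refine (φ.app 2).irrStab_of_bijective h2 ?_
      rwa [(φ.app 2).map_bch (hG 2), (φ.app 2).map_bch (hG 2), map_neg, φ.comm_apply,
        φ.comm_apply, φ.comm_apply, φ.comm_apply, φ.comm_apply]
  have rel : ∀ z w : G.Z1, Z1.Rel G' ⟨((φ.app 0).f 1 z.1.1, (φ.app 1).f 0 z.1.2), φ.map_isZ1 hG z.2⟩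
      ⟨((φ.app 0).f 1 w.1.1, (φ.app 1).f 0 w.1.2), φ.map_isZ1 hG w.2⟩ → Z1.Rel G z w := by
    rintro z w ⟨a, ha1, ha2⟩
    obtain ⟨a, rfl⟩ := (h0 0).2 a
    refine ⟨a, (h0 1).1 ?_, (φ.app 1).irrStab_of_bijective h1 ?_⟩
    · rw [(φ.app 0).map_gauge (hG 0), ha1]
    · rwa [(φ.app 1).map_bch (hG 1), (φ.app 1).map_bch (hG 1), (φ.app 1).map_bch (hG 1), map_neg,
        map_neg, φ.comm_apply, φ.comm_apply, φ.comm_apply]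
  have lift : ∀ z : G'.Z1, ∃ w : G.Z1,
      z = ⟨((φ.app 0).f 1 w.1.1, (φ.app 1).f 0 w.1.2), φ.map_isZ1 hG w.2⟩ := by
    rintro ⟨⟨l, m⟩, hz⟩
    obtain ⟨l, rfl⟩ := (h0 1).2 l
    obtain ⟨m, rfl⟩ := (h1 0).2 m
    exact ⟨⟨(l, m), reflect l m hz⟩, rfl⟩
  refine Function.bijective_iff_has_inverse.mpr ?_
  choose w hw using lift
  refine ⟨Quot.lift (fun z => Quot.mk _ (w z)) fun z z' hzz => Quot.sound (rel _ _ ?_), ?_, ?_⟩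
  · rw [← hw, ← hw]; exact hzz
  · intro z
    induction z using Quot.ind with
    | mk z =>
      refine congrArg (Quot.mk _) (Subtype.ext ?_)
      have := congrArg Subtype.val (hw ⟨((φ.app 0).f 1 z.1.1, (φ.app 1).f 0 z.1.2), φ.map_isZ1 hG z.2⟩)
      exact Prod.ext ((h0 1).1 (congrArg Prod.fst this)).symm ((h1 0).1 (congrArg Prod.snd this)).symm
  · intro z
    induction z using Quot.ind with
    | mk z => exact congrArg (Quot.mk _) (hw z).symm

/-- The projection of a semicosimplicial DGLA to its truncation. -/
def toTrunc (N : ℕ) (g : SemicosimplicialDGLA K) : Hom g (g.trunc N) where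
  app n := toCut (n ≤ N) (g.obj n)
  comm n k := by
    ext i x
    change (g.obj n).X i at x
    by_cases hQ : n + 1 ≤ N
    · have h1 : n ≤ N := by omega
      apply Subtype.ext
      change ((cutMap (n ≤ N) (n + 1 ≤ N) (g.face n k)).f i ((toCut (n ≤ N) (g.obj n)).f i x)).1 =
        ((toCut (n + 1 ≤ N) (g.obj (n + 1))).f i ((g.face n k).f i x)).1
      rw [cutMap_coe _ hQ, toCut_coe h1, toCut_coe hQ]
    · exact cut_eq hQ _ _

theorem toTrunc_natural (N : ℕ) (φ : Hom g h) (n : ℕ) :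
    ((toTrunc N g).app n).comp ((truncMap N φ).app n) = (φ.app n).comp ((toTrunc N h).app n) := by
  ext i x
  by_cases hn : n ≤ N
  · apply Subtype.ext
    change ((cutMap (n ≤ N) (n ≤ N) (φ.app n)).f i ((toCut (n ≤ N) (g.obj n)).f i x)).1 =
      ((toCut (n ≤ N) (h.obj n)).f i ((φ.app n).f i x)).1
    rw [cutMap_coe _ hn, toCut_coe hn, toCut_coe hn]
  · exact cut_eq hn _ _

/-- The functor `H¹_sc` only depends on the levels up to two. -/
def truncIso (g : SemicosimplicialDGLA K) : g.h1sc ≅ (g.trunc 2).h1sc :=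
  NatIso.ofComponents
    (fun A => (Equiv.ofBijective (h1Map (toTrunc 2 g) (𝟙 A)) (H1Set.map_bijective _ _ fun n hn j =>
      tn_bijective (fun j => toCut_bijective hn (g.obj n) j) A j)).toIso)
    fun f => (h1scMap (toTrunc 2 g)).naturality f

theorem truncIso_natural (φ : Hom g h) :
    g.truncIso.hom ≫ h1scMap (truncMap 2 φ) = h1scMap φ ≫ h.truncIso.hom := by
  let χ : Hom g (h.trunc 2) :=
    { app := fun n => ((toTrunc 2 g).app n).comp ((truncMap 2 φ).app n)
      comm := fun n k => Hom.ext (funext fun j => LinearMap.ext fun x => by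
        change ((h.trunc 2).face n k).f j (((truncMap 2 φ).app n).f j (((toTrunc 2 g).app n).f j x)) =
          ((truncMap 2 φ).app (n + 1)).f j (((toTrunc 2 g).app (n + 1)).f j ((g.face n k).f j x))
        exact (((truncMap 2 φ).comm_apply n k j _).symm.trans
          (congrArg _ ((toTrunc 2 g).comm_apply n k j x).symm))) }
  ext A x
  have h1 := h1Map_comp (toTrunc 2 g) (truncMap 2 φ) χ (fun _ => rfl) (𝟙 A) (𝟙 A) x
  have h2 := h1Map_comp φ (toTrunc 2 h) χ (toTrunc_natural 2 φ) (𝟙 A) (𝟙 A) x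
  exact h1.symm.trans h2

theorem trunc_subsingleton_H (hg : Subsingleton ((g.obj 2).H (-1))) (n : ℕ) (hn : 2 ≤ n) :
    Subsingleton (((g.trunc 2).obj n).H (1 - n)) := by
  refine subsingleton_H_cut fun h => ?_
  obtain rfl : n = 2 := le_antisymm h hn
  exact hg

theorem trunc_subsingleton_H_of_lt (n : ℕ) (hn : 3 ≤ n) (i : ℤ) :
    Subsingleton (((g.trunc 2).obj n).H i) :=
  subsingleton_H_cut fun h => by omega

/-- The isomorphism `Def_{Tot_TW} ≅ H¹_sc` for the truncation. -/
def truncCompareIso [CharZero K] (g : SemicosimplicialDGLA K) (hg : Subsingleton ((g.obj 2).H (-1))) :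
    (g.trunc 2).totTW.defFunctor ≅ g.h1sc :=
  (g.trunc 2).compareIso (trunc_subsingleton_H hg) (fun n hn => trunc_subsingleton_H_of_lt n hn _) ≪≫
    g.truncIso.symm

theorem truncCompareIso_natural [CharZero K] (hg : Subsingleton ((g.obj 2).H (-1)))
    (hh : Subsingleton ((h.obj 2).H (-1))) (φ : Hom g h) :
    DGLA.defMap (totTWMap (truncMap 2 φ)) ≫ (h.truncCompareIso hh).hom =
      (g.truncCompareIso hg).hom ≫ h1scMap φ := by
  rw [truncCompareIso, truncCompareIso, Iso.trans_hom, Iso.trans_hom, Iso.symm_hom, Iso.symm_hom,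
    ← Category.assoc, compareIso_natural (trunc_subsingleton_H hg)
      (fun n hn => trunc_subsingleton_H_of_lt n hn _), Category.assoc, Category.assoc]
  congr 1
  rw [Iso.comp_inv_eq, Category.assoc, ← truncIso_natural, Iso.inv_hom_id_assoc]

end SemicosimplicialDGLA

/-! ### Tangent spaces -/

section

variable {K : Type u} [Field K]

theorem contr_add {V m : Type*} [AddCommGroup V] [Module K V] [AddCommGroup m] [Module K m]
    (φ ψ : Module.Dual K m) (z : V ⊗[K] m) : contr (φ + ψ) z = contr φ z + contr ψ z := by
  simp [contr, LinearMap.lTensor_add]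

theorem contr_smul {V m : Type*} [AddCommGroup V] [Module K V] [AddCommGroup m] [Module K m]
    (c : K) (φ : Module.Dual K m) (z : V ⊗[K] m) : contr (c • φ) z = c • contr φ z := by
  simp [contr, LinearMap.lTensor_smul]

theorem contr_lTensor {V m n : Type*} [AddCommGroup V] [Module K V] [AddCommGroup m] [Module K m]
    [AddCommGroup n] [Module K n] (φ : Module.Dual K n) (f : m →ₗ[K] n) (z : V ⊗[K] m) :
    contr φ (f.lTensor V z) = contr (φ ∘ₗ f) z := by
  simp [contr, LinearMap.lTensor_comp]

end

namespace DGLA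

variable {K : Type u} [Field K] {L : DGLA K} {A B : Art K}

theorem br_eq_zero_of_maxMul (hA : ∀ a b, A.maxMul a b = 0) {i j k : ℤ} (h : i + j = k)
    (s : (L.tens A).X i) (t : (L.tens A).X j) : (L.tens A).br i j k h s t = 0 := by
  change L.X i ⊗[K] A.max at s
  change L.X j ⊗[K] A.max at t
  change TensorProduct.map₂ (L.br i j k h) A.maxMul s t = 0
  induction s with
  | zero => simp
  | add s s' hs hs' => rw [map_add, LinearMap.add_apply, hs, hs', add_zero]
  | tmul x a =>
    induction t with
    | zero => simp
    | add t t' ht ht' => rw [map_add, ht, ht', add_zero]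
    | tmul y b => rw [map₂_tmul_tmul, hA, TensorProduct.tmul_zero]

theorem isMC_iff_of_maxMul (hA : ∀ a b, A.maxMul a b = 0) (x : (L.tens A).X 1) :
    (L.tens A).IsMC x ↔ (L.tens A).d 1 2 one_add_one_eq_two x = 0 := by
  rw [IsMC, br_eq_zero_of_maxMul hA, smul_zero, add_zero]

theorem gauge_of_maxMul (hA : ∀ a b, A.maxMul a b = 0) (a : (L.tens A).X 0) (x : (L.tens A).X 1) :
    (L.tens A).gauge a x = x - (L.tens A).d 0 1 (zero_add 1) a := by
  have h0 : (L.tens A).ad₁ a = 0 := LinearMap.ext fun y => br_eq_zero_of_maxMul hA _ a y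
  rw [gauge, h0, finsum_eq_single _ 0 fun n hn => by rw [zero_pow hn, LinearMap.zero_apply, smul_zero]]
  simp [sub_eq_add_neg]

variable {T : Type u} [AddCommGroup T] [Module K T] (q : L.X 1 →ₗ[K] T)

/-- The class of a first order deformation, evaluated on a functional on `𝔪_A`. -/
def tangentClass (hqd : ∀ u, q (L.d 0 1 (zero_add 1) u) = 0) (hA : ∀ a b, A.maxMul a b = 0)
    (φ : Module.Dual K A.max) : (L.tens A).DefSet → T :=
  Quot.lift (fun x => q (contr (V := L.X 1) φ x.1)) fun x y ⟨a, ha⟩ => by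
    rw [gauge_of_maxMul hA] at ha
    have h1 : contr (V := L.X 1) φ ((L.tens A).d 0 1 (zero_add 1) a) =
        L.d 0 1 (zero_add 1) (contr (V := L.X 0) φ a) := contr_rTensor φ _ a
    have h2 : contr (V := L.X 1) φ (x.1 - (L.tens A).d 0 1 (zero_add 1) a) =
      contr (V := L.X 1) φ x.1 - contr (V := L.X 1) φ ((L.tens A).d 0 1 (zero_add 1) a) :=
        map_sub _ _ _
    rw [← ha, h2, h1, map_sub, hqd, sub_zero]

theorem tangentClass_map (hqd : ∀ u, q (L.d 0 1 (zero_add 1) u) = 0)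
    (hA : ∀ a b, A.maxMul a b = 0) (hB : ∀ a b, B.maxMul a b = 0) (f : A ⟶ B)
    (φ : Module.Dual K B.max) (x : L.defFunctor.obj A) :
    tangentClass q hqd hB φ (L.defFunctor.map f x) =
      tangentClass q hqd hA (φ ∘ₗ Art.maxMap f) x := by
  induction x using Quot.ind with
  | mk x => exact congrArg q (contr_lTensor φ (Art.maxMap f) x.1)

theorem tangentClass_add (hqd : ∀ u, q (L.d 0 1 (zero_add 1) u) = 0)
    (hA : ∀ a b, A.maxMul a b = 0) (φ ψ : Module.Dual K A.max) (x : (L.tens A).DefSet) :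
    tangentClass q hqd hA (φ + ψ) x = tangentClass q hqd hA φ x + tangentClass q hqd hA ψ x := by
  induction x using Quot.ind with
  | mk x => exact (congrArg q (contr_add φ ψ x.1)).trans (map_add _ _ _)

theorem tangentClass_smul (hqd : ∀ u, q (L.d 0 1 (zero_add 1) u) = 0)
    (hA : ∀ a b, A.maxMul a b = 0) (c : K) (φ : Module.Dual K A.max) (x : (L.tens A).DefSet) :
    tangentClass q hqd hA (c • φ) x = c • tangentClass q hqd hA φ x := by
  induction x using Quot.ind with
  | mk x => exact (congrArg q (contr_smul c φ x.1)).trans (map_smul _ _ _)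

/-- With zero multiplication, Maurer–Cartan elements are cocycles and the gauge action subtracts
coboundaries. If all contractions of x - y are exact, then so is x - y, by solving coefficientwise;
`S = Empty` means that there are no side conditions. -/
theorem eq_of_tangentClass
    (hq : ∀ z, L.d 1 2 one_add_one_eq_two z = 0 → q z = 0 → ∃ u, L.d 0 1 (zero_add 1) u = z)
    (hqd : ∀ u, q (L.d 0 1 (zero_add 1) u) = 0) (hA : ∀ a b, A.maxMul a b = 0)
    (x y : (L.tens A).DefSet)
    (h : ∀ φ, tangentClass q hqd hA φ x = tangentClass q hqd hA φ y) : x = y := by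
  induction x using Quot.ind with
  | mk x =>
  induction y using Quot.ind with
  | mk y =>
  let x' : L.X 1 ⊗[K] A.max := x.1
  let y' : L.X 1 ⊗[K] A.max := y.1
  have hx : (L.d 1 2 one_add_one_eq_two).rTensor A.max x' = 0 := (isMC_iff_of_maxMul hA x.1).mp x.2
  have hy : (L.d 1 2 one_add_one_eq_two).rTensor A.max y' = 0 := (isMC_iff_of_maxMul hA y.1).mp y.2
  obtain ⟨u, hu, -⟩ := exists_tensor_of_forall_contr (m := A.max) (S := Empty) (V := fun _ => K)
    (L.d 0 1 (zero_add 1)) (fun s => s.elim)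
    (fun v _ => L.d 1 2 one_add_one_eq_two v = 0 ∧ q v = 0) (fun v w hv => by
      obtain ⟨u, hu⟩ := hq v hv.1 hv.2
      exact ⟨u, hu, fun s => s.elim⟩) (x' - y') (fun s => s.elim) (fun φ => by
      refine ⟨?_, ?_⟩
      · rw [← contr_rTensor, map_sub, hx, hy, sub_zero, map_zero]
      · rw [map_sub, map_sub, sub_eq_zero]
        exact h φ)
  refine Quot.sound ⟨u, ?_⟩
  refine (gauge_of_maxMul hA _ _).trans ?_
  change x' - (L.d 0 1 (zero_add 1)).rTensor A.max u = y'
  rw [hu, sub_sub_cancel]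

end DGLA

namespace Art

variable {K : Type u} [Field K]

section SqZero

variable (V : Type u) [AddCommGroup V] [Module K V] [Module Kᵐᵒᵖ V] [IsCentralScalar K V]
  [Module.Finite K V]

theorem mem_max_sqZero (a : TrivSqZeroExt K V) :
    (show (sqZero (K := K) V).carrier from a) ∈ (sqZero (K := K) V).max ↔ a.fst = 0 := by
  have : IsUnit (show (sqZero (K := K) V).carrier from a) ↔ IsUnit a.fst :=
    TrivSqZeroExt.isUnit_iff_isUnit_fst
  rw [IsLocalRing.mem_maximalIdeal, mem_nonunits_iff, this, isUnit_iff_ne_zero, not_not]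

/-- The identification of the maximal ideal of `K ⊕ V` with `V`. -/
def sqZeroMax : (sqZero (K := K) V).max ≃ₗ[K] V where
  toFun a := TrivSqZeroExt.snd (R := K) a.1
  invFun v := ⟨TrivSqZeroExt.inr v, (mem_max_sqZero V _).mpr (TrivSqZeroExt.fst_inr K v)⟩
  map_add' _ _ := rfl
  map_smul' _ _ := rfl
  left_inv a := Subtype.ext (TrivSqZeroExt.ext ((mem_max_sqZero V a.1).mp a.2).symm rfl)
  right_inv _ := rfl

theorem maxMul_sqZero (a b : (sqZero (K := K) V).max) : (sqZero (K := K) V).maxMul a b = 0 := by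
  obtain ⟨v, rfl⟩ := (sqZeroMax (K := K) V).symm.surjective a
  obtain ⟨w, rfl⟩ := (sqZeroMax (K := K) V).symm.surjective b
  exact Subtype.ext (TrivSqZeroExt.inr_mul_inr K v w)

variable {V} {W : Type u} [AddCommGroup W] [Module K W] [Module Kᵐᵒᵖ W] [IsCentralScalar K W]
  [Module.Finite K W]

theorem sqZeroMax_map (f : V →ₗ[K] W) :
    (sqZeroMax W).toLinearMap ∘ₗ maxMap (sqZeroMap f) = f ∘ₗ (sqZeroMax (K := K) V).toLinearMap :=
  LinearMap.ext fun a => TrivSqZeroExt.snd_map f (a.1 : TrivSqZeroExt K V)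

end SqZero

variable {L : DGLA K} {T : Type u} [AddCommGroup T] [Module K T]

section SqZeroClass

variable (q : L.X 1 →ₗ[K] T) (hqd : ∀ u, q (L.d 0 1 (zero_add 1) u) = 0)
  (V : Type u) [AddCommGroup V] [Module K V] [Module Kᵐᵒᵖ V] [IsCentralScalar K V]
  [Module.Finite K V]

/-- The class of a deformation over `K ⊕ V`, evaluated on a functional on `V`. -/
def sqZeroClass (φ : Module.Dual K V) (x : L.defFunctor.obj (sqZero V)) : T :=
  DGLA.tangentClass q hqd (maxMul_sqZero V) (φ ∘ₗ (sqZeroMax V).toLinearMap) x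

theorem sqZeroClass_ext
    (hq : ∀ z, L.d 1 2 one_add_one_eq_two z = 0 → q z = 0 → ∃ u, L.d 0 1 (zero_add 1) u = z)
    (x y : L.defFunctor.obj (sqZero V))
    (h : ∀ φ, sqZeroClass q hqd V φ x = sqZeroClass q hqd V φ y) : x = y := by
  refine DGLA.eq_of_tangentClass q hq hqd (maxMul_sqZero V) x y fun φ => ?_
  have e : (φ ∘ₗ (sqZeroMax V).symm.toLinearMap) ∘ₗ (sqZeroMax V).toLinearMap = φ := by
    ext; simp
  have := h (φ ∘ₗ (sqZeroMax V).symm.toLinearMap)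
  rwa [sqZeroClass, sqZeroClass, e] at this

theorem sqZeroClass_add (φ ψ : Module.Dual K V) (x : L.defFunctor.obj (sqZero V)) :
    sqZeroClass q hqd V (φ + ψ) x = sqZeroClass q hqd V φ x + sqZeroClass q hqd V ψ x := by
  rw [sqZeroClass, LinearMap.add_comp]
  exact DGLA.tangentClass_add q hqd (maxMul_sqZero V) _ _ x

theorem sqZeroClass_smul (c : K) (φ : Module.Dual K V) (x : L.defFunctor.obj (sqZero V)) :
    sqZeroClass q hqd V (c • φ) x = c • sqZeroClass q hqd V φ x := by
  rw [sqZeroClass, LinearMap.smul_comp]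
  exact DGLA.tangentClass_smul q hqd (maxMul_sqZero V) c _ x

variable {V} {W : Type u} [AddCommGroup W] [Module K W] [Module Kᵐᵒᵖ W] [IsCentralScalar K W]
  [Module.Finite K W]

theorem sqZeroClass_map (f : V →ₗ[K] W) (φ : Module.Dual K W) (x : L.defFunctor.obj (sqZero V)) :
    sqZeroClass q hqd W φ (L.defFunctor.map (sqZeroMap f) x) = sqZeroClass q hqd V (φ ∘ₗ f) x := by
  refine (DGLA.tangentClass_map q hqd (maxMul_sqZero V) (maxMul_sqZero W) _ _ x).trans ?_
  rw [LinearMap.comp_assoc, sqZeroMax_map, sqZeroClass, LinearMap.comp_assoc]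

/-- Two summands suffice: with t = 0 this gives surjectivity onto T, and on K × K with the two basis
vectors it gives a common lift of two tangent vectors. -/
theorem exists_sqZeroClass_eq (hqs : ∀ t, ∃ z, L.d 1 2 one_add_one_eq_two z = 0 ∧ q z = t)
    (v w : V) (s t : T) : ∃ x : L.defFunctor.obj (sqZero V),
      ∀ φ, sqZeroClass q hqd V φ x = φ v • s + φ w • t := by
  obtain ⟨y, hy, rfl⟩ := hqs s
  obtain ⟨z, hz, rfl⟩ := hqs t
  let x : L.X 1 ⊗[K] (sqZero (K := K) V).max :=
    y ⊗ₜ (sqZeroMax V).symm v + z ⊗ₜ (sqZeroMax V).symm w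
  have hx : (L.d 1 2 one_add_one_eq_two).rTensor (sqZero (K := K) V).max x = 0 := by
    simp only [x, map_add, LinearMap.rTensor_tmul, hy, hz, TensorProduct.zero_tmul, add_zero]
  refine ⟨Quot.mk _ ⟨x, (DGLA.isMC_iff_of_maxMul (maxMul_sqZero V) x).mpr hx⟩, fun φ => ?_⟩
  change q (contr (φ ∘ₗ (sqZeroMax V).toLinearMap) x) = _
  simp only [x, map_add, contr_tmul, map_smul, LinearMap.comp_apply, LinearEquiv.coe_coe,
    LinearEquiv.apply_symm_apply]

end SqZeroClass

/-- The tangent space of a deformation functor. -/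
theorem tangentIso_defFunctor (q : L.X 1 →ₗ[K] T)
    (hq : ∀ z, L.d 1 2 one_add_one_eq_two z = 0 → q z = 0 → ∃ u, L.d 0 1 (zero_add 1) u = z)
    (hqd : ∀ u, q (L.d 0 1 (zero_add 1) u) = 0)
    (hqs : ∀ t, ∃ z, L.d 1 2 one_add_one_eq_two z = 0 ∧ q z = t) :
    Nonempty (TangentIso L.defFunctor T) := by
  have hdual : ∀ φ : Module.Dual K K, φ = φ 1 • LinearMap.id := fun φ => by ext; simp
  have hinj : ∀ x y : L.defFunctor.obj (sqZero K), sqZeroClass q hqd K LinearMap.id x =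
      sqZeroClass q hqd K LinearMap.id y → x = y := by
    intro x y h
    refine sqZeroClass_ext q hqd K hq x y fun φ => ?_
    rw [hdual φ, sqZeroClass_smul, sqZeroClass_smul, h]
  refine ⟨⟨Equiv.ofBijective (sqZeroClass q hqd K LinearMap.id)
    ⟨fun x y => hinj x y, fun t => ?_⟩, ⟨?_, ?_⟩, ?_, ?_⟩⟩
  · obtain ⟨x, hx⟩ := exists_sqZeroClass_eq q hqd hqs (1 : K) 0 t 0
    exact ⟨x, by rw [hx]; simp⟩
  · intro x y h
    have h1 := congrArg (fun p => sqZeroClass q hqd K LinearMap.id p.1) h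
    have h2 := congrArg (fun p => sqZeroClass q hqd K LinearMap.id p.2) h
    simp only [sqZeroClass_map] at h1 h2
    refine sqZeroClass_ext q hqd _ hq x y fun φ => ?_
    have : φ = φ (1, 0) • (LinearMap.id ∘ₗ LinearMap.fst K K K) +
        φ (0, 1) • (LinearMap.id ∘ₗ LinearMap.snd K K K) := by
      ext <;> simp
    rw [this, sqZeroClass_add, sqZeroClass_add, sqZeroClass_smul, sqZeroClass_smul,
      sqZeroClass_smul, sqZeroClass_smul, h1, h2]
  · rintro ⟨x, y⟩
    obtain ⟨z, hz⟩ := exists_sqZeroClass_eq q hqd hqs ((1, 0) : K × K) (0, 1)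
      (sqZeroClass q hqd K LinearMap.id x) (sqZeroClass q hqd K LinearMap.id y)
    refine ⟨z, Prod.ext (hinj _ _ ?_) (hinj _ _ ?_)⟩
    · rw [sqZeroClass_map, hz]; simp
    · rw [sqZeroClass_map, hz]; simp
  · intro z
    change sqZeroClass q hqd K LinearMap.id _ =
      sqZeroClass q hqd K LinearMap.id _ + sqZeroClass q hqd K LinearMap.id _
    rw [sqZeroClass_map, sqZeroClass_map, sqZeroClass_map, ← sqZeroClass_add, LinearMap.comp_add]
  · intro c x
    change sqZeroClass q hqd K LinearMap.id _ = c • sqZeroClass q hqd K LinearMap.id _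
    rw [sqZeroClass_map, ← sqZeroClass_smul, LinearMap.comp_smul, LinearMap.id_comp]

theorem inv_app_map {F G : Art K ⥤ Type u} (e : F ≅ G) {A B : Art K} (f : A ⟶ B) (x : G.obj A) :
    e.inv.app B (G.map f x) = F.map f (e.inv.app A x) :=
  ConcreteCategory.congr_hom (e.inv.naturality f) x

/-- Transport of a tangent space along an isomorphism of functors. -/
def TangentIso.ofIso {F G : Art K ⥤ Type u} (e : F ≅ G) (t : TangentIso F T) : TangentIso G T where
  equiv := (e.app (sqZero K)).toEquiv.symm.trans t.equiv
  bijective := by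
    let E := fun A => (e.app A).toEquiv.symm
    have h := t.bijective.comp (E (sqZero (K × K))).bijective
    refine (Function.Bijective.of_comp_iff'
      ((E (sqZero K)).prodCongr (E (sqZero K))).bijective _).mp ?_
    refine (congrArg Function.Bijective (funext fun z => ?_)).mpr h
    exact Prod.ext (inv_app_map e _ z) (inv_app_map e _ z)
  map_add z := by
    have h := t.map_add (e.inv.app _ z)
    rw [← inv_app_map, ← inv_app_map, ← inv_app_map] at h
    exact h
  map_smul c x := by
    have h := t.map_smul c (e.inv.app _ x)
    rw [← inv_app_map] at h
    exact h

/-- Transport of an obstruction theory along an isomorphism of functors. -/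
def ObstructionTheory.ofIso {F G : Art K ⥤ Type u} (e : F ≅ G) (t : ObstructionTheory F T) :
    ObstructionTheory G T where
  ob π hπ x := t.ob π hπ (e.inv.app _ x)
  natural π π' hπ hπ' β α w x := by
    rw [inv_app_map, t.natural π π' hπ hπ' β α w]
  complete {B A} π hπ x := by
    rw [t.complete]
    constructor
    · rintro ⟨y, hy⟩
      refine ⟨e.hom.app B y, ?_⟩
      have := inv_app_map e.symm π y
      refine this.symm.trans ((congrArg (e.hom.app A) hy).trans ?_)
      exact ConcreteCategory.congr_hom (e.inv_hom_id_app A) x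
    · rintro ⟨y, rfl⟩
      exact ⟨e.inv.app B y, (inv_app_map e π y).symm⟩

end Art

/-! ### Obstructions -/

theorem nexp_apply_of_apply_eq_zero {K V : Type*} [Field K] [CharZero K] [AddCommGroup V] [Module K V]
    {a : Module.End K V} (ha : IsNilpotent a) {v : V} (hv : a v = 0) : nexp K a v = v := by
  obtain ⟨k, hk⟩ := ha
  rw [nexp_apply_eq_sum K (k := k + 1) (by rw [pow_succ, hk, zero_mul]), Finset.sum_range_succ',
    Finset.sum_eq_zero fun i _ => by rw [pow_succ, Module.End.mul_apply, hv, map_zero, smul_zero]]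
  simp

namespace Art

variable {K : Type u} [Field K] {A B : Art K}

theorem mem_max_of_map {π : B ⟶ A} {b : B.carrier} (h : Hom.alg π b ∈ A.max) : b ∈ B.max := by
  rw [IsLocalRing.mem_maximalIdeal, mem_nonunits_iff] at h ⊢
  exact fun hb => h (hb.map (Hom.alg π))

/-- The inclusion of the kernel of `B → A` in `𝔪_B`. -/
def kerIncl (π : B ⟶ A) : ker π →ₗ[K] B.max where
  toFun x := ⟨x.1, mem_max_of_map (π := π) (by rw [(RingHom.mem_ker).mp x.2]; exact zero_mem _)⟩
  map_add' _ _ := rfl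
  map_smul' _ _ := rfl

theorem kerIncl_injective (π : B ⟶ A) : Function.Injective (kerIncl π) := fun _ _ h =>
  Subtype.ext (congrArg (fun b : B.max => b.1) h)

theorem exact_kerIncl (π : B ⟶ A) : Function.Exact (kerIncl π) (maxMap π) := by
  intro b
  constructor
  · intro h
    exact ⟨⟨b.1, congrArg Subtype.val h⟩, rfl⟩
  · rintro ⟨x, rfl⟩
    exact Subtype.ext x.2

theorem IsSmallExtension.maxMap_surjective {π : B ⟶ A} (hπ : IsSmallExtension π) :
    Function.Surjective (maxMap π) := by
  rintro ⟨a, ha⟩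
  obtain ⟨b, rfl⟩ := hπ.surjective a
  exact ⟨⟨b, mem_max_of_map ha⟩, rfl⟩

theorem IsSmallExtension.maxMul_kerIncl {π : B ⟶ A} (hπ : IsSmallExtension π) (b : B.max)
    (x : ker π) : B.maxMul b (kerIncl π x) = 0 :=
  Subtype.ext (hπ.mul_eq_zero b.1 b.2 x.1 x.2)

end Art

namespace DGLA

variable {K : Type u} [Field K] {L : DGLA K} {A B : Art K}

open Art

/-- The inclusion `L ⊗ J → L ⊗ 𝔪_B`. -/
def kerTens (L : DGLA K) (π : B ⟶ A) (i : ℤ) : L.X i ⊗[K] ker π →ₗ[K] (L.tens B).X i :=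
  (kerIncl π).lTensor (L.X i)

theorem kerTens_injective (π : B ⟶ A) (i : ℤ) : Function.Injective (L.kerTens π i) :=
  Module.Flat.lTensor_preserves_injective_linearMap _ (kerIncl_injective π)

theorem d_kerTens (π : B ⟶ A) (i j : ℤ) (h : i + 1 = j) (r : L.X i ⊗[K] ker π) :
    (L.tens B).d i j h (L.kerTens π i r) = L.kerTens π j ((L.d i j h).rTensor (ker π) r) :=
  rTensor_lTensor_comm _ _ _

theorem tensMap_kerTens (π : B ⟶ A) (i : ℤ) (r : L.X i ⊗[K] ker π) :
    (tensMap (Hom.id L) π).f i (L.kerTens π i r) = 0 := by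
  refine (LinearMap.lTensor_comp_apply (L.X i) (maxMap π) (kerIncl π) r).symm.trans ?_
  rw [(exact_kerIncl π).linearMap_comp_eq_zero, LinearMap.lTensor_zero]
  rfl

theorem exists_kerTens_eq {π : B ⟶ A} (hπ : IsSmallExtension π) {i : ℤ} {t : (L.tens B).X i}
    (ht : (tensMap (Hom.id L) π).f i t = 0) : ∃ r, L.kerTens π i r = t :=
  (lTensor_exact (L.X i) (exact_kerIncl π) hπ.maxMap_surjective t).mp ht

theorem exists_tensMap_eq {π : B ⟶ A} (hπ : IsSmallExtension π) {i : ℤ} (t : (L.tens A).X i) :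
    ∃ s, (tensMap (Hom.id L) π).f i s = t :=
  LinearMap.lTensor_surjective (L.X i) hπ.maxMap_surjective t

theorem br_kerTens {π : B ⟶ A} (hπ : IsSmallExtension π) {i j k : ℤ} (h : i + j = k)
    (s : (L.tens B).X i) (r : L.X j ⊗[K] ker π) : (L.tens B).br i j k h s (L.kerTens π j r) = 0 := by
  change L.X i ⊗[K] B.max at s
  change TensorProduct.map₂ (L.br i j k h) B.maxMul s ((kerIncl π).lTensor (L.X j) r) = 0
  induction s with
  | zero => simp
  | add s s' hs hs' => rw [map_add, LinearMap.add_apply, hs, hs', add_zero]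
  | tmul x a =>
    induction r with
    | zero => simp
    | add t t' ht ht' => rw [map_add, map_add, ht, ht', add_zero]
    | tmul y b => rw [LinearMap.lTensor_tmul, map₂_tmul_tmul, hπ.maxMul_kerIncl,
        TensorProduct.tmul_zero]

theorem kerTens_br {π : B ⟶ A} (hπ : IsSmallExtension π) {i j k : ℤ} (h : i + j = k)
    (s : (L.tens B).X j) (r : L.X i ⊗[K] ker π) : (L.tens B).br i j k h (L.kerTens π i r) s = 0 := by
  rw [(L.tens B).br_symm i j k h (by omega), br_kerTens hπ, smul_zero, neg_zero]

/-- Brackets with L ⊗ J vanish because 𝔪_B J = 0. So a different lift changes the curvature by a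
coboundary, and only its cohomology class is an invariant. -/
theorem curv_sub_kerTens {π : B ⟶ A} (hπ : IsSmallExtension π) (x : (L.tens B).X 1)
    (y : L.X 1 ⊗[K] ker π) : (L.tens B).curv (x - L.kerTens π 1 y) =
      (L.tens B).curv x - L.kerTens π 2 ((L.d 1 2 one_add_one_eq_two).rTensor (ker π) y) := by
  rw [curv_sub, br_kerTens hπ, kerTens_br hπ, add_zero, smul_zero, sub_zero, d_kerTens]

variable {V : Type u} [AddCommGroup V] [Module K V]

/-- `o` is the obstruction to lifting `x` to `B`: the class of the curvature of a lift. -/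
def IsOb (q : L.X 2 →ₗ[K] V) (π : B ⟶ A) (x : (L.tens A).X 1) (o : V ⊗[K] ker π) : Prop :=
  ∃ (y : (L.tens B).X 1) (r : L.X 2 ⊗[K] ker π), (tensMap (Hom.id L) π).f 1 y = x ∧
    L.kerTens π 2 r = (L.tens B).curv y ∧ q.rTensor (ker π) r = o

variable (q : L.X 2 →ₗ[K] V)

theorem exists_isOb {π : B ⟶ A} (hπ : IsSmallExtension π) {x : (L.tens A).X 1}
    (hx : (L.tens A).IsMC x) : ∃ o, IsOb q π x o := by
  obtain ⟨y, rfl⟩ := exists_tensMap_eq hπ x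
  obtain ⟨r, hr⟩ := exists_kerTens_eq hπ (t := (L.tens B).curv y) ((Hom.map_curv _ y).trans hx)
  exact ⟨_, y, r, rfl, hr, rfl⟩

/-- The gauge element lifts to B and transforms the curvature of the lift by the exponential of a
bracket, which is trivial on L² ⊗ J. -/
theorem IsOb.gauge [CharZero K] {q : L.X 2 →ₗ[K] V} {π : B ⟶ A} (hπ : IsSmallExtension π) {x : (L.tens A).X 1}
    {o : V ⊗[K] ker π} (h : IsOb q π x o) (a : (L.tens A).X 0) :
    IsOb q π ((L.tens A).gauge a x) o := by
  obtain ⟨y, r, rfl, hr, ho⟩ := h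
  obtain ⟨b, rfl⟩ := exists_tensMap_eq hπ a
  refine ⟨(L.tens B).gauge b y, r, Hom.map_gauge _ (L.tens_nilp B) b y, ?_, ho⟩
  rw [curv_gauge, ← hr]
  exact (nexp_apply_of_apply_eq_zero (isNilpotent_act 2 b) (br_kerTens hπ _ b r)).symm

theorem IsOb.unique {q : L.X 2 →ₗ[K] V} (hqd : ∀ u, q (L.d 1 2 one_add_one_eq_two u) = 0)
    {π : B ⟶ A} (hπ : IsSmallExtension π) {x : (L.tens A).X 1} {o o' : V ⊗[K] ker π}
    (h : IsOb q π x o) (h' : IsOb q π x o') : o = o' := by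
  obtain ⟨y, r, hy, hr, rfl⟩ := h
  obtain ⟨y', r', hy', hr', rfl⟩ := h'
  obtain ⟨z, hz⟩ := exists_kerTens_eq hπ (t := y - y') (by rw [map_sub, hy, hy', sub_self])
  have h1 := curv_sub_kerTens hπ y z
  rw [hz, sub_sub_cancel, ← hr', ← hr, ← map_sub] at h1
  rw [kerTens_injective π 2 h1, map_sub, ← LinearMap.comp_apply, ← LinearMap.rTensor_comp,
    show q ∘ₗ L.d 1 2 one_add_one_eq_two = 0 from LinearMap.ext hqd, LinearMap.rTensor_zero,
    LinearMap.zero_apply, sub_zero]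

theorem IsOb.map {q : L.X 2 →ₗ[K] V} {B' A' : Art K} {π : B ⟶ A} {π' : B' ⟶ A'} {β : B ⟶ B'}
    {α : A ⟶ A'} (w : π ≫ α = β ≫ π') {x : (L.tens A).X 1} {o : V ⊗[K] ker π}
    (h : IsOb q π x o) :
    IsOb q π' ((tensMap (Hom.id L) α).f 1 x) ((kerMap π π' β α w).lTensor V o) := by
  obtain ⟨y, r, rfl, hr, rfl⟩ := h
  refine ⟨(tensMap (Hom.id L) β).f 1 y, (kerMap π π' β α w).lTensor (L.X 2) r, ?_, ?_, ?_⟩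
  · have h1 := tensMap_comp (Hom.id L) (Hom.id L) β π'
    have h2 := tensMap_comp (Hom.id L) (Hom.id L) π α
    rw [w, h1] at h2
    exact congrArg (fun χ : Hom _ _ => χ.f 1 y) h2
  · rw [← Hom.map_curv, ← hr]
    have h1 : kerIncl π' ∘ₗ kerMap π π' β α w = maxMap β ∘ₗ kerIncl π := rfl
    refine (LinearMap.lTensor_comp_apply _ _ _ r).symm.trans ?_
    rw [h1]
    exact LinearMap.lTensor_comp_apply _ _ _ r
  · exact rTensor_lTensor_comm _ _ _

/-- By the Bianchi identity the curvature r in L² ⊗ J is a cocycle. If its class is zero, it is the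
coboundary of some u in L¹ ⊗ J, and subtracting u from the lift removes the curvature. -/
theorem IsOb.exists_lift [CharZero K] {q : L.X 2 →ₗ[K] V}
    (hq : ∀ z, L.d 2 3 two_add_one_eq_three z = 0 → q z = 0 → ∃ u, L.d 1 2 one_add_one_eq_two u = z)
    {π : B ⟶ A} (hπ : IsSmallExtension π) {x : (L.tens A).X 1} (h : IsOb q π x 0) :
    ∃ y, (L.tens B).IsMC y ∧ (tensMap (Hom.id L) π).f 1 y = x := by
  obtain ⟨y, r, rfl, hr, ho⟩ := h
  have hd : (L.d 2 3 two_add_one_eq_three).rTensor (ker π) r = 0 := by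
    apply kerTens_injective π 3
    have h1 := (L.tens B).dtw_curv y
    rwa [dtw_apply, ← hr, br_kerTens hπ, add_zero, d_kerTens, ← map_zero (L.kerTens π 3)] at h1
  obtain ⟨u, hu, -⟩ := exists_tensor_of_forall_contr (m := ker π) (S := Empty) (V := fun _ => K)
    (L.d 1 2 one_add_one_eq_two) (fun s => s.elim)
    (fun v _ => L.d 2 3 two_add_one_eq_three v = 0 ∧ q v = 0) (fun v w hv => by
      obtain ⟨u, hu⟩ := hq v hv.1 hv.2
      exact ⟨u, hu, fun s => s.elim⟩) r (fun s => s.elim) (fun φ => by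
      refine ⟨?_, ?_⟩
      · rw [← contr_rTensor, hd, map_zero]
      · rw [← contr_rTensor, ho, map_zero])
  refine ⟨y - L.kerTens π 1 u, ?_, ?_⟩
  · rw [isMC_iff, curv_sub_kerTens hπ, hu, hr, sub_self]
  · rw [map_sub, tensMap_kerTens, sub_zero]

/-- The obstruction theory of a deformation functor. -/
theorem obstructionTheory_defFunctor [CharZero K] (q : L.X 2 →ₗ[K] V)
    (hq : ∀ z, L.d 2 3 two_add_one_eq_three z = 0 → q z = 0 → ∃ u, L.d 1 2 one_add_one_eq_two u = z)
    (hqd : ∀ u, q (L.d 1 2 one_add_one_eq_two u) = 0) :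
    Nonempty (ObstructionTheory L.defFunctor V) := by
  let ob : ∀ {B A : Art K} (π : B ⟶ A), IsSmallExtension π → L.defFunctor.obj A → V ⊗[K] ker π :=
    fun π hπ => Quot.lift (fun x => (exists_isOb q hπ x.2).choose) fun x x' ⟨a, ha⟩ => by
      have h := (exists_isOb q hπ x.2).choose_spec.gauge hπ a
      rw [ha] at h
      exact h.unique hqd hπ (exists_isOb q hπ x'.2).choose_spec
  have hob : ∀ {B A : Art K} (π : B ⟶ A) (hπ : IsSmallExtension π) (x : {x // (L.tens A).IsMC x})
      (o : V ⊗[K] ker π), IsOb q π x.1 o → ob π hπ (Quot.mk _ x) = o := fun π hπ x o ho =>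
    (exists_isOb q hπ x.2).choose_spec.unique hqd hπ ho
  refine ⟨⟨ob, fun π π' hπ hπ' β α w x => ?_, fun {B A} π hπ x => ⟨fun h => ?_, ?_⟩⟩⟩
  · induction x using Quot.ind with
    | mk x =>
      obtain ⟨o, ho⟩ := exists_isOb q hπ x.2
      rw [hob π hπ x o ho]
      exact hob π' hπ' ⟨(tensMap (Hom.id L) α).f 1 x.1, _⟩ _ (ho.map w)
  · induction x using Quot.ind with
    | mk x =>
      obtain ⟨o, ho⟩ := exists_isOb q hπ x.2
      obtain rfl : o = 0 := (hob π hπ x o ho).symm.trans h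
      obtain ⟨y, hy, hyx⟩ := ho.exists_lift hq hπ
      exact ⟨Quot.mk _ ⟨y, hy⟩, congrArg (Quot.mk _) (Subtype.ext hyx)⟩
  · rintro ⟨y, rfl⟩
    induction y using Quot.ind with
    | mk y =>
      refine hob π hπ ⟨(tensMap (Hom.id L) π).f 1 y.1, _⟩ 0 ⟨y.1, 0, rfl, ?_, map_zero _⟩
      rw [map_zero]
      exact y.2.symm

end DGLA

/-! ### Cohomology of Tot_TW and the conclusion. -/

namespace SemicosimplicialDGLA

variable {K : Type u} [Field K] [CharZero K]

/-- A linear map on the Thom–Whitney complex that induces the isomorphism of its cohomology with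
that of the total complex. -/
theorem exists_twClass (g : SemicosimplicialDGLA K) (k : ℤ) : ∃ q : g.totTW.X k →ₗ[K] g.HTot k,
    (∀ z, g.totTW.d k (k + 1) rfl z = 0 → q z = 0 →
      ∃ u, g.totTW.d (k - 1) k (sub_add_cancel k 1) u = z) ∧
    (∀ u, q (g.totTW.d (k - 1) k (sub_add_cancel k 1) u) = 0) ∧
    ∀ t, ∃ z, g.totTW.d k (k + 1) rfl z = 0 ∧ q z = t := by
  -- The class map is extended from cocycles to all cochains, so that it can be tensored with J or
  -- composed with contractions without keeping track of the cocycle condition.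
  obtain ⟨p, hp⟩ := LinearMap.exists_extend (p := LinearMap.ker (g.totD k (k + 1) rfl))
    (Submodule.mkQ ((LinearMap.range (g.totD (k - 1) k (sub_add_cancel k 1))).submoduleOf
      (LinearMap.ker (g.totD k (k + 1) rfl))))
  have hp' : ∀ c (hc : g.totD k (k + 1) rfl c = 0), p c = Submodule.Quotient.mk ⟨c, hc⟩ :=
    fun c hc => LinearMap.congr_fun hp ⟨c, hc⟩
  have h0 : ∀ c (hc : g.totD k (k + 1) rfl c = 0),
      p c = 0 ↔ ∃ t, g.totD (k - 1) k (sub_add_cancel k 1) t = c := fun c hc => by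
    rw [hp' c hc, Submodule.Quotient.mk_eq_zero]
    rfl
  have hcl : ∀ z, g.totTW.d k (k + 1) rfl z = 0 → g.totD k (k + 1) rfl (g.twInt k z) = 0 :=
    fun z hz => by rw [← twInt_d, hz, map_zero]
  refine ⟨p ∘ₗ g.twInt k, fun z hz hqz => ?_, fun u => ?_, fun t => ?_⟩
  · obtain ⟨t, ht⟩ := (h0 _ (hcl z hz)).mp hqz
    obtain ⟨w, hw, -⟩ := g.exists_twInt_eq (sub_add_cancel k 1) z hz t ht 0
      (fun n hn => absurd hn (Nat.not_lt_zero n)) fun n _ _ hn => absurd hn (Nat.not_lt_zero n)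
    exact ⟨w, hw⟩
  · exact (h0 _ (hcl _ (DGLA.d_d _ _ _ _ _ _ _))).mpr ⟨g.twInt _ u, (g.twInt_d _ u).symm⟩
  · obtain ⟨⟨c, hc⟩, rfl⟩ := Submodule.Quotient.mk_surjective _ t
    -- Applied to the zero cocycle one degree higher, the lifting statement yields a cocycle with
    -- integral c.
    obtain ⟨w, hw1, hw2, -⟩ := g.exists_twInt_eq (k := k + 1) (k' := k) rfl 0 (map_zero _) c
      (by rw [map_zero]; exact hc) 0
      (fun n hn => absurd hn (Nat.not_lt_zero n)) fun n _ _ hn => absurd hn (Nat.not_lt_zero n)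
    exact ⟨w, hw1, by rw [LinearMap.comp_apply, hw2, hp' c hc]⟩

theorem tangentIso_totTW (g : SemicosimplicialDGLA K) :
    Nonempty (Art.TangentIso g.totTW.defFunctor (g.HTot 1)) := by
  obtain ⟨q, h1, h2, h3⟩ := g.exists_twClass 1
  exact Art.tangentIso_defFunctor q h1 h2 h3

theorem obstructionTheory_totTW (g : SemicosimplicialDGLA K) :
    Nonempty (Art.ObstructionTheory g.totTW.defFunctor (g.HTot 2)) := by
  obtain ⟨q, h1, h2, -⟩ := g.exists_twClass 2
  exact DGLA.obstructionTheory_defFunctor q h1 h2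

/-- The isomorphism `Def_{Tot_TW} ≅ H¹_sc` under the vanishing of negative cohomology. -/
def negCompareIso (g : SemicosimplicialDGLA K) (hg : ∀ i j, j < 0 → Subsingleton ((g.obj i).H j)) :
    g.totTW.defFunctor ≅ g.h1sc :=
  g.compareIso (fun n hn => hg n _ (by omega)) (fun n hn => hg n _ (by omega))

end SemicosimplicialDGLA

end

theorem mainTheorem1 (K : Type u) [Field K] [IsAlgClosed K] [CharZero K] :
    (∃ Φ : ∀ g : SemicosimplicialDGLA K, Subsingleton ((g.obj 2).H (-1)) →
        ((g.trunc 2).totTW.defFunctor ≅ g.h1sc),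
      ∀ (g h : SemicosimplicialDGLA K) (hg : Subsingleton ((g.obj 2).H (-1)))
        (hh : Subsingleton ((h.obj 2).H (-1))) (φ : SemicosimplicialDGLA.Hom g h),
        DGLA.defMap (SemicosimplicialDGLA.totTWMap (SemicosimplicialDGLA.truncMap 2 φ)) ≫
            (Φ h hh).hom =
          (Φ g hg).hom ≫ SemicosimplicialDGLA.h1scMap φ) ∧
    (∃ Ψ : ∀ g : SemicosimplicialDGLA K, (∀ i j, j < 0 → Subsingleton ((g.obj i).H j)) →
        (g.totTW.defFunctor ≅ g.h1sc),
      ∀ (g h : SemicosimplicialDGLA K) (hg : ∀ i j, j < 0 → Subsingleton ((g.obj i).H j))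
        (hh : ∀ i j, j < 0 → Subsingleton ((h.obj i).H j)) (φ : SemicosimplicialDGLA.Hom g h),
        DGLA.defMap (SemicosimplicialDGLA.totTWMap φ) ≫ (Ψ h hh).hom =
          (Ψ g hg).hom ≫ SemicosimplicialDGLA.h1scMap φ) ∧
    (∀ g : SemicosimplicialDGLA K, (∀ i j, j < 0 → Subsingleton ((g.obj i).H j)) →
      Nonempty (Art.TangentIso g.h1sc (g.HTot 1)) ∧
        Nonempty (Art.ObstructionTheory g.h1sc (g.HTot 2))) := by
  refine ⟨⟨fun g hg => g.truncCompareIso hg, fun g h hg hh φ =>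
      SemicosimplicialDGLA.truncCompareIso_natural hg hh φ⟩,
    ⟨fun g hg => g.negCompareIso hg, fun g h hg hh φ =>
      SemicosimplicialDGLA.compareIso_natural _ _ _ _ φ⟩, fun g hg => ⟨?_, ?_⟩⟩
  · obtain ⟨t⟩ := g.tangentIso_totTW
    exact ⟨t.ofIso (g.negCompareIso hg)⟩
  · obtain ⟨t⟩ := g.obstructionTheory_totTW
    exact ⟨t.ofIso (g.negCompareIso hg)⟩
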